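/- Let $(R,\mathfrak m)$ be a noetherian local ring of prime characteristic $p$ and dimension $d\ge 2$, and let $I$ be an $\mathfrak m$-primary ideal that has a reduction $J=(f_1,\dots,f_d)$ generated by $d$ elements. Let $\mathscr R=\bigoplus_{n\ge 0}I^nt^n\subseteq R[t]$ be the Rees algebra and $\mathscr R'=\bigoplus_{n\in\mathbb Z}I^nt^n\subseteq R[t,t^{-1}]$ (with $I^n=R$ for $n\le 0$) the extended Rees algebra of $I$. Put $\mathscr R_+=\bigoplus_{n>0}I^nt^n$, $\mathfrak M=\mathfrak m\mathscr R+\mathscr R_+$ and $\mathfrak N=\sqrt{\mathscr R_+\mathscr R'+t^{-1}\mathscr R'}$. Assume that $R$ and $\mathscr R$ are Cohen–Macaulay. For a ring $S$ of characteristic $p$ let $S^0$ be the complement of the union of the minimal primes of $S$. For a submodule $N$ of an $S$-module $H$ and $q=p^e$, let ${}^eS$ be $S$ viewed as an $S$-algebra through the $e$-th iterate of Frobenius, let ${}^eH={}^eS\otimes_S H$, write $z^q=1\otimes z\in {}^eH$ for $z\in H$, and let $N^{[q]}_H$ be the ${}^eS$-submodule of ${}^eH$ generated by the $z^q$, $z\in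 N$. The tight closure of $N$ in $H$ is $$N^*_H=\{z\in H\mid \text{there is } c\in S^0 \text{ with } cz^q\in N^{[q]}_H \text{ for all } q=p^e\gg 0\};$$ in particular $0^*_H$ consists of the $z$ such that, for some $c\in S^0$, $cz^q=0$ in ${}^eH$ for all $q\gg0$. An ideal of $S$ is tightly closed if it equals its tight closure in $S$. A local ring is called $F$-rational if the ideal generated by some system of parameters is tightly closed. Write $f=f_1\cdots f_d$. Compute $H^{d+1}_{\mathfrak M}(\mathscr R)$ from the Čech complex on $f_1,\dots,f_d,f_1t,\dots,f_dt$ and $H^{d+1}_{\mathfrak N}(\mathscr R')$ from the Čech complex on $f_1t,\dots,f_dt,t^{-1}$. For $a\in R$, $l\ge 0$ and $m>0$, let $\pi(a,l,m)\in H^{d+1}_{\mathfrak M}(\mathscr R)$ be the class of the Čech cocycle whose component in $\mathscr R_{f\cdot f_jt}=R_f[t,t^{-1}]$ is $\frac{a}{f^l}t^{-m}$ for $j=1,\dots,d$ and whose other components are $0$, and let $\rho(a,l,m)\in H^{d+1}_{\mathfrak N}(\mathscr R')$ be the class of $\frac{a}{f^l}t^{-m}\in \mathscr R'_{(f_1t)\cdots(f_dt)t^{-1}}=R_f[t,t^{-1}]$.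 (These are the images of $\left[\frac{a}{f^l}\right]t^{-m}$, $\left[\frac{a}{f^l}\right]\in H^d_{\mathfrak m}(R)$, under the natural maps $\bigoplus_{n<0}H^d_{\mathfrak m}(R)t^n\to H^{d+1}_{\mathfrak M}(\mathscr R)$ and $\bigoplus_{n\in\mathbb Z}H^d_{\mathfrak m}(R)t^n\to H^{d+1}_{\mathfrak N}(\mathscr R')$.) Then: 1. There is a unique $R$-linear map $\gamma:H^{d+1}_{\mathfrak M}(\mathscr R)\to H^{d+1}_{\mathfrak N}(\mathscr R')$ with $\gamma(\pi(a,l,m))=\rho(a,l,m)$ for all $a\in R$, $l\ge0$, $m>0$; that is, $\gamma$ is the map induced by the inclusion $\bigoplus_{n<0}H^d_{\mathfrak m}(R)t^n\hookrightarrow\bigoplus_{n\in\mathbb Z}H^d_{\mathfrak m}(R)t^n$. 2. With tight closures taken over $\mathscr R$ and $\mathscr R'$ respectively, $$\gamma\left(0^*_{H^{d+1}_{\mathfrak M}(\mathscr R)}\right)=\bigoplus_{j<0}\left(0^*_{H^{d+1}_{\mathfrak N}(\mathscr R')}\right)_j ,$$ where $(0^*)_j$ is the set of homogeneous elements of degree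 $j$ (together with $0$) in $0^*$. 3. If $\mathscr R'_{\mathfrak N}$ is $F$-rational, then so is $\mathscr R_{\mathfrak M}$. -/

import Mathlib

open scoped TensorProduct

noncomputable section

/-! ### Tight closure and F-rationality -/

/-- `A` regarded as an `A`-algebra through the `e`-th iterate of its Frobenius endomorphism. -/
def FrobeniusTwist (A : Type*) (_p _e : ℕ) : Type _ := A

instance FrobeniusTwist.instCommRing (A : Type*) [CommRing A] (p e : ℕ) :
    CommRing (FrobeniusTwist A p e) := inferInstanceAs (CommRing A)

instance FrobeniusTwist.instAlgebra (A : Type*) [CommRing A] (p e : ℕ) [Fact p.Prime]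
    [CharP A p] : Algebra A (FrobeniusTwist A p e) :=
  (iterateFrobenius A p e).toAlgebra

/-- An element of `A`, seen in the Frobenius twist (the identity map on elements). -/
def FrobeniusTwist.of {A : Type*} (p e : ℕ) (a : A) : FrobeniusTwist A p e := a

/-- The set `A⁰`: the complement of the union of the minimal primes of `A`. -/
def minimalPrimesCompl (A : Type*) [CommRing A] : Submonoid A where
  carrier := {c | ∀ P ∈ minimalPrimes A, c ∉ P}
  one_mem' := fun _ hP h => (Ideal.ne_top_iff_one _).1 hP.1.1.ne_top h
  mul_mem' := fun {_ _} ha hb P hP h =>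
    (hP.1.1.mem_or_mem h).elim (ha P hP) (hb P hP)

/-- The tight closure `N*_M` of a submodule `N` of `M`: the elements `z` such that for some
`c ∈ A⁰` and all `q = p ^ e ≫ 0`, the element `c z^q = c ⊗ z` of `ᵉA ⊗ M` lies in the
`ᵉA`-submodule `N^[q]_M` generated by the image of `N`. -/
def tightClosure {A : Type*} [CommRing A] (p : ℕ) [Fact p.Prime] [CharP A p]
    {M : Type*} [AddCommGroup M] [Module A M] (N : Submodule A M) : Submodule A M where
  carrier := {z | ∃ c ∈ minimalPrimesCompl A, ∃ e₀ : ℕ, ∀ e ≥ e₀,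
    FrobeniusTwist.of p e c • ((1 : FrobeniusTwist A p e) ⊗ₜ[A] z) ∈
      N.baseChange (FrobeniusTwist A p e)}
  zero_mem' := ⟨1, one_mem _, 0, fun e _ => by simp⟩
  add_mem' := by
    rintro y z ⟨c, hc, e₁, h₁⟩ ⟨c', hc', e₂, h₂⟩
    refine ⟨c * c', mul_mem hc hc', max e₁ e₂, fun e he => ?_⟩
    have hmul : FrobeniusTwist.of p e (c * c')
        = FrobeniusTwist.of p e c * FrobeniusTwist.of p e c' := rfl
    rw [TensorProduct.tmul_add, smul_add]
    refine add_mem ?_ ?_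
    · rw [hmul, mul_comm, mul_smul]
      exact Submodule.smul_mem _ _ (h₁ e (le_trans (le_max_left _ _) he))
    · rw [hmul, mul_smul]
      exact Submodule.smul_mem _ _ (h₂ e (le_trans (le_max_right _ _) he))
  smul_mem' := by
    rintro a z ⟨c, hc, e₀, h⟩
    refine ⟨c, hc, e₀, fun e he => ?_⟩
    have : (1 : FrobeniusTwist A p e) ⊗ₜ[A] (a • z)
        = algebraMap A (FrobeniusTwist A p e) a • ((1 : FrobeniusTwist A p e) ⊗ₜ[A] z) := by
      rw [TensorProduct.tmul_smul, algebraMap_smul]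
    rw [this, smul_comm]
    exact Submodule.smul_mem _ _ (h e he)

/-- `y₁, …, yₙ` is a system of parameters of the local ring `A`: `n = dim A`, and the `yᵢ`
generate an ideal whose radical is the maximal ideal. -/
def IsSystemOfParameters {A : Type*} [CommRing A] [IsLocalRing A] {n : ℕ} (y : Fin n → A) : Prop :=
  ringKrullDim A = n ∧ (Ideal.span (Set.range y)).radical = IsLocalRing.maximalIdeal A

/-- A local ring of characteristic `p` is F-rational if the ideal generated by some system of
parameters is tightly closed. -/
def IsFRationalLocal (p : ℕ) [Fact p.Prime] (A : Type*) [CommRing A] [IsLocalRing A]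
    [CharP A p] : Prop :=
  ∃ (n : ℕ) (y : Fin n → A), IsSystemOfParameters y ∧
    tightClosure p (Ideal.span (Set.range y)) = Ideal.span (Set.range y)

/-! ### Cohen–Macaulay rings -/

/-- A noetherian local ring is Cohen–Macaulay if its maximal ideal contains a regular sequence
of length `dim A`. -/
def IsCohenMacaulayLocal (A : Type*) [CommRing A] [IsLocalRing A] : Prop :=
  IsNoetherianRing A ∧ ∃ rs : List A, (∀ r ∈ rs, r ∈ IsLocalRing.maximalIdeal A) ∧
    RingTheory.Sequence.IsRegular A rs ∧ ringKrullDim A = rs.length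

/-- A noetherian ring is Cohen–Macaulay if all its localizations at maximal ideals are. -/
def IsCohenMacaulay (A : Type*) [CommRing A] : Prop :=
  IsNoetherianRing A ∧
    ∀ (P : Ideal A) [P.IsMaximal], IsCohenMacaulayLocal (Localization.AtPrime P)

/-! ### Čech cohomology, i.e. local cohomology of a noetherian ring -/

section Cech

variable {A : Type*} [CommRing A] {ι : Type*} [LinearOrder ι] (x : ι → A)

/-- The localization `A_{x_s}`, where `x_s = ∏ i ∈ s, x i`. -/
abbrev CechLoc (s : Finset ι) : Type _ := Localization.Away (∏ i ∈ s, x i)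

/-- The element `a / x_s ^ l` of `A_{x_s}`. -/
def cechFraction (s : Finset ι) (a : A) (l : ℕ) : CechLoc x s :=
  Localization.mk a (⟨(∏ i ∈ s, x i) ^ l, l, rfl⟩ : Submonoid.powers (∏ i ∈ s, x i))

/-- The localization map `A_{x_s} → A_{x_t}` for `s ⊆ t`. -/
def cechRestrict {s t : Finset ι} (h : s ⊆ t) : CechLoc x s →ₐ[A] CechLoc x t :=
  IsLocalization.liftAlgHom (M := Submonoid.powers (∏ i ∈ s, x i))
    (f := Algebra.ofId A (CechLoc x t)) (by
      rintro ⟨_, n, rfl⟩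
      have : IsUnit (algebraMap A (CechLoc x t) (∏ i ∈ s, x i)) :=
        isUnit_of_dvd_unit (map_dvd _ (Finset.prod_dvd_prod_of_subset s t x h))
          (IsLocalization.Away.algebraMap_isUnit (∏ i ∈ t, x i))
      change IsUnit (algebraMap A (CechLoc x t) _)
      simpa using this.pow n)

/-- The Čech differential on families `(c_s)_s`, `c_s ∈ A_{x_s}`, indexed by the finite
subsets `s` of `ι`; it maps families supported on `#s = k` to families supported on `#s = k + 1`:
`(d c)_s = ∑_{i ∈ s} (-1)^{#{j ∈ s | j < i}} c_{s ∖ i}`. -/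
def cechD : (∀ s : Finset ι, CechLoc x s) →ₗ[A] (∀ s : Finset ι, CechLoc x s) :=
  LinearMap.pi fun s => ∑ i ∈ s, (-1 : A) ^ (s.filter (· < i)).card •
    ((cechRestrict x (s.erase_subset i)).toLinearMap ∘ₗ LinearMap.proj (s.erase i))

theorem cechD_apply (c : ∀ s : Finset ι, CechLoc x s) (s : Finset ι) :
    cechD x c s = ∑ i ∈ s, (-1 : A) ^ (s.filter (· < i)).card •
      cechRestrict x (s.erase_subset i) (c (s.erase i)) := by
  simp [cechD]

/-- The Čech cochains of degree `k`: `∏_{#s = k} A_{x_s}`. -/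
def cechCochains (k : ℕ) : Submodule A (∀ s : Finset ι, CechLoc x s) where
  carrier := {c | ∀ s, s.card ≠ k → c s = 0}
  zero_mem' := fun _ _ => rfl
  add_mem' := fun ha hb s hs => by simp [ha s hs, hb s hs]
  smul_mem' := fun a c hc s hs => by simp [hc s hs]

/-- The Čech cocycles of degree `k`. -/
def cechCocycles (k : ℕ) : Submodule A (∀ s : Finset ι, CechLoc x s) :=
  cechCochains x k ⊓ LinearMap.ker (cechD x)

/-- The Čech coboundaries of degree `k`: the image of the cochains of degree `k - 1`. -/
def cechCoboundaries : ℕ → Submodule A (∀ s : Finset ι, CechLoc x s)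
  | 0 => ⊥
  | k + 1 => (cechCochains x k).map (cechD x)

/-- The `k`-th cohomology of the Čech complex `Č(x; A)`, that is, the local cohomology
module `H^k_𝔞(A)` for `A` noetherian and `𝔞` any ideal with the same radical as `(x_i)_i`. -/
def CechCohomology (k : ℕ) : Type _ :=
  (cechCocycles x k) ⧸ (cechCoboundaries x k).submoduleOf (cechCocycles x k)

instance (k : ℕ) : AddCommGroup (CechCohomology x k) :=
  inferInstanceAs (AddCommGroup
    ((cechCocycles x k) ⧸ (cechCoboundaries x k).submoduleOf (cechCocycles x k)))

/-- The module structure over `A` (take `R = A`), and over any base ring `R` of `A`. -/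
instance {R : Type*} [CommRing R] [Algebra R A] (k : ℕ) : Module R (CechCohomology x k) :=
  inferInstanceAs (Module R
    ((cechCocycles x k) ⧸ (cechCoboundaries x k).submoduleOf (cechCocycles x k)))

instance {R : Type*} [CommRing R] [Algebra R A] (k : ℕ) :
    IsScalarTower R A (CechCohomology x k) :=
  inferInstanceAs (IsScalarTower R A
    ((cechCocycles x k) ⧸ (cechCoboundaries x k).submoduleOf (cechCocycles x k)))

/-- The class of a cocycle. -/
def cechClass (k : ℕ) : cechCocycles x k →ₗ[A] CechCohomology x k :=
  Submodule.mkQ _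

/-- The degree `j` part of the `k`-th Čech cohomology when `A` is graded by `𝒜` and `x i` is
homogeneous of degree `δ i`: it consists of the classes of the cocycles all of whose components
are fractions `a / x_s ^ l` with `a` homogeneous of degree `j + l * deg x_s`. -/
def cechGradedPiece {R : Type*} [CommRing R] [Algebra R A] (𝒜 : ℤ → Submodule R A) (δ : ι → ℤ)
    (k : ℕ) (j : ℤ) : Submodule R (CechCohomology x k) :=
  Submodule.span R {ζ | ∃ z : cechCocycles x k, cechClass x k z = ζ ∧
    ∀ s : Finset ι, ∃ (l : ℕ) (a : A), a ∈ 𝒜 (j + l * ∑ i ∈ s, δ i) ∧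
      z.1 s = cechFraction x s a l}

end Cech

theorem neg_one_pow_smul_add {A M : Type*} [CommRing A] [AddCommGroup M] [Module A M] (n : ℕ)
    (v : M) : (-1 : A) ^ n • v + (-1 : A) ^ (n + 1) • v = 0 := by
  rw [← add_smul, pow_succ, mul_neg_one, add_neg_cancel, zero_smul]

/-! ### Rees algebras -/

section Rees

open Polynomial LaurentPolynomial

variable {R : Type*} [CommRing R] (I : Ideal R)

/-- The extended Rees algebra `R[It, t⁻¹] = ⨁_{n ∈ ℤ} Iⁿ tⁿ ⊆ R[t, t⁻¹]`, where `Iⁿ = R` for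
`n ≤ 0`. -/
def extendedReesAlgebra : Subalgebra R R[T;T⁻¹] where
  carrier := {p | ∀ n : ℤ, p.coeff n ∈ I ^ n.toNat}
  add_mem' := fun {a b} ha hb n => by simpa using add_mem (ha n) (hb n)
  mul_mem' := fun {a b} ha hb n => by
    classical
    rw [AddMonoidAlgebra.coeff_mul]
    refine Ideal.sum_mem _ fun i _ => Ideal.sum_mem _ fun j _ => ?_
    dsimp only
    split_ifs with h
    · refine Ideal.pow_le_pow_right (show n.toNat ≤ i.toNat + j.toNat by omega) ?_
      rw [pow_add]
      exact Ideal.mul_mem_mul (ha i) (hb j)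
    · exact zero_mem _
  algebraMap_mem' := fun r n => by
    rw [LaurentPolynomial.algebraMap_apply, LaurentPolynomial.C_apply]
    split_ifs with h
    · subst h
      simp
    · exact zero_mem _

/-- The ideal `𝓡₊ = ⨁_{n > 0} Iⁿ tⁿ` of the Rees algebra `𝓡 = reesAlgebra I`. -/
def reesIrrelevant : Ideal (reesAlgebra I) :=
  RingHom.ker ((Polynomial.constantCoeff : R[X] →+* R).comp (reesAlgebra I).val.toRingHom)

/-- The inclusion of the Rees algebra in the extended Rees algebra. -/
def reesInclusion : reesAlgebra I →ₐ[R] extendedReesAlgebra I :=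
  (Polynomial.toLaurentAlg.comp (reesAlgebra I).val).codRestrict (extendedReesAlgebra I) (by
    rintro ⟨p, hp⟩ n
    change (Polynomial.toLaurent p).coeff n ∈ _
    rw [LaurentPolynomial.coeff_toLaurent]
    by_cases hn : ∃ k : ℕ, (k : ℤ) = n
    · obtain ⟨k, rfl⟩ := hn
      have := Finsupp.mapDomain_apply Nat.castEmbedding.injective (p.toFinsupp.coeff) (a := k) (β := ℤ)
      rw [show ((k : ℤ)) = Nat.castEmbedding k from rfl, this]
      exact hp k
    · rw [Finsupp.mapDomain_of_notMem_range]
      · exact zero_mem _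
      · rintro ⟨k, hk⟩
        exact hn ⟨k, hk⟩)

variable {I} in
/-- The element `a t` of the Rees algebra, for `a ∈ I`. -/
def reesT (a : R) (ha : a ∈ I) : reesAlgebra I :=
  ⟨Polynomial.monomial 1 a, reesAlgebra.monomial_mem.2 (by simpa using ha)⟩

/-- The element `t⁻¹` of the extended Rees algebra. -/
def reesTInv : extendedReesAlgebra I :=
  ⟨T (-1), fun n => by
    rw [LaurentPolynomial.T_apply]
    split_ifs with h
    · subst h
      simp
    · exact zero_mem _⟩

/-- The degree `n` part `Iⁿ tⁿ` of the extended Rees algebra. -/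
def extendedReesPiece (n : ℤ) : Submodule R (extendedReesAlgebra I) where
  carrier := {p | ∀ k : ℤ, k ≠ n → p.1.coeff k = 0}
  zero_mem' := fun _ _ => by simp
  add_mem' := fun ha hb k hk => by simp [ha k hk, hb k hk]
  smul_mem' := fun a c hc k hk => by simp [hc k hk]

/-! #### The ideals `𝔐` and `𝔑` -/

/-- The ideal `𝔐 = 𝔪𝓡 + 𝓡₊` of the Rees algebra `𝓡` of an ideal of a local ring `(R, 𝔪)`. -/
def reesMaximal [IsLocalRing R] : Ideal (reesAlgebra I) :=
  (IsLocalRing.maximalIdeal R).map (algebraMap R (reesAlgebra I)) ⊔ reesIrrelevant I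

/-- The ideal `𝔑 = √(𝓡₊𝓡' + t⁻¹𝓡')` of the extended Rees algebra `𝓡'`. -/
def extendedReesMaximal : Ideal (extendedReesAlgebra I) :=
  ((reesIrrelevant I).map (reesInclusion I).toRingHom ⊔ Ideal.span {reesTInv I}).radical

theorem reesMaximal_isPrime [IsLocalRing R] : (reesMaximal I).IsPrime := by
  let φ : reesAlgebra I →+* IsLocalRing.ResidueField R := (IsLocalRing.residue R).comp
    ((Polynomial.constantCoeff : R[X] →+* R).comp (reesAlgebra I).val.toRingHom)
  have : reesMaximal I = RingHom.ker φ := by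
    apply le_antisymm
    · refine sup_le (Ideal.map_le_iff_le_comap.2 fun r hr => ?_) fun p hp => ?_
      · change IsLocalRing.residue R (Polynomial.constantCoeff (Polynomial.C r)) = 0
        rw [Polynomial.constantCoeff_apply, Polynomial.coeff_C_zero]
        exact (IsLocalRing.residue_eq_zero_iff r).2 hr
      · change IsLocalRing.residue R _ = 0
        have hp' : Polynomial.constantCoeff p.1 = 0 := hp
        exact (congrArg (IsLocalRing.residue R) hp').trans (map_zero _)
    · intro p hp
      have h0 : p.1.coeff 0 ∈ IsLocalRing.maximalIdeal R :=
        (IsLocalRing.residue_eq_zero_iff _).1 hp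
      rw [← add_sub_cancel (algebraMap R (reesAlgebra I) (p.1.coeff 0)) p]
      refine add_mem (Ideal.mem_sup_left (Ideal.mem_map_of_mem _ h0)) (Ideal.mem_sup_right ?_)
      change (p.1 - Polynomial.C (p.1.coeff 0)).coeff 0 = 0
      simp
  rw [this]
  exact RingHom.ker_isPrime φ

theorem extendedRees_coeff_mul (p q : extendedReesAlgebra I) :
    (p * q).1.coeff 0 - p.1.coeff 0 * q.1.coeff 0 ∈ I := by
  classical
  rw [← Ideal.Quotient.eq, map_mul]
  change Ideal.Quotient.mk I ((p.1 * q.1).coeff 0) = _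
  have key : ∀ i j : ℤ, Ideal.Quotient.mk I
      (if i + j = 0 then p.1.coeff i * q.1.coeff j else 0) = if i = 0 then if j = 0 then
        Ideal.Quotient.mk I (p.1.coeff i) * Ideal.Quotient.mk I (q.1.coeff j) else 0 else 0 := by
    have hpos : ∀ (r : extendedReesAlgebra I) (i : ℤ), 0 < i →
        Ideal.Quotient.mk I (r.1.coeff i) = 0 := fun r i hi =>
      Ideal.Quotient.eq_zero_iff_mem.2
        (Ideal.pow_le_self (show i.toNat ≠ 0 by omega) (r.2 i))
    intro i j
    split_ifs with h h1 h2 h2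
    · rw [map_mul]
    · omega
    · rw [map_mul]
      rcases lt_or_gt_of_ne h1 with h3 | h3
      · rw [hpos q j (by omega), mul_zero]
      · rw [hpos p i h3, zero_mul]
    · omega
    · simp
    · simp
  rw [AddMonoidAlgebra.coeff_mul, Finsupp.sum, map_sum]
  simp_rw [Finsupp.sum, map_sum, key]
  by_cases hp : p.1.coeff 0 = 0
  · simp [hp]
  by_cases hq : q.1.coeff 0 = 0
  · simp [hq]
  simp [hp, hq]

/-- The element `a tⁿ` of the extended Rees algebra, for `a ∈ Iⁿ`. -/
def extendedReesMonomial (n : ℤ) (a : R) (ha : a ∈ I ^ n.toNat) : extendedReesAlgebra I :=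
  ⟨AddMonoidAlgebra.single n a, fun k => by
    classical
    rw [AddMonoidAlgebra.coeff_single, Finsupp.single_apply]
    split_ifs with h
    · exact h ▸ ha
    · exact zero_mem _⟩

theorem extendedReesMaximal_isPrime [IsLocalRing R]
    (hI : I.radical = IsLocalRing.maximalIdeal R) : (extendedReesMaximal I).IsPrime := by
  classical
  have hIm : I ≤ IsLocalRing.maximalIdeal R := hI ▸ Ideal.le_radical
  let ψ : extendedReesAlgebra I →+* IsLocalRing.ResidueField R :=
    { toFun := fun p => IsLocalRing.residue R (p.1.coeff 0)
      map_zero' := by simp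
      map_one' := by
        change IsLocalRing.residue R ((1 : R[T;T⁻¹]).coeff 0) = 1
        rw [← LaurentPolynomial.T_zero, LaurentPolynomial.T_apply, if_pos rfl, map_one]
      map_add' := fun p q => by simp
      map_mul' := fun p q => by
        rw [← map_mul, ← sub_eq_zero, ← map_sub, IsLocalRing.residue_eq_zero_iff]
        exact hIm (extendedRees_coeff_mul I p q) }
  let K : Ideal (extendedReesAlgebra I) :=
    (reesIrrelevant I).map (reesInclusion I).toRingHom ⊔ Ideal.span {reesTInv I}
  have hT : reesTInv I ∈ K := Ideal.mem_sup_right (Ideal.mem_span_singleton_self _)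
  have hneg : ∀ (n : ℤ) (a : R) (ha : a ∈ I ^ n.toNat), n < 0 →
      extendedReesMonomial I n a ha ∈ K := by
    intro n a ha hn
    have : extendedReesMonomial I n a ha = extendedReesMonomial I (n + 1) a (by
        rw [show (n + 1).toNat = 0 by omega]; simp) * reesTInv I := by
      apply Subtype.ext
      change AddMonoidAlgebra.single n a
        = AddMonoidAlgebra.single (n + 1) a * AddMonoidAlgebra.single (-1) 1
      rw [AddMonoidAlgebra.single_mul_single]
      simp
    rw [this]
    exact Ideal.mul_mem_left _ _ hT
  have hpos : ∀ (n : ℤ) (a : R) (ha : a ∈ I ^ n.toNat), 0 < n →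
      extendedReesMonomial I n a ha ∈ K := by
    intro n a ha hn
    lift n to ℕ using hn.le
    have h1 : (⟨Polynomial.monomial n a, reesAlgebra.monomial_mem.2 ha⟩ : reesAlgebra I)
        ∈ reesIrrelevant I := by
      change (Polynomial.monomial n a).coeff 0 = 0
      rw [Polynomial.coeff_monomial, if_neg (by omega)]
    have h2 := Ideal.mem_map_of_mem (reesInclusion I).toRingHom h1
    convert! Ideal.mem_sup_left h2 using 1
    apply Subtype.ext
    change _ = Polynomial.toLaurent (Polynomial.monomial n a)
    rw [← Polynomial.C_mul_X_pow_eq_monomial, Polynomial.toLaurent_C_mul_X_pow]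
    exact LaurentPolynomial.single_eq_C_mul_T a n
  have hsub : ∀ p : extendedReesAlgebra I,
      p - algebraMap R (extendedReesAlgebra I) (p.1.coeff 0) ∈ K := by
    intro p
    have hsum : p = ∑ n ∈ p.1.coeff.support, extendedReesMonomial I n (p.1.coeff n) (p.2 n) := by
      apply Subtype.ext
      rw [AddSubmonoidClass.coe_finsetSum]
      exact (AddMonoidAlgebra.sum_coeff_single p.1).symm
    rw [← Ideal.Quotient.eq]
    have h0 : ∀ n : ℤ, Ideal.Quotient.mk K (extendedReesMonomial I n (p.1.coeff n) (p.2 n))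
        = if n = 0 then Ideal.Quotient.mk K
          (algebraMap R (extendedReesAlgebra I) (p.1.coeff 0)) else 0 := by
      intro n
      split_ifs with h
      · subst h
        rfl
      · rcases lt_or_gt_of_ne h with h | h
        · exact Ideal.Quotient.eq_zero_iff_mem.2 (hneg _ _ _ h)
        · exact Ideal.Quotient.eq_zero_iff_mem.2 (hpos _ _ _ h)
    conv_lhs => rw [hsum]
    rw [map_sum]
    simp_rw [h0]
    by_cases hp : p.1.coeff 0 = 0 <;> simp [hp]
  have hdeg0 : ∀ a ∈ I, algebraMap R (extendedReesAlgebra I) a ∈ K := by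
    intro a ha
    have : algebraMap R (extendedReesAlgebra I) a
        = extendedReesMonomial I 1 a (by simpa using ha) * reesTInv I := by
      apply Subtype.ext
      change AddMonoidAlgebra.single 0 a
        = AddMonoidAlgebra.single 1 a * AddMonoidAlgebra.single (-1) 1
      rw [AddMonoidAlgebra.single_mul_single]
      simp
    rw [this]
    exact Ideal.mul_mem_left _ _ hT
  have hprime : (RingHom.ker ψ).IsPrime := RingHom.ker_isPrime ψ
  have : extendedReesMaximal I = RingHom.ker ψ := by
    apply le_antisymm
    · refine hprime.radical_le_iff.2 (sup_le (Ideal.map_le_iff_le_comap.2 fun p hp => ?_) ?_)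
      · have hp' : p.1.coeff 0 = 0 := hp
        change IsLocalRing.residue R ((Polynomial.toLaurent p.1).coeff 0) = 0
        rw [LaurentPolynomial.coeff_toLaurent, show (0 : ℤ) = Nat.castEmbedding 0 from rfl,
          Finsupp.mapDomain_apply Nat.castEmbedding.injective]
        exact (congrArg (IsLocalRing.residue R) hp').trans (map_zero _)
      · rw [Ideal.span_le, Set.singleton_subset_iff]
        change IsLocalRing.residue R ((T (-1) : R[T;T⁻¹]).coeff 0) = 0
        simp
    · intro p hp
      have hp' : p.1.coeff 0 ∈ I.radical := by
        rw [hI]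
        exact (IsLocalRing.residue_eq_zero_iff _).1 hp
      obtain ⟨k, hk⟩ := hp'
      rw [← sub_add_cancel p (algebraMap R (extendedReesAlgebra I) (p.1.coeff 0))]
      refine add_mem (Ideal.le_radical (hsub p)) ⟨k, ?_⟩
      rw [← map_pow]
      exact hdeg0 _ hk
  rw [this]
  exact hprime

/-! #### Characteristic -/

theorem charP_of_algebra_nontrivial (p : ℕ) [Fact p.Prime] (A B : Type*) [CommRing A]
    [CommRing B] [Algebra A B] [CharP A p] [Nontrivial B] : CharP B p := by
  have h : ((p : ℕ) : B) = 0 := by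
    rw [← map_natCast (algebraMap A B), CharP.cast_eq_zero, map_zero]
  obtain ⟨q, hq⟩ := CharP.exists B
  have hdvd : q ∣ p := (CharP.cast_eq_zero_iff B q p).1 h
  rcases (Nat.dvd_prime Fact.out).1 hdvd with rfl | rfl
  · exact absurd rfl (CharP.char_ne_one B 1)
  · exact hq

instance reesAlgebra.instCharP (p : ℕ) [Fact p.Prime] [CharP R p] : CharP (reesAlgebra I) p :=
  have : Nontrivial R := CharP.nontrivial_of_char_ne_one (Fact.out : p.Prime).ne_one
  charP_of_algebra_nontrivial p R _

instance extendedReesAlgebra.instCharP (p : ℕ) [Fact p.Prime] [CharP R p] :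
    CharP (extendedReesAlgebra I) p :=
  have : Nontrivial R := CharP.nontrivial_of_char_ne_one (Fact.out : p.Prime).ne_one
  charP_of_algebra_nontrivial p R _

/-- The localization of `A` at its prime ideal `P` is F-rational. -/
def IsFRationalAt (p : ℕ) [Fact p.Prime] {A : Type*} [CommRing A] [CharP A p] (P : Ideal A)
    (hP : P.IsPrime) : Prop :=
  have : CharP (Localization.AtPrime P) p := charP_of_algebra_nontrivial p A _
  IsFRationalLocal p (Localization.AtPrime P)

/-- `J` is a reduction of `I`. -/
def IsReductionOf (J I : Ideal R) : Prop :=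
  J ≤ I ∧ ∃ n : ℕ, I ^ (n + 1) = J * I ^ n

/-! #### Local cohomology of the Rees algebras and the map `γ` -/

variable {I} {d : ℕ} (f : Fin d → R) (hf : ∀ i, f i ∈ I)

/-- The sequence `f₁, …, f_d, f₁t, …, f_dt` in `𝓡`. If `(f₁, …, f_d)` is a reduction of the
`𝔪`-primary ideal `I`, it generates `𝔐` up to radical. -/
def reesSeq : Fin (d + d) → reesAlgebra I :=
  Fin.append (fun i => algebraMap R (reesAlgebra I) (f i)) (fun i => reesT (f i) (hf i))

/-- The sequence `f₁t, …, f_dt, t⁻¹` in `𝓡'`. If `(f₁, …, f_d)` is a reduction of the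
`𝔪`-primary ideal `I`, it generates `𝔑` up to radical. -/
def extendedReesSeq : Fin (d + 1) → extendedReesAlgebra I :=
  Fin.snoc (α := fun _ => extendedReesAlgebra I)
    (fun i => reesInclusion I (reesT (f i) (hf i))) (reesTInv I)

/-- The degrees `1, …, 1, -1` of `f₁t, …, f_dt, t⁻¹`. -/
def extendedReesSeqDegree (d : ℕ) : Fin (d + 1) → ℤ :=
  Fin.snoc (α := fun _ => ℤ) (fun _ => 1) (-1)

/-- `H^{d+1}_𝔐(𝓡)`. -/
abbrev ReesLocalCohomology : Type _ := CechCohomology (reesSeq f hf) (d + 1)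

/-- `H^{d+1}_𝔑(𝓡')`. -/
abbrev ExtendedReesLocalCohomology : Type _ := CechCohomology (extendedReesSeq f hf) (d + 1)

/-- `H^{d+1}_𝔑(𝓡')_j`. -/
abbrev extendedReesLocalCohomologyPiece (j : ℤ) :
    Submodule R (ExtendedReesLocalCohomology f hf) :=
  cechGradedPiece (extendedReesSeq f hf) (extendedReesPiece I) (extendedReesSeqDegree d) (d + 1) j

/-- The set of indices of the `d + 1` elements `f₁, …, f_d, f_j t` in `reesSeq`. -/
def reesTopIndex (j : Fin d) : Finset (Fin (d + d)) :=
  insert (Fin.natAdd d j) (Finset.univ.map (Fin.castAddEmb d))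

/-- The element `(a / f ^ l) t ^ (-m)` of `𝓡_{f · f_j t} = R_f[t, t⁻¹]`, `f = f₁ ⋯ f_d`; it is
written as `a f_j ^ m f ^ m (f_j t) ^ l / (f · f_j t) ^ (l + m)`. -/
def reesFraction (a : R) (l m : ℕ) (j : Fin d) : CechLoc (reesSeq f hf) (reesTopIndex j) :=
  cechFraction (reesSeq f hf) (reesTopIndex j)
    (algebraMap R (reesAlgebra I) (a * f j ^ m * (∏ i, f i) ^ m) * reesT (f j) (hf j) ^ l) (l + m)

/-- The Čech cochain of `𝓡` whose component in `𝓡_{f · f_j t}` is `(a / f ^ l) t ^ (-m)`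
for `j = 1, …, d`, and whose other components are zero. -/
def reesCochain (a : R) (l m : ℕ) : ∀ s, CechLoc (reesSeq f hf) s :=
  ∑ j : Fin d, Pi.single (reesTopIndex j) (reesFraction f hf a l m j)

/-- The Čech cochain of `𝓡'` whose component in `𝓡'_{(f₁t) ⋯ (f_dt) t⁻¹} = R_f[t, t⁻¹]` is
`(a / f ^ l) t ^ (-m)`, and whose other components are zero; the fraction is written as
`a ((f₁t) ⋯ (f_dt)) ^ ((d - 1) l) (t⁻¹) ^ m / ((f₁t) ⋯ (f_dt) t⁻¹) ^ (d l)`. -/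
def extendedReesCochain (a : R) (l m : ℕ) : ∀ s, CechLoc (extendedReesSeq f hf) s :=
  Pi.single Finset.univ (cechFraction (extendedReesSeq f hf) Finset.univ
    (algebraMap R (extendedReesAlgebra I) a *
      (∏ i, reesInclusion I (reesT (f i) (hf i))) ^ ((d - 1) * l) * reesTInv I ^ m) (d * l))

/-- The nonzero component of `extendedReesCochain` is the element `(a / f ^ l) t ^ (-m)`. -/
theorem extendedReesCochain_spec (a : R) (l m : ℕ) :
    algebraMap (extendedReesAlgebra I) _ (algebraMap R (extendedReesAlgebra I) (∏ i, f i) ^ l) *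
      extendedReesCochain f hf a l m Finset.univ
    = algebraMap (extendedReesAlgebra I) _
      (algebraMap R (extendedReesAlgebra I) a * reesTInv I ^ m) := by
  have hft : ∀ i, algebraMap R (extendedReesAlgebra I) (f i)
      = reesInclusion I (reesT (f i) (hf i)) * reesTInv I := by
    intro i
    apply Subtype.ext
    change AddMonoidAlgebra.single 0 (f i)
      = Polynomial.toLaurent (Polynomial.monomial 1 (f i)) * T (-1)
    rw [← Polynomial.C_mul_X_pow_eq_monomial, Polynomial.toLaurent_C_mul_X_pow, mul_assoc,
      ← LaurentPolynomial.T_add, LaurentPolynomial.single_eq_C_mul_T]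
    simp
  have hd : d * l = (d - 1) * l + l ∨ d = 0 := by
    rcases d with _ | d
    · exact Or.inr rfl
    · exact Or.inl (by rw [Nat.add_sub_cancel]; ring)
  rw [extendedReesCochain, Pi.single_eq_same, cechFraction, ← Localization.mk_one_eq_algebraMap,
    ← Localization.mk_one_eq_algebraMap, Localization.mk_mul, Localization.mk_eq_mk_iff,
    Localization.r_iff_exists]
  refine ⟨1, ?_⟩
  have hden : ((1 * (⟨(∏ i, extendedReesSeq f hf i) ^ (d * l), d * l, rfl⟩ :
      Submonoid.powers (∏ i, extendedReesSeq f hf i)) :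
      Submonoid.powers (∏ i, extendedReesSeq f hf i)) : extendedReesAlgebra I)
      = (∏ i, extendedReesSeq f hf i) ^ (d * l) := by rw [one_mul]
  rw [hden]
  simp only [Submonoid.coe_one, one_mul, extendedReesSeq, Fin.prod_snoc, map_prod, hft,
    Finset.prod_mul_distrib, Finset.prod_const, Finset.card_univ, Fintype.card_fin]
  rcases hd with hd | rfl
  · have h1 : (reesTInv I ^ d) ^ l = reesTInv I ^ (d * l) := (pow_mul _ _ _).symm
    rw [mul_pow _ (reesTInv I), mul_pow _ (reesTInv I ^ d), h1]
    conv_rhs => rw [hd, pow_add (∏ i, reesInclusion I (reesT (f i) (hf i))), ← hd]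
    ring
  · simp

theorem extendedReesCochain_mem (a : R) (l m : ℕ) :
    extendedReesCochain f hf a l m ∈ cechCocycles (extendedReesSeq f hf) (d + 1) := by
  refine ⟨fun s hs => ?_, ?_⟩
  · refine Pi.single_eq_of_ne (fun h => hs ?_) _
    simp [h]
  · refine LinearMap.mem_ker.2 (funext fun s => ?_)
    rw [cechD_apply]
    refine Finset.sum_eq_zero fun i hi => ?_
    have : extendedReesCochain f hf a l m (s.erase i) = 0 :=
      Pi.single_eq_of_ne
        (fun h : s.erase i = Finset.univ => Finset.notMem_erase i s (by rw [h]; simp)) _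
    rw [this, map_zero, smul_zero]

theorem castAdd_mem_reesTopIndex (i j : Fin d) : Fin.castAdd d i ∈ reesTopIndex j :=
  Finset.mem_insert_of_mem (Finset.mem_map_of_mem (Fin.castAddEmb d) (Finset.mem_univ i))

theorem natAdd_mem_reesTopIndex (i j : Fin d) : Fin.natAdd d i ∈ reesTopIndex j ↔ i = j := by
  simp only [reesTopIndex, Finset.mem_insert, Finset.mem_map, Finset.mem_univ, true_and,
    Fin.castAddEmb_apply, Fin.ext_iff, Fin.val_natAdd, Fin.val_castAdd]
  constructor
  · rintro (h | ⟨b, h⟩)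
    · omega
    · omega
  · intro h
    left
    omega

theorem reesTopIndex_injective : Function.Injective (reesTopIndex (d := d)) := fun i j h =>
  (natAdd_mem_reesTopIndex i j).1 (h ▸ (natAdd_mem_reesTopIndex i i).2 rfl)

theorem card_reesTopIndex (j : Fin d) : (reesTopIndex j).card = d + 1 := by
  rw [reesTopIndex, Finset.card_insert_of_notMem, Finset.card_map, Finset.card_univ,
    Fintype.card_fin]
  simp only [Finset.mem_map, Finset.mem_univ, true_and, Fin.castAddEmb_apply, Fin.ext_iff,
    Fin.val_natAdd, Fin.val_castAdd]
  rintro ⟨b, h⟩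
  omega

theorem prod_reesTopIndex (j : Fin d) : ∏ i ∈ reesTopIndex j, reesSeq f hf i
    = algebraMap R (reesAlgebra I) (∏ i, f i) * reesT (f j) (hf j) := by
  rw [reesTopIndex, Finset.prod_insert, Finset.prod_map, map_prod, mul_comm]
  · simp only [reesSeq, Fin.castAddEmb_apply, Fin.append_left, Fin.append_right]
  · simp only [Finset.mem_map, Finset.mem_univ, true_and, Fin.castAddEmb_apply, Fin.ext_iff,
      Fin.val_natAdd, Fin.val_castAdd]
    rintro ⟨b, h⟩
    omega

/-- `reesFraction` is the element `(a / f ^ l) t ^ (-m) = (a / f ^ l) (f_j / f_j t) ^ m`. -/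
theorem reesFraction_spec (a : R) (l m : ℕ) (j : Fin d) :
    algebraMap (reesAlgebra I) _ (algebraMap R (reesAlgebra I) (∏ i, f i) ^ l *
      reesT (f j) (hf j) ^ m) * reesFraction f hf a l m j
    = algebraMap (reesAlgebra I) _ (algebraMap R (reesAlgebra I) (a * f j ^ m)) := by
  rw [reesFraction, cechFraction, ← Localization.mk_one_eq_algebraMap,
    ← Localization.mk_one_eq_algebraMap, Localization.mk_mul, Localization.mk_eq_mk_iff,
    Localization.r_iff_exists]
  refine ⟨1, ?_⟩
  simp only [Submonoid.coe_one, one_mul, prod_reesTopIndex, map_mul, map_pow]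
  ring

theorem reesCochain_apply (a : R) (l m : ℕ) (j : Fin d) :
    reesCochain f hf a l m (reesTopIndex j) = reesFraction f hf a l m j := by
  rw [reesCochain, Finset.sum_apply, Finset.sum_eq_single j, Pi.single_eq_same]
  · intro k _ hk
    exact Pi.single_eq_of_ne (fun h => hk (reesTopIndex_injective h).symm) _
  · simp

theorem reesCochain_apply_of_ne (a : R) (l m : ℕ) (s : Finset (Fin (d + d)))
    (hs : ∀ j, s ≠ reesTopIndex j) : reesCochain f hf a l m s = 0 := by
  rw [reesCochain, Finset.sum_apply]
  exact Finset.sum_eq_zero fun k _ => Pi.single_eq_of_ne (hs k) _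

theorem cechRestrict_reesFraction (a : R) (l m : ℕ) (j k : Fin d) (s : Finset (Fin (d + d)))
    (hj : reesTopIndex j ⊆ s) (hk : reesTopIndex k ⊆ s) :
    cechRestrict (reesSeq f hf) hj (reesFraction f hf a l m j)
      = cechRestrict (reesSeq f hf) hk (reesFraction f hf a l m k) := by
  have hu : ∀ i, reesTopIndex i ⊆ s → IsUnit (algebraMap (reesAlgebra I)
      (CechLoc (reesSeq f hf) s) (algebraMap R (reesAlgebra I) (∏ i, f i) ^ l *
        reesT (f i) (hf i) ^ m)) := by
    intro i hi
    have h1 : IsUnit (algebraMap (reesAlgebra I) (CechLoc (reesSeq f hf) s)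
        (algebraMap R (reesAlgebra I) (∏ i, f i) * reesT (f i) (hf i))) := by
      rw [← prod_reesTopIndex]
      exact isUnit_of_dvd_unit (map_dvd _ (Finset.prod_dvd_prod_of_subset _ s _ hi))
        (IsLocalization.Away.algebraMap_isUnit (∏ i ∈ s, reesSeq f hf i))
    rw [map_mul, IsUnit.mul_iff] at h1
    rw [map_mul, map_pow, map_pow]
    exact (h1.1.pow l).mul (h1.2.pow m)
  have e : ∀ i (hi : reesTopIndex i ⊆ s),
      algebraMap (reesAlgebra I) (CechLoc (reesSeq f hf) s)
        (algebraMap R (reesAlgebra I) (∏ i, f i) ^ l * reesT (f i) (hf i) ^ m) *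
        cechRestrict (reesSeq f hf) hi (reesFraction f hf a l m i)
      = algebraMap (reesAlgebra I) (CechLoc (reesSeq f hf) s)
        (algebraMap R (reesAlgebra I) (a * f i ^ m)) := by
    intro i hi
    have := congrArg (cechRestrict (reesSeq f hf) hi) (reesFraction_spec f hf a l m i)
    rwa [map_mul, AlgHom.commutes, AlgHom.commutes] at this
  have hT : ∀ i i' : Fin d, algebraMap R (reesAlgebra I) (f i) * reesT (f i') (hf i')
      = algebraMap R (reesAlgebra I) (f i') * reesT (f i) (hf i) := by
    intro i i'
    apply Subtype.ext
    change Polynomial.C (f i) * Polynomial.monomial 1 (f i')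
      = Polynomial.C (f i') * Polynomial.monomial 1 (f i)
    rw [Polynomial.C_mul_monomial, Polynomial.C_mul_monomial, mul_comm]
  have hTm : algebraMap R (reesAlgebra I) (f j) ^ m * reesT (f k) (hf k) ^ m
      = algebraMap R (reesAlgebra I) (f k) ^ m * reesT (f j) (hf j) ^ m := by
    rw [← mul_pow, hT, mul_pow]
  apply ((hu j hj).mul (hu k hk)).mul_left_cancel
  rw [mul_right_comm, e j hj, mul_assoc, e k hk, ← map_mul, ← map_mul]
  congr 1
  simp only [map_mul, map_pow]
  linear_combination (algebraMap R (reesAlgebra I) a *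
    algebraMap R (reesAlgebra I) (∏ i, f i) ^ l) * hTm

theorem reesCochain_mem (a : R) (l m : ℕ) :
    reesCochain f hf a l m ∈ cechCocycles (reesSeq f hf) (d + 1) := by
  refine ⟨fun s hs => ?_, ?_⟩
  · exact reesCochain_apply_of_ne f hf a l m s fun j hj => hs (hj ▸ card_reesTopIndex j)
  refine LinearMap.mem_ker.2 (funext fun s => ?_)
  rw [cechD_apply]
  have hzero : ∀ i ∈ s, (∀ j, s.erase i ≠ reesTopIndex j) →
      (-1 : reesAlgebra I) ^ (s.filter (· < i)).card •
        cechRestrict (reesSeq f hf) (s.erase_subset i) (reesCochain f hf a l m (s.erase i)) = 0 :=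
    fun i _ h => by rw [reesCochain_apply_of_ne f hf a l m _ h, map_zero, smul_zero]
  by_cases h : ∃ i ∈ s, ∃ j, s.erase i = reesTopIndex j
  swap
  · push Not at h
    exact Finset.sum_eq_zero fun i hi => hzero i hi (h i hi)
  obtain ⟨j, k, hjk, hs⟩ : ∃ j k : Fin d, j < k ∧
      s = insert (Fin.natAdd d k) (reesTopIndex j) := by
    obtain ⟨i, hi, j, hj⟩ := h
    have his : s = insert i (reesTopIndex j) := by rw [← hj, Finset.insert_erase hi]
    have hij : i ∉ reesTopIndex j := hj ▸ Finset.notMem_erase i s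
    induction i using Fin.addCases with
    | left i => exact absurd (castAdd_mem_reesTopIndex i j) hij
    | right k =>
      have hne : k ≠ j := fun h => hij ((natAdd_mem_reesTopIndex k j).2 h)
      rcases lt_or_gt_of_ne hne with h | h
      · exact ⟨k, j, h, by rw [his, reesTopIndex, reesTopIndex, Finset.insert_comm]⟩
      · exact ⟨j, k, h, his⟩
  have hs' : s = insert (Fin.natAdd d j) (reesTopIndex k) := by
    rw [hs, reesTopIndex, reesTopIndex, Finset.insert_comm]
  have hk : s.erase (Fin.natAdd d k) = reesTopIndex j := by
    rw [hs, Finset.erase_insert]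
    exact fun h => hjk.ne' ((natAdd_mem_reesTopIndex k j).1 h)
  have hj : s.erase (Fin.natAdd d j) = reesTopIndex k := by
    rw [hs', Finset.erase_insert]
    exact fun h => hjk.ne ((natAdd_mem_reesTopIndex j k).1 h)
  have hmem : ∀ i, i ∈ s ↔ i = Fin.natAdd d k ∨ i = Fin.natAdd d j ∨ ∃ b, Fin.castAdd d b = i := by
    intro i
    simp [hs, reesTopIndex]
  have hfj : (s.filter (· < Fin.natAdd d j)) = Finset.univ.map (Fin.castAddEmb d) := by
    ext i
    simp only [Finset.mem_filter, hmem, Finset.mem_map, Finset.mem_univ, true_and,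
      Fin.castAddEmb_apply, Fin.ext_iff, Fin.lt_def, Fin.val_natAdd, Fin.val_castAdd]
    constructor
    · rintro ⟨h | h | h, h'⟩
      · omega
      · omega
      · exact h
    · rintro ⟨b, hb⟩
      exact ⟨Or.inr (Or.inr ⟨b, hb⟩), by omega⟩
  have hfk : (s.filter (· < Fin.natAdd d k)) = reesTopIndex j := by
    ext i
    simp only [reesTopIndex, Finset.mem_filter, hmem, Finset.mem_insert, Finset.mem_map,
      Finset.mem_univ, true_and, Fin.castAddEmb_apply, Fin.ext_iff, Fin.lt_def, Fin.val_natAdd,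
      Fin.val_castAdd]
    constructor
    · rintro ⟨h | h | h, h'⟩
      · omega
      · exact Or.inl h
      · exact Or.inr h
    · rintro (h | ⟨b, hb⟩)
      · exact ⟨Or.inr (Or.inl h), by omega⟩
      · exact ⟨Or.inr (Or.inr ⟨b, hb⟩), by omega⟩
  rw [Finset.sum_eq_add_of_mem (Fin.natAdd d j) (Fin.natAdd d k)
    ((hmem _).2 (Or.inr (Or.inl rfl))) ((hmem _).2 (Or.inl rfl))
    (fun h => hjk.ne (Fin.natAdd_injective d d h))]
  · rw [hfj, hfk, Finset.card_map, Finset.card_univ, Fintype.card_fin, card_reesTopIndex]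
    have key : ∀ (t u : Finset (Fin (d + d))) (ht : t ⊆ s) (hu : u ⊆ s),
        t = reesTopIndex k → u = reesTopIndex j →
        cechRestrict (reesSeq f hf) ht (reesCochain f hf a l m t)
          = cechRestrict (reesSeq f hf) hu (reesCochain f hf a l m u) := by
      rintro t u ht hu rfl rfl
      rw [reesCochain_apply, reesCochain_apply]
      exact cechRestrict_reesFraction f hf a l m k j s ht hu
    rw [key _ _ _ (s.erase_subset (Fin.natAdd d k)) hj hk, Pi.zero_apply]
    exact neg_one_pow_smul_add _ _
  · intro i hi hne
    refine hzero i hi fun b hb => ?_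
    rcases (hmem i).1 hi with h | h | ⟨c, rfl⟩
    · exact hne.2 h
    · exact hne.1 h
    · exact Finset.notMem_erase _ s (hb ▸ castAdd_mem_reesTopIndex c b)

/-- The map `γ : H^{d+1}_𝔐(𝓡) → H^{d+1}_𝔑(𝓡')`: in terms of the surjections
`⨁_{n < 0} H^d_𝔪(R) tⁿ → H^{d+1}_𝔐(𝓡)` and `⨁_{n ∈ ℤ} H^d_𝔪(R) tⁿ → H^{d+1}_𝔑(𝓡')`, it is
induced by the inclusion `⨁_{n < 0} H^d_𝔪(R) tⁿ → ⨁_{n ∈ ℤ} H^d_𝔪(R) tⁿ`. That is, for all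
`m > 0` it maps the image of `[a / f ^ l] t ^ (-m)` to the image of `[a / f ^ l] t ^ (-m)`. (This
map is linear over `R`, but not over `𝓡`.) -/
def IsReesComparison
    (γ : ReesLocalCohomology f hf →ₗ[R] ExtendedReesLocalCohomology f hf) : Prop :=
  ∀ (a : R) (l m : ℕ), 0 < m →
    γ (cechClass _ _ ⟨reesCochain f hf a l m, reesCochain_mem f hf a l m⟩) =
      cechClass _ _ ⟨extendedReesCochain f hf a l m, extendedReesCochain_mem f hf a l m⟩

end Rees

end

-- Since R is Cohen–Macaulay and f_1, …, f_d is a system of parameters, the f_i are nonzerodivisors.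
-- Every localization in either Čech complex therefore embeds in the single ring L = R_f[t, t⁻¹],
-- and both local cohomology modules can be written as quotients of L.
--
-- For 𝓡' the Čech complex has d + 1 elements, so H^{d+1} = L / K', where K' is the sum of the
-- localizations that omit one of them (`exists_cechCohomology_top`). For 𝓡 the complex has 2d
-- elements and H^{d+1} is not its last term. However, once a set of indices contains some f_i and
-- some f_jt, the localization contains t and t⁻¹ and depends only on which subscripts occur. This
-- lets every cocycle of degree d + 1 be moved to one given by a single u ∈ L
-- (`exists_eq_fullD_add_topCochain`), and it gives H^{d+1} = L / K with K = K' + R_f[t]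
-- (`exists_reesLocalCohomology_presentation`). All summands are graded, so u ∈ K exactly when the
-- part of u in negative degrees lies in K' (`mem_reesKer_iff`). Truncation to negative degrees thus
-- induces γ, and γ is injective.
--
-- For tight closure, Frobenius base change commutes with localization, so c z^q = 0 for the class z
-- of u means that c u^q lies in the kernel (`smul_tmul_eq_zero_iff`). If q exceeds the degree of c
-- ∈ 𝓡, the part of c u^q with degrees in [nq, (n+1)q) is exactly c (u_n t^n)^q
-- (`ambRestr_algebraMap_mul_pow`). As K' is graded, each negative component of u is separately in
-- the tight closure of zero, with the same c. For the converse, a multiplier c ∈ 𝓡' is moved into 𝓡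
-- by a power of f_1t. Membership in A⁰ is handled as being a nonzerodivisor modulo the nilradical.
--
-- For F-rationality one first needs 𝓡'_𝔑 to be Cohen–Macaulay. The identity f_1 𝓡_+ = (f_1t) I𝓡
-- makes 𝓡_+ and I𝓡 isomorphic modules. As 𝓡 / 𝓡_+ = R has depth d, so does 𝓡 / I𝓡 = 𝓡' / t⁻¹𝓡'
-- (`depthGE_quotient_of_span_mul_eq`). In a Cohen–Macaulay local ring, one tightly closed parameter
-- ideal forces the ideals of powers of any system of parameters to be tightly closed, hence zero to
-- be tightly closed in top local cohomology (`tightClosure_span_pow_le`,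
-- `tightClosure_cechCohomology_eq_bot`). Injectivity of γ carries this over to 𝓡. To return to
-- ideals, one takes a cohomology class whose annihilator is, locally at 𝔐, a given parameter ideal
-- (`exists_cechCohomology_annihilator`). If a is in the tight closure of that ideal, then a times
-- the class is in the tight closure of zero, hence zero.

universe u

section
open RingTheory.Sequence IsLocalRing CategoryTheory Abelian Pointwise

/-! ### Depth and systems of parameters in local rings. -/

section LocalAlgebra
variable {B : Type u} [CommRing B] [IsLocalRing B]

/-- The depth of `M` is at least `k`: `Extⁱ(B/𝔪, M) = 0` for `i < k`. -/
def DepthGE (B : Type u) [CommRing B] [IsLocalRing B] (M : Type u) [AddCommGroup M] [Module B M]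
    (k : ℕ) : Prop :=
  ∀ i < k, Subsingleton (Ext (ModuleCat.of B (B ⧸ maximalIdeal B)) (ModuleCat.of B M) i)

variable {M M' M'' : Type u} [AddCommGroup M] [Module B M] [AddCommGroup M'] [Module B M']
  [AddCommGroup M''] [Module B M'']

theorem smul_top_lt_top [Module.Finite B M] [Nontrivial M] :
    maximalIdeal B • (⊤ : Submodule B (ModuleCat.of B M)) < ⊤ := by
  refine lt_top_iff_ne_top.2 fun h => ?_
  have : Nontrivial (Submodule B M) := inferInstance
  exact top_ne_bot (Submodule.eq_bot_of_le_smul_of_le_jacobson_bot (maximalIdeal B)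
    (⊤ : Submodule B M) Module.Finite.fg_top h.ge (maximalIdeal_le_jacobson _))

/-- Rees's characterization of depth. Ext against B/𝔪 suffices because its support is exactly V(𝔪).
The Ext form is kept as the definition because it passes through short exact sequences, and regular
sequences are recovered from it when needed. -/
theorem depthGE_of_isRegular [IsNoetherianRing B] [Module.Finite B M] [Nontrivial M] (rs : List B)
    (hrs : ∀ r ∈ rs, r ∈ maximalIdeal B) (h : IsWeaklyRegular M rs) : DepthGE B M rs.length :=
  ModuleCat.subsingleton_ext_of_exists_isRegular (maximalIdeal B) (ModuleCat.of B (B ⧸ maximalIdeal B))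
    (by change Module.support B (B ⧸ maximalIdeal B) ⊆ _
        rw [Module.support_eq_zeroLocus, Ideal.annihilator_quotient]) (ModuleCat.of B M) smul_top_lt_top rs hrs
    (IsRegular.of_isWeaklyRegular_of_mem_maximalIdeal M hrs h)

theorem DepthGE.exists_isWeaklyRegular [IsNoetherianRing B] [Module.Finite B M] {k : ℕ}
    (h : DepthGE B M k) : ∃ rs : List B, rs.length = k ∧ (∀ r ∈ rs, r ∈ maximalIdeal B) ∧
      IsWeaklyRegular M rs := by
  rcases subsingleton_or_nontrivial M with _ | _
  -- On the zero module every sequence is weakly regular, so any list of the right length in 𝔪 will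
  -- do.
  · refine ⟨List.replicate k 0, by simp, fun r hr => by simp [List.eq_of_mem_replicate hr], ?_⟩
    exact ⟨fun i _ => Function.injective_of_subsingleton _⟩
  · obtain ⟨rs, h1, h2, h3⟩ := ModuleCat.exists_isRegular_of_exists_subsingleton_ext
      (maximalIdeal B) k (ModuleCat.of B M) smul_top_lt_top
      (ModuleCat.of B (B ⧸ maximalIdeal B))
      (by change Module.support B (B ⧸ maximalIdeal B) = _
          rw [Module.support_eq_zeroLocus, Ideal.annihilator_quotient]) h
    exact ⟨rs, h1, h2, h3.1⟩

theorem DepthGE.mono {k l : ℕ} (h : DepthGE B M k) (hl : l ≤ k) : DepthGE B M l :=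
  fun i hi => h i (hi.trans_le hl)

omit [IsLocalRing B] in
theorem shortExact_of_exact {f : M' →ₗ[B] M} {g : M →ₗ[B] M''} (hf : Function.Injective f)
    (hg : Function.Surjective g) (hfg : Function.Exact f g) :
    (ShortComplex.mk (ModuleCat.ofHom f) (ModuleCat.ofHom g)
      (by ext x; exact hfg.apply_apply_eq_zero x)).ShortExact where
  exact := (ShortComplex.ShortExact.moduleCat_exact_iff_function_exact _).2 hfg
  mono_f := (ModuleCat.mono_iff_injective _).2 hf
  epi_g := (ModuleCat.epi_iff_surjective _).2 hg

/-- Ext^{i+1} of the submodule sits between Ext^i of the quotient and Ext^{i+1} of the middle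
module; in degree zero, left exactness of Hom is enough. -/
theorem DepthGE.left {f : M' →ₗ[B] M} {g : M →ₗ[B] M''} (hf : Function.Injective f)
    (hg : Function.Surjective g) (hfg : Function.Exact f g) {k : ℕ}
    (h : DepthGE B M (k + 1)) (h'' : DepthGE B M'' k) : DepthGE B M' (k + 1) := by
  intro i hi
  have S := shortExact_of_exact hf hg hfg
  have zero2 := AddCommGrpCat.isZero_of_iff_subsingleton.mpr (h i hi)
  rcases i with _ | i
  · have : Subsingleton (ModuleCat.of B (B ⧸ maximalIdeal B) ⟶ ModuleCat.of B M) :=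
      Ext.addEquiv₀.symm.subsingleton_congr.mpr (h 0 hi)
    refine Ext.addEquiv₀.subsingleton_congr.mpr ⟨fun a b => ?_⟩
    have := S.mono_f
    exact (cancel_mono (ModuleCat.ofHom f)).1 (Subsingleton.elim _ _)
  · have zero1 := AddCommGrpCat.isZero_of_iff_subsingleton.mpr (h'' i (by omega))
    exact AddCommGrpCat.subsingleton_of_isZero <| ShortComplex.Exact.isZero_of_both_zeros
        (Ext.covariant_sequence_exact₁' _ S i (i + 1) rfl)
        (zero1.eq_zero_of_src _) (zero2.eq_zero_of_tgt _)

theorem DepthGE.right {f : M' →ₗ[B] M} {g : M →ₗ[B] M''} (hf : Function.Injective f)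
    (hg : Function.Surjective g) (hfg : Function.Exact f g) {k : ℕ}
    (h' : DepthGE B M' (k + 1)) (h : DepthGE B M k) : DepthGE B M'' k := by
  intro i hi
  have S := shortExact_of_exact hf hg hfg
  have zero1 := AddCommGrpCat.isZero_of_iff_subsingleton.mpr (h i hi)
  have zero2 := AddCommGrpCat.isZero_of_iff_subsingleton.mpr (h' (i + 1) (by omega))
  exact AddCommGrpCat.subsingleton_of_isZero <| ShortComplex.Exact.isZero_of_both_zeros
    (Ext.covariant_sequence_exact₃' _ S i (i + 1) rfl)
    (zero1.eq_zero_of_src _) (zero2.eq_zero_of_tgt _)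

theorem DepthGE.quotSMulTop {k : ℕ} (h : DepthGE B M (k + 1)) {x : B} (hx : IsSMulRegular M x) :
    DepthGE B (QuotSMulTop x M) k :=
  DepthGE.right (f := LinearMap.lsmul B M x) (g := Submodule.mkQ _) hx
    (Submodule.mkQ_surjective _) (LinearMap.exact_lsmul_mkQ_smul_top M x) h (h.mono k.le_succ)

theorem DepthGE.of_linearEquiv [IsNoetherianRing B] [Module.Finite B M] [Nontrivial M] {k : ℕ}
    (h : DepthGE B M k) (e : M ≃ₗ[B] M') : DepthGE B M' k := by
  obtain ⟨rs, rfl, h2, h3⟩ := h.exists_isWeaklyRegular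
  have := Module.Finite.equiv e
  have := e.symm.toEquiv.nontrivial
  exact depthGE_of_isRegular rs h2 ((e.isWeaklyRegular_congr rs).1 h3)

/-- The depth of a module is at most dim B/P for each associated prime P. Dividing by the first
element r lowers the depth by one. Some element killed by P survives in M/rM, so M/rM has an
associated prime Q containing both P and r. As r ∉ P, the dimension drops from B/P to B/Q. -/
theorem length_le_ringKrullDim_of_isAssociatedPrime [IsNoetherianRing B] [Module.Finite B M]
    (rs : List B) (hrs : ∀ r ∈ rs, r ∈ maximalIdeal B) (h : IsWeaklyRegular M rs) (P : Ideal B)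
    (hP : IsAssociatedPrime P M) : (rs.length : WithBot ℕ∞) ≤ ringKrullDim (B ⧸ P) := by
  induction rs generalizing M P with
  | nil =>
    have := hP.1
    simpa using! ringKrullDim_nonneg_of_nontrivial
  | cons r rs ih =>
    rw [isWeaklyRegular_cons_iff] at h
    have hPp := hP.1
    obtain ⟨-, x, hx⟩ := isAssociatedPrime_iff.1 hP
    have hxP : ∀ a ∈ P, a • x = 0 := fun a ha => by
      rw [hx] at ha; simpa using Submodule.mem_colon_singleton.1 ha
    have hx0 : x ≠ 0 := by
      rintro rfl
      exact hPp.ne_top (by rw [hx]; simp)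
    have hrP : r ∉ P := fun hr => hx0 (h.1 (by simpa using hxP r hr))
    let N : Submodule B M :=
      { carrier := {m | ∀ a ∈ P, a • m = 0}
        zero_mem' := fun a _ => smul_zero a
        add_mem' := fun hm hn a ha => by rw [smul_add, hm a ha, hn a ha, add_zero]
        smul_mem' := fun c m hm a ha => by rw [smul_comm, hm a ha, smul_zero] }
    -- If all of N were in rM, then, r being regular, an m = r m' in N would have m' ∈ N as well. So
    -- N ⊆ 𝔪N, and Nakayama contradicts x ≠ 0.
    obtain ⟨m, hmN, hm⟩ : ∃ m ∈ N, m ∉ r • (⊤ : Submodule B M) := by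
      by_contra! hN
      have hle : N ≤ maximalIdeal B • N := by
        intro m hm
        obtain ⟨m', -, rfl⟩ := (Submodule.mem_smul_pointwise_iff_exists _ _ _).1 (hN m hm)
        refine Submodule.smul_mem_smul (hrs r (by simp)) fun a ha => h.1 ?_
        change r • a • m' = r • (0 : M)
        rw [smul_zero]
        exact (smul_comm r a m').trans (hm a ha)
      have := Submodule.eq_bot_of_le_smul_of_le_jacobson_bot (maximalIdeal B) N
        (IsNoetherian.noetherian N) hle (maximalIdeal_le_jacobson _)
      exact hx0 ((Submodule.eq_bot_iff _).1 this x hxP)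
    obtain ⟨Q, hQ, hQm⟩ := exists_le_isAssociatedPrime_of_isNoetherianRing B
      (Submodule.mkQ (r • (⊤ : Submodule B M)) m) (by simpa using hm)
    have hPQ : P ≤ Q := fun a ha => hQm (by
      simp only [Submodule.mem_colon_singleton]
      rw [← map_smul, hmN a ha]; simp)
    have hrQ : r ∈ Q := hQm (by
      simp only [Submodule.mem_colon_singleton]
      rw [← map_smul]
      exact (Submodule.Quotient.mk_eq_zero _).2 (Submodule.smul_mem_pointwise_smul m r ⊤ trivial))
    have h1 := ih (M := QuotSMulTop r M) (fun r hr => hrs r (by simp [hr])) h.2 Q hQ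
    have h2 := ringKrullDim_succ_le_of_surjective (Ideal.Quotient.factor hPQ)
      (Ideal.Quotient.factor_surjective hPQ) (r := Ideal.Quotient.mk P r)
      (mem_nonZeroDivisors_of_ne_zero (by simpa [Ideal.Quotient.eq_zero_iff_mem] using hrP))
      (by simpa [Ideal.Quotient.eq_zero_iff_mem] using hrQ)
    refine le_trans ?_ h2
    rw [List.length_cons]
    push_cast
    gcongr

theorem ringKrullDim_le_length_of_le_radical [IsNoetherianRing B] (xs : List B)
    (hxs : ∀ x ∈ xs, x ∈ maximalIdeal B) (hx : maximalIdeal B ≤ (Ideal.ofList xs).radical) :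
    ringKrullDim B ≤ xs.length := by
  classical
  rw [← maximalIdeal_height_eq_ringKrullDim]
  have hmin : maximalIdeal B ∈ (Ideal.span (xs.toFinset : Set B)).minimalPrimes := by
    have hset : Ideal.span (xs.toFinset : Set B) = Ideal.ofList xs := by simp [Ideal.ofList]
    rw [hset]
    refine ⟨⟨inferInstance, Ideal.span_le.2 hxs⟩, fun Q hQ _ => ?_⟩
    exact hx.trans (hQ.1.radical_le_iff.2 hQ.2)
  have h := Ideal.height_le_card_of_mem_minimalPrimes_span_finset hmin
  exact WithBot.coe_le_coe.2 (h.trans (by exact_mod_cast xs.toFinset_card_le))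

theorem ringKrullDim_quotient_le_length [IsNoetherianRing B] (P : Ideal B) [hP : P.IsPrime]
    (xs : List B) (hxs : ∀ x ∈ xs, x ∈ maximalIdeal B)
    (hx : maximalIdeal B ≤ (P ⊔ Ideal.ofList xs).radical) :
    ringKrullDim (B ⧸ P) ≤ xs.length := by
  have : Nontrivial (B ⧸ P) := Ideal.Quotient.nontrivial_iff.2 hP.ne_top
  have : IsLocalRing (B ⧸ P) := .of_surjective' _ Ideal.Quotient.mk_surjective
  have hm : maximalIdeal (B ⧸ P) = (maximalIdeal B).map (Ideal.Quotient.mk P) :=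
    (IsLocalRing.map_maximalIdeal_of_surjective _ Ideal.Quotient.mk_surjective).symm
  have h := ringKrullDim_le_length_of_le_radical (xs.map (Ideal.Quotient.mk P)) (by
      intro y hy
      obtain ⟨x, hx, rfl⟩ := List.mem_map.1 hy
      rw [hm]
      exact Ideal.mem_map_of_mem _ (hxs x hx)) (by
      rw [hm, Ideal.map_le_iff_le_comap]
      intro b hb
      obtain ⟨n, hn⟩ := hx hb
      refine ⟨n, ?_⟩
      have := Ideal.mem_map_of_mem (Ideal.Quotient.mk P) hn
      rw [Ideal.map_sup, Ideal.map_quotient_self, bot_sup_eq, Ideal.map_ofList, map_pow] at this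
      exact this)
  simpa using h

/-- In a module of depth at least n, any n elements that define the maximal ideal up to radical
modulo the annihilator form a regular sequence. If the first one lay in an associated prime P, the
remaining n - 1 elements would already bound dim B/P by n - 1, against the depth bound. -/
theorem isWeaklyRegular_of_le_radical [IsNoetherianRing B] [Module.Finite B M] (xs : List B)
    (hxs : ∀ x ∈ xs, x ∈ maximalIdeal B) (h : DepthGE B M xs.length)
    (hx : maximalIdeal B ≤ (Module.annihilator B M ⊔ Ideal.ofList xs).radical) :
    IsWeaklyRegular M xs := by
  induction xs generalizing M with
  | nil => exact .nil _ _
  | cons x xs ih =>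
    have hreg : IsSMulRegular M x := by
      by_contra hcon
      have : x ∈ ⋃ p ∈ associatedPrimes B M, (p : Set B) := by
        rw [biUnion_associatedPrimes_eq_compl_regular]
        exact hcon
      simp only [Set.mem_iUnion] at this
      obtain ⟨P, hP, hxP⟩ := this
      obtain ⟨rs, h1, h2, h3⟩ := h.exists_isWeaklyRegular
      have h4 := length_le_ringKrullDim_of_isAssociatedPrime rs h2 h3 P hP
      have := hP.1
      have h5 := ringKrullDim_quotient_le_length P xs (fun y hy => hxs y (by simp [hy])) (hx.trans (Ideal.radical_mono (sup_le
        ((Submodule.annihilator_top (R := B) (M := M) ▸ hP.annihilator_le).trans le_sup_left) (by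
          rw [Ideal.ofList_cons]
          exact sup_le_sup_right ((Ideal.span_singleton_le_iff_mem _).2 hxP) _))))
      have h6 := h4.trans h5
      rw [h1, List.length_cons] at h6
      norm_cast at h6
      omega
    rw [isWeaklyRegular_cons_iff]
    refine ⟨hreg, ih (fun y hy => hxs y (by simp [hy])) (h.quotSMulTop hreg)
      (hx.trans (Ideal.radical_mono (sup_le ?_ ?_)))⟩
    · refine le_trans ?_ le_sup_left
      exact LinearMap.annihilator_le_of_surjective _ (Submodule.mkQ_surjective _)
    · rw [Ideal.ofList_cons]
      refine sup_le_sup_right ((Ideal.span_singleton_le_iff_mem _).2 ?_) _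
      rw [Module.mem_annihilator]
      intro m
      obtain ⟨m, rfl⟩ := Submodule.mkQ_surjective _ m
      rw [← map_smul]
      exact (Submodule.Quotient.mk_eq_zero _).2 (Submodule.smul_mem_pointwise_smul m x ⊤ trivial)

/-- The criterion by radicals is insensitive to order, so `x` may be placed last, and is then
regular modulo all the others. -/
theorem isSMulRegular_of_le_radical [IsNoetherianRing B] (x : B) (w : List B)
    (hmem : ∀ y ∈ x :: w, y ∈ maximalIdeal B) (h : DepthGE B B (w.length + 1))
    (hx : maximalIdeal B ≤ (Ideal.ofList (x :: w)).radical) {a : B}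
    (ha : x * a ∈ Ideal.ofList w) : a ∈ Ideal.ofList w := by
  have hperm : Ideal.ofList (w ++ [x]) = Ideal.ofList (x :: w) := by
    rw [Ideal.ofList_append, Ideal.ofList_cons x w, Ideal.ofList_singleton, sup_comm]
  have hreg : IsWeaklyRegular B (w ++ [x]) := by
    refine isWeaklyRegular_of_le_radical _ (fun y hy => hmem y ?_) (by simpa using h) ?_
    · simpa [or_comm] using hy
    · rw [hperm]
      exact hx.trans (Ideal.radical_mono le_sup_right)
  rw [isWeaklyRegular_append_iff, isWeaklyRegular_singleton_iff] at hreg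
  have := mem_of_isSMulRegular_quotient_of_smul_mem hreg.2 (x := a) (by simpa using ha)
  simpa using this

theorem depthGE_of_isCohenMacaulayLocal (h : IsCohenMacaulayLocal B) {n : ℕ}
    (hn : n ≤ ringKrullDim B) : DepthGE B B n := by
  obtain ⟨hN, rs, h1, h2, h3⟩ := h
  refine (depthGE_of_isRegular rs h1 h2.1).mono ?_
  rw [h3] at hn
  exact_mod_cast hn

end LocalAlgebra
end

noncomputable section

/-! ### Tight closure of ideals and of powers of parameters. -/

section TightClosure

/-- The nilradical is the intersection of the minimal primes, and their union consists of the
zerodivisors modulo it. In this form A⁰ can be compared between rings by elements alone, without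
matching up minimal primes. -/
theorem mem_minimalPrimesCompl_iff {A : Type*} [CommRing A] {c : A} :
    c ∈ minimalPrimesCompl A ↔ ∀ b, IsNilpotent (c * b) → IsNilpotent b := by
  constructor
  · intro hc b hb
    rw [← mem_nilradical, nilradical, ← Ideal.sInf_minimalPrimes, Submodule.mem_sInf]
    intro P hP
    have := hP.1.1
    obtain ⟨k, hk⟩ := hb
    exact (this.mem_or_mem (Ideal.IsPrime.mem_of_pow_mem this k
      (hk ▸ P.zero_mem))).resolve_left (hc P hP)
  · intro h P hP hcP
    obtain ⟨x, hx, hcx⟩ : ∃ x ∉ nilradical A, c * x ∈ nilradical A := by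
      have hmem : c ∈ ⋃ P ∈ (⊥ : Ideal A).minimalPrimes, (P : Set A) :=
        Set.mem_biUnion (show P ∈ (⊥ : Ideal A).minimalPrimes from hP) hcP
      rw [Ideal.iUnion_minimalPrimes] at hmem
      exact hmem
    exact hx (h x hcx)

variable (p : ℕ) [Fact p.Prime]

variable {A : Type*} [CommRing A] [CharP A p]

theorem tmul_smul_frobeniusTwist {H : Type*} [AddCommGroup H] [Module A H] (e : ℕ) (a : A)
    (z : H) : (1 : FrobeniusTwist A p e) ⊗ₜ[A] (a • z)
      = FrobeniusTwist.of p e (a ^ p ^ e) • ((1 : FrobeniusTwist A p e) ⊗ₜ[A] z) := by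
  rw [TensorProduct.tmul_smul, ← algebraMap_smul (FrobeniusTwist A p e) a]
  rfl

/-- Under the identification of the twist of A with A itself, the image of J becomes the Frobenius
power J^[q]; this recovers the classical definition of tight closure of ideals. -/
theorem smul_tmul_mem_baseChange_iff (J : Ideal A) (e : ℕ) (c z : A) :
    FrobeniusTwist.of p e c • ((1 : FrobeniusTwist A p e) ⊗ₜ[A] z) ∈
      J.baseChange (FrobeniusTwist A p e) ↔ c * z ^ p ^ e ∈ J.map (iterateFrobenius A p e) := by
  let F := FrobeniusTwist A p e
  have h0 : c * z ^ p ^ e ∈ J.map (iterateFrobenius A p e) ↔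
    FrobeniusTwist.of p e c * algebraMap A F z ∈ J.map (algebraMap A F) := Iff.rfl
  rw [h0]
  let ε := TensorProduct.AlgebraTensorModule.rid A F F
  have h1 : (J.baseChange F).map ε.toLinearMap = J.map (algebraMap A F) := by
    rw [Submodule.baseChange_eq_span, Submodule.map_span, Ideal.map]
    congr 1
    ext y
    simp [ε, Algebra.smul_def, F]
  have h2 : ε (FrobeniusTwist.of p e c • ((1 : F) ⊗ₜ[A] z))
      = FrobeniusTwist.of p e c * algebraMap A F z := by
    rw [map_smul]
    simp [ε, Algebra.smul_def, F]
  rw [← h1, ← h2]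
  exact ⟨fun h => Submodule.mem_map_of_mem h, fun ⟨y, hy, e⟩ => ε.injective e ▸ hy⟩

theorem mem_tightClosure_ideal_iff {J : Ideal A} {z : A} :
    z ∈ tightClosure p J ↔ ∃ c ∈ minimalPrimesCompl A, ∃ e₀ : ℕ, ∀ e ≥ e₀,
      c * z ^ p ^ e ∈ J.map (iterateFrobenius A p e) := by
  simp only [← smul_tmul_mem_baseChange_iff]
  rfl

/-- Since b^q (1 ⊗ η) = 1 ⊗ bη, the annihilator of 1 ⊗ η contains J^[q]. Thus a relation for the
tight closure of J yields one for the tight closure of zero. -/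
theorem smul_tmul_smul_eq_zero {H : Type*} [AddCommGroup H] [Module A H]
    (η : H) {J : Ideal A} (hJ : ∀ a ∈ J, a • η = 0) {e : ℕ} {c a : A}
    (h : c * a ^ p ^ e ∈ J.map (iterateFrobenius A p e)) :
    FrobeniusTwist.of p e c • ((1 : FrobeniusTwist A p e) ⊗ₜ[A] (a • η)) = 0 := by
  let F := FrobeniusTwist A p e
  let T : Ideal F := LinearMap.ker (LinearMap.toSpanSingleton F (F ⊗[A] H) ((1 : F) ⊗ₜ[A] η))
  have hle : J.map (algebraMap A F) ≤ T := by
    refine Ideal.map_le_iff_le_comap.2 fun b hb => ?_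
    refine Ideal.mem_comap.2 (LinearMap.mem_ker.2 ?_)
    refine (tmul_smul_frobeniusTwist p e b η).symm.trans ?_
    rw [hJ b hb, TensorProduct.tmul_zero]
  rw [tmul_smul_frobeniusTwist, ← mul_smul]
  exact hle h

theorem le_tightClosure (J : Ideal A) : J ≤ tightClosure p J := fun z hz =>
  (mem_tightClosure_ideal_iff p).2 ⟨1, one_mem _, 0, fun e _ => by
    rw [one_mul]
    exact Ideal.mem_map_of_mem (iterateFrobenius A p e) hz⟩

/-- Colon ideals of tightly closed ideals are tightly closed: multiplying c z^q ∈ J'^[q] by b^q puts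
it into J^[q], so zb lies in the tight closure of J. -/
theorem tightClosure_le_of_colon {J J' : Ideal A} (b : A) (h : ∀ a, a * b ∈ J ↔ a ∈ J')
    (hJ : tightClosure p J ≤ J) : tightClosure p J' ≤ J' := by
  intro z hz
  obtain ⟨c, hc, e₀, hz⟩ := (mem_tightClosure_ideal_iff p).1 hz
  refine (h z).1 (hJ ((mem_tightClosure_ideal_iff p).2 ⟨c, hc, e₀, fun e he => ?_⟩))
  have hle : J'.map (iterateFrobenius A p e) * Ideal.span {b ^ p ^ e} ≤
      J.map (iterateFrobenius A p e) := by
    rw [Ideal.map, Ideal.span_mul_span', Ideal.span_le]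
    rintro _ ⟨_, ⟨a, ha, rfl⟩, _, rfl, rfl⟩
    have := Ideal.mem_map_of_mem (iterateFrobenius A p e) ((h a).2 ha)
    rwa [map_mul, iterateFrobenius_def _ _ b] at this
  rw [mul_pow, ← mul_assoc]
  exact hle (Ideal.mul_mem_mul (hz e he) (Ideal.mem_span_singleton_self _))

theorem tightClosure_mono {J J' : Ideal A} (h : J ≤ J') : tightClosure p J ≤ tightClosure p J' := by
  intro z hz
  obtain ⟨c, hc, e₀, hz⟩ := (mem_tightClosure_ideal_iff p).1 hz
  exact (mem_tightClosure_ideal_iff p).2 ⟨c, hc, e₀, fun e he => Ideal.map_mono h (hz e he)⟩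

/-- Write an element of the tight closure of (y^{m+1}, w) as a y^m + b with b ∈ w, using that (y^m,
w) is tightly closed. Its relation gives y^{mq}(c a^q - r y^q) ∈ w^[q]; cancelling y^{mq} shows that
a is in the tight closure of (y, w), hence in (y, w). -/
theorem tightClosure_span_pow_succ_sup_le (y : A) (w : Ideal A)
    (hreg : ∀ e a, y * a ∈ w.map (iterateFrobenius A p e) → a ∈ w.map (iterateFrobenius A p e))
    {m : ℕ} (h1 : tightClosure p (Ideal.span {y} ⊔ w) ≤ Ideal.span {y} ⊔ w)
    (hm : tightClosure p (Ideal.span {y ^ m} ⊔ w) ≤ Ideal.span {y ^ m} ⊔ w) :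
    tightClosure p (Ideal.span {y ^ (m + 1)} ⊔ w) ≤ Ideal.span {y ^ (m + 1)} ⊔ w := by
  have hreg' : ∀ e n a, y ^ n * a ∈ w.map (iterateFrobenius A p e) →
      a ∈ w.map (iterateFrobenius A p e) := by
    intro e n
    induction n with
    | zero => intro a ha; simpa using ha
    | succ n ih => intro a ha; exact ih a (hreg e _ (by rwa [← mul_assoc, ← pow_succ']))
  intro z hz
  have hle : Ideal.span {y ^ (m + 1)} ⊔ w ≤ Ideal.span {y ^ m} ⊔ w :=
    sup_le_sup_right (Ideal.span_singleton_le_span_singleton.2 (pow_dvd_pow y m.le_succ)) _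
  have hz' := hm (tightClosure_mono p hle hz)
  obtain ⟨a, b, hb, hab⟩ := Ideal.mem_span_singleton_sup.1 hz'
  obtain ⟨c, hc, e₀, hcz⟩ := (mem_tightClosure_ideal_iff p).1 hz
  have ha : a ∈ Ideal.span {y} ⊔ w := by
    refine h1 ((mem_tightClosure_ideal_iff p).2 ⟨c, hc, e₀, fun e he => ?_⟩)
    have h2 := hcz e he
    have hb' : b ^ p ^ e ∈ w.map (iterateFrobenius A p e) :=
      Ideal.mem_map_of_mem (iterateFrobenius A p e) hb
    rw [Ideal.map_sup, Ideal.map_span, Set.image_singleton, iterateFrobenius_def] at h2 ⊢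
    rw [Ideal.mem_span_singleton_sup] at h2 ⊢
    obtain ⟨r, s, hs, hrs⟩ := h2
    rw [← hab, add_pow_char_pow] at hrs
    refine ⟨r, c * a ^ p ^ e - r * y ^ p ^ e, hreg' e (m * p ^ e) _ ?_, by ring⟩
    have h3 : y ^ (m * p ^ e) * (c * a ^ p ^ e - r * y ^ p ^ e) = s - c * b ^ p ^ e := by
      rw [← pow_mul] at hrs
      have : y ^ ((m + 1) * p ^ e) = y ^ (m * p ^ e) * y ^ p ^ e := by
        rw [← pow_add]; ring_nf
      rw [this, mul_pow, ← pow_mul] at hrs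
      linear_combination -hrs
    rw [h3]
    exact sub_mem hs (Ideal.mul_mem_left _ _ hb')
  rw [← hab]
  refine add_mem ?_ (Ideal.mem_sup_right hb)
  obtain ⟨a', b', hb', rfl⟩ := Ideal.mem_span_singleton_sup.1 ha
  rw [add_mul]
  refine add_mem (Ideal.mem_sup_left ?_) (Ideal.mem_sup_right (Ideal.mul_mem_right _ _ hb'))
  rw [mul_assoc, ← pow_succ']
  exact Ideal.mul_mem_left _ _ (Ideal.mem_span_singleton_self _)

/-- The exponents are raised one parameter at a time, and for each parameter one unit at a time. The
elements of `pre` already carry the exponent k. -/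
theorem tightClosure_ofList_map_pow_le {B : Type u} [CommRing B] [IsLocalRing B] [IsNoetherianRing B]
    [CharP B p] (xs : List B) (hxs : ∀ x ∈ xs, x ∈ IsLocalRing.maximalIdeal B)
    (h : DepthGE B B xs.length) (hx : IsLocalRing.maximalIdeal B ≤ (Ideal.ofList xs).radical)
    (htc : tightClosure p (Ideal.ofList xs) ≤ Ideal.ofList xs) {k : ℕ} (hk : k ≠ 0) :
    tightClosure p (Ideal.ofList (xs.map (· ^ k))) ≤ Ideal.ofList (xs.map (· ^ k)) := by
  have hrad : ∀ ys : List B, (∀ x ∈ xs, ∃ n, x ^ n ∈ ys) →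
      IsLocalRing.maximalIdeal B ≤ (Ideal.ofList ys).radical := fun ys hys => by
    refine hx.trans (Ideal.radical_le_radical_iff.2 (Ideal.span_le.2 fun x hx => ?_))
    obtain ⟨n, hn⟩ := hys x hx
    exact ⟨n, Ideal.subset_span hn⟩
  suffices H : ∀ pre suf : List B, pre ++ suf = xs →
      tightClosure p (Ideal.ofList (pre.map (· ^ k) ++ suf)) ≤
        Ideal.ofList (pre.map (· ^ k) ++ suf) by
    simpa using H xs [] (by simp)
  intro pre
  induction pre using List.reverseRecOn with
  | nil => rintro suf rfl; simpa using htc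
  | append_singleton pre x ih =>
    intro suf hsuf
    have ih := ih (x :: suf) (by rw [← hsuf]; simp)
    have hsplit : ∀ y, Ideal.ofList (pre.map (· ^ k) ++ y :: suf)
        = Ideal.span {y} ⊔ Ideal.ofList (pre.map (· ^ k) ++ suf) := fun y => by
      rw [Ideal.ofList_append, Ideal.ofList_append, Ideal.ofList_cons]
      exact sup_left_comm _ _ _
    have hmem : ∀ y ∈ pre ++ x :: suf, y ∈ IsLocalRing.maximalIdeal B := fun y hy =>
      hxs y (by rw [← hsuf]; simpa using hy)
    -- A Frobenius power of the ideal of the other parameters is again generated by powers of them,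
    -- so x stays regular modulo it.
    have hreg : ∀ e a, x * a ∈ (Ideal.ofList (pre.map (· ^ k) ++ suf)).map (iterateFrobenius B p e) →
        a ∈ (Ideal.ofList (pre.map (· ^ k) ++ suf)).map (iterateFrobenius B p e) := by
      intro e a ha
      rw [Ideal.map_ofList] at ha ⊢
      have hpe : p ^ e ≠ 0 := pow_ne_zero _ (Fact.out : p.Prime).ne_zero
      refine isSMulRegular_of_le_radical x _ (fun y hy => ?_) ?_ (hrad _ fun y hy => ?_) ha
      · rcases List.mem_cons.1 hy with rfl | hy
        · exact hmem _ (by simp)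
        · obtain ⟨z, hz, rfl⟩ := List.mem_map.1 hy
          rw [iterateFrobenius_def]
          refine Ideal.pow_mem_of_mem _ ?_ _ (Nat.pos_of_ne_zero hpe)
          rcases List.mem_append.1 hz with hz | hz
          · obtain ⟨z, hz', rfl⟩ := List.mem_map.1 hz
            exact Ideal.pow_mem_of_mem _ (hmem z (by simp [hz'])) _ (Nat.pos_of_ne_zero hk)
          · exact hmem z (by simp [hz])
      · rw [← hsuf] at h
        simpa [add_assoc, add_comm, add_left_comm] using h
      · rw [← hsuf] at hy
        simp only [List.append_assoc, List.mem_append, List.mem_singleton] at hy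
        rcases hy with hy | rfl | hy
        · exact ⟨k * p ^ e, List.mem_cons_of_mem _ (List.mem_map.2 ⟨y ^ k,
            List.mem_append_left _ (List.mem_map.2 ⟨y, hy, rfl⟩), by
              rw [iterateFrobenius_def, pow_mul]⟩)⟩
        · exact ⟨1, by simp⟩
        · exact ⟨p ^ e, List.mem_cons_of_mem _ (List.mem_map.2 ⟨y,
            List.mem_append_right _ hy, iterateFrobenius_def _ _ _⟩)⟩
    rw [hsplit] at ih
    rw [List.map_append, List.append_assoc, List.map_singleton, List.singleton_append, hsplit]
    clear hsplit
    obtain ⟨k, rfl⟩ := Nat.exists_eq_succ_of_ne_zero hk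
    generalize Ideal.ofList (pre.map (· ^ (k + 1)) ++ suf) = w at *
    have : ∀ n, tightClosure p (Ideal.span {x ^ (n + 1)} ⊔ w) ≤ Ideal.span {x ^ (n + 1)} ⊔ w := by
      intro n
      induction n with
      | zero => simpa using ih
      | succ n ihn => exact tightClosure_span_pow_succ_sup_le p x w hreg ih ihn
    exact this k

end TightClosure
end

noncomputable section

/-! ### Frobenius base change of a quotient of a localization. -/

section SubLocalization

/-- The elements of the `A`-algebra `L` which become elements of `A` after multiplication by a power
of `x`. If `A ⊆ L` and `x` is invertible in `L`, this is `A_x`. -/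
def locSub (A L : Type*) [CommRing A] [CommRing L] [Algebra A L] (x : A) : Subalgebra A L where
  carrier := {u | ∃ (N : ℕ) (a : A), algebraMap A L x ^ N * u = algebraMap A L a}
  mul_mem' := by
    rintro u v ⟨N, a, hu⟩ ⟨M, b, hv⟩
    refine ⟨N + M, a * b, ?_⟩
    rw [map_mul, ← hu, ← hv]
    ring
  add_mem' := by
    rintro u v ⟨N, a, hu⟩ ⟨M, b, hv⟩
    refine ⟨N + M, x ^ M * a + x ^ N * b, ?_⟩
    simp only [map_add, map_mul, map_pow, ← hu, ← hv]
    ring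
  algebraMap_mem' a := ⟨0, a, by simp⟩

variable {A L : Type*} [CommRing A] [CommRing L] [Algebra A L]

theorem mem_locSub_of_mul_eq_one {x : A} {ξ : L} (h : algebraMap A L x * ξ = 1) :
    ξ ∈ locSub A L x := ⟨1, 1, by simpa using h⟩

theorem mem_locSub_iff_of_mul_eq_one {x : A} {ξ : L} (h : algebraMap A L x * ξ = 1) {u : L} :
    u ∈ locSub A L x ↔ ∃ (N : ℕ) (a : A), u = algebraMap A L a * ξ ^ N := by
  refine exists_congr fun N => exists_congr fun a => ?_
  have h1 : algebraMap A L x ^ N * ξ ^ N = 1 := by rw [← mul_pow, h, one_pow]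
  constructor
  · intro hu; linear_combination ξ ^ N * hu - u * h1
  · intro hu; linear_combination algebraMap A L x ^ N * hu + algebraMap A L a * h1

variable (p : ℕ) [Fact p.Prime] [CharP A p]

/-- The Frobenius twist commutes with localization, so the twist of L / Σ A_{y_i} is L / Σ A_{y_i}
again, with c ⊗ π(u) corresponding to the class of c u^q. One direction maps out of the twist by
this formula; the other lifts kernel elements to tensors that visibly vanish. -/
theorem smul_tmul_eq_zero_iff (hinj : Function.Injective (algebraMap A L)) {x : A}
    (hx : IsUnit (algebraMap A L x)) (hL : locSub A L x = ⊤) {ι : Type*} (y : ι → A)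
    (hy : ∀ i, IsUnit (algebraMap A L (y i))) {H : Type*} [AddCommGroup H] [Module A H]
    (π : L →ₗ[A] H) (hπ : Function.Surjective π)
    (hker : LinearMap.ker π = ⨆ i, Subalgebra.toSubmodule (locSub A L (y i)))
    (e : ℕ) (c : A) (u : L) :
    FrobeniusTwist.of p e c • ((1 : FrobeniusTwist A p e) ⊗ₜ[A] π u) = 0 ↔
      algebraMap A L c * u ^ p ^ e ∈ LinearMap.ker π := by
  have hL' : ∀ u : L, u ∈ locSub A L x := fun u => hL ▸ Algebra.mem_top
  obtain ⟨ξ, hξ⟩ := hx.exists_right_inv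
  have : Nontrivial A := CharP.nontrivial_of_char_ne_one (Fact.out : p.Prime).ne_one
  have : Nontrivial L := hinj.nontrivial
  have : CharP L p := charP_of_algebra_nontrivial p A L
  have hpe : p ^ e ≠ 0 := pow_ne_zero _ (Fact.out : p.Prime).ne_zero
  have hpow : ∀ k ∈ LinearMap.ker π, k ^ p ^ e ∈ LinearMap.ker π := by
    rw [hker]
    intro k hk
    induction hk using Submodule.iSup_induction' with
    | mem i k hk => exact Submodule.mem_iSup_of_mem i ((locSub A L (y i)).pow_mem hk _)
    | zero => rw [zero_pow hpe]; exact zero_mem _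
    | add k l _ _ hk hl => rw [add_pow_char_pow]; exact add_mem hk hl
  have hof : ∀ c u, FrobeniusTwist.of p e c • ((1 : FrobeniusTwist A p e) ⊗ₜ[A] π u)
      = (FrobeniusTwist.of p e c) ⊗ₜ[A] π u := fun c u => by
    rw [TensorProduct.smul_tmul', smul_eq_mul, mul_one]
  rw [hof]
  constructor
  · intro h
    -- The map π(u) ↦ [u^q] is well defined and additive because each A_{y_i} is a subring and the
    -- q-th power is additive, so the kernel is stable under q-th powers.
    let g : H →+ L ⧸ LinearMap.ker π := AddMonoidHom.mk'
      (fun z => Submodule.Quotient.mk (Function.surjInv hπ z ^ p ^ e)) (by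
        intro z w
        rw [← Submodule.Quotient.mk_add, Submodule.Quotient.eq, ← add_pow_char_pow, ← sub_pow_char_pow]
        refine hpow _ ?_
        rw [LinearMap.mem_ker, map_sub, map_add]
        simp only [Function.surjInv_eq, sub_self])
    have hg : ∀ u, g (π u) = Submodule.Quotient.mk (u ^ p ^ e) := by
      intro u
      refine (Submodule.Quotient.eq _).2 ?_
      rw [← sub_pow_char_pow]
      refine hpow _ ?_
      rw [LinearMap.mem_ker, map_sub, Function.surjInv_eq hπ, sub_self]
    let G : FrobeniusTwist A p e ⊗[A] H →+ L ⧸ LinearMap.ker π :=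
      TensorProduct.liftAddHom (AddMonoidHom.mk' (M := FrobeniusTwist A p e)
        (fun a => (DistribSMul.toAddMonoidHom (L ⧸ LinearMap.ker π) (show A from a)).comp g) (by
          intro a b
          ext z
          exact add_smul (show A from a) (show A from b) (g z))) (by
          intro r a z
          obtain ⟨u, rfl⟩ := hπ z
          rw [← map_smul]
          change (r ^ p ^ e * (show A from a)) • g (π u) = (show A from a) • g (π (r • u))
          rw [hg, hg, Algebra.smul_def r u, mul_pow, ← map_pow, ← Algebra.smul_def,
            Submodule.Quotient.mk_smul, smul_smul, mul_comm])
    have h1 : G ((FrobeniusTwist.of p e c) ⊗ₜ[A] π u) = c • Submodule.Quotient.mk (u ^ p ^ e) :=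
      congrArg (c • ·) (hg u)
    rw [h, map_zero, ← Submodule.Quotient.mk_smul] at h1
    rw [← Algebra.smul_def]
    exact (Submodule.Quotient.mk_eq_zero _).1 h1.symm
  · intro h
    -- The map a ⊗ u ↦ a u^q from the twist of L to L. It is injective because a common denominator
    -- turns every tensor into a single a ⊗ ξ^N with ξ = 1/x.
    let μ : FrobeniusTwist A p e ⊗[A] L →+ L :=
      TensorProduct.liftAddHom (AddMonoidHom.mk' (M := FrobeniusTwist A p e)
        (fun a => (DistribSMul.toAddMonoidHom L (show A from a)).comp
          (iterateFrobenius L p e).toAddMonoidHom) (by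
          intro a b
          ext z
          exact add_smul (show A from a) (show A from b) _)) (by
          intro r a z
          change (r ^ p ^ e * (show A from a)) • z ^ p ^ e = (show A from a) • (r • z) ^ p ^ e
          rw [Algebra.smul_def r z, mul_pow, ← map_pow, ← Algebra.smul_def, smul_smul, mul_comm])
    have hμ : ∀ (a : A) (u : L), μ ((FrobeniusTwist.of p e a) ⊗ₜ[A] u) = a • u ^ p ^ e :=
      fun a u => rfl
    have hmv : ∀ (r a : A) (u : L), (FrobeniusTwist.of p e a) ⊗ₜ[A] (r • u) =
        (FrobeniusTwist.of p e (r ^ p ^ e * a)) ⊗ₜ[A] u := by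
      intro r a u
      rw [← TensorProduct.smul_tmul]
      rfl
    have hstep : ∀ (a : A) (N M : ℕ), (FrobeniusTwist.of p e a) ⊗ₜ[A] (ξ ^ N) =
        (FrobeniusTwist.of p e ((x ^ M) ^ p ^ e * a)) ⊗ₜ[A] (ξ ^ (N + M)) := by
      intro a N M
      rw [← hmv, Algebra.smul_def, map_pow, pow_add, mul_left_comm, ← mul_pow, hξ, one_pow, mul_one]
    have hnf : ∀ t : FrobeniusTwist A p e ⊗[A] L, ∃ (a : A) (N : ℕ),
        t = (FrobeniusTwist.of p e a) ⊗ₜ[A] (ξ ^ N) := by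
      intro t
      induction t using TensorProduct.induction_on with
      | zero => exact ⟨0, 0, (TensorProduct.zero_tmul _ _).symm⟩
      | tmul a u =>
        obtain ⟨N, b, rfl⟩ := (mem_locSub_iff_of_mul_eq_one hξ).1 (hL' u)
        exact ⟨_, N, by rw [← Algebra.smul_def]; exact hmv b a _⟩
      | add s t hs ht =>
        obtain ⟨a, N, rfl⟩ := hs
        obtain ⟨b, M, rfl⟩ := ht
        refine ⟨(x ^ M) ^ p ^ e * a + (x ^ N) ^ p ^ e * b, N + M, ?_⟩
        rw [hstep a N M, hstep b M N, add_comm M N, ← TensorProduct.add_tmul]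
        rfl
    have hμinj : ∀ t, μ t = 0 → t = 0 := by
      intro t ht
      obtain ⟨a, N, rfl⟩ := hnf t
      rw [hμ, Algebra.smul_def] at ht
      have h1 : algebraMap A L a = 0 := by
        have h2 : algebraMap A L x ^ (N * p ^ e) * ((ξ ^ N) ^ p ^ e) = 1 := by
          rw [← pow_mul, ← mul_pow, hξ, one_pow]
        linear_combination algebraMap A L x ^ (N * p ^ e) * ht - algebraMap A L a * h2
      rw [(map_eq_zero_iff _ hinj).1 h1]
      exact TensorProduct.zero_tmul _ _
    have hlift : ∀ v ∈ LinearMap.ker π, ∃ t, μ t = v ∧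
        TensorProduct.map (LinearMap.id (R := A) (M := FrobeniusTwist A p e)) π t = 0 := by
      rw [hker]
      intro v hv
      induction hv using Submodule.iSup_induction' with
      | mem i k hk =>
        obtain ⟨η, hη⟩ := (hy i).exists_right_inv
        obtain ⟨N, a, rfl⟩ := (mem_locSub_iff_of_mul_eq_one hη).1 hk
        -- An element a η^N with η = 1/y_i is rewritten as a y_i^{N(q-1)} (η^N)^q, so that the
        -- tensor factor η^N lies in A_{y_i} and dies under π.
        refine ⟨(FrobeniusTwist.of p e (a * y i ^ (N * (p ^ e - 1)))) ⊗ₜ[A] (η ^ N), ?_, ?_⟩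
        · rw [hμ, Algebra.smul_def, map_mul, map_pow, ← pow_mul]
          have h2 : algebraMap A L (y i) ^ (N * (p ^ e - 1)) * η ^ (N * (p ^ e - 1)) = 1 := by
            rw [← mul_pow, hη, one_pow]
          have h3 : N * p ^ e = N * (p ^ e - 1) + N := by
            obtain ⟨k, hk⟩ := Nat.exists_eq_succ_of_ne_zero hpe
            rw [hk]; simp; ring
          rw [h3, pow_add]
          linear_combination (algebraMap A L a) * η ^ N * h2
        · have : π (η ^ N) = 0 := by
            rw [← LinearMap.mem_ker, hker]
            exact Submodule.mem_iSup_of_mem i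
              ((locSub A L (y i)).pow_mem (mem_locSub_of_mul_eq_one hη) N)
          rw [TensorProduct.map_tmul, this, TensorProduct.tmul_zero]
      | zero => exact ⟨0, map_zero _, map_zero _⟩
      | add k l _ _ hk hl =>
        obtain ⟨s, hs, hs'⟩ := hk
        obtain ⟨t, ht, ht'⟩ := hl
        exact ⟨s + t, by rw [map_add, hs, ht], by rw [map_add, hs', ht', add_zero]⟩
    obtain ⟨t, ht, ht'⟩ := hlift _ h
    have : (FrobeniusTwist.of p e c) ⊗ₜ[A] u = t := by
      refine sub_eq_zero.1 (hμinj _ ?_)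
      rw [map_sub, ht, hμ, Algebra.smul_def, sub_self]
    rw [← this, TensorProduct.map_tmul] at ht'
    exact ht'

end SubLocalization
end

noncomputable section

set_option linter.unusedSectionVars false

/-! ### Signs in the Čech complex. -/

section Signs

variable {ι : Type*} [LinearOrder ι]

/-- The number of elements of `s` below `i`, which determines the signs in the Čech complex. -/
abbrev cechPos (i : ι) (s : Finset ι) : ℕ := (s.filter (· < i)).card

theorem cechPos_insert_self (i : ι) (s : Finset ι) : cechPos i (insert i s) = cechPos i s := by
  rw [cechPos, Finset.filter_insert, if_neg (lt_irrefl i)]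

theorem cechPos_erase_self (i : ι) (s : Finset ι) : cechPos i (s.erase i) = cechPos i s := by
  rw [cechPos, Finset.filter_erase, Finset.erase_eq_of_notMem (by simp)]

theorem neg_one_pow_cechPos {A : Type*} [CommRing A] {i j : ι} {s : Finset ι} (hi : i ∉ s)
    (hj : j ∈ s) : (-1 : A) ^ cechPos j s * (-1) ^ cechPos i (s.erase j) =
      -((-1) ^ cechPos j (insert i s) * (-1) ^ cechPos i s) := by
  have hij : i ≠ j := fun h => hi (h ▸ hj)
  rcases lt_or_gt_of_ne hij with h | h
  · have h1 : cechPos j (insert i s) = cechPos j s + 1 := by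
      rw [cechPos, Finset.filter_insert, if_pos h, Finset.card_insert_of_notMem (by simp [hi])]
    have h2 : cechPos i (s.erase j) = cechPos i s := by
      rw [cechPos, Finset.filter_erase, Finset.erase_eq_of_notMem (by simp [h.le])]
    rw [h1, h2]
    ring
  · have h1 : cechPos j (insert i s) = cechPos j s := by
      rw [cechPos, Finset.filter_insert, if_neg h.le.not_gt]
    have h2 : cechPos i s = cechPos i (s.erase j) + 1 := by
      rw [cechPos, cechPos, Finset.filter_erase, Finset.card_erase_add_one (by simp [hj, h])]
    rw [h1, h2]
    ring

theorem neg_one_pow_cechPos_erase {A : Type*} [CommRing A] {i j : ι} {s : Finset ι} (hi : i ∈ s)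
    (hj : j ∈ s) (hij : i ≠ j) : (-1 : A) ^ cechPos i s * (-1) ^ cechPos j (s.erase i) =
      -((-1) ^ cechPos j s * (-1) ^ cechPos i (s.erase j)) := by
  have h := neg_one_pow_cechPos (A := A) (i := i) (j := j) (s := s.erase i) (by simp)
    (by simp [hij.symm, hj])
  rw [Finset.insert_erase hi, Finset.erase_right_comm, cechPos_erase_self,
    cechPos_erase_self] at h
  have h2 : ((-1 : A) ^ cechPos i (s.erase j)) * (-1) ^ cechPos i (s.erase j) = 1 := by
    rw [← mul_pow]; simp
  have h3 : ((-1 : A) ^ cechPos i s) * (-1) ^ cechPos i s = 1 := by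
    rw [← mul_pow]; simp
  linear_combination ((-1) ^ cechPos i s * (-1) ^ cechPos i (s.erase j)) * h +
    (-(-1 : A) ^ cechPos i s * (-1) ^ cechPos j (s.erase i)) * h2 +
    (-(-1 : A) ^ cechPos j s * (-1) ^ cechPos i (s.erase j)) * h3

end Signs

/-! ### The Čech complex modulo an ideal. -/

section Cech

variable {A : Type*} [CommRing A] {ι : Type*} [LinearOrder ι] (x : ι → A)

theorem cechRestrict_cechRestrict {s t u : Finset ι} (h : s ⊆ t) (h' : t ⊆ u) (a : CechLoc x s) :
    cechRestrict x h' (cechRestrict x h a) = cechRestrict x (h.trans h') a := by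
  have : ((cechRestrict x h').comp (cechRestrict x h)).toRingHom
      = (cechRestrict x (h.trans h')).toRingHom :=
    IsLocalization.ringHom_ext (Submonoid.powers (∏ i ∈ s, x i)) (by ext; simp)
  exact DFunLike.congr_fun this a

theorem cechRestrict_congr (c : ∀ s, CechLoc x s) {s t u : Finset ι} (h : s = t) (hs : s ⊆ u)
    (ht : t ⊆ u) : cechRestrict x hs (c s) = cechRestrict x ht (c t) := by
  subst h; rfl

theorem cechD_apply_cechPos (c : ∀ s, CechLoc x s) (s : Finset ι) :
    cechD x c s = ∑ i ∈ s, (-1 : A) ^ cechPos i s •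
      cechRestrict x (s.erase_subset i) (c (s.erase i)) := cechD_apply x c s

theorem cechD_cechD (c : ∀ s, CechLoc x s) : cechD x (cechD x c) = 0 := by
  funext s
  rw [cechD_apply]
  simp only [cechD_apply, map_sum, map_smul, Finset.smul_sum, cechRestrict_cechRestrict, smul_smul]
  rw [Finset.sum_sigma']
  refine Finset.sum_involution (fun q _ => ⟨q.2, q.1⟩) ?_ ?_ ?_ ?_
  · rintro ⟨i, j⟩ hij
    simp only [Finset.mem_sigma, Finset.mem_erase] at hij
    rw [neg_one_pow_cechPos_erase hij.1 hij.2.2 hij.2.1.symm, neg_smul,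
      cechRestrict_congr x c (Finset.erase_right_comm (a := i) (b := j))
        _ (((s.erase j).erase_subset i).trans (s.erase_subset j)), neg_add_cancel]
  · rintro ⟨i, j⟩ hij _
    simp only [Finset.mem_sigma, Finset.mem_erase] at hij
    intro h
    exact hij.2.1 (congrArg Sigma.fst h)
  · rintro ⟨i, j⟩ hij
    simp only [Finset.mem_sigma, Finset.mem_erase] at hij ⊢
    exact ⟨hij.2.2, hij.2.1.symm, hij.1⟩
  · rintro ⟨i, j⟩ _
    rfl

theorem cechD_mem_cechCochains {k : ℕ} {c : ∀ s, CechLoc x s} (hc : c ∈ cechCochains x k) :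
    cechD x c ∈ cechCochains x (k + 1) := by
  intro s hs
  rw [cechD_apply]
  refine Finset.sum_eq_zero fun i hi => ?_
  rw [hc _ (fun h => hs (by rw [← Finset.card_erase_add_one hi, h])), map_zero, smul_zero]

/-- The Čech cochains of degree `k - 1`, with none for `k = 0`. -/
def cechPred : ℕ → Submodule A (∀ s, CechLoc x s)
  | 0 => ⊥
  | k + 1 => cechCochains x k

theorem cechCoboundaries_eq (k : ℕ) : cechCoboundaries x k = (cechPred x k).map (cechD x) := by
  cases k
  · exact (Submodule.map_bot _).symm
  · rfl

theorem cechD_mem_of_mem_cechPred {k : ℕ} {c : ∀ s, CechLoc x s} (hc : c ∈ cechPred x k) :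
    cechD x c ∈ cechCochains x k := by
  cases k
  · rw [(Submodule.mem_bot A).1 hc, map_zero]; exact zero_mem _
  · exact cechD_mem_cechCochains x hc

/-- The cochains with values in `J`. -/
def cechIdeal (J : Ideal A) : Submodule A (∀ s, CechLoc x s) where
  carrier := {c | ∀ s, c s ∈ J.map (algebraMap A (CechLoc x s))}
  zero_mem' := fun _ => zero_mem _
  add_mem' := fun hc hc' s => add_mem (hc s) (hc' s)
  smul_mem' := fun a c hc s => by
    rw [Pi.smul_apply, Algebra.smul_def]
    exact Ideal.mul_mem_left _ _ (hc s)

variable {x}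

theorem cechRestrict_mem {J : Ideal A} {s t : Finset ι} (h : s ⊆ t) {a : CechLoc x s}
    (ha : a ∈ J.map (algebraMap A (CechLoc x s))) :
    cechRestrict x h a ∈ J.map (algebraMap A (CechLoc x t)) := by
  have := Ideal.mem_map_of_mem (cechRestrict x h).toRingHom ha
  rw [Ideal.map_map] at this
  rwa [show (cechRestrict x h).toRingHom.comp (algebraMap A (CechLoc x s)) =
    algebraMap A (CechLoc x t) from (cechRestrict x h).comp_algebraMap] at this

theorem cechD_mem_cechIdeal {J : Ideal A} {c : ∀ s, CechLoc x s} (hc : c ∈ cechIdeal x J) :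
    cechD x c ∈ cechIdeal x J := by
  intro s
  rw [cechD_apply]
  refine sum_mem fun i _ => ?_
  rw [Algebra.smul_def]
  exact Ideal.mul_mem_left _ _ (cechRestrict_mem _ (hc _))

theorem cechIdeal_mono {J J' : Ideal A} (h : J ≤ J') : cechIdeal x J ≤ cechIdeal x J' :=
  fun _ hc s => Ideal.map_mono h (hc s)

theorem exists_cechRestrict_eq {i : ι} {s : Finset ι} (hi : i ∉ s) (u : CechLoc x (insert i s)) :
    ∃ m : ℕ, ∃ v, cechRestrict x (s.subset_insert i) v = x i ^ m • u := by
  obtain ⟨N, a, ha⟩ := IsLocalization.Away.surj (∏ j ∈ insert i s, x j) u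
  have hu : IsUnit (algebraMap A (CechLoc x s) (∏ j ∈ s, x j)) :=
    IsLocalization.Away.algebraMap_isUnit _
  have hu' : IsUnit (algebraMap A (CechLoc x (insert i s)) (∏ j ∈ s, x j)) := by
    simpa using hu.map (cechRestrict x (s.subset_insert i))
  obtain ⟨v, hv⟩ := ((hu.pow N).dvd (a := algebraMap A (CechLoc x s) a))
  refine ⟨N, v, (hu'.pow N).mul_left_cancel ?_⟩
  have := congrArg (cechRestrict x (s.subset_insert i)) hv
  rw [map_mul, map_pow, AlgHom.commutes, AlgHom.commutes] at this
  have hp : algebraMap A (CechLoc x (insert i s)) (∏ j ∈ insert i s, x j) =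
      algebraMap A _ (x i) * algebraMap A _ (∏ j ∈ s, x j) := by
    rw [← map_mul, ← Finset.prod_insert hi]
  rw [← this, ← ha, hp, Algebra.smul_def, map_pow]
  ring

theorem algebraMap_mem_cechLoc_iff {J : Ideal A} {s : Finset ι} {a : A} :
    algebraMap A (CechLoc x s) a ∈ J.map (algebraMap A (CechLoc x s)) ↔
      ∃ N : ℕ, (∏ j ∈ s, x j) ^ N * a ∈ J := by
  rw [IsLocalization.algebraMap_mem_map_algebraMap_iff (Submonoid.powers (∏ j ∈ s, x j))]
  constructor
  · rintro ⟨_, ⟨N, rfl⟩, h⟩; exact ⟨N, h⟩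
  · rintro ⟨N, h⟩; exact ⟨_, ⟨N, rfl⟩, h⟩

theorem exists_pow_smul_eq {s : Finset ι} (u : CechLoc x s) :
    ∃ (N : ℕ) (a : A), (∏ j ∈ s, x j) ^ N • u = algebraMap A (CechLoc x s) a := by
  obtain ⟨N, a, ha⟩ := IsLocalization.Away.surj (∏ j ∈ s, x j) u
  exact ⟨N, a, by rw [← ha, Algebra.smul_def, map_pow, mul_comm]⟩

theorem pow_smul_mem_cechLoc_iff {J : Ideal A} {s : Finset ι} {u : CechLoc x s} {N : ℕ} :
    (∏ j ∈ s, x j) ^ N • u ∈ J.map (algebraMap A (CechLoc x s)) ↔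
      u ∈ J.map (algebraMap A (CechLoc x s)) := by
  rw [Algebra.smul_def]
  refine Ideal.unit_mul_mem_iff_mem _ ?_
  rw [map_pow]
  exact (IsLocalization.Away.algebraMap_isUnit _).pow N

theorem exists_pow_smul_mem {J : Ideal A} {i : ι} {s : Finset ι} (hi : i ∉ s) (u : CechLoc x s)
    (hu : cechRestrict x (s.subset_insert i) u ∈ J.map (algebraMap A (CechLoc x (insert i s)))) :
    ∃ m : ℕ, x i ^ m • u ∈ J.map (algebraMap A (CechLoc x s)) := by
  obtain ⟨N, a, ha⟩ := exists_pow_smul_eq u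
  have h1 : algebraMap A (CechLoc x (insert i s)) a ∈ J.map (algebraMap A _) := by
    have := congrArg (cechRestrict x (s.subset_insert i)) ha
    rw [map_smul, AlgHom.commutes] at this
    rw [← this, Algebra.smul_def]
    exact Ideal.mul_mem_left _ _ hu
  obtain ⟨M, hM⟩ := algebraMap_mem_cechLoc_iff.1 h1
  refine ⟨M, (pow_smul_mem_cechLoc_iff (N := N)).1 ?_⟩
  rw [smul_comm, ha, Algebra.smul_def, ← map_mul]
  refine algebraMap_mem_cechLoc_iff.2 ⟨M, ?_⟩
  rw [Finset.prod_insert hi] at hM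
  convert! hM using 1
  ring

variable [Fintype ι]

/-- Multiplication by powers of `x i` kills the Čech cohomology of `A / J`. -/
theorem exists_pow_smul_sub_cechD_mem {J : Ideal A} {k : ℕ} {c : ∀ s, CechLoc x s}
    (hc : c ∈ cechCochains x k) (hd : cechD x c ∈ cechIdeal x J) (i : ι) :
    ∃ m : ℕ, ∃ b ∈ cechPred x k, x i ^ m • c - cechD x b ∈ cechIdeal x J := by
  have h1 : ∀ s : Finset ι, ∃ m : ℕ, ∃ v : CechLoc x s, i ∉ s →
      cechRestrict x (s.subset_insert i) v = x i ^ m • c (insert i s) := by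
    intro s
    by_cases hi : i ∈ s
    · exact ⟨0, 0, fun h => absurd hi h⟩
    · obtain ⟨m, v, h⟩ := exists_cechRestrict_eq hi (c (insert i s))
      exact ⟨m, v, fun _ => h⟩
  choose m v hv using h1
  let M := Finset.univ.sup m
  -- The value is set to zero wherever c_{s ∪ i} vanishes, which keeps b in degree k - 1.
  have h2 : ∀ s : Finset ι, ∃ v : CechLoc x s, (c (insert i s) = 0 → v = 0) ∧ (i ∈ s → v = 0) ∧
      (i ∉ s → cechRestrict x (s.subset_insert i) v =
        (-1 : A) ^ cechPos i s • x i ^ M • c (insert i s)) := by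
    intro s
    by_cases hz : c (insert i s) = 0 ∨ i ∈ s
    · refine ⟨0, fun _ => rfl, fun _ => rfl, fun hi => ?_⟩
      rw [hz.resolve_right hi, map_zero, smul_zero, smul_zero]
    · push Not at hz
      refine ⟨(-1 : A) ^ cechPos i s • x i ^ (M - m s) • v s, fun h => absurd h hz.1,
        fun h => absurd h hz.2, fun hi => ?_⟩
      rw [map_smul, map_smul, hv s hi, smul_smul (x i ^ _), ← pow_add,
        Nat.sub_add_cancel (Finset.le_sup (Finset.mem_univ s))]
  choose b hb0 hbi hb using h2
  have hbk : b ∈ cechPred x k := by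
    cases k with
    | zero =>
      refine (Submodule.mem_bot A).2 (funext fun s => hb0 s (hc _ ?_))
      exact Finset.card_ne_zero_of_mem (Finset.mem_insert_self i s)
    | succ k =>
      intro s hs
      by_cases hi : i ∈ s
      · exact hbi s hi
      · refine hb0 s (hc _ fun h => hs ?_)
        rw [Finset.card_insert_of_notMem hi] at h
        omega
  -- For i ∈ s the homotopy identity is exact. For i ∉ s it holds modulo J only after restriction to
  -- A_{x_{s ∪ i}}, and the discrepancy is killed by a further power of x_i.
  have h3 : ∀ s : Finset ι, ∃ m' : ℕ, x i ^ m' • (x i ^ M • c s - cechD x b s) ∈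
      J.map (algebraMap A (CechLoc x s)) := by
    intro s
    by_cases hi : i ∈ s
    · refine ⟨0, ?_⟩
      have hsq : ((-1 : A) ^ cechPos i s) * (-1) ^ cechPos i s = 1 := by rw [← mul_pow]; simp
      have : cechD x b s = x i ^ M • c s := by
        rw [cechD_apply, Finset.sum_eq_single i]
        · have key : ∀ (t : Finset ι) (ht : t ⊆ s), insert i t = s → i ∉ t →
              (-1 : A) ^ cechPos i s • cechRestrict x ht (b t) = x i ^ M • c s := by
            rintro t ht rfl hit
            rw [hb t hit, cechPos_insert_self, smul_smul, ← cechPos_insert_self, ← mul_pow]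
            simp
          exact key _ _ (Finset.insert_erase hi) (Finset.notMem_erase i s)
        · intro j hj hji
          rw [hbi _ (Finset.mem_erase.2 ⟨hji.symm, hi⟩), map_zero, smul_zero]
        · exact fun h => absurd hi h
      rw [this, sub_self, smul_zero]
      exact zero_mem _
    · refine exists_pow_smul_mem hi _ ?_
      have : cechRestrict x (s.subset_insert i) (x i ^ M • c s - cechD x b s) =
          ((-1 : A) ^ cechPos i s * x i ^ M) • cechD x c (insert i s) := by
        rw [cechD_apply_cechPos, cechD_apply_cechPos, Finset.sum_insert hi, smul_add, map_sub, map_smul, map_sum,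
          sub_eq_add_neg, ← Finset.sum_neg_distrib, Finset.smul_sum]
        congr 1
        · rw [cechRestrict_congr x c (Finset.erase_insert hi) _ (s.subset_insert i),
            cechPos_insert_self, smul_smul, mul_right_comm, ← mul_pow]
          simp
        · refine Finset.sum_congr rfl fun j hj => ?_
          have hij : i ≠ j := fun h => hi (h ▸ hj)
          have hij' : i ∉ s.erase j := fun h => hi (Finset.mem_of_mem_erase h)
          rw [map_smul, cechRestrict_cechRestrict,
            ← cechRestrict_cechRestrict x ((s.erase j).subset_insert i)
              (Finset.insert_subset_insert i (s.erase_subset j)), hb _ hij', map_smul, map_smul,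
            cechRestrict_congr x c (Finset.erase_insert_of_ne hij).symm _
              ((insert i s).erase_subset j), smul_smul, neg_one_pow_cechPos hi hj, neg_smul, neg_neg,
            smul_smul, smul_smul]
          congr 1
          ring
      rw [this, Algebra.smul_def]
      exact Ideal.mul_mem_left _ _ (hd _)
  choose m' hm' using h3
  refine ⟨Finset.univ.sup m' + M, x i ^ (Finset.univ.sup m') • b, Submodule.smul_mem _ _ hbk,
    fun s => ?_⟩
  have : (x i ^ (Finset.univ.sup m' + M) • c - cechD x (x i ^ Finset.univ.sup m' • b)) s =
      x i ^ (Finset.univ.sup m' - m' s) • x i ^ m' s • (x i ^ M • c s - cechD x b s) := by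
    rw [smul_smul, ← pow_add, Nat.sub_add_cancel (Finset.le_sup (Finset.mem_univ s)), smul_sub,
      smul_smul, ← pow_add, map_smul]
    rfl
  rw [this, Algebra.smul_def]
  exact Ideal.mul_mem_left _ _ (hm' s)

end Cech
end

noncomputable section

set_option linter.unusedSectionVars false

/-! ### Vanishing below the length of a regular sequence, and classes with prescribed annihilator.
-/

section QuasiRegular

variable {A : Type*} [CommRing A]

/-- The sequence becomes weakly regular on `A / J` after localization at `𝔪`. -/
def IsRegularAt (𝔪 : Ideal A) : Ideal A → List A → Prop
  | _, [] => True
  | J, v :: vs => (∀ a, v * a ∈ J → ∃ s ∉ 𝔪, s * a ∈ J) ∧ IsRegularAt 𝔪 (Ideal.span {v} ⊔ J) vs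

variable {ι : Type*} [LinearOrder ι] (x : ι → A)

/-- The cochains of degree `k` which are coboundaries modulo `J`. -/
def cechBd (J : Ideal A) (k : ℕ) : Submodule A (∀ s, CechLoc x s) :=
  (cechPred x k).map (cechD x) ⊔ cechIdeal x J

variable {x}

theorem mem_cechBd {J : Ideal A} {k : ℕ} {c : ∀ s, CechLoc x s} :
    c ∈ cechBd x J k ↔ ∃ w ∈ cechPred x k, ∃ j ∈ cechIdeal x J, cechD x w + j = c := by
  simp only [cechBd, Submodule.mem_sup, Submodule.mem_map, exists_exists_and_eq_and]

theorem cechBd_mono {J J' : Ideal A} (h : J ≤ J') (k : ℕ) : cechBd x J k ≤ cechBd x J' k :=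
  sup_le_sup_left (cechIdeal_mono h) _

theorem exists_smul_add_eq_of_mem_cechIdeal_sup {J : Ideal A} {v : A} {k : ℕ}
    {c : ∀ s, CechLoc x s} (hc : c ∈ cechIdeal x (Ideal.span {v} ⊔ J))
    (hk : c ∈ cechCochains x k) :
    ∃ b ∈ cechCochains x k, ∃ j ∈ cechIdeal x J, v • b + j = c := by
  have : ∀ s : Finset ι, ∃ b : CechLoc x s, (s.card ≠ k → b = 0) ∧
      c s - v • b ∈ J.map (algebraMap A (CechLoc x s)) := by
    intro s
    by_cases hs : s.card = k
    · have h1 := hc s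
      rw [Ideal.map_sup, Ideal.map_span, Set.image_singleton, Ideal.mem_span_singleton_sup] at h1
      obtain ⟨b, j, hj, h⟩ := h1
      refine ⟨b, fun h => absurd hs h, ?_⟩
      rw [← h, Algebra.smul_def, mul_comm, add_sub_cancel_left]
      exact hj
    · exact ⟨0, fun _ => rfl, by rw [hk s hs, smul_zero, sub_zero]; exact zero_mem _⟩
  choose b hb hb' using this
  exact ⟨b, hb, c - v • b, hb', add_sub_cancel _ _⟩

theorem exists_pow_smul_mem_cechBd [Fintype ι] {J : Ideal A} {k : ℕ} {c : ∀ s, CechLoc x s}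
    (hc : c ∈ cechCochains x k) (hd : cechD x c ∈ cechIdeal x J) {a : A}
    (ha : a ∈ (Ideal.span (Set.range x)).radical) : ∃ N : ℕ, a ^ N • c ∈ cechBd x J k := by
  let T : Ideal A := (cechBd x J k).comap (LinearMap.toSpanSingleton A _ c)
  have hT : (Ideal.span (Set.range x)).radical ≤ T.radical := by
    refine Ideal.radical_le_radical_iff.2 (Ideal.span_le.2 ?_)
    rintro _ ⟨i, rfl⟩
    obtain ⟨m, b, hb, h⟩ := exists_pow_smul_sub_cechD_mem hc hd i
    exact ⟨m, mem_cechBd.2 ⟨b, hb, _, h, add_sub_cancel _ _⟩⟩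
  exact hT ha

variable [Fintype ι] {𝔪 : Ideal A} [h𝔪 : 𝔪.IsMaximal]

/-- Every class is killed by a power of each element of 𝔪. As 𝔪 is maximal, an s outside it is
coprime to such a power, so s acts injectively on cohomology. This permits regularity that holds
only after localizing at 𝔪. -/
theorem mem_cechBd_of_smul_mem (hx : 𝔪 ≤ (Ideal.span (Set.range x)).radical) {J : Ideal A} {k : ℕ}
    {c : ∀ s, CechLoc x s} (hc : c ∈ cechCochains x k) (hd : cechD x c ∈ cechIdeal x J) {s : A}
    (hs : s ∉ 𝔪) (h : s • c ∈ cechBd x J k) : c ∈ cechBd x J k := by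
  obtain ⟨y, m, hm, hy⟩ := h𝔪.exists_inv hs
  obtain ⟨N, hN⟩ := exists_pow_smul_mem_cechBd hc hd (hx hm)
  have hcop : IsCoprime s (m ^ N) := IsCoprime.pow_right ⟨y, 1, by rw [one_mul]; exact hy⟩
  obtain ⟨a, b, hab⟩ := hcop
  rw [← one_smul A c, ← hab, add_smul, mul_smul, mul_smul]
  exact add_mem (Submodule.smul_mem _ _ h) (Submodule.smul_mem _ _ hN)

/-- Regularity is available only up to an element outside 𝔪 for each component; the product over the
finitely many components works for the whole cochain. -/
theorem exists_smul_mem_cechIdeal {J : Ideal A} {v : A}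
    (hv : ∀ a, v * a ∈ J → ∃ s ∉ 𝔪, s * a ∈ J) {c : ∀ s, CechLoc x s}
    (hc : v • c ∈ cechIdeal x J) : ∃ s ∉ 𝔪, s • c ∈ cechIdeal x J := by
  have h1 : ∀ t : Finset ι, ∃ s ∈ 𝔪.primeCompl, s • c t ∈ J.map (algebraMap A (CechLoc x t)) := by
    intro t
    obtain ⟨N, a, ha⟩ := exists_pow_smul_eq (c t)
    have h2 : algebraMap A (CechLoc x t) (v * a) ∈ J.map (algebraMap A _) := by
      rw [map_mul, ← ha, ← Algebra.smul_def, smul_comm, Algebra.smul_def]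
      exact Ideal.mul_mem_left _ _ (hc t)
    obtain ⟨M, hM⟩ := algebraMap_mem_cechLoc_iff.1 h2
    rw [mul_left_comm] at hM
    obtain ⟨s, hs, h⟩ := hv _ hM
    refine ⟨s, hs, (pow_smul_mem_cechLoc_iff (N := N)).1 ?_⟩
    rw [smul_comm, ha, Algebra.smul_def, ← map_mul]
    refine algebraMap_mem_cechLoc_iff.2 ⟨M, ?_⟩
    rwa [mul_left_comm]
  choose s hs h using h1
  refine ⟨∏ t, s t, prod_mem (S := 𝔪.primeCompl) fun t _ => hs t, fun t => ?_⟩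
  rw [Pi.smul_apply, ← Finset.prod_erase_mul _ _ (Finset.mem_univ t), mul_smul, Algebra.smul_def]
  exact Ideal.mul_mem_left _ _ (h t)

/-- The long exact sequence of multiplication by v makes v injective on H^k(A/J), since H^{k-1} of
A/(v, J) vanishes by induction. But v ∈ 𝔪 also acts nilpotently on each class, so the class is zero.
-/
theorem mem_cechBd_of_lt_length (hx : 𝔪 ≤ (Ideal.span (Set.range x)).radical) (vs : List A) :
    ∀ J : Ideal A, IsRegularAt 𝔪 J vs → (∀ v ∈ vs, v ∈ 𝔪) → ∀ k < vs.length,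
      ∀ c ∈ cechCochains x k, cechD x c ∈ cechIdeal x J → c ∈ cechBd x J k := by
  induction vs with
  | nil => intro J _ _ k hk; simp at hk
  | cons v vs ih =>
    rintro J ⟨hv, hvs⟩ hmem k hk c hc hd
    -- Injectivity of v on cohomology: if v c = dw modulo J, then w is a cocycle modulo (v, J),
    -- hence dw_2 + v w_3 modulo J, and v (c - d w_3) ∈ J.
    have step : ∀ c ∈ cechCochains x k, cechD x c ∈ cechIdeal x J → v • c ∈ cechBd x J k →
        c ∈ cechBd x J k := by
      intro c hc hd h
      obtain ⟨w, hw, j, hj, hwj⟩ := mem_cechBd.1 h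
      cases k with
      | zero =>
        rw [(Submodule.mem_bot A).1 hw, map_zero, zero_add] at hwj
        obtain ⟨s, hs, h⟩ := exists_smul_mem_cechIdeal hv (hwj ▸ hj)
        exact mem_cechBd_of_smul_mem hx hc hd hs (Submodule.mem_sup_right h)
      | succ k =>
        have hdw : cechD x w ∈ cechIdeal x (Ideal.span {v} ⊔ J) := by
          rw [eq_sub_of_add_eq hwj]
          refine sub_mem (fun s => ?_) (cechIdeal_mono le_sup_right hj)
          rw [Pi.smul_apply, Algebra.smul_def]
          exact Ideal.mul_mem_right _ _ (Ideal.mem_map_of_mem _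
            (Ideal.mem_sup_left (Ideal.mem_span_singleton_self v)))
        obtain ⟨w₂, hw₂, j', hj', rfl⟩ := mem_cechBd.1 (ih _ hvs
          (fun y hy => hmem y (List.mem_cons_of_mem _ hy)) k (by simpa using hk) w hw hdw)
        have hj'k : j' ∈ cechCochains x k := by
          rw [← add_sub_cancel_left (cechD x w₂) j']
          exact sub_mem hw (cechD_mem_of_mem_cechPred x hw₂)
        obtain ⟨w₃, hw₃, j₃, hj₃, rfl⟩ := exists_smul_add_eq_of_mem_cechIdeal_sup hj' hj'k
        rw [map_add, map_add, map_smul, cechD_cechD, zero_add] at hwj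
        have h1 : v • (c - cechD x w₃) ∈ cechIdeal x J := by
          rw [smul_sub, ← hwj, add_assoc, add_sub_cancel_left]
          exact add_mem (cechD_mem_cechIdeal hj₃) hj
        obtain ⟨s, hs, h2⟩ := exists_smul_mem_cechIdeal hv h1
        refine mem_cechBd_of_smul_mem hx hc hd hs (mem_cechBd.2
          ⟨s • w₃, Submodule.smul_mem _ _ hw₃, _, h2, ?_⟩)
        rw [map_smul, smul_sub, add_sub_cancel]
    have hdesc : ∀ N, v ^ N • c ∈ cechBd x J k → c ∈ cechBd x J k := by
      intro N
      induction N with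
      | zero => intro h; simpa using h
      | succ N ihN =>
        intro h
        refine ihN (step _ (Submodule.smul_mem _ _ hc) ?_ ?_)
        · rw [map_smul]; exact Submodule.smul_mem _ _ hd
        · rwa [smul_smul, ← pow_succ']
    obtain ⟨N, hN⟩ := exists_pow_smul_mem_cechBd hc hd (hx (hmem v List.mem_cons_self))
    exact hdesc N hN

/-- The class is the image of 1 ∈ A/(J, vs) under the iterated connecting homomorphisms, one for
each element of `vs`. Each of them is injective up to elements outside 𝔪, because the cohomology of
A/J just below the length vanishes, so the annihilator is not enlarged. -/
theorem exists_cochain_annihilator (hx : 𝔪 ≤ (Ideal.span (Set.range x)).radical) (vs : List A) :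
    ∀ J : Ideal A, IsRegularAt 𝔪 J vs → (∀ v ∈ vs, v ∈ 𝔪) →
      (∀ i, x i ∈ (J ⊔ Ideal.ofList vs).radical) →
      ∃ c ∈ cechCochains x vs.length, cechD x c ∈ cechIdeal x J ∧
        (∀ a ∈ J ⊔ Ideal.ofList vs, a • c ∈ cechBd x J vs.length) ∧
        ∀ a, a • c ∈ cechBd x J vs.length → ∃ s ∉ 𝔪, s * a ∈ J ⊔ Ideal.ofList vs := by
  induction vs with
  | nil =>
    intro J _ _ hJ
    simp only [Ideal.ofList_nil, sup_bot_eq] at hJ ⊢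
    have htop : ∀ s : Finset ι, s.Nonempty → J.map (algebraMap A (CechLoc x s)) = ⊤ := by
      rintro s ⟨i, hi⟩
      obtain ⟨n, hn⟩ := hJ i
      refine Ideal.eq_top_of_isUnit_mem _ (Ideal.mem_map_of_mem _ hn) ?_
      rw [map_pow]
      exact (isUnit_of_dvd_unit (map_dvd _ (Finset.dvd_prod_of_mem x hi))
        (IsLocalization.Away.algebraMap_isUnit (∏ i ∈ s, x i))).pow n
    have happ : ∀ a : A, (a • Pi.single (M := fun s => CechLoc x s) ∅ 1) ∅
        = algebraMap A (CechLoc x ∅) a := fun a => by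
      rw [Pi.smul_apply, Pi.single_eq_same, Algebra.smul_def, mul_one]
    -- With an empty sequence all x_i are nilpotent modulo J, so the complex of A/J is concentrated
    -- in degree zero and 1 generates H⁰ = A/J.
    refine ⟨Pi.single ∅ 1, fun s hs => ?_, fun s => ?_, fun a ha => ?_, fun a ha => ?_⟩
    · exact Pi.single_eq_of_ne (fun h => hs (by rw [h]; rfl)) _
    · rcases s.eq_empty_or_nonempty with rfl | hs
      · rw [cechD_apply, Finset.sum_empty]; exact zero_mem _
      · rw [htop s hs]; trivial
    · refine Submodule.mem_sup_right fun s => ?_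
      rcases s.eq_empty_or_nonempty with rfl | hs
      · rw [happ]; exact Ideal.mem_map_of_mem _ ha
      · rw [htop s hs]; trivial
    · obtain ⟨w, hw, j, hj, hwj⟩ := mem_cechBd.1 ha
      rw [(Submodule.mem_bot A).1 hw, map_zero, zero_add] at hwj
      have := hj ∅
      rw [hwj, happ, algebraMap_mem_cechLoc_iff] at this
      refine ⟨1, fun h => h𝔪.ne_top ((Ideal.eq_top_iff_one _).2 h), ?_⟩
      simpa using this
  | cons v vs ih =>
    rintro J ⟨hv, hvs⟩ hmem hJ
    have hassoc : (Ideal.span {v} ⊔ J) ⊔ Ideal.ofList vs = J ⊔ Ideal.ofList (v :: vs) := by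
      rw [Ideal.ofList_cons, sup_comm (Ideal.span {v}), sup_assoc]
    obtain ⟨c, hc, hd, hann, hann'⟩ := ih (Ideal.span {v} ⊔ J) hvs
      (fun y hy => hmem y (List.mem_cons_of_mem _ hy)) (by rwa [hassoc])
    rw [hassoc] at hann hann'
    obtain ⟨b, hb, j, hj, hbj⟩ := exists_smul_add_eq_of_mem_cechIdeal_sup hd
      (cechD_mem_cechCochains x hc)
    have hvb : v • cechD x b ∈ cechIdeal x J := by
      have := congrArg (cechD x) hbj
      rw [cechD_cechD, map_add, map_smul] at this
      rw [eq_neg_of_add_eq_zero_left this]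
      exact neg_mem (cechD_mem_cechIdeal hj)
    -- From dc = v b + j the connecting homomorphism sends c to b. But v regular only at 𝔪 makes b a
    -- cocycle modulo J only after multiplication by s; the chosen cochain is therefore s b.
    obtain ⟨s, hs, hsb⟩ := exists_smul_mem_cechIdeal hv hvb
    have hsb' : cechD x (s • b) ∈ cechIdeal x J := by rwa [map_smul]
    have hmemv : ∀ b : ∀ s, CechLoc x s, v • b ∈ cechIdeal x (Ideal.span {v} ⊔ J) := fun b s => by
      rw [Pi.smul_apply, Algebra.smul_def]
      exact Ideal.mul_mem_right _ _ (Ideal.mem_map_of_mem _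
        (Ideal.mem_sup_left (Ideal.mem_span_singleton_self v)))
    refine ⟨s • b, Submodule.smul_mem _ _ hb, hsb', fun a ha => ?_, fun a ha => ?_⟩
    · obtain ⟨w, hw, j₂, hj₂, hwj⟩ := mem_cechBd.1 (hann a ha)
      have hj₂k : j₂ ∈ cechCochains x vs.length := by
        rw [← add_sub_cancel_left (cechD x w) j₂, hwj]
        exact sub_mem (Submodule.smul_mem _ _ hc) (cechD_mem_of_mem_cechPred x hw)
      obtain ⟨w₃, hw₃, j₃, hj₃, rfl⟩ := exists_smul_add_eq_of_mem_cechIdeal_sup hj₂ hj₂k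
      have h1 := congrArg (cechD x) hwj
      rw [map_add, cechD_cechD, zero_add, map_add, map_smul, map_smul, ← hbj] at h1
      have h2 : v • (a • b - cechD x w₃) ∈ cechIdeal x J := by
        have : v • (a • b - cechD x w₃) = cechD x j₃ - a • j := by
          rw [smul_sub, smul_comm v a b, eq_sub_of_add_eq h1, smul_add]
          abel
        rw [this]
        exact sub_mem (cechD_mem_cechIdeal hj₃) (Submodule.smul_mem _ _ hj)
      obtain ⟨s₂, hs₂, h3⟩ := exists_smul_mem_cechIdeal hv h2
      refine mem_cechBd_of_smul_mem hx (Submodule.smul_mem _ _ (Submodule.smul_mem _ _ hb)) ?_ hs₂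
        (mem_cechBd.2 ⟨(s * s₂) • w₃, Submodule.smul_mem _ _ hw₃, _,
          Submodule.smul_mem _ s h3, ?_⟩)
      · rw [map_smul]; exact Submodule.smul_mem _ _ hsb'
      · rw [map_smul, mul_smul, ← smul_add, ← smul_add, add_sub_cancel, smul_comm a s b,
          smul_comm s₂ s]
    · obtain ⟨w, hw, j₁, hj₁, hwj⟩ := mem_cechBd.1 ha
      have hw : w ∈ cechCochains x vs.length := hw
      have h1 : cechD x ((a * s) • c - v • w) ∈ cechIdeal x J := by
        have : cechD x ((a * s) • c - v • w) = (a * s) • j + v • j₁ := by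
          rw [map_sub, map_smul, map_smul, ← hbj, eq_sub_of_add_eq hwj, smul_add, smul_sub,
            mul_smul, smul_comm s v, smul_comm a v]
          abel
        rw [this]
        exact add_mem (Submodule.smul_mem _ _ hj) (Submodule.smul_mem _ _ hj₁)
      -- If a s b = dw modulo J, then a s c - v w is a cocycle modulo J of degree below the length
      -- of v :: vs, hence a coboundary; so a s c is a coboundary modulo (v, J).
      have h2 := mem_cechBd_of_lt_length hx (v :: vs) J ⟨hv, hvs⟩ hmem vs.length (by simp)
        ((a * s) • c - v • w) (sub_mem (Submodule.smul_mem _ _ hc) (Submodule.smul_mem _ _ hw)) h1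
      have h3 := add_mem (cechBd_mono le_sup_right _ h2)
        (show v • w ∈ cechBd x (Ideal.span {v} ⊔ J) vs.length from Submodule.mem_sup_right (hmemv w))
      rw [sub_add_cancel] at h3
      obtain ⟨s', hs', h4⟩ := hann' _ h3
      exact ⟨s' * s, 𝔪.primeCompl.mul_mem hs' hs, by rwa [mul_assoc, mul_comm s a]⟩

theorem cechIdeal_bot : cechIdeal x (⊥ : Ideal A) = ⊥ := by
  refine (Submodule.eq_bot_iff _).2 fun c hc => funext fun s => ?_
  simpa using hc s

theorem cechClass_eq_zero_iff {k : ℕ} (c : cechCocycles x k) :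
    cechClass x k c = 0 ↔ c.1 ∈ cechCoboundaries x k :=
  Submodule.Quotient.mk_eq_zero _

theorem exists_cechCohomology_annihilator (hx : (Ideal.span (Set.range x)).radical = 𝔪)
    (vs : List A) (hreg : IsRegularAt 𝔪 ⊥ vs) (hvs : (Ideal.ofList vs).radical = 𝔪) :
    ∃ ζ : CechCohomology x vs.length, (∀ a ∈ Ideal.ofList vs, a • ζ = 0) ∧
      ∀ a : A, a • ζ = 0 → ∃ s ∉ 𝔪, s * a ∈ Ideal.ofList vs := by
  obtain ⟨c, hc, hd, h1, h2⟩ := exists_cochain_annihilator hx.ge vs ⊥ hreg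
    (fun v hv => hvs ▸ Ideal.le_radical (Ideal.subset_span hv))
    (fun i => by
      rw [bot_sup_eq, hvs, ← hx]
      exact Ideal.le_radical (Ideal.subset_span ⟨i, rfl⟩))
  rw [cechIdeal_bot, Submodule.mem_bot] at hd
  have hBd : cechBd x ⊥ vs.length = cechCoboundaries x vs.length := by
    rw [cechBd, cechIdeal_bot, sup_bot_eq, cechCoboundaries_eq]
  rw [hBd, bot_sup_eq] at h1 h2
  have key : ∀ a : A, a • cechClass x _ ⟨c, hc, hd⟩ = 0 ↔ a • c ∈ cechCoboundaries x vs.length := by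
    intro a
    rw [← map_smul, cechClass_eq_zero_iff]
    rfl
  exact ⟨cechClass x _ ⟨c, hc, hd⟩, fun a ha => (key a).2 (h1 a ha), fun a ha => h2 a ((key a).1 ha)⟩

end QuasiRegular
end

noncomputable section

set_option linter.unusedSectionVars false

/-! ### Čech cochains as families in one ambient ring. -/

section FullCochains

variable (A : Type*) {L : Type*} [CommRing A] [CommRing L] [Algebra A L]
  {ι : Type*} [LinearOrder ι]

/-- The Čech differential on families of elements of `L`. -/
def fullD : (Finset ι → L) →ₗ[A] (Finset ι → L) :=
  LinearMap.pi fun s => ∑ i ∈ s, (-1 : A) ^ cechPos i s • LinearMap.proj (s.erase i)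

variable {A}

theorem fullD_apply (c : Finset ι → L) (s : Finset ι) :
    fullD A c s = ∑ i ∈ s, (-1 : A) ^ cechPos i s • c (s.erase i) := by
  simp [fullD]

theorem fullD_fullD (c : Finset ι → L) : fullD A (fullD A c) = 0 := by
  funext s
  rw [fullD_apply]
  simp only [fullD_apply, Finset.smul_sum, smul_smul]
  rw [Finset.sum_sigma']
  refine Finset.sum_involution (fun q _ => ⟨q.2, q.1⟩) ?_ ?_ ?_ ?_
  · rintro ⟨i, j⟩ hij
    simp only [Finset.mem_sigma, Finset.mem_erase] at hij
    rw [neg_one_pow_cechPos_erase hij.1 hij.2.2 hij.2.1.symm, neg_smul,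
      Finset.erase_right_comm (a := i) (b := j), neg_add_cancel]
  · rintro ⟨i, j⟩ hij _
    simp only [Finset.mem_sigma, Finset.mem_erase] at hij
    intro h
    exact hij.2.1 (congrArg Sigma.fst h)
  · rintro ⟨i, j⟩ hij
    simp only [Finset.mem_sigma, Finset.mem_erase] at hij ⊢
    exact ⟨hij.2.2, hij.2.1.symm, hij.1⟩
  · rintro ⟨i, j⟩ _
    rfl

variable (A) in
/-- The contracting homotopy of the families of elements of `L` given by the index `i`. -/
def fullH (i : ι) (c : Finset ι → L) : Finset ι → L := fun s =>
  if i ∈ s then 0 else (-1 : A) ^ cechPos i s • c (insert i s)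

theorem neg_one_pow_mul_self {B : Type*} [CommRing B] (n : ℕ) : (-1 : B) ^ n * (-1) ^ n = 1 := by
  rw [← mul_pow]; simp

/-- With all components in the same ring L the complex is contractible, a homotopy being given by
any one index. Cohomology thus comes only from the requirement that components lie in the smaller
localizations. -/
theorem fullD_fullH_add (i : ι) (c : Finset ι → L) (s : Finset ι) :
    fullD A (fullH A i c) s + fullH A i (fullD A c) s = c s := by
  by_cases hi : i ∈ s
  · rw [fullD_apply, Finset.sum_eq_single i]
    · rw [fullH, if_neg (Finset.notMem_erase i s), fullH, if_pos hi, add_zero, cechPos_erase_self,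
        Finset.insert_erase hi, smul_smul, neg_one_pow_mul_self, one_smul]
    · intro j _ hji
      rw [fullH, if_pos (Finset.mem_erase.2 ⟨hji.symm, hi⟩), smul_zero]
    · exact fun h => absurd hi h
  · rw [fullH, if_neg hi, fullD_apply, fullD_apply, Finset.sum_insert hi, cechPos_insert_self,
      Finset.erase_insert hi, smul_add, smul_smul, neg_one_pow_mul_self, one_smul,
      add_left_comm, Finset.smul_sum, ← Finset.sum_add_distrib, Finset.sum_eq_zero, add_zero]
    intro j hj
    have hij : i ≠ j := fun h => hi (h ▸ hj)
    rw [fullH, if_neg (fun h => hi (Finset.mem_of_mem_erase h)), smul_smul, smul_smul,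
      neg_one_pow_cechPos hi hj, Finset.erase_insert_of_ne hij, mul_comm, neg_smul, neg_add_cancel]

theorem fullD_apply_eq_zero_of_card {k : ℕ} {c : Finset ι → L} (hc : ∀ s, s.card ≠ k → c s = 0)
    {s : Finset ι} (hs : s.card ≠ k + 1) : fullD A c s = 0 := by
  rw [fullD_apply]
  refine Finset.sum_eq_zero fun i hi => ?_
  rw [hc _ (fun h => hs (by rw [← Finset.card_erase_add_one hi, h])), smul_zero]

variable {x : ι → A} (hx : ∀ i, IsUnit (algebraMap A L (x i)))

include hx

theorem isUnit_algebraMap_prod (s : Finset ι) : IsUnit (algebraMap A L (∏ i ∈ s, x i)) := by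
  rw [map_prod]
  exact IsUnit.prod_iff.2 fun i _ => hx i

/-- The canonical map `A_{x_s} → L` if the `x i` are invertible in `L`. -/
def cechLocHom (s : Finset ι) : CechLoc x s →ₐ[A] L :=
  IsLocalization.liftAlgHom (M := Submonoid.powers (∏ i ∈ s, x i)) (f := Algebra.ofId A L) (by
    rintro ⟨_, n, rfl⟩
    change IsUnit (algebraMap A L _)
    rw [map_pow]
    exact (isUnit_algebraMap_prod hx s).pow n)

theorem cechLocHom_cechRestrict {s t : Finset ι} (h : s ⊆ t) (a : CechLoc x s) :
    cechLocHom hx t (cechRestrict x h a) = cechLocHom hx s a := by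
  have : ((cechLocHom hx t).comp (cechRestrict x h)).toRingHom = (cechLocHom hx s).toRingHom :=
    IsLocalization.ringHom_ext (Submonoid.powers (∏ i ∈ s, x i)) (by ext; simp)
  exact DFunLike.congr_fun this a

theorem cechLocHom_injective (hinj : Function.Injective (algebraMap A L)) (s : Finset ι) :
    Function.Injective (cechLocHom hx s) := by
  refine (injective_iff_map_eq_zero _).2 fun u hu => ?_
  obtain ⟨N, a, ha⟩ := exists_pow_smul_eq u
  have h1 := congrArg (cechLocHom hx s) ha
  rw [map_smul, hu, smul_zero, AlgHom.commutes] at h1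
  rw [(map_eq_zero_iff _ hinj).1 h1.symm, map_zero, Algebra.smul_def, map_pow] at ha
  exact ((IsLocalization.Away.algebraMap_isUnit _).pow N).mul_right_eq_zero.1 ha

theorem cechLocHom_mem (s : Finset ι) (u : CechLoc x s) :
    cechLocHom hx s u ∈ locSub A L (∏ i ∈ s, x i) := by
  obtain ⟨N, a, ha⟩ := exists_pow_smul_eq u
  have h1 := congrArg (cechLocHom hx s) ha
  rw [map_smul, AlgHom.commutes, Algebra.smul_def, map_pow] at h1
  exact ⟨N, a, h1⟩

theorem exists_cechLocHom_eq {s : Finset ι} {u : L} (hu : u ∈ locSub A L (∏ i ∈ s, x i)) :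
    ∃ v, cechLocHom hx s v = u := by
  obtain ⟨N, a, ha⟩ := hu
  have hu : IsUnit (algebraMap A (CechLoc x s) (∏ j ∈ s, x j)) :=
    IsLocalization.Away.algebraMap_isUnit _
  obtain ⟨v, hv⟩ := ((hu.pow N).dvd (a := algebraMap A (CechLoc x s) a))
  refine ⟨v, ((isUnit_algebraMap_prod hx s).pow N).mul_left_cancel ?_⟩
  have := congrArg (cechLocHom hx s) hv
  rw [map_mul, map_pow, AlgHom.commutes, AlgHom.commutes] at this
  rw [ha, this]

/-- The Čech cochains as families of elements of `L`. -/
def cechEmb : (∀ s, CechLoc x s) →ₗ[A] (Finset ι → L) :=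
  LinearMap.pi fun s => (cechLocHom hx s).toLinearMap ∘ₗ LinearMap.proj s

theorem cechEmb_apply (c : ∀ s, CechLoc x s) (s : Finset ι) :
    cechEmb hx c s = cechLocHom hx s (c s) := rfl

theorem cechEmb_cechD (c : ∀ s, CechLoc x s) :
    cechEmb hx (cechD x c) = fullD A (cechEmb hx c) := by
  funext s
  rw [cechEmb_apply, cechD_apply_cechPos, fullD_apply, map_sum]
  refine Finset.sum_congr rfl fun i _ => ?_
  rw [map_smul, cechLocHom_cechRestrict, cechEmb_apply]

theorem cechEmb_injective (hinj : Function.Injective (algebraMap A L)) :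
    Function.Injective (cechEmb hx) := fun _ _ h =>
  funext fun s => cechLocHom_injective hx hinj s (congrFun h s)

theorem exists_cechEmb_eq {c : Finset ι → L} (hc : ∀ s, c s ∈ locSub A L (∏ i ∈ s, x i)) :
    ∃ c', cechEmb hx c' = c := by
  choose c' hc' using fun s => exists_cechLocHom_eq hx (hc s)
  exact ⟨c', funext hc'⟩

variable (hinj : Function.Injective (algebraMap A L))

include hinj

theorem cechEmb_apply_eq_zero {c : ∀ s, CechLoc x s} {s : Finset ι} :
    cechEmb hx c s = 0 ↔ c s = 0 := by
  rw [cechEmb_apply, map_eq_zero_iff _ (cechLocHom_injective hx hinj s)]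

theorem cechClass_eq_zero_iff_exists {k : ℕ} (z : cechCocycles x (k + 1)) :
    cechClass x (k + 1) z = 0 ↔ ∃ b : Finset ι → L, (∀ s, b s ∈ locSub A L (∏ i ∈ s, x i)) ∧
      (∀ s, s.card ≠ k → b s = 0) ∧ fullD A b = cechEmb hx z.1 := by
  refine (Submodule.Quotient.mk_eq_zero _).trans ?_
  constructor
  · rintro ⟨b, hb, h⟩
    refine ⟨cechEmb hx b, fun s => cechLocHom_mem hx s _, fun s hs => ?_, ?_⟩
    · rw [cechEmb_apply_eq_zero hx hinj, hb s hs]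
    · rw [← cechEmb_cechD, h]
      rfl
  · rintro ⟨b, hb, hb', h⟩
    obtain ⟨b, rfl⟩ := exists_cechEmb_eq hx hb
    refine ⟨b, fun s hs => (cechEmb_apply_eq_zero hx hinj).1 (hb' s hs), ?_⟩
    exact cechEmb_injective hx hinj (by rw [cechEmb_cechD, h]; rfl)

theorem exists_cechCocycles_eq {k : ℕ} {c : Finset ι → L}
    (hc : ∀ s, c s ∈ locSub A L (∏ i ∈ s, x i)) (hk : ∀ s, s.card ≠ k → c s = 0)
    (hd : fullD A c = 0) : ∃ z : cechCocycles x k, cechEmb hx z.1 = c := by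
  obtain ⟨c, rfl⟩ := exists_cechEmb_eq hx hc
  refine ⟨⟨c, fun s hs => (cechEmb_apply_eq_zero hx hinj).1 (hk s hs), LinearMap.mem_ker.2 ?_⟩, rfl⟩
  exact cechEmb_injective hx hinj (by rw [cechEmb_cechD, hd, map_zero])

/-- A linear family of cocycles with values in `L`, parametrized by `L`, induces a map to the Čech
cohomology. -/
theorem exists_linearMap_cechCohomology {k : ℕ} (Z : L →ₗ[A] (Finset ι → L))
    (hc : ∀ u s, Z u s ∈ locSub A L (∏ i ∈ s, x i)) (hk : ∀ u s, s.card ≠ k → Z u s = 0)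
    (hd : ∀ u, fullD A (Z u) = 0) : ∃ π : L →ₗ[A] CechCohomology x k,
      ∀ u (z : cechCocycles x k), cechEmb hx z.1 = Z u → π u = cechClass x k z := by
  let E : cechCocycles x k →ₗ[A] (Finset ι → L) := cechEmb hx ∘ₗ Submodule.subtype _
  have hE : Function.Injective E := (cechEmb_injective hx hinj).comp Subtype.val_injective
  have hZ : ∀ u, Z u ∈ LinearMap.range E := fun u =>
    exists_cechCocycles_eq hx hinj (hc u) (hk u) (hd u)
  refine ⟨cechClass x k ∘ₗ (LinearEquiv.ofInjective E hE).symm.toLinearMap ∘ₗ Z.codRestrict _ hZ,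
    fun u z hz => congrArg (cechClass x k) ?_⟩
  refine (LinearEquiv.symm_apply_eq _).2 (Subtype.ext ?_)
  exact hz.symm

end FullCochains

/-! ### Top Čech cohomology as a quotient of the full localization. -/

section Top

variable {A L : Type*} [CommRing A] [CommRing L] [Algebra A L] {ι : Type*} [LinearOrder ι]
  [Fintype ι] {x : ι → A} (hx : ∀ i, IsUnit (algebraMap A L (x i)))
  (hinj : Function.Injective (algebraMap A L)) (hL : locSub A L (∏ i, x i) = ⊤)

include hinj hL in
-- In the last degree every cochain is a cocycle with one component, and coboundaries are signed
-- sums of elements of the localizations omitting one x_i.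
theorem exists_cechCohomology_top {k : ℕ} (hk : Fintype.card ι = k + 1) :
    ∃ π : L →ₗ[A] CechCohomology x (k + 1), Function.Surjective π ∧
      (∀ u (z : cechCocycles x (k + 1)), cechLocHom hx Finset.univ (z.1 Finset.univ) = u →
        π u = cechClass x (k + 1) z) ∧
      LinearMap.ker π =
        ⨆ i, Subalgebra.toSubmodule (locSub A L (∏ j ∈ Finset.univ.erase i, x j)) := by
  have hsingle : ∀ (c : Finset ι → L), (∀ s, s.card ≠ k + 1 → c s = 0) →
      Pi.single Finset.univ (c Finset.univ) = c := by
    intro c hc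
    funext s
    by_cases hs : s = Finset.univ
    · rw [hs, Pi.single_eq_same]
    · rw [Pi.single_eq_of_ne hs, hc]
      rwa [← hk, Ne, Finset.card_eq_iff_eq_univ]
  have hZd : ∀ u : L, fullD A (Pi.single (M := fun _ : Finset ι => L) Finset.univ u) = 0 := by
    intro u
    funext s
    rw [fullD_apply]
    refine Finset.sum_eq_zero fun i _ => ?_
    rw [Pi.single_eq_of_ne, smul_zero]
    intro h
    simpa using congrArg (i ∈ ·) h
  have hZk : ∀ (u : L) (s : Finset ι), s.card ≠ k + 1 →
      Pi.single (M := fun _ : Finset ι => L) Finset.univ u s = 0 := by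
    intro u s hs
    refine Pi.single_eq_of_ne (fun h => hs ?_) _
    rw [h, Finset.card_univ, hk]
  have hZm : ∀ (u : L) (s : Finset ι),
      Pi.single (M := fun _ : Finset ι => L) Finset.univ u s ∈ locSub A L (∏ i ∈ s, x i) := by
    intro u s
    by_cases hs : s = Finset.univ
    · rw [hs, hL]; trivial
    · rw [Pi.single_eq_of_ne hs]; exact zero_mem _
  obtain ⟨π, hπ⟩ := exists_linearMap_cechCohomology hx hinj (k := k + 1)
    (LinearMap.single A (fun _ : Finset ι => L) Finset.univ) hZm hZk hZd
  have hπ' : ∀ u (z : cechCocycles x (k + 1)), cechLocHom hx Finset.univ (z.1 Finset.univ) = u →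
        π u = cechClass x (k + 1) z := by
    intro u z hz
    refine hπ u z ?_
    rw [← hsingle (cechEmb hx z.1), cechEmb_apply, hz]
    · rfl
    · exact fun s hs => by rw [cechEmb_apply_eq_zero hx hinj, z.2.1 s hs]
  refine ⟨π, fun ζ => ?_, hπ', ?_⟩
  · obtain ⟨z, rfl⟩ := Submodule.Quotient.mk_surjective _ ζ
    exact ⟨_, hπ' _ z rfl⟩
  · ext u
    obtain ⟨z, hz⟩ := exists_cechCocycles_eq hx hinj (hZm u) (hZk u) (hZd u)
    rw [LinearMap.mem_ker, hπ u z hz, cechClass_eq_zero_iff_exists hx hinj, hz]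
    constructor
    · rintro ⟨b, hb, _, h⟩
      have h1 := congrFun h Finset.univ
      rw [Pi.single_eq_same, fullD_apply] at h1
      rw [← h1]
      refine sum_mem fun i _ => Submodule.smul_mem _ _ (Submodule.mem_iSup_of_mem i ?_)
      exact hb _
    · intro hu
      clear hz
      induction hu using Submodule.iSup_induction' with
      | mem i u hu =>
        refine ⟨Pi.single (Finset.univ.erase i) ((-1 : A) ^ cechPos i Finset.univ • u),
          fun s => ?_, fun s hs => ?_, ?_⟩
        · by_cases h : s = Finset.univ.erase i
          · subst h
            rw [Pi.single_eq_same]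
            exact Subalgebra.smul_mem _ hu _
          · rw [Pi.single_eq_of_ne h]; exact zero_mem _
        · refine Pi.single_eq_of_ne (fun h => hs ?_) _
          rw [h, Finset.card_erase_of_mem (Finset.mem_univ i), Finset.card_univ, hk,
            Nat.add_sub_cancel]
        · rw [← hsingle (fullD A _)]
          · congr 1
            rw [fullD_apply, Finset.sum_eq_single i]
            · rw [Pi.single_eq_same, smul_smul, neg_one_pow_mul_self, one_smul]
            · intro j _ hj
              rw [Pi.single_eq_of_ne, smul_zero]
              intro h
              have := congrArg (i ∈ ·) h
              simp [hj.symm] at this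
            · simp
          · intro s hs
            refine fullD_apply_eq_zero_of_card (k := k) (fun t ht => ?_) hs
            refine Pi.single_eq_of_ne (fun h => ht ?_) _
            rw [h, Finset.card_erase_of_mem (Finset.mem_univ i), Finset.card_univ, hk,
              Nat.add_sub_cancel]
      | zero => exact ⟨0, fun s => zero_mem _, fun s _ => rfl, by rw [map_zero]; simp⟩
      | add u v _ _ hu hv =>
        obtain ⟨b, hb, hb', h⟩ := hu
        obtain ⟨b₂, hb₂, hb₂', h₂⟩ := hv
        refine ⟨b + b₂, fun s => add_mem (hb s) (hb₂ s), fun s hs => ?_, ?_⟩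
        · rw [Pi.add_apply, hb' s hs, hb₂' s hs, add_zero]
        · rw [map_add, h, h₂]
          exact (map_add (LinearMap.single A (fun _ : Finset ι => L) Finset.univ) u v).symm

include hx hinj in
-- The description of top local cohomology as the direct limit of A/(x_i^k): after a common
-- denominator is chosen, a decomposition of u becomes a relation with the powers x_i^{k+N}. No
-- regularity is assumed, so N need not be zero.
theorem mem_iSup_locSub_iff {k : ℕ} {a : A} {u : L}
    (hu : algebraMap A L (∏ i, x i) ^ k * u = algebraMap A L a) :
    u ∈ ⨆ i, Subalgebra.toSubmodule (locSub A L (∏ j ∈ Finset.univ.erase i, x j)) ↔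
      ∃ N, (∏ i, x i) ^ N * a ∈ Ideal.span (Set.range fun i => x i ^ (k + N)) := by
  have hsplit : ∀ i, ∏ j, x j = x i * ∏ j ∈ Finset.univ.erase i, x j := fun i =>
    (Finset.mul_prod_erase _ _ (Finset.mem_univ i)).symm
  have hunit : ∀ s : Finset ι, IsUnit (algebraMap A L (∏ i ∈ s, x i)) := isUnit_algebraMap_prod hx
  constructor
  · intro h
    obtain ⟨v, hv, rfl⟩ : ∃ v : ι → L, (∀ i, v i ∈ locSub A L (∏ j ∈ Finset.univ.erase i, x j)) ∧
        ∑ i, v i = u := by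
      obtain ⟨v, hv⟩ := (Submodule.mem_iSup_iff_exists_finsupp _ _).1 h
      refine ⟨v, hv.1, ?_⟩
      rw [← hv.2, Finsupp.sum_fintype _ _ (fun _ => rfl)]
    choose n b hb using hv
    let M := Finset.univ.sup n
    have hb' : ∀ i, ∃ b' : A, algebraMap A L (∏ j ∈ Finset.univ.erase i, x j) ^ (k + M) * v i =
        algebraMap A L b' := by
      intro i
      refine ⟨(∏ j ∈ Finset.univ.erase i, x j) ^ (k + M - n i) * b i, ?_⟩
      rw [map_mul, ← hb, ← mul_assoc, map_pow, ← pow_add, Nat.sub_add_cancel]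
      exact (Finset.le_sup (f := n) (Finset.mem_univ i)).trans (Nat.le_add_left _ _)
    choose b' hb' using hb'
    refine ⟨M, ?_⟩
    have : (∏ i, x i) ^ M * a = ∑ i, b' i * x i ^ (k + M) := by
      apply hinj
      rw [map_mul, ← hu, map_pow, ← mul_assoc, ← pow_add, Finset.mul_sum, map_sum]
      refine Finset.sum_congr rfl fun i _ => ?_
      rw [map_mul, ← hb', hsplit i, map_mul, mul_pow, map_pow, add_comm M k]
      ring
    rw [this]
    exact Ideal.sum_mem _ fun i _ => Ideal.mul_mem_left _ _ (Ideal.subset_span ⟨i, rfl⟩)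
  · rintro ⟨N, h⟩
    obtain ⟨b, hb⟩ := (Submodule.mem_span_range_iff_exists_fun A).1 h
    have hinv := fun i => (hunit (Finset.univ.erase i)).exists_right_inv
    choose ξ hξ using hinv
    have : u = ∑ i, algebraMap A L (b i) * ξ i ^ (k + N) := by
      refine ((hunit Finset.univ).pow (k + N)).mul_left_cancel ?_
      have h1 := congrArg (algebraMap A L) hb
      rw [map_mul, map_sum, ← hu, map_pow, ← mul_assoc, ← pow_add, add_comm N k] at h1
      rw [← h1, Finset.mul_sum]
      refine Finset.sum_congr rfl fun i _ => ?_
      have h2 : algebraMap A L (∏ j ∈ Finset.univ.erase i, x j) ^ (k + N) * ξ i ^ (k + N) = 1 := by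
        rw [← mul_pow, hξ, one_pow]
      rw [hsplit i, map_mul, mul_pow, smul_eq_mul, map_mul, map_pow]
      linear_combination (-algebraMap A L (b i) * algebraMap A L (x i) ^ (k + N)) * h2
    rw [this]
    refine sum_mem fun i _ => Submodule.mem_iSup_of_mem i ?_
    exact (locSub A L _).mul_mem (Subalgebra.algebraMap_mem _ _)
      (pow_mem (mem_locSub_of_mul_eq_one (hξ i)) _)

end Top
end

noncomputable section

set_option linter.unusedSectionVars false

/-! ### Comparison of localizations inside an ambient ring. -/

section LocSub

variable {A L : Type*} [CommRing A] [CommRing L] [Algebra A L]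

theorem mem_of_mem_locSub {S : Subring L} (hA : ∀ a, algebraMap A L a ∈ S) {x : A} {ξ : L}
    (h : algebraMap A L x * ξ = 1) (hξ : ξ ∈ S) {u : L} (hu : u ∈ locSub A L x) : u ∈ S := by
  obtain ⟨N, a, rfl⟩ := (mem_locSub_iff_of_mul_eq_one h).1 hu
  exact mul_mem (hA a) (pow_mem hξ N)

theorem locSub_mono_of_dvd {x y : A} (h : x ∣ y) : locSub A L x ≤ locSub A L y := by
  rintro u ⟨N, a, hu⟩
  obtain ⟨z, rfl⟩ := h
  exact ⟨N, z ^ N * a, by rw [map_mul, mul_pow, map_mul, map_pow, ← hu]; ring⟩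

theorem mem_locSub_of_dvd {x y : A} {ξ : L} (h : algebraMap A L x * ξ = 1) (hd : x ∣ y) :
    ξ ∈ locSub A L y := locSub_mono_of_dvd hd (mem_locSub_of_mul_eq_one h)

end LocSub

/-! ### The ambient ring R_f[t, t⁻¹] and its grading. -/

section Ambient

open Polynomial LaurentPolynomial

variable {R : Type*} [CommRing R] {d : ℕ}

/-- The ring `R_f[t, t⁻¹]`, `f = f₁ ⋯ f_d`. -/
def ReesAmbient (f : Fin d → R) : Type _ := LaurentPolynomial (Localization.Away (∏ i, f i))

variable (f : Fin d → R)

instance : CommRing (ReesAmbient f) :=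
  inferInstanceAs (CommRing (LaurentPolynomial (Localization.Away (∏ i, f i))))

instance : Algebra R (ReesAmbient f) :=
  inferInstanceAs (Algebra R (LaurentPolynomial (Localization.Away (∏ i, f i))))

instance : Algebra R[T;T⁻¹] (ReesAmbient f) :=
  RingHom.toAlgebra (S := LaurentPolynomial (Localization.Away (∏ i, f i)))
    (AddMonoidAlgebra.mapRingHom ℤ (algebraMap R (Localization.Away (∏ i, f i))))

variable {I : Ideal R}

instance : Algebra (reesAlgebra I) (ReesAmbient f) :=
  ((algebraMap (extendedReesAlgebra I) (ReesAmbient f)).comp (reesInclusion I).toRingHom).toAlgebra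

/-- The coefficients of an element of `R_f[t, t⁻¹]`. -/
def ambCoeff (u : ReesAmbient f) (n : ℤ) : Localization.Away (∏ i, f i) :=
  (show LaurentPolynomial (Localization.Away (∏ i, f i)) from u).coeff n

/-- The monomial `a tⁿ` of `R_f[t, t⁻¹]`. -/
def ambMono (n : ℤ) (a : Localization.Away (∏ i, f i)) : ReesAmbient f :=
  (AddMonoidAlgebra.single n a : LaurentPolynomial (Localization.Away (∏ i, f i)))

variable {f}

theorem ambCoeff_add (u v : ReesAmbient f) (n : ℤ) :
    ambCoeff f (u + v) n = ambCoeff f u n + ambCoeff f v n := rfl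

theorem ambCoeff_ext {u v : ReesAmbient f} (h : ∀ n, ambCoeff f u n = ambCoeff f v n) : u = v :=
  LaurentPolynomial.ext h

theorem ambCoeff_mono (n : ℤ) (a : Localization.Away (∏ i, f i)) (m : ℤ) :
    ambCoeff f (ambMono f n a) m = if n = m then a else 0 := by
  classical
  exact Finsupp.single_apply

theorem ambMono_mul (n m : ℤ) (a b : Localization.Away (∏ i, f i)) :
    ambMono f n a * ambMono f m b = ambMono f (n + m) (a * b) :=
  AddMonoidAlgebra.single_mul_single ..

theorem ambMono_pow (n : ℤ) (a : Localization.Away (∏ i, f i)) (N : ℕ) :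
    ambMono f n a ^ N = ambMono f (N * n) (a ^ N) := by
  refine (AddMonoidAlgebra.single_pow ..).trans ?_
  rw [nsmul_eq_mul]
  rfl

theorem ambMono_one : ambMono f 0 1 = 1 := rfl

theorem ambMono_add (n : ℤ) (a b : Localization.Away (∏ i, f i)) :
    ambMono f n (a + b) = ambMono f n a + ambMono f n b :=
  AddMonoidAlgebra.single_add ..

theorem ambMono_zero (n : ℤ) : ambMono f n 0 = 0 := AddMonoidAlgebra.single_zero _

theorem smul_ambMono (r : R) (n : ℤ) (a : Localization.Away (∏ i, f i)) :
    r • ambMono f n a = ambMono f n (r • a) :=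
  AddMonoidAlgebra.smul_single ..

theorem algebraMap_ambient (r : R) :
    algebraMap R (ReesAmbient f) r = ambMono f 0 (algebraMap R _ r) := rfl

theorem ambient_induction {P : ReesAmbient f → Prop} (u : ReesAmbient f)
    (hz : P 0) (ha : ∀ u v, P u → P v → P (u + v)) (hm : ∀ n, P (ambMono f n (ambCoeff f u n))) :
    P u := by
  have : u = ∑ n ∈ (show LaurentPolynomial (Localization.Away (∏ i, f i)) from u).coeff.support,
      ambMono f n (ambCoeff f u n) := (AddMonoidAlgebra.sum_coeff_single
        (show LaurentPolynomial (Localization.Away (∏ i, f i)) from u)).symm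
  rw [this]
  exact Finset.sum_induction _ P ha hz fun n _ => hm n

theorem ambCoeff_mono_mul (m : ℤ) (a : Localization.Away (∏ i, f i)) (u : ReesAmbient f) (n : ℤ) :
    ambCoeff f (ambMono f m a * u) n = a * ambCoeff f u (n - m) := by
  refine ambient_induction u (P := fun u => ∀ n, ambCoeff f (ambMono f m a * u) n
    = a * ambCoeff f u (n - m)) ?_ ?_ ?_ n
  · intro n; rw [mul_zero]; exact (mul_zero a).symm
  · intro u v hu hv n
    rw [mul_add, ambCoeff_add, hu, hv, ambCoeff_add, mul_add]
  · intro k n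
    rw [ambMono_mul, ambCoeff_mono, ambCoeff_mono]
    by_cases h : m + k = n
    · rw [if_pos h, if_pos (by omega)]
    · rw [if_neg h, if_neg (by omega), mul_zero]

theorem ambCoeff_algebraMap_laurent (q : R[T;T⁻¹]) (n : ℤ) :
    ambCoeff f (algebraMap R[T;T⁻¹] (ReesAmbient f) q) n = algebraMap R _ (q.coeff n) := by
  change (AddMonoidAlgebra.mapRingHom ℤ (algebraMap R (Localization.Away (∏ i, f i))) q).coeff n = _
  simp

theorem ambCoeff_algebraMap (q : extendedReesAlgebra I) (n : ℤ) :
    ambCoeff f (algebraMap _ (ReesAmbient f) q) n = algebraMap R _ (q.1.coeff n) :=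
  ambCoeff_algebraMap_laurent q.1 n

theorem algebraMap_reesInclusion (q : reesAlgebra I) :
    algebraMap (extendedReesAlgebra I) (ReesAmbient f) (reesInclusion I q) =
      algebraMap (reesAlgebra I) (ReesAmbient f) q := rfl

theorem reesInclusion_coeff_natCast (q : reesAlgebra I) (n : ℕ) :
    (reesInclusion I q).1.coeff (n : ℤ) = q.1.coeff n := by
  change (toLaurent q.1).coeff n = _
  rw [coeff_toLaurent, show (n : ℤ) = Nat.castEmbedding n from rfl,
    Finsupp.mapDomain_apply Nat.castEmbedding.injective]
  rfl

theorem reesInclusion_coeff_neg (q : reesAlgebra I) {n : ℤ} (hn : n < 0) :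
    (reesInclusion I q).1.coeff n = 0 := by
  change (toLaurent q.1).coeff n = _
  rw [coeff_toLaurent, Finsupp.mapDomain_of_notMem_range]
  rintro ⟨k, hk⟩
  have : (k : ℤ) = n := hk
  omega

theorem reesInclusion_injective : Function.Injective (reesInclusion I) := fun p q h => by
  apply Subtype.ext
  ext n
  rw [← reesInclusion_coeff_natCast, ← reesInclusion_coeff_natCast, h]

theorem exists_reesInclusion_eq {q : extendedReesAlgebra I} (hq : ∀ n < 0, q.1.coeff n = 0) :
    ∃ q', reesInclusion I q' = q := by
  have h : ∀ n, (LaurentPolynomial.trunc q.1).coeff n = q.1.coeff (n : ℤ) := by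
    intro n
    rfl
  refine ⟨⟨LaurentPolynomial.trunc q.1, fun n => ?_⟩, ?_⟩
  · rw [h]; exact q.2 n
  · apply Subtype.ext
    ext n
    by_cases hn : 0 ≤ n
    · lift n to ℕ using hn
      rw [reesInclusion_coeff_natCast, h]
    · rw [reesInclusion_coeff_neg _ (by omega), hq n (by omega)]

instance : IsScalarTower R (extendedReesAlgebra I) (ReesAmbient f) :=
  IsScalarTower.of_algebraMap_eq fun r => ambCoeff_ext fun n => by
    rw [ambCoeff_algebraMap, algebraMap_ambient, ambCoeff_mono]
    change _ = algebraMap R _ ((algebraMap R R[T;T⁻¹] r).coeff n)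
    rw [LaurentPolynomial.algebraMap_apply, LaurentPolynomial.C_apply]
    by_cases h : n = 0
    · rw [if_pos h, if_pos h.symm]; rfl
    · rw [if_neg h, if_neg (Ne.symm h), map_zero]

instance : IsScalarTower R (reesAlgebra I) (ReesAmbient f) :=
  IsScalarTower.of_algebraMap_eq fun r => by
    rw [← algebraMap_reesInclusion, AlgHom.commutes, ← IsScalarTower.algebraMap_apply]

theorem algebraMap_reesTInv :
    algebraMap (extendedReesAlgebra I) (ReesAmbient f) (reesTInv I) = ambMono f (-1) 1 :=
  ambCoeff_ext fun n => by
    rw [ambCoeff_algebraMap, ambCoeff_mono]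
    change algebraMap R _ ((T (-1) : R[T;T⁻¹]).coeff n) = _
    rw [T_apply]
    split_ifs <;> simp

theorem algebraMap_reesT (a : R) (ha : a ∈ I) :
    algebraMap (reesAlgebra I) (ReesAmbient f) (reesT a ha) = ambMono f 1 (algebraMap R _ a) :=
  ambCoeff_ext fun n => by
    rw [← algebraMap_reesInclusion, ambCoeff_algebraMap, ambCoeff_mono]
    by_cases hn : 0 ≤ n
    · lift n to ℕ using hn
      rw [reesInclusion_coeff_natCast]
      change algebraMap R _ ((Polynomial.monomial 1 a).coeff n) = _
      rw [Polynomial.coeff_monomial]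
      by_cases h : 1 = n
      · rw [if_pos h, if_pos (by omega)]
      · rw [if_neg h, if_neg (by omega), map_zero]
    · rw [reesInclusion_coeff_neg _ (by omega), if_neg (by omega), map_zero]

theorem algebraMap_rees_algebraMap (a : R) :
    algebraMap (reesAlgebra I) (ReesAmbient f) (algebraMap R _ a) = ambMono f 0 (algebraMap R _ a) := by
  rw [← IsScalarTower.algebraMap_apply]; rfl

open Classical in
/-- `ambRestr` as a function. -/
def ambFilter (f : Fin d → R) (W : Set ℤ) (u : ReesAmbient f) : ReesAmbient f :=
  (AddMonoidAlgebra.ofCoeff (Finsupp.filter (· ∈ W) (AddMonoidAlgebra.coeff u)) :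
    LaurentPolynomial (Localization.Away (∏ i, f i)))

open Classical in
theorem ambCoeff_filter (W : Set ℤ) (u : ReesAmbient f) (n : ℤ) :
    ambCoeff f (ambFilter f W u) n = if n ∈ W then ambCoeff f u n else 0 :=
  Finsupp.filter_apply ..

theorem ambCoeff_smul (r : R) (u : ReesAmbient f) (n : ℤ) :
    ambCoeff f (r • u) n = r • ambCoeff f u n := rfl

/-- The part of an element of `R_f[t, t⁻¹]` with degrees in `W`. -/
def ambRestr (f : Fin d → R) (W : Set ℤ) : ReesAmbient f →ₗ[R] ReesAmbient f where
  toFun := ambFilter f W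
  map_add' u v := ambCoeff_ext fun n => by
    rw [ambCoeff_filter, ambCoeff_add, ambCoeff_add, ambCoeff_filter, ambCoeff_filter]
    split_ifs
    · rfl
    · rw [add_zero]
  map_smul' r u := ambCoeff_ext fun n => by
    rw [ambCoeff_filter, RingHom.id_apply, ambCoeff_smul, ambCoeff_smul, ambCoeff_filter]
    split_ifs
    · rfl
    · rw [smul_zero]

open Classical in
theorem ambCoeff_restr (W : Set ℤ) (u : ReesAmbient f) (n : ℤ) :
    ambCoeff f (ambRestr f W u) n = if n ∈ W then ambCoeff f u n else 0 := ambCoeff_filter W u n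

theorem ambRestr_mono_mul (W : Set ℤ) (m : ℤ) (a : Localization.Away (∏ i, f i))
    (u : ReesAmbient f) : ambMono f m a * ambRestr f W u =
      ambRestr f {n | n - m ∈ W} (ambMono f m a * u) := ambCoeff_ext fun n => by
  rw [ambCoeff_mono_mul, ambCoeff_restr, ambCoeff_restr, ambCoeff_mono_mul, mul_ite, mul_zero]
  rfl

theorem exists_algebraMap_eq_of_ambCoeff {u : ReesAmbient f}
    (h : ∀ n : ℤ, ∃ r ∈ I ^ n.toNat, algebraMap R _ r = ambCoeff f u n) :
    ∃ q : extendedReesAlgebra I, algebraMap _ (ReesAmbient f) q = u ∧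
      ∀ n, ambCoeff f u n = 0 → q.1.coeff n = 0 := by
  classical
  choose r hr hru using h
  -- Outside the support the chosen lift could be a nonzero element that vanishes in R_f, so it is
  -- replaced by 0 there; this also keeps the support finite.
  let s := (show LaurentPolynomial (Localization.Away (∏ i, f i)) from u).coeff.support
  refine ⟨⟨AddMonoidAlgebra.ofCoeff (Finsupp.onFinset s (fun n => if n ∈ s then r n else 0)
    (by intro n hn; by_contra h; exact hn (if_neg h))), fun n => ?_⟩, ?_, fun n hn => ?_⟩
  · change (if n ∈ s then r n else 0) ∈ _
    split_ifs
    · exact hr n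
    · exact zero_mem _
  · refine ambCoeff_ext fun n => ?_
    rw [ambCoeff_algebraMap]
    change algebraMap R _ (if n ∈ s then r n else 0) = _
    split_ifs with h
    · exact hru n
    · rw [map_zero]
      exact (Finsupp.notMem_support_iff.1 h).symm
  · change (if n ∈ s then r n else 0) = 0
    rw [if_neg]
    exact Finsupp.notMem_support_iff.2 hn

theorem exists_algebraMap_rees_eq_of_ambCoeff {u : ReesAmbient f}
    (h : ∀ n : ℤ, ∃ r ∈ I ^ n.toNat, algebraMap R _ r = ambCoeff f u n)
    (h0 : ∀ n < 0, ambCoeff f u n = 0) :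
    ∃ q : reesAlgebra I, algebraMap _ (ReesAmbient f) q = u := by
  obtain ⟨q, hq, hq0⟩ := exists_algebraMap_eq_of_ambCoeff h
  obtain ⟨q', rfl⟩ := exists_reesInclusion_eq fun n hn => hq0 n (h0 n hn)
  exact ⟨q', hq⟩

theorem exists_algebraMap_eq_ambRestr (W : Set ℤ) (q : extendedReesAlgebra I) :
    ∃ q' : extendedReesAlgebra I, algebraMap _ (ReesAmbient f) q' =
      ambRestr f W (algebraMap _ (ReesAmbient f) q) := by
  classical
  obtain ⟨q', h, -⟩ := exists_algebraMap_eq_of_ambCoeff (I := I)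
    (u := ambRestr f W (algebraMap _ (ReesAmbient f) q)) (fun n => by
      rw [ambCoeff_restr, ambCoeff_algebraMap]
      split_ifs
      · exact ⟨_, q.2 n, rfl⟩
      · exact ⟨0, zero_mem _, map_zero _⟩)
  exact ⟨q', h⟩

/-- Localization at a homogeneous element is a graded subring, so restricting degrees to W stays
inside it. This is where homogeneity of the kernel comes from. -/
theorem ambRestr_mem_locSub {x : extendedReesAlgebra I} {m : ℤ} {a : Localization.Away (∏ i, f i)}
    (hx : algebraMap _ (ReesAmbient f) x = ambMono f m a) (W : Set ℤ) {u : ReesAmbient f}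
    (hu : u ∈ locSub (extendedReesAlgebra I) (ReesAmbient f) x) :
    ambRestr f W u ∈ locSub (extendedReesAlgebra I) (ReesAmbient f) x := by
  obtain ⟨N, b, hb⟩ := hu
  rw [hx, ambMono_pow] at hb
  obtain ⟨c, hc⟩ := exists_algebraMap_eq_ambRestr (f := f) {n | n - N * m ∈ W} b
  refine ⟨N, c, ?_⟩
  rw [hx, ambMono_pow, ambRestr_mono_mul, hb, hc]

section Injective

variable (hnzd : ∀ i, f i ∈ nonZeroDivisors R)
include hnzd

theorem algebraMap_away_injective : Function.Injective (algebraMap R (Localization.Away (∏ i, f i))) :=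
  IsLocalization.injective _ (M := Submonoid.powers (∏ i, f i))
    (Submonoid.powers_le.2 (prod_mem fun i _ => hnzd i))

theorem algebraMap_extendedRees_injective :
    Function.Injective (algebraMap (extendedReesAlgebra I) (ReesAmbient f)) := fun p q h => by
  apply Subtype.ext
  ext n
  apply algebraMap_away_injective hnzd
  rw [← ambCoeff_algebraMap, ← ambCoeff_algebraMap, h]

theorem algebraMap_rees_injective :
    Function.Injective (algebraMap (reesAlgebra I) (ReesAmbient f)) :=
  (algebraMap_extendedRees_injective hnzd).comp reesInclusion_injective

end Injective

/-- The inverse of `f i` in `R_f`. -/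
def ambInv (f : Fin d → R) (i : Fin d) : Localization.Away (∏ i, f i) :=
  algebraMap R _ (∏ j ∈ Finset.univ.erase i, f j) * IsLocalization.Away.invSelf (∏ i, f i)

theorem algebraMap_mul_ambInv (i : Fin d) : algebraMap R _ (f i) * ambInv f i = 1 := by
  rw [ambInv, ← mul_assoc, ← map_mul, Finset.mul_prod_erase _ _ (Finset.mem_univ i)]
  exact IsLocalization.Away.mul_invSelf _

theorem exists_eq_mul_prod_ambInv (q : Localization.Away (∏ i, f i)) :
    ∃ (N : ℕ) (a : R), q = algebraMap R _ a * (∏ i, ambInv f i) ^ N := by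
  obtain ⟨N, a, h⟩ := IsLocalization.Away.surj (∏ i, f i) q
  refine ⟨N, a, ?_⟩
  have h1 : algebraMap R (Localization.Away (∏ i, f i)) (∏ i, f i) * ∏ i, ambInv f i = 1 := by
    rw [map_prod, ← Finset.prod_mul_distrib]
    exact Finset.prod_eq_one fun i _ => algebraMap_mul_ambInv i
  rw [← h, mul_assoc, ← mul_pow, h1, one_pow, mul_one]

end Ambient
end

noncomputable section

set_option linter.unusedSectionVars false

/-! ### Localizations of the two Rees algebras inside R_f[t, t⁻¹]. -/

section ReesLoc

variable {R : Type*} [CommRing R] {I : Ideal R} {d : ℕ} {f : Fin d → R} (hf : ∀ i, f i ∈ I)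

theorem ambMono_mul_eq_one {n : ℤ} {a b : Localization.Away (∏ i, f i)} (h : a * b = 1) :
    ambMono f n a * ambMono f (-n) b = 1 := by
  rw [ambMono_mul, add_neg_cancel, h, ambMono_one]

/-- The inverses of the elements `f₁, …, f_d, f₁t, …, f_dt`. -/
def reesSeqInv (f : Fin d → R) : Fin (d + d) → ReesAmbient f :=
  Fin.append (fun i => ambMono f 0 (ambInv f i)) (fun i => ambMono f (-1) (ambInv f i))

theorem reesSeq_castAdd (i : Fin d) :
    reesSeq f hf (Fin.castAdd d i) = algebraMap R (reesAlgebra I) (f i) := Fin.append_left ..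

theorem reesSeq_natAdd (i : Fin d) :
    reesSeq f hf (Fin.natAdd d i) = reesT (f i) (hf i) := Fin.append_right ..

theorem reesSeqInv_castAdd (i : Fin d) :
    reesSeqInv f (Fin.castAdd d i) = ambMono f 0 (ambInv f i) := Fin.append_left ..

theorem reesSeqInv_natAdd (i : Fin d) :
    reesSeqInv f (Fin.natAdd d i) = ambMono f (-1) (ambInv f i) := Fin.append_right ..

theorem algebraMap_reesSeq_mul_inv (i : Fin (d + d)) :
    algebraMap _ (ReesAmbient f) (reesSeq f hf i) * reesSeqInv f i = 1 := by
  induction i using Fin.addCases with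
  | left i =>
    rw [reesSeq_castAdd, reesSeqInv_castAdd, algebraMap_rees_algebraMap, ambMono_mul,
      algebraMap_mul_ambInv, add_zero, ambMono_one]
  | right i =>
    rw [reesSeq_natAdd, reesSeqInv_natAdd, algebraMap_reesT]
    exact ambMono_mul_eq_one (algebraMap_mul_ambInv i)

theorem isUnit_algebraMap_reesSeq (i : Fin (d + d)) :
    IsUnit (algebraMap _ (ReesAmbient f) (reesSeq f hf i)) :=
  IsUnit.of_mul_eq_one _ (algebraMap_reesSeq_mul_inv hf i)

/-- The localization of the Rees algebra at a product of some of the elements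
`f₁, …, f_d, f₁t, …, f_dt`, as a subring of `R_f[t, t⁻¹]`. -/
abbrev reesLoc (s : Finset (Fin (d + d))) : Subalgebra (reesAlgebra I) (ReesAmbient f) :=
  locSub (reesAlgebra I) (ReesAmbient f) (∏ i ∈ s, reesSeq f hf i)

variable {hf}

theorem reesSeqInv_mem {s : Finset (Fin (d + d))} {i : Fin (d + d)} (hi : i ∈ s) :
    reesSeqInv f i ∈ reesLoc hf s :=
  mem_locSub_of_dvd (algebraMap_reesSeq_mul_inv hf i) (Finset.dvd_prod_of_mem _ hi)

/-- A single index on the left already gives t = (f_it) / f_i. -/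
theorem ambMono_one_one_mem {s : Finset (Fin (d + d))} {i : Fin d} (hi : Fin.castAdd d i ∈ s) :
    ambMono f 1 1 ∈ reesLoc hf s := by
  have := (reesLoc hf s).mul_mem (Subalgebra.algebraMap_mem _ (reesT (f i) (hf i)))
    (reesSeqInv_mem hi)
  rwa [reesSeqInv_castAdd, algebraMap_reesT, ambMono_mul, algebraMap_mul_ambInv] at this

/-- A single index on the right already gives t⁻¹ = f_i / (f_it). -/
theorem ambMono_neg_one_one_mem {s : Finset (Fin (d + d))} {i : Fin d}
    (hi : Fin.natAdd d i ∈ s) : ambMono f (-1) 1 ∈ reesLoc hf s := by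
  have := (reesLoc hf s).mul_mem
    (Subalgebra.algebraMap_mem _ (algebraMap R (reesAlgebra I) (f i))) (reesSeqInv_mem hi)
  rwa [reesSeqInv_natAdd, algebraMap_rees_algebraMap, ambMono_mul, algebraMap_mul_ambInv,
    zero_add] at this

theorem ambMono_coe_mem {S : Subalgebra (reesAlgebra I) (ReesAmbient f)} {r : R} {n : ℤ}
    (hr : r ∈ I ^ n.toNat) (h : n < 0 → ambMono f (-1) 1 ∈ S) :
    ambMono f n (algebraMap R _ r) ∈ S := by
  by_cases hn : 0 ≤ n
  · obtain ⟨q, hq⟩ := exists_algebraMap_rees_eq_of_ambCoeff (I := I)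
      (u := ambMono f n (algebraMap R _ r)) (fun m => by
        rw [ambCoeff_mono]
        split_ifs with h
        · exact ⟨r, h ▸ hr, rfl⟩
        · exact ⟨0, zero_mem _, map_zero _⟩) (fun m hm => by
        rw [ambCoeff_mono, if_neg (by omega)])
    exact hq ▸ S.algebraMap_mem q
  · have := S.mul_mem (S.algebraMap_mem (algebraMap R (reesAlgebra I) r))
      (S.pow_mem (h (by omega)) (-n).toNat)
    rwa [algebraMap_rees_algebraMap, ambMono_pow, ambMono_mul, one_pow, mul_one,
      show (0 : ℤ) + ((-n).toNat : ℤ) * (-1) = n by omega] at this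

theorem algebraMap_extendedRees_mem {S : Subalgebra (reesAlgebra I) (ReesAmbient f)}
    (h : ambMono f (-1) 1 ∈ S) (q : extendedReesAlgebra I) :
    algebraMap _ (ReesAmbient f) q ∈ S := by
  refine ambient_induction _ S.zero_mem (fun u v => S.add_mem) fun n => ?_
  rw [ambCoeff_algebraMap]
  exact ambMono_coe_mem (q.2 n) fun _ => h

theorem reesLoc_subset {S : Subring (ReesAmbient f)}
    (hA : ∀ a : reesAlgebra I, algebraMap _ (ReesAmbient f) a ∈ S) {s : Finset (Fin (d + d))}
    (hs : ∀ i ∈ s, reesSeqInv f i ∈ S) {u : ReesAmbient f} (hu : u ∈ reesLoc hf s) : u ∈ S := by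
  refine mem_of_mem_locSub hA (ξ := ∏ i ∈ s, reesSeqInv f i) ?_ (prod_mem hs) hu
  rw [map_prod, ← Finset.prod_mul_distrib]
  exact Finset.prod_eq_one fun i _ => algebraMap_reesSeq_mul_inv hf i

theorem reesLoc_mono {s s' : Finset (Fin (d + d))} (h : s ⊆ s') : reesLoc hf s ≤ reesLoc hf s' :=
  locSub_mono_of_dvd (Finset.prod_dvd_prod_of_subset _ _ _ h)

/-- Whether the index `i` occurs in `s`, on the left or on the right. -/
def IsCovered (s : Finset (Fin (d + d))) (i : Fin d) : Prop :=
  Fin.castAdd d i ∈ s ∨ Fin.natAdd d i ∈ s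

/-- Whether `s` contains indices both on the left and on the right. -/
def IsMixed (s : Finset (Fin (d + d))) : Prop :=
  (∃ i, Fin.castAdd d i ∈ s) ∧ ∃ i, Fin.natAdd d i ∈ s

theorem reesSeqInv_mem_of_isMixed {s : Finset (Fin (d + d))} (hs : IsMixed s) {i : Fin d}
    (hi : IsCovered s i) : ambMono f 0 (ambInv f i) ∈ reesLoc hf s ∧
      ambMono f (-1) (ambInv f i) ∈ reesLoc hf s := by
  obtain ⟨⟨j, hj⟩, ⟨k, hk⟩⟩ := hs
  rcases hi with hi | hi
  · have h := reesSeqInv_mem (hf := hf) hi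
    rw [reesSeqInv_castAdd] at h
    refine ⟨h, ?_⟩
    have := (reesLoc hf s).mul_mem h (ambMono_neg_one_one_mem hk)
    rwa [ambMono_mul, zero_add, mul_one] at this
  · have h := reesSeqInv_mem (hf := hf) hi
    rw [reesSeqInv_natAdd] at h
    refine ⟨?_, h⟩
    have := (reesLoc hf s).mul_mem h (ambMono_one_one_mem hj)
    rwa [ambMono_mul, neg_add_cancel, mul_one] at this

/-- A mixed localization contains t and t⁻¹, so inverting f_i and inverting f_it amount to the same.
Only the set of covered indices matters for the larger set; the smaller one need not be mixed. -/
theorem reesLoc_le_of_isMixed {s s' : Finset (Fin (d + d))} (hs' : IsMixed s')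
    (h : ∀ i, IsCovered s i → IsCovered s' i) : reesLoc hf s ≤ reesLoc hf s' := by
  intro u hu
  refine reesLoc_subset (S := (reesLoc hf s').toSubring) (Subalgebra.algebraMap_mem _) ?_ hu
  intro i hi
  induction i using Fin.addCases with
  | left i =>
    rw [reesSeqInv_castAdd]
    exact (reesSeqInv_mem_of_isMixed hs' (h i (Or.inl hi))).1
  | right i =>
    rw [reesSeqInv_natAdd]
    exact (reesSeqInv_mem_of_isMixed hs' (h i (Or.inr hi))).2

theorem ambMono_mem_of_one_mem {S : Subring (ReesAmbient f)} (h : ambMono f 1 1 ∈ S)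
    (h' : ambMono f (-1) 1 ∈ S) (n : ℤ) : ambMono f n 1 ∈ S := by
  rcases Int.eq_nat_or_neg n with ⟨k, rfl | rfl⟩
  · have := pow_mem h k
    rwa [ambMono_pow, one_pow, mul_one] at this
  · have := pow_mem h' k
    rwa [ambMono_pow, one_pow, mul_neg_one] at this

theorem mem_of_forall_ambInv_mem {S : Subring (ReesAmbient f)}
    (hR : ∀ r, algebraMap R (ReesAmbient f) r ∈ S) (h1 : ∀ n, ambMono f n 1 ∈ S)
    (hi : ∀ i, ambMono f 0 (ambInv f i) ∈ S) (u : ReesAmbient f) : u ∈ S := by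
  refine ambient_induction u S.zero_mem (fun u v => S.add_mem) fun n => ?_
  obtain ⟨N, a, h⟩ := exists_eq_mul_prod_ambInv (ambCoeff f u n)
  have h2 : ∀ s : Finset (Fin d), ambMono f 0 (∏ i ∈ s, ambInv f i) ∈ S := by
    intro s
    induction s using Finset.induction_on with
    | empty => exact S.one_mem
    | insert i s his ih =>
      have := S.mul_mem (hi i) ih
      rwa [ambMono_mul, ← Finset.prod_insert his, add_zero] at this
  have := S.mul_mem (S.mul_mem (hR a) (pow_mem (h2 Finset.univ) N)) (h1 n)
  rw [algebraMap_ambient, ambMono_pow, ambMono_mul, ambMono_mul] at this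
  rw [h]
  simpa using this

theorem reesLoc_eq_top {s : Finset (Fin (d + d))} (hs : IsMixed s) (h : ∀ i, IsCovered s i) :
    reesLoc hf s = ⊤ := by
  refine eq_top_iff.2 fun u _ => ?_
  refine mem_of_forall_ambInv_mem (S := (reesLoc hf s).toSubring) (fun r => ?_)
    (ambMono_mem_of_one_mem ?_ ?_) (fun i => (reesSeqInv_mem_of_isMixed hs (h i)).1) u
  · rw [IsScalarTower.algebraMap_apply R (reesAlgebra I) (ReesAmbient f)]
    exact Subalgebra.algebraMap_mem _ _
  · exact ambMono_one_one_mem hs.1.choose_spec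
  · exact ambMono_neg_one_one_mem hs.2.choose_spec

/-- The inverses of the elements `f₁t, …, f_dt, t⁻¹`. -/
def extendedReesSeqInv (f : Fin d → R) : Fin (d + 1) → ReesAmbient f :=
  Fin.snoc (α := fun _ => ReesAmbient f) (fun i => ambMono f (-1) (ambInv f i)) (ambMono f 1 1)

variable (hf)

theorem extendedReesSeq_castSucc (i : Fin d) : extendedReesSeq f hf i.castSucc =
    reesInclusion I (reesT (f i) (hf i)) := by simp [extendedReesSeq]

theorem extendedReesSeq_last : extendedReesSeq f hf (Fin.last d) = reesTInv I := by
  simp [extendedReesSeq]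

theorem extendedReesSeqInv_castSucc (i : Fin d) : extendedReesSeqInv f i.castSucc =
    ambMono f (-1) (ambInv f i) := by simp [extendedReesSeqInv]

theorem extendedReesSeqInv_last : extendedReesSeqInv f (Fin.last d) = ambMono f 1 1 := by
  simp [extendedReesSeqInv]

theorem algebraMap_extendedReesSeq_castSucc (i : Fin d) :
    algebraMap _ (ReesAmbient f) (extendedReesSeq f hf i.castSucc) =
      ambMono f 1 (algebraMap R _ (f i)) := by
  rw [extendedReesSeq_castSucc, algebraMap_reesInclusion, algebraMap_reesT]

theorem algebraMap_extendedReesSeq_last :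
    algebraMap _ (ReesAmbient f) (extendedReesSeq f hf (Fin.last d)) = ambMono f (-1) 1 := by
  rw [extendedReesSeq_last, algebraMap_reesTInv]

theorem algebraMap_extendedReesSeq_mul_inv (i : Fin (d + 1)) :
    algebraMap _ (ReesAmbient f) (extendedReesSeq f hf i) * extendedReesSeqInv f i = 1 := by
  induction i using Fin.lastCases with
  | cast i =>
    rw [algebraMap_extendedReesSeq_castSucc, extendedReesSeqInv_castSucc]
    exact ambMono_mul_eq_one (algebraMap_mul_ambInv i)
  | last =>
    rw [algebraMap_extendedReesSeq_last, extendedReesSeqInv_last, ambMono_mul, one_mul,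
      neg_add_cancel, ambMono_one]

theorem isUnit_algebraMap_extendedReesSeq (i : Fin (d + 1)) :
    IsUnit (algebraMap _ (ReesAmbient f) (extendedReesSeq f hf i)) :=
  IsUnit.of_mul_eq_one _ (algebraMap_extendedReesSeq_mul_inv hf i)

/-- The localization of the extended Rees algebra at a product of some of the elements
`f₁t, …, f_dt, t⁻¹`, as a subring of `R_f[t, t⁻¹]`. -/
abbrev extendedReesLoc (s : Finset (Fin (d + 1))) :
    Subalgebra (extendedReesAlgebra I) (ReesAmbient f) :=
  locSub (extendedReesAlgebra I) (ReesAmbient f) (∏ i ∈ s, extendedReesSeq f hf i)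

variable {hf}

theorem extendedReesSeqInv_mem {s : Finset (Fin (d + 1))} {i : Fin (d + 1)} (hi : i ∈ s) :
    extendedReesSeqInv f i ∈ extendedReesLoc hf s :=
  mem_locSub_of_dvd (algebraMap_extendedReesSeq_mul_inv hf i) (Finset.dvd_prod_of_mem _ hi)

theorem extendedReesLoc_subset {S : Subring (ReesAmbient f)}
    (hA : ∀ a : extendedReesAlgebra I, algebraMap _ (ReesAmbient f) a ∈ S)
    {s : Finset (Fin (d + 1))} (hs : ∀ i ∈ s, extendedReesSeqInv f i ∈ S) {u : ReesAmbient f}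
    (hu : u ∈ extendedReesLoc hf s) : u ∈ S := by
  refine mem_of_mem_locSub hA (ξ := ∏ i ∈ s, extendedReesSeqInv f i) ?_ (prod_mem hs) hu
  rw [map_prod, ← Finset.prod_mul_distrib]
  exact Finset.prod_eq_one fun i _ => algebraMap_extendedReesSeq_mul_inv hf i

theorem ambMono_neg_one_one_mem_extendedReesLoc (s : Finset (Fin (d + 1))) :
    ambMono f (-1) 1 ∈ extendedReesLoc hf s := by
  rw [← algebraMap_reesTInv (I := I)]
  exact Subalgebra.algebraMap_mem _ _

theorem algebraMap_rees_mem_extendedReesLoc (s : Finset (Fin (d + 1))) (q : reesAlgebra I) :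
    algebraMap _ (ReesAmbient f) q ∈ extendedReesLoc hf s :=
  Subalgebra.algebraMap_mem (extendedReesLoc hf s) (reesInclusion I q)

theorem extendedReesLoc_univ : extendedReesLoc hf Finset.univ = ⊤ := by
  refine eq_top_iff.2 fun u _ => ?_
  have h1 : ambMono f 1 1 ∈ extendedReesLoc hf Finset.univ := by
    rw [← extendedReesSeqInv_last]
    exact extendedReesSeqInv_mem (Finset.mem_univ _)
  refine mem_of_forall_ambInv_mem (S := (extendedReesLoc hf Finset.univ).toSubring) (fun r => ?_)
    (ambMono_mem_of_one_mem h1 (ambMono_neg_one_one_mem_extendedReesLoc _)) (fun i => ?_) u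
  · rw [IsScalarTower.algebraMap_apply R (extendedReesAlgebra I) (ReesAmbient f)]
    exact Subalgebra.algebraMap_mem _ _
  · have := (extendedReesLoc hf Finset.univ).mul_mem
      (extendedReesSeqInv_mem (Finset.mem_univ i.castSucc)) h1
    rwa [extendedReesSeqInv_castSucc, ambMono_mul, neg_add_cancel, mul_one] at this

/-- All indices except the two belonging to `i`. -/
def dblErase (i : Fin d) : Finset (Fin (d + d)) :=
  (Finset.univ.erase (Fin.castAdd d i)).erase (Fin.natAdd d i)

theorem castAdd_mem_dblErase {i j : Fin d} : Fin.castAdd d j ∈ dblErase i ↔ j ≠ i := by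
  simp only [dblErase, Finset.mem_erase, Finset.mem_univ, and_true, ne_eq, Fin.ext_iff, Fin.val_natAdd,
    Fin.val_castAdd]
  omega

theorem natAdd_mem_dblErase {i j : Fin d} : Fin.natAdd d j ∈ dblErase i ↔ j ≠ i := by
  simp only [dblErase, Finset.mem_erase, Finset.mem_univ, and_true, ne_eq, Fin.ext_iff, Fin.val_natAdd,
    Fin.val_castAdd]
  omega

theorem isMixed_dblErase (hd : 2 ≤ d) (i : Fin d) : IsMixed (dblErase i) := by
  have : Nontrivial (Fin d) := Fin.nontrivial_iff_two_le.2 hd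
  obtain ⟨j, hj⟩ := exists_ne i
  exact ⟨⟨j, castAdd_mem_dblErase.2 hj⟩, ⟨j, natAdd_mem_dblErase.2 hj⟩⟩

theorem isCovered_dblErase {i j : Fin d} : IsCovered (dblErase i) j ↔ j ≠ i := by
  rw [IsCovered, castAdd_mem_dblErase, natAdd_mem_dblErase, or_self]

/-- Both rings invert t and exactly the f_j with j ≠ i. The hypothesis 2 ≤ d leaves at least one
such j, so that the index set on the Rees side is mixed. -/
theorem mem_extendedReesLoc_erase_castSucc (hd : 2 ≤ d) (i : Fin d) (u : ReesAmbient f) :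
    u ∈ extendedReesLoc hf (Finset.univ.erase i.castSucc) ↔ u ∈ reesLoc hf (dblErase i) := by
  have hm := isMixed_dblErase hd i
  have hlast : ambMono f 1 1 ∈ extendedReesLoc hf (Finset.univ.erase i.castSucc) := by
    rw [← extendedReesSeqInv_last]
    exact extendedReesSeqInv_mem
      (Finset.mem_erase.2 ⟨(Fin.castSucc_lt_last i).ne', Finset.mem_univ _⟩)
  have hc : ∀ j ≠ i, ambMono f (-1) (ambInv f j) ∈
      extendedReesLoc hf (Finset.univ.erase i.castSucc) := by
    intro j hj
    rw [← extendedReesSeqInv_castSucc]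
    exact extendedReesSeqInv_mem
      (Finset.mem_erase.2 ⟨fun h => hj (Fin.castSucc_injective d h), Finset.mem_univ _⟩)
  constructor
  · refine extendedReesLoc_subset (S := (reesLoc hf (dblErase i)).toSubring)
      (algebraMap_extendedRees_mem (ambMono_neg_one_one_mem hm.2.choose_spec)) fun j hj => ?_
    induction j using Fin.lastCases with
    | last =>
      rw [extendedReesSeqInv_last]
      exact ambMono_one_one_mem hm.1.choose_spec
    | cast j =>
      rw [extendedReesSeqInv_castSucc]
      refine (reesSeqInv_mem_of_isMixed hm (isCovered_dblErase.2 fun h => ?_)).2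
      exact Finset.ne_of_mem_erase hj (congrArg _ h)
  · refine reesLoc_subset
      (S := (extendedReesLoc hf (Finset.univ.erase i.castSucc)).toSubring)
      (algebraMap_rees_mem_extendedReesLoc _) fun j hj => ?_
    induction j using Fin.addCases with
    | left j =>
      have := (extendedReesLoc hf _).mul_mem (hc j (castAdd_mem_dblErase.1 hj)) hlast
      rw [ambMono_mul, neg_add_cancel, mul_one] at this
      rwa [reesSeqInv_castAdd]
    | right j =>
      rw [reesSeqInv_natAdd]
      exact hc j (natAdd_mem_dblErase.1 hj)

/-- Inverting one f_it in 𝓡 produces t⁻¹ = f_i / (f_it), so 𝓡 and 𝓡' have the same localization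
there. -/
theorem mem_extendedReesLoc_erase_last (hd : 0 < d) (u : ReesAmbient f) :
    u ∈ extendedReesLoc hf (Finset.univ.erase (Fin.last d)) ↔
      u ∈ reesLoc hf (Finset.univ.map (Fin.natAddEmb d)) := by
  have hmem : ∀ j : Fin d, Fin.natAdd d j ∈ Finset.univ.map (Fin.natAddEmb d) := fun j =>
    Finset.mem_map_of_mem _ (Finset.mem_univ j)
  constructor
  · refine extendedReesLoc_subset (S := (reesLoc hf _).toSubring)
      (algebraMap_extendedRees_mem (ambMono_neg_one_one_mem (hmem ⟨0, hd⟩))) fun j hj => ?_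
    induction j using Fin.lastCases with
    | last => simp at hj
    | cast j =>
      rw [extendedReesSeqInv_castSucc, ← reesSeqInv_natAdd]
      exact reesSeqInv_mem (hmem j)
  · refine reesLoc_subset (S := (extendedReesLoc hf (Finset.univ.erase (Fin.last d))).toSubring)
      (algebraMap_rees_mem_extendedReesLoc _) fun j hj => ?_
    obtain ⟨j, -, rfl⟩ := Finset.mem_map.1 hj
    change reesSeqInv f (Fin.natAdd d j) ∈ _
    rw [reesSeqInv_natAdd, ← extendedReesSeqInv_castSucc]
    exact extendedReesSeqInv_mem
      (Finset.mem_erase.2 ⟨(Fin.castSucc_lt_last j).ne, Finset.mem_univ _⟩)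

/-- The localization at f_1, …, f_d is R_f[t], since f_i ∈ I and t = (f_it) / f_i. This is the part
of K which is absent from K' and accounts for the restriction to negative degrees. -/
theorem mem_reesLoc_castAdd_iff (hd : 0 < d) {u : ReesAmbient f} :
    u ∈ reesLoc hf (Finset.univ.map (Fin.castAddEmb d)) ↔ ∀ n < 0, ambCoeff f u n = 0 := by
  have hx : ∏ i ∈ Finset.univ.map (Fin.castAddEmb d), reesSeq f hf i =
      algebraMap R (reesAlgebra I) (∏ i, f i) := by
    rw [Finset.prod_map, map_prod]
    exact Finset.prod_congr rfl fun i _ => reesSeq_castAdd hf i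
  have hinv : algebraMap R (Localization.Away (∏ i, f i)) (∏ i, f i) * ∏ i, ambInv f i = 1 := by
    rw [map_prod, ← Finset.prod_mul_distrib]
    exact Finset.prod_eq_one fun i _ => algebraMap_mul_ambInv i
  constructor
  · rintro ⟨N, a, h⟩ n hn
    rw [hx, algebraMap_rees_algebraMap, ambMono_pow, mul_zero] at h
    have h1 := congrArg (ambCoeff f · n) h
    simp only [ambCoeff_mono_mul, sub_zero] at h1
    rw [← algebraMap_reesInclusion, ambCoeff_algebraMap, reesInclusion_coeff_neg a hn, map_zero]
      at h1
    have h2 : (algebraMap R (Localization.Away (∏ i, f i)) (∏ i, f i)) ^ N *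
        (∏ i, ambInv f i) ^ N = 1 := by rw [← mul_pow, hinv, one_pow]
    linear_combination (∏ i, ambInv f i) ^ N * h1 - ambCoeff f u n * h2
  · intro h
    refine ambient_induction u (Subalgebra.zero_mem _) (fun u v => Subalgebra.add_mem _) fun n => ?_
    by_cases hn : n < 0
    · rw [h n hn, ambMono_zero]; exact Subalgebra.zero_mem _
    push Not at hn
    lift n to ℕ using hn
    obtain ⟨N, a, h⟩ := exists_eq_mul_prod_ambInv (ambCoeff f u n)
    have h1 : ambMono f n 1 ∈ reesLoc hf (Finset.univ.map (Fin.castAddEmb d)) := by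
      have := Subalgebra.pow_mem _ (ambMono_one_one_mem (hf := hf) (i := ⟨0, hd⟩)
        (Finset.mem_map_of_mem (Fin.castAddEmb d) (Finset.mem_univ _))) n
      rwa [ambMono_pow, one_pow, mul_one] at this
    have h2 : ambMono f 0 (∏ i, ambInv f i) ∈ reesLoc hf (Finset.univ.map (Fin.castAddEmb d)) := by
      refine mem_locSub_of_mul_eq_one ?_
      rw [hx, algebraMap_rees_algebraMap, ambMono_mul, hinv, add_zero, ambMono_one]
    have h3 := Subalgebra.mul_mem _ (Subalgebra.mul_mem _ (Subalgebra.algebraMap_mem _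
      (algebraMap R (reesAlgebra I) a)) (Subalgebra.pow_mem _ h2 N)) h1
    rw [algebraMap_rees_algebraMap, ambMono_pow, ambMono_mul, ambMono_mul] at h3
    rw [h]
    simpa using h3

end ReesLoc
end

noncomputable section

set_option linter.unusedSectionVars false

/-! ### Differentials of cochains with one component. -/

section SingleCochains

variable {A L : Type*} [CommRing A] [CommRing L] [Algebra A L] {ι : Type*} [LinearOrder ι]

theorem fullD_single_apply_insert {i : ι} {t : Finset ι} (hi : i ∉ t) (u : L) :
    fullD A (Pi.single (M := fun _ => L) t u) (insert i t) = (-1 : A) ^ cechPos i t • u := by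
  rw [fullD_apply, Finset.sum_eq_single i]
  · rw [Finset.erase_insert hi, Pi.single_eq_same, cechPos_insert_self]
  · intro j hj hji
    rw [Pi.single_eq_of_ne, smul_zero]
    intro h
    exact hi (h ▸ Finset.mem_erase.2 ⟨hji.symm, Finset.mem_insert_self i t⟩)
  · exact fun h => absurd (Finset.mem_insert_self i t) h

theorem fullD_single_apply_of_ne {t s : Finset ι} (h : ∀ i ∉ t, s ≠ insert i t) (u : L) :
    fullD A (Pi.single (M := fun _ => L) t u) s = 0 := by
  rw [fullD_apply]
  refine Finset.sum_eq_zero fun i hi => ?_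
  rw [Pi.single_eq_of_ne, smul_zero]
  intro h'
  refine h i (h' ▸ Finset.notMem_erase i s) ?_
  rw [← h', Finset.insert_erase hi]

end SingleCochains

/-! ### Normalizing the cocycles of degree d + 1 of the Rees algebra. -/

section ReesCohomology

variable {R : Type*} [CommRing R] {I : Ideal R} {d : ℕ} {f : Fin d → R} {hf : ∀ i, f i ∈ I}

/-- The set of indices on the left. -/
abbrev leftAll (d : ℕ) : Finset (Fin (d + d)) := Finset.univ.map (Fin.castAddEmb d)

/-- The set of indices on the right. -/
abbrev rightAll (d : ℕ) : Finset (Fin (d + d)) := Finset.univ.map (Fin.natAddEmb d)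

theorem castAdd_mem_leftAll (i : Fin d) : Fin.castAdd d i ∈ leftAll d :=
  Finset.mem_map_of_mem (Fin.castAddEmb d) (Finset.mem_univ i)

theorem natAdd_mem_rightAll (i : Fin d) : Fin.natAdd d i ∈ rightAll d :=
  Finset.mem_map_of_mem (Fin.natAddEmb d) (Finset.mem_univ i)

theorem natAdd_notMem_leftAll (i : Fin d) : Fin.natAdd d i ∉ leftAll d := by
  intro h
  obtain ⟨j, -, h⟩ := Finset.mem_map.1 h
  have := congrArg Fin.val h
  simp only [Fin.castAddEmb_apply, Fin.val_castAdd, Fin.val_natAdd] at this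
  omega

theorem castAdd_notMem_rightAll (i : Fin d) : Fin.castAdd d i ∉ rightAll d := by
  intro h
  obtain ⟨j, -, h⟩ := Finset.mem_map.1 h
  have := congrArg Fin.val h
  simp only [Fin.natAddEmb_apply, Fin.val_castAdd, Fin.val_natAdd] at this
  omega

theorem card_leftAll : (leftAll d).card = d := by simp

theorem card_rightAll : (rightAll d).card = d := by simp

theorem reesTopIndex_eq (j : Fin d) : reesTopIndex j = insert (Fin.natAdd d j) (leftAll d) := rfl

/-- The part of `s` on the left. -/
def leftPart (s : Finset (Fin (d + d))) : Finset (Fin d) :=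
  Finset.univ.filter (Fin.castAdd d · ∈ s)

theorem mem_leftPart {s : Finset (Fin (d + d))} {i : Fin d} :
    i ∈ leftPart s ↔ Fin.castAdd d i ∈ s := by simp [leftPart]

theorem leftPart_mono {s t : Finset (Fin (d + d))} (h : s ⊆ t) : leftPart s ⊆ leftPart t :=
  fun _ hi => mem_leftPart.2 (h (mem_leftPart.1 hi))

theorem leftPart_erase_natAdd (s : Finset (Fin (d + d))) (i : Fin d) :
    leftPart (s.erase (Fin.natAdd d i)) = leftPart s := by
  ext j
  rw [mem_leftPart, mem_leftPart, Finset.mem_erase, and_iff_right]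
  intro h
  exact natAdd_notMem_leftAll i (h ▸ castAdd_mem_leftAll j)

theorem leftPart_insert_natAdd (s : Finset (Fin (d + d))) (i : Fin d) :
    leftPart (insert (Fin.natAdd d i) s) = leftPart s := by
  ext j
  rw [mem_leftPart, mem_leftPart, Finset.mem_insert, or_iff_right]
  intro h
  exact natAdd_notMem_leftAll i (h ▸ castAdd_mem_leftAll j)

theorem card_leftPart_erase_castAdd_lt {s : Finset (Fin (d + d))} {i : Fin d}
    (hi : Fin.castAdd d i ∈ s) : (leftPart (s.erase (Fin.castAdd d i))).card < (leftPart s).card := by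
  refine Finset.card_lt_card (Finset.ssubset_iff_subset_ne.2
    ⟨leftPart_mono (Finset.erase_subset _ _), fun h => ?_⟩)
  have := mem_leftPart.2 hi
  rw [← h, mem_leftPart] at this
  exact Finset.notMem_erase _ _ this

theorem exists_natAdd_mem {s : Finset (Fin (d + d))} (h : (leftPart s).card < s.card) :
    ∃ i, Fin.natAdd d i ∈ s := by
  by_contra! hn
  refine h.not_ge ?_
  have : s ⊆ (leftPart s).map (Fin.castAddEmb d) := by
    intro i hi
    induction i using Fin.addCases with
    | left i => exact Finset.mem_map_of_mem (Fin.castAddEmb d) (mem_leftPart.2 hi)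
    | right i => exact absurd hi (hn i)
  simpa using Finset.card_le_card this

theorem eq_reesTopIndex {s : Finset (Fin (d + d))} (h : d ≤ (leftPart s).card)
    (hs : s.card = d + 1) : ∃ j, s = reesTopIndex j := by
  have hl : leftPart s = Finset.univ :=
    (Finset.card_eq_iff_eq_univ _).1 (le_antisymm (Finset.card_le_univ _) (by simpa using h))
  have hsub : leftAll d ⊆ s := by
    intro i hi
    obtain ⟨i, -, rfl⟩ := Finset.mem_map.1 hi
    exact mem_leftPart.1 (hl ▸ Finset.mem_univ i)
  obtain ⟨j, hj⟩ := exists_natAdd_mem (s := s) (by rw [hl, Finset.card_fin, hs]; omega)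
  refine ⟨j, (Finset.eq_of_subset_of_card_le ?_ ?_).symm⟩
  · exact Finset.insert_subset hj hsub
  · rw [hs, card_reesTopIndex]

theorem isMixed_reesTopIndex (j : Fin d) : IsMixed (reesTopIndex j) :=
  ⟨⟨j, castAdd_mem_reesTopIndex j j⟩, ⟨j, (natAdd_mem_reesTopIndex j j).2 rfl⟩⟩

theorem isCovered_reesTopIndex (i j : Fin d) : IsCovered (reesTopIndex j) i :=
  Or.inl (castAdd_mem_reesTopIndex i j)

variable (f) in
/-- The family with value `u` at the indices `1, …, d, j`. -/
def topCochain (I : Ideal R) :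
    ReesAmbient f →ₗ[reesAlgebra I] (Finset (Fin (d + d)) → ReesAmbient f) :=
  ∑ j : Fin d, LinearMap.single (reesAlgebra I) (fun _ => ReesAmbient f) (reesTopIndex j)

theorem topCochain_apply_top (u : ReesAmbient f) (j : Fin d) :
    topCochain f I u (reesTopIndex j) = u := by
  rw [topCochain, LinearMap.sum_apply, Finset.sum_apply, Finset.sum_eq_single j]
  · exact Pi.single_eq_same _ _
  · intro k _ hk
    exact Pi.single_eq_of_ne (fun h => hk (reesTopIndex_injective h).symm) _
  · simp

theorem topCochain_apply_of_ne (u : ReesAmbient f) {s : Finset (Fin (d + d))}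
    (hs : ∀ j, s ≠ reesTopIndex j) : topCochain f I u s = 0 := by
  rw [topCochain, LinearMap.sum_apply, Finset.sum_apply]
  exact Finset.sum_eq_zero fun k _ => Pi.single_eq_of_ne (hs k) _

theorem topCochain_apply_of_card_ne (u : ReesAmbient f) {s : Finset (Fin (d + d))}
    (hs : s.card ≠ d + 1) : topCochain f I u s = 0 :=
  topCochain_apply_of_ne u fun j hj => hs (hj ▸ card_reesTopIndex j)

theorem topCochain_mem (u : ReesAmbient f) (s : Finset (Fin (d + d))) :
    topCochain f I u s ∈ reesLoc hf s := by
  by_cases h : ∃ j, s = reesTopIndex j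
  · obtain ⟨j, rfl⟩ := h
    rw [reesLoc_eq_top (isMixed_reesTopIndex j) fun i => isCovered_reesTopIndex i j]
    trivial
  · push Not at h
    rw [topCochain_apply_of_ne u h]; exact Subalgebra.zero_mem _

theorem cechPos_natAdd_leftAll (j : Fin d) : cechPos (Fin.natAdd d j) (leftAll d) = d := by
  rw [cechPos, Finset.filter_true_of_mem, card_leftAll]
  intro i hi
  obtain ⟨i, -, rfl⟩ := Finset.mem_map.1 hi
  rw [Fin.lt_def, Fin.castAddEmb_apply, Fin.val_castAdd, Fin.val_natAdd]
  omega

/-- The sets obtained from `leftAll` by adding one index are the sets 1, …, d, j, all with the sign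
(-1)^d because the right indices come last. So the family with equal values u is a coboundary in the
contractible complex, hence a cocycle, although u need not lie in the localization at f. -/
theorem fullD_single_leftAll (u : ReesAmbient f) :
    fullD (reesAlgebra I) (Pi.single (M := fun _ => ReesAmbient f) (leftAll d) u) =
      topCochain f I ((-1 : reesAlgebra I) ^ d • u) := by
  funext s
  by_cases h : ∃ j, s = reesTopIndex j
  · obtain ⟨j, rfl⟩ := h
    rw [topCochain_apply_top, reesTopIndex_eq, fullD_single_apply_insert (natAdd_notMem_leftAll j),
      cechPos_natAdd_leftAll]
  · push Not at h
    rw [topCochain_apply_of_ne _ h, fullD_single_apply_of_ne]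
    intro i hi
    induction i using Fin.addCases with
    | left i => exact absurd (castAdd_mem_leftAll i) hi
    | right i => exact h i

theorem fullD_topCochain (u : ReesAmbient f) : fullD (reesAlgebra I) (topCochain f I u) = 0 := by
  have := fullD_single_leftAll (I := I) ((-1 : reesAlgebra I) ^ d • u)
  rw [smul_smul, neg_one_pow_mul_self, one_smul] at this
  rw [← this, fullD_fullD]

theorem fullD_mem_reesLoc {c : Finset (Fin (d + d)) → ReesAmbient f}
    (hc : ∀ s, c s ∈ reesLoc hf s) (s : Finset (Fin (d + d))) :
    fullD (reesAlgebra I) c s ∈ reesLoc hf s := by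
  rw [fullD_apply]
  exact Subalgebra.sum_mem _ fun i _ =>
    Subalgebra.smul_mem _ (reesLoc_mono (Finset.erase_subset i s) (hc _)) _

theorem single_mem_reesLoc {t : Finset (Fin (d + d))} {u : ReesAmbient f} (hu : u ∈ reesLoc hf t)
    (s : Finset (Fin (d + d))) : Pi.single (M := fun _ => ReesAmbient f) t u s ∈ reesLoc hf s := by
  by_cases h : s = t
  · subst h; rwa [Pi.single_eq_same]
  · rw [Pi.single_eq_of_ne h]; exact Subalgebra.zero_mem _

theorem single_apply_of_card_ne {k : ℕ} {t : Finset (Fin (d + d))} (ht : t.card = k)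
    (u : ReesAmbient f) {s : Finset (Fin (d + d))} (hs : s.card ≠ k) :
    Pi.single (M := fun _ => ReesAmbient f) t u s = 0 :=
  Pi.single_eq_of_ne (fun h => hs (by rw [h, ht])) _

/-- The complex is filtered by the number p of left indices. For 0 < p < d, each row with fixed left
part S is contracted by the homotopy at a right index whose subscript is in S. Adding that index
covers no new subscript, so the homotopy preserves the localizations. -/
theorem exists_fullD_eq_of_card_leftPart_lt {c : Finset (Fin (d + d)) → ReesAmbient f}
    (hc : ∀ s, c s ∈ reesLoc hf s) (hk : ∀ s, s.card ≠ d + 1 → c s = 0)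
    (hD : fullD (reesAlgebra I) c = 0) {p : ℕ} (hp : 1 ≤ p) (hpd : p ≤ d) :
    ∃ b : Finset (Fin (d + d)) → ReesAmbient f, (∀ s, b s ∈ reesLoc hf s) ∧
      (∀ s, s.card ≠ d → b s = 0) ∧ (∀ s, leftPart s = ∅ → b s = 0) ∧
      ∀ s, (leftPart s).card < p → c s = fullD (reesAlgebra I) b s := by
  induction p, hp using Nat.le_induction with
  | base =>
    -- A set of d + 1 indices cannot lie entirely on the right, so nothing has to be corrected when
    -- there is no left index.
    refine ⟨0, fun s => Subalgebra.zero_mem _, fun _ _ => rfl, fun _ _ => rfl, fun s hs => ?_⟩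
    rw [map_zero]
    refine hk s fun h => ?_
    have hsub : s ⊆ rightAll d := by
      intro i hi
      induction i using Fin.addCases with
      | left i =>
        have := Finset.card_pos.2 ⟨i, mem_leftPart.2 hi⟩
        omega
      | right i => exact natAdd_mem_rightAll i
    have := Finset.card_le_card hsub
    rw [card_rightAll] at this
    omega
  | succ p hp ih =>
    obtain ⟨b, hb, hbd, hb0, hbc⟩ := ih (by omega)
    set c' := c - fullD (reesAlgebra I) b with hc'
    have hc'm : ∀ s, c' s ∈ reesLoc hf s := fun s =>
      Subalgebra.sub_mem _ (hc s) (fullD_mem_reesLoc hb s)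
    have hc'k : ∀ s, s.card ≠ d + 1 → c' s = 0 := fun s hs => by
      rw [hc', Pi.sub_apply, hk s hs, fullD_apply_eq_zero_of_card hbd hs, sub_zero]
    have hc'D : fullD (reesAlgebra I) c' = 0 := by rw [hc', map_sub, hD, fullD_fullD, sub_zero]
    have hc'p : ∀ s, (leftPart s).card < p → c' s = 0 := fun s hs => by
      rw [hc', Pi.sub_apply, hbc s hs, sub_self]
    -- The subscript used for the homotopy may depend only on the left part, so that it stays fixed
    -- when right indices are removed.
    have hm : ∃ m : Finset (Fin d) → Fin d, ∀ S, S.Nonempty → m S ∈ S := by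
      have : ∀ S : Finset (Fin d), ∃ i, S.Nonempty → i ∈ S := fun S => by
        rcases S.eq_empty_or_nonempty with rfl | ⟨i, hi⟩
        · exact ⟨⟨0, by omega⟩, fun h => absurd h (by simp)⟩
        · exact ⟨i, fun _ => hi⟩
      exact ⟨_, fun S => (this S).choose_spec⟩
    obtain ⟨m, hm⟩ := hm
    let b' : Finset (Fin (d + d)) → ReesAmbient f := fun s =>
      if (leftPart s).card = p then
        fullH (reesAlgebra I) (Fin.natAdd d (m (leftPart s))) c' s else 0
    have hb'k : ∀ s, s.card ≠ d → b' s = 0 := by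
      intro s hs
      simp only [b', fullH]
      split_ifs with h1 h2
      · rfl
      · rw [hc'k, smul_zero]
        rw [Finset.card_insert_of_notMem h2]
        omega
      · rfl
    have hb'm : ∀ s, b' s ∈ reesLoc hf s := by
      intro s
      by_cases hs : s.card = d
      · simp only [b', fullH]
        split_ifs with h1 h2
        · exact Subalgebra.zero_mem _
        -- Here s has d elements of which p < d are on the left, so it also has a right index; being
        -- mixed, its localization contains the value of c' at the larger set.
        · have hne : (leftPart s).Nonempty := Finset.card_pos.1 (by omega)
          have hmem := mem_leftPart.1 (hm _ hne)
          refine Subalgebra.smul_mem _ (reesLoc_le_of_isMixed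
            ⟨⟨_, hmem⟩, exists_natAdd_mem (by omega)⟩ (fun i hi => ?_) (hc'm _)) _
          rcases hi with hi | hi
          · refine Or.inl ?_
            rwa [← mem_leftPart, leftPart_insert_natAdd, mem_leftPart] at hi
          · rcases Finset.mem_insert.1 hi with hi | hi
            · rw [Fin.natAdd_injective _ _ hi]
              exact Or.inl hmem
            · exact Or.inr hi
        · exact Subalgebra.zero_mem _
      · rw [hb'k s hs]; exact Subalgebra.zero_mem _
    have hb'0 : ∀ s, (leftPart s).card ≠ p → b' s = 0 := fun s hs => if_neg hs
    refine ⟨b + b', fun s => Subalgebra.add_mem _ (hb s) (hb'm s), fun s hs => ?_, fun s hs => ?_,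
      fun s hs => ?_⟩
    · rw [Pi.add_apply, hbd s hs, hb'k s hs, add_zero]
    · rw [Pi.add_apply, hb0 s hs, hb'0, add_zero]
      rw [hs, Finset.card_empty]; omega
    · rw [map_add, Pi.add_apply, ← sub_eq_iff_eq_add']
      change c' s = _
      rcases Nat.lt_or_eq_of_le (Nat.lt_succ_iff.1 hs) with hlt | heq
      · rw [hc'p s hlt, fullD_apply, Finset.sum_eq_zero]
        intro i _
        rw [hb'0, smul_zero]
        have := Finset.card_le_card (leftPart_mono (Finset.erase_subset i s))
        omega
      · have h1 := fullD_fullH_add (A := reesAlgebra I) (Fin.natAdd d (m (leftPart s))) c' s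
        have h2 : fullH (reesAlgebra I) (Fin.natAdd d (m (leftPart s)))
            (fullD (reesAlgebra I) c') s = 0 := by
          rw [hc'D, fullH]
          split_ifs
          · rfl
          · rw [Pi.zero_apply, smul_zero]
        rw [h2, add_zero] at h1
        rw [← h1, fullD_apply, fullD_apply]
        -- Removing a left index lands in a lower step of the filtration, where c' is already zero;
        -- removing a right index keeps the left part. So `b'` and the homotopy have the same
        -- differential at s.
        refine Finset.sum_congr rfl fun i hi => ?_
        congr 1
        induction i using Fin.addCases with
        | left i =>
          have hlt := card_leftPart_erase_castAdd_lt hi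
          rw [hb'0 _ (by omega), fullH]
          split_ifs
          · rfl
          · rw [hc'p, smul_zero]
            rw [leftPart_insert_natAdd]; omega
        | right i =>
          simp only [b']
          rw [leftPart_erase_natAdd, if_pos heq]

/-- Every cocycle of degree `d + 1` is cohomologous to a cocycle given by a single element. -/
theorem exists_eq_fullD_add_topCochain (hd : 0 < d) {c : Finset (Fin (d + d)) → ReesAmbient f}
    (hc : ∀ s, c s ∈ reesLoc hf s) (hk : ∀ s, s.card ≠ d + 1 → c s = 0)
    (hD : fullD (reesAlgebra I) c = 0) :
    ∃ b : Finset (Fin (d + d)) → ReesAmbient f, (∀ s, b s ∈ reesLoc hf s) ∧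
      (∀ s, s.card ≠ d → b s = 0) ∧ (∀ s, leftPart s = ∅ → b s = 0) ∧
      ∃ g, c = fullD (reesAlgebra I) b + topCochain f I g := by
  obtain ⟨b, hb, hbd, hb0, hbc⟩ := exists_fullD_eq_of_card_leftPart_lt hc hk hD hd le_rfl
  refine ⟨b, hb, hbd, hb0, (c - fullD (reesAlgebra I) b) (reesTopIndex ⟨0, hd⟩), ?_⟩
  set g := (c - fullD (reesAlgebra I) b) (reesTopIndex ⟨0, hd⟩) with hg
  rw [← sub_eq_zero, ← sub_sub]
  set e := c - fullD (reesAlgebra I) b - topCochain f I g with he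
  have heD : fullD (reesAlgebra I) e = 0 := by
    rw [he, map_sub, map_sub, hD, fullD_fullD, fullD_topCochain, sub_zero, sub_zero]
  have hlt : ∀ s, (leftPart s).card < d → e s = 0 := by
    intro s hs
    rw [he, Pi.sub_apply, Pi.sub_apply, hbc s hs, sub_self, zero_sub, neg_eq_zero]
    refine topCochain_apply_of_ne _ fun j hj => ?_
    have : leftPart s = Finset.univ := by
      ext i
      simp only [mem_leftPart, hj, castAdd_mem_reesTopIndex, Finset.mem_univ]
    rw [this, Finset.card_fin] at hs
    exact lt_irrefl _ hs
  have h0 : e (reesTopIndex ⟨0, hd⟩) = 0 := by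
    rw [he, Pi.sub_apply, topCochain_apply_top, hg, sub_self]
  funext s
  by_cases hs : s.card = d + 1
  · by_cases hl : (leftPart s).card < d
    · exact hlt s hl
    · obtain ⟨k, rfl⟩ := eq_reesTopIndex (not_lt.1 hl) hs
      by_cases hk0 : k = ⟨0, hd⟩
      · rw [hk0]; exact h0
      have hnot : Fin.natAdd d ⟨0, hd⟩ ∉ reesTopIndex k := fun h =>
        hk0 ((natAdd_mem_reesTopIndex _ _).1 h).symm
      -- After normalization only the sets 1, …, d, j carry values. The cocycle condition on two
      -- right indices forces these values to agree, so subtracting the value at the first one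
      -- removes all of them.
      have h1 := congrFun heD (insert (Fin.natAdd d ⟨0, hd⟩) (reesTopIndex k))
      rw [fullD_apply, Finset.sum_eq_single (Fin.natAdd d ⟨0, hd⟩), Finset.erase_insert hnot] at h1
      · have h2 := congrArg ((-1 : reesAlgebra I) ^ cechPos (Fin.natAdd d ⟨0, hd⟩)
          (insert (Fin.natAdd d ⟨0, hd⟩) (reesTopIndex k)) • ·) h1
        simp only [smul_smul, neg_one_pow_mul_self, one_smul, Pi.zero_apply, smul_zero] at h2
        exact h2
      · intro i hi hi0
        rcases Finset.mem_insert.1 hi with h | h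
        · exact absurd h hi0
        rcases Finset.mem_insert.1 h with h | h
        · subst h
          have : (insert (Fin.natAdd d ⟨0, hd⟩) (reesTopIndex k)).erase (Fin.natAdd d k) =
              reesTopIndex ⟨0, hd⟩ := by
            rw [reesTopIndex_eq, Finset.insert_comm, Finset.erase_insert, reesTopIndex_eq]
            rw [← reesTopIndex_eq]
            exact fun h => hk0 ((natAdd_mem_reesTopIndex _ _).1 h)
          rw [this, h0, smul_zero]
        · obtain ⟨i, -, rfl⟩ := Finset.mem_map.1 h
          rw [hlt, smul_zero]
          exact (card_leftPart_erase_castAdd_lt hi).trans_le (card_finset_fin_le _)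
      · exact fun h => absurd (Finset.mem_insert_self _ _) h
  · rw [he, Pi.sub_apply, Pi.sub_apply, hk s hs, fullD_apply_eq_zero_of_card hbd hs,
      topCochain_apply_of_card_ne _ hs, sub_zero, sub_zero]
    rfl

end ReesCohomology
end

noncomputable section

set_option linter.unusedSectionVars false

/-! ### The kernel of the map from R_f[t, t⁻¹] to the cohomology of the Rees algebra. -/

section ReesKernel

variable {R : Type*} [CommRing R] {I : Ideal R} {d : ℕ} {f : Fin d → R} (hf : ∀ i, f i ∈ I)

/-- The index sets of the localizations whose sum is the kernel of `R_f[t, t⁻¹] → H^{d+1}_𝔐(𝓡)`. -/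
def reesKerIndex : Fin d ⊕ Bool → Finset (Fin (d + d)) :=
  Sum.elim dblErase fun b => if b then leftAll d else rightAll d

/-- The kernel of `R_f[t, t⁻¹] → H^{d+1}_𝔐(𝓡)`. -/
def reesKer : Submodule (reesAlgebra I) (ReesAmbient f) :=
  ⨆ w : Fin d ⊕ Bool, Subalgebra.toSubmodule (reesLoc hf (reesKerIndex w))

/-- The sum of the localizations of `𝓡` at the products of `d - 1` of the `fᵢ` and `fᵢt`. -/
def reesKerMixed : Submodule (reesAlgebra I) (ReesAmbient f) :=
  ⨆ i : Fin d, Subalgebra.toSubmodule (reesLoc hf (dblErase i))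

/-- The set of indices `1, …, k` on the left and `k, …, d` on the right, with `k` starting from `0`. -/
def diagIndex (d k : ℕ) : Finset (Fin (d + d)) :=
  Finset.univ.filter fun x => x.1 ≤ k ∨ d + k ≤ x.1

/-- The set of indices less than `k` on the left and at least `k` on the right. -/
def diagIndexPred (d k : ℕ) : Finset (Fin (d + d)) :=
  Finset.univ.filter fun x => x.1 < k ∨ d + k ≤ x.1

theorem mem_diagIndex {k : ℕ} {x : Fin (d + d)} : x ∈ diagIndex d k ↔ x.1 ≤ k ∨ d + k ≤ x.1 := by
  simp [diagIndex]

theorem mem_diagIndexPred {k : ℕ} {x : Fin (d + d)} :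
    x ∈ diagIndexPred d k ↔ x.1 < k ∨ d + k ≤ x.1 := by
  simp [diagIndexPred]

theorem diagIndex_erase_castAdd (k : Fin d) :
    (diagIndex d k).erase (Fin.castAdd d k) = diagIndexPred d k := by
  ext x
  simp only [Finset.mem_erase, mem_diagIndex, mem_diagIndexPred, ne_eq, Fin.ext_iff, Fin.val_castAdd]
  omega

theorem diagIndex_erase_natAdd (k : Fin d) :
    (diagIndex d k).erase (Fin.natAdd d k) = diagIndexPred d (k + 1) := by
  ext x
  simp only [Finset.mem_erase, mem_diagIndex, mem_diagIndexPred, ne_eq, Fin.ext_iff, Fin.val_natAdd]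
  omega

theorem diagIndexPred_zero : diagIndexPred d 0 = rightAll d := by
  ext x
  induction x using Fin.addCases with
  | left i =>
    simp only [mem_diagIndexPred, castAdd_notMem_rightAll, Fin.val_castAdd, iff_false]
    omega
  | right i =>
    simp only [mem_diagIndexPred, natAdd_mem_rightAll, Fin.val_natAdd, iff_true]
    omega

theorem diagIndexPred_self : diagIndexPred d d = leftAll d := by
  ext x
  induction x using Fin.addCases with
  | left i =>
    simp only [mem_diagIndexPred, castAdd_mem_leftAll, Fin.val_castAdd, iff_true]
    omega
  | right i =>
    simp only [mem_diagIndexPred, natAdd_notMem_leftAll, Fin.val_natAdd, iff_false]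
    omega

/-- The left and right copies of k are consecutive in this set, so their removals have opposite
signs. This makes the alternating sum telescope. -/
theorem cechPos_natAdd_diagIndex (k : Fin d) : cechPos (Fin.natAdd d k) (diagIndex d k) =
    cechPos (Fin.castAdd d k) (diagIndex d k) + 1 := by
  have : (diagIndex d k).filter (· < Fin.natAdd d k) =
      insert (Fin.castAdd d k) ((diagIndex d k).filter (· < Fin.castAdd d k)) := by
    ext x
    simp only [Finset.mem_filter, Finset.mem_insert, mem_diagIndex, Fin.lt_def, Fin.ext_iff,
      Fin.val_natAdd, Fin.val_castAdd]
    omega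
  rw [cechPos, this, Finset.card_insert_of_notMem (by simp)]

/-- The sign of the `k`-th term in `diagSum`. -/
def diagSign (A : Type*) [CommRing A] (k : Fin d) : A :=
  (-1) ^ cechPos (Fin.castAdd d k) (diagIndex d k)

/-- A functional on cochains of degree `d + 1` which vanishes on coboundaries modulo `reesKer`. -/
def diagSum (I : Ideal R) (c : Finset (Fin (d + d)) → ReesAmbient f) : ReesAmbient f :=
  ∑ k : Fin d, diagSign (reesAlgebra I) k • c (diagIndex d k)

variable {hf}

theorem mem_reesKerMixed_of_mem_reesLoc {s : Finset (Fin (d + d))} {i : Fin d}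
    (hd : 2 ≤ d) (hs : ¬ IsCovered s i) {u : ReesAmbient f} (hu : u ∈ reesLoc hf s) :
    u ∈ reesKerMixed hf := by
  refine Submodule.mem_iSup_of_mem i (reesLoc_le_of_isMixed (isMixed_dblErase hd i) ?_ hu)
  intro j hj
  exact isCovered_dblErase.2 fun h => hs (h ▸ hj)

/-- The sets in the sum form a staircase from `rightAll` to `leftAll`. Removing either copy of k
gives two consecutive steps, and these terms telescope. Removing any other index leaves its
subscript uncovered, so that term lies in a mixed localization omitting the subscript. -/
theorem diagSum_fullD_mem (hd : 2 ≤ d) {b : Finset (Fin (d + d)) → ReesAmbient f}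
    (hb : ∀ s, b s ∈ reesLoc hf s) :
    diagSum I (fullD (reesAlgebra I) b) - (b (rightAll d) - b (leftAll d)) ∈ reesKerMixed hf := by
  have hterm : ∀ k : Fin d, diagSign (reesAlgebra I) k • fullD (reesAlgebra I) b (diagIndex d k) -
      (b (diagIndexPred d k) - b (diagIndexPred d (k + 1))) ∈ reesKerMixed hf := by
    intro k
    have hck : Fin.castAdd d k ∈ diagIndex d k := mem_diagIndex.2 (by simp)
    have hnk : Fin.natAdd d k ∈ (diagIndex d k).erase (Fin.castAdd d k) :=
      Finset.mem_erase.2 ⟨fun h => natAdd_notMem_leftAll k (h ▸ castAdd_mem_leftAll k),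
        mem_diagIndex.2 (Or.inr (Fin.val_natAdd d k).ge)⟩
    rw [fullD_apply, ← Finset.add_sum_erase _ _ hck, ← Finset.add_sum_erase _ _ hnk,
      diagIndex_erase_castAdd, diagIndex_erase_natAdd, cechPos_natAdd_diagIndex, ← add_assoc,
      smul_add, smul_add, smul_smul, smul_smul, diagSign, pow_succ, ← mul_assoc,
      neg_one_pow_mul_self, one_smul, one_mul, neg_smul, one_smul, ← sub_eq_add_neg,
      add_sub_cancel_left]
    refine Submodule.smul_mem _ _ (sum_mem fun i hi => Submodule.smul_mem _ _ ?_)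
    simp only [← diagIndex_erase_castAdd, Finset.mem_erase, mem_diagIndex] at hi
    induction i using Fin.addCases with
    | left i =>
      refine mem_reesKerMixed_of_mem_reesLoc hd (i := i) ?_ (hb _)
      simp only [ne_eq, Fin.ext_iff, Fin.val_castAdd, Fin.val_natAdd] at hi
      simp only [IsCovered, Finset.mem_erase, mem_diagIndex, ne_eq, Fin.ext_iff, Fin.val_castAdd,
        Fin.val_natAdd, not_true_eq_false, false_and, false_or]
      omega
    | right i =>
      refine mem_reesKerMixed_of_mem_reesLoc hd (i := i) ?_ (hb _)
      simp only [ne_eq, Fin.ext_iff, Fin.val_castAdd, Fin.val_natAdd] at hi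
      simp only [IsCovered, Finset.mem_erase, mem_diagIndex, ne_eq, Fin.ext_iff, Fin.val_castAdd,
        Fin.val_natAdd, not_true_eq_false, false_and, or_false]
      omega
  have htel : b (rightAll d) - b (leftAll d) =
      ∑ k : Fin d, (b (diagIndexPred d k) - b (diagIndexPred d (k + 1))) := by
    rw [Fin.sum_univ_eq_sum_range (fun k => b (diagIndexPred d k) - b (diagIndexPred d (k + 1))) d,
      Finset.sum_range_sub', diagIndexPred_zero, diagIndexPred_self]
  rw [htel, diagSum, ← Finset.sum_sub_distrib]
  exact sum_mem fun k _ => hterm k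

/-- Only the last staircase set contains all left indices, so the functional reads off u up to sign.
-/
theorem diagSum_topCochain (hd : 0 < d) (u : ReesAmbient f) :
    diagSum I (topCochain f I u) = diagSign (reesAlgebra I) (⟨d - 1, by omega⟩ : Fin d) • u := by
  rw [diagSum, Finset.sum_eq_single (⟨d - 1, by omega⟩ : Fin d)]
  · have : diagIndex d (d - 1) = reesTopIndex ⟨d - 1, by omega⟩ := by
      ext x
      rw [reesTopIndex_eq, Finset.mem_insert]
      induction x using Fin.addCases with
      | left i =>
        simp only [mem_diagIndex, castAdd_mem_leftAll, Fin.val_castAdd, or_true, iff_true]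
        omega
      | right i =>
        simp only [mem_diagIndex, natAdd_notMem_leftAll, Fin.val_natAdd, or_false, Fin.ext_iff]
        omega
    rw [this, topCochain_apply_top]
  · intro k _ hk
    rw [topCochain_apply_of_ne, smul_zero]
    intro j hj
    have h1 : Fin.castAdd d ⟨d - 1, by omega⟩ ∈ diagIndex d k := hj ▸ castAdd_mem_reesTopIndex _ j
    rw [mem_diagIndex, Fin.val_castAdd] at h1
    refine hk (Fin.ext ?_)
    simp only at h1 ⊢
    omega
  · exact fun h => absurd (Finset.mem_univ _) h

theorem diagSum_add (c c' : Finset (Fin (d + d)) → ReesAmbient f) :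
    diagSum I (c + c') = diagSum I c + diagSum I c' := by
  simp only [diagSum, Pi.add_apply, smul_add, Finset.sum_add_distrib]

theorem diagSign_mul_self (A : Type*) [CommRing A] (k : Fin d) :
    diagSign A k * diagSign A k = 1 := neg_one_pow_mul_self _

theorem reesKerMixed_le : reesKerMixed hf ≤ reesKer hf :=
  iSup_le fun i => le_iSup (fun w => Subalgebra.toSubmodule (reesLoc hf (reesKerIndex w))) (Sum.inl i)

theorem mem_reesKer_of_mem_leftAll {u : ReesAmbient f} (hu : u ∈ reesLoc hf (leftAll d)) :
    u ∈ reesKer hf :=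
  Submodule.mem_iSup_of_mem (p := fun w => Subalgebra.toSubmodule (reesLoc hf (reesKerIndex w)))
    (Sum.inr true) hu

theorem mem_reesKer_of_mem_rightAll {u : ReesAmbient f} (hu : u ∈ reesLoc hf (rightAll d)) :
    u ∈ reesKer hf :=
  Submodule.mem_iSup_of_mem (p := fun w => Subalgebra.toSubmodule (reesLoc hf (reesKerIndex w)))
    (Sum.inr false) hu

/-- The top local cohomology of the Rees algebra as a quotient of `R_f[t, t⁻¹]`. -/
theorem exists_reesLocalCohomology_presentation (hd : 2 ≤ d) (hnzd : ∀ i, f i ∈ nonZeroDivisors R) :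
    ∃ π : ReesAmbient f →ₗ[reesAlgebra I] ReesLocalCohomology f hf, Function.Surjective π ∧
      (∀ u (z : cechCocycles (reesSeq f hf) (d + 1)),
        cechEmb (isUnit_algebraMap_reesSeq hf) z.1 = topCochain f I u →
          π u = cechClass (reesSeq f hf) (d + 1) z) ∧
      LinearMap.ker π = reesKer hf := by
  have hd0 : 0 < d := by omega
  have hx := isUnit_algebraMap_reesSeq hf
  have hinj := algebraMap_rees_injective (I := I) hnzd
  obtain ⟨π, hπ⟩ := exists_linearMap_cechCohomology hx hinj (k := d + 1) (topCochain f I)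
    topCochain_mem (fun u s => topCochain_apply_of_card_ne u) fullD_topCochain
  have hzero : ∀ u, π u = 0 ↔ ∃ b : Finset (Fin (d + d)) → ReesAmbient f,
      (∀ s, b s ∈ reesLoc hf s) ∧ (∀ s, s.card ≠ d → b s = 0) ∧
        fullD (reesAlgebra I) b = topCochain f I u := by
    intro u
    obtain ⟨z, hz⟩ := exists_cechCocycles_eq hx hinj (topCochain_mem (hf := hf) u)
      (fun s => topCochain_apply_of_card_ne u) (fullD_topCochain u)
    rw [hπ u z hz, cechClass_eq_zero_iff_exists hx hinj, hz]
  have hunit : ∀ (ε : reesAlgebra I) (u : ReesAmbient f), ε * ε = 1 → π (ε • u) = 0 → π u = 0 := by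
    intro ε u hε h
    rw [← one_smul (reesAlgebra I) u, ← hε, mul_smul, map_smul, h, smul_zero]
  have hsq : ∀ n : ℕ, (-1 : reesAlgebra I) ^ n * (-1) ^ n = 1 := neg_one_pow_mul_self
  have hleft : ∀ u ∈ reesLoc hf (leftAll d), π u = 0 := by
    intro u hu
    refine hunit ((-1) ^ d) u (hsq d) ((hzero _).2 ⟨Pi.single (leftAll d) u,
      single_mem_reesLoc hu, fun s => single_apply_of_card_ne card_leftAll u, ?_⟩)
    rw [fullD_single_leftAll]
  have hmixed : ∀ u ∈ reesKerMixed hf, π u = 0 := by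
    intro u hu
    -- Take the coboundary of u placed at the left set without i and delete its component at the
    -- full left set. What is left has mixed components covering every subscript except possibly i,
    -- so it is a legitimate cochain. Since d² = 0, its differential is that of minus the deleted
    -- component, i.e. ± the family with value u.
    have hle : reesKerMixed hf ≤ LinearMap.ker π := by
      refine iSup_le fun i u hu => ?_
      rw [LinearMap.mem_ker]
      let S := (leftAll d).erase (Fin.castAdd d i)
      have hiS : Fin.castAdd d i ∉ S := Finset.notMem_erase _ _
      have hins : insert (Fin.castAdd d i) S = leftAll d :=
        Finset.insert_erase (castAdd_mem_leftAll i)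
      have hSc : S.card = d - 1 := by
        rw [Finset.card_erase_of_mem (castAdd_mem_leftAll i), card_leftAll]
      let e := fullD (reesAlgebra I) (Pi.single (M := fun _ => ReesAmbient f) S u)
      have hec : ∀ s, s.card ≠ d → e s = 0 := fun s hs =>
        fullD_apply_eq_zero_of_card (k := d - 1) (fun t => single_apply_of_card_ne hSc u) (by omega)
      have heS : e (leftAll d) = (-1 : reesAlgebra I) ^ cechPos (Fin.castAdd d i) S • u := by
        rw [← hins]; exact fullD_single_apply_insert hiS u
      refine hunit (-((-1) ^ d * (-1) ^ cechPos (Fin.castAdd d i) S)) u ?_ ((hzero _).2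
        ⟨e - Pi.single (leftAll d) (e (leftAll d)), fun s => ?_, fun s hs => ?_, ?_⟩)
      · linear_combination hsq (d + cechPos (Fin.castAdd d i) S)
      · by_cases hs : s = leftAll d
        · rw [Pi.sub_apply, hs, Pi.single_eq_same, sub_self]
          exact Subalgebra.zero_mem _
        · rw [Pi.sub_apply, Pi.single_eq_of_ne hs, sub_zero]
          by_cases h : ∃ x ∉ S, s = insert x S
          · obtain ⟨x, hxS, rfl⟩ := h
            induction x using Fin.addCases with
            | left j =>
              exfalso
              by_cases hj : j = i
              · exact hs (by rw [hj, hins])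
              · exact hxS (Finset.mem_erase.2
                  ⟨fun h => hj (Fin.castAdd_injective _ _ h), castAdd_mem_leftAll j⟩)
            | right j =>
              change fullD _ _ _ ∈ _
              rw [fullD_single_apply_insert hxS]
              have hcov : ∀ k ≠ i, Fin.castAdd d k ∈ insert (Fin.natAdd d j) S := fun k hk =>
                Finset.mem_insert_of_mem (Finset.mem_erase.2
                  ⟨fun h => hk (Fin.castAdd_injective _ _ h), castAdd_mem_leftAll k⟩)
              have : Nontrivial (Fin d) := Fin.nontrivial_iff_two_le.2 hd
              obtain ⟨k, hk⟩ := exists_ne i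
              refine Subalgebra.smul_mem _ (reesLoc_le_of_isMixed
                ⟨⟨k, hcov k hk⟩, ⟨j, Finset.mem_insert_self _ _⟩⟩ (fun k hk => ?_) hu) _
              exact Or.inl (hcov k (isCovered_dblErase.1 hk))
          · push Not at h
            change fullD _ _ _ ∈ _
            rw [fullD_single_apply_of_ne h]
            exact Subalgebra.zero_mem _
      · rw [Pi.sub_apply, hec s hs, single_apply_of_card_ne card_leftAll _ hs, sub_zero]
      · rw [map_sub, fullD_fullD, zero_sub, fullD_single_leftAll, heS, smul_smul, neg_smul, map_neg]
    exact LinearMap.mem_ker.1 (hle hu)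
  have hright : ∀ u ∈ reesLoc hf (rightAll d), π u = 0 := by
    intro u hu
    -- For u from the localization at the f_it, the coboundary of u at `rightAll` normalizes to db
    -- plus the family of some g. Here π(g) = 0 because that family is d(a - b). Applying the
    -- staircase functional to both sides expresses u through g, b at `leftAll` and mixed terms, all
    -- of which π kills.
    let a : Finset (Fin (d + d)) → ReesAmbient f := Pi.single (rightAll d) u
    have ham : ∀ s, a s ∈ reesLoc hf s := single_mem_reesLoc hu
    have hac : ∀ s, s.card ≠ d → a s = 0 := fun s => single_apply_of_card_ne card_rightAll u
    obtain ⟨b, hb, hbd, hb0, g, hg⟩ := exists_eq_fullD_add_topCochain (I := I) hd0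
      (fullD_mem_reesLoc ham) (fun s => fullD_apply_eq_zero_of_card hac) (fullD_fullD a)
    have hg0 : π g = 0 := (hzero g).2 ⟨a - b, fun s => Subalgebra.sub_mem _ (ham s) (hb s),
      fun s hs => by rw [Pi.sub_apply, hac s hs, hbd s hs, sub_zero],
      by rw [map_sub, hg, add_sub_cancel_left]⟩
    have h1 := hmixed _ (diagSum_fullD_mem hd ham)
    have h2 := hmixed _ (diagSum_fullD_mem hd hb)
    have hlr : leftAll d ≠ rightAll d := fun h =>
      castAdd_notMem_rightAll ⟨0, hd0⟩ (h ▸ castAdd_mem_leftAll _)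
    have ha1 : a (rightAll d) = u := Pi.single_eq_same _ _
    have ha2 : a (leftAll d) = 0 := Pi.single_eq_of_ne hlr _
    -- The normalizing cochain vanishes on sets without left indices, so it does not disturb the
    -- value at `rightAll`.
    have hb1 : b (rightAll d) = 0 := hb0 _ (by
      ext i; simp only [mem_leftPart, castAdd_notMem_rightAll, Finset.notMem_empty])
    rw [hg, diagSum_add, diagSum_topCochain hd0, ha1, ha2, sub_zero, map_sub, map_add, map_smul,
      hg0, smul_zero, add_zero] at h1
    rw [hb1, zero_sub, sub_neg_eq_add, map_add, hleft _ (hb _), add_zero] at h2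
    rw [h2, zero_sub, neg_eq_zero] at h1
    exact h1
  refine ⟨π, fun ζ => ?_, hπ, le_antisymm (fun u hu => ?_) ?_⟩
  · obtain ⟨z, rfl⟩ := Submodule.Quotient.mk_surjective _ ζ
    have hzk : ∀ s, s.card ≠ d + 1 → cechEmb hx z.1 s = 0 := fun s hs => by
      rw [cechEmb_apply_eq_zero hx hinj, z.2.1 s hs]
    have hzD : fullD (reesAlgebra I) (cechEmb hx z.1) = 0 := by
      rw [← cechEmb_cechD, LinearMap.mem_ker.1 z.2.2, map_zero]
    obtain ⟨b, hb, hbd, -, g, hg⟩ := exists_eq_fullD_add_topCochain (hf := hf) hd0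
      (c := cechEmb hx z.1) (fun s => cechLocHom_mem hx s _) hzk hzD
    obtain ⟨z', hz'⟩ := exists_cechCocycles_eq hx hinj (topCochain_mem (hf := hf) g)
      (fun s => topCochain_apply_of_card_ne g) (fullD_topCochain g)
    refine ⟨g, ?_⟩
    rw [hπ g z' hz']
    refine (sub_eq_zero.1 ?_).symm
    change cechClass _ _ z - _ = 0
    rw [← map_sub, cechClass_eq_zero_iff_exists hx hinj]
    refine ⟨b, hb, hbd, ?_⟩
    change _ = cechEmb hx (z.1 - z'.1)
    rw [map_sub, hz', hg, add_sub_cancel_right]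
  -- Conversely, the staircase functional of a coboundary is its value at `rightAll` minus that at
  -- `leftAll` up to mixed terms, hence in the proposed kernel.
  · obtain ⟨b, hb, -, h⟩ := (hzero u).1 (LinearMap.mem_ker.1 hu)
    have h1 := reesKerMixed_le (diagSum_fullD_mem hd hb)
    rw [h, diagSum_topCochain hd0] at h1
    have h2 := add_mem h1 (sub_mem (mem_reesKer_of_mem_rightAll (hb (rightAll d)))
      (mem_reesKer_of_mem_leftAll (hb (leftAll d))))
    rw [sub_add_cancel] at h2
    have h3 := Submodule.smul_mem _ (diagSign (reesAlgebra I) (⟨d - 1, by omega⟩ : Fin d)) h2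
    rwa [smul_smul, diagSign_mul_self, one_smul] at h3
  · refine iSup_le ?_
    rintro (i | b)
    · exact fun u hu => hmixed u (Submodule.mem_iSup_of_mem i hu)
    · cases b
      · exact fun u hu => hright u hu
      · exact fun u hu => hleft u hu

end ReesKernel
end

noncomputable section

set_option linter.unusedSectionVars false

/-! ### The two kernels compared by degree. -/

section Kernels

variable {R : Type*} [CommRing R] {I : Ideal R} {d : ℕ} {f : Fin d → R} (hf : ∀ i, f i ∈ I)

/-- The kernel of `R_f[t, t⁻¹] → H^{d+1}_𝔑(𝓡')`. -/
def extendedReesKer : Submodule (extendedReesAlgebra I) (ReesAmbient f) :=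
  ⨆ i, Subalgebra.toSubmodule (extendedReesLoc hf (Finset.univ.erase i))

theorem exists_algebraMap_prod_extendedReesSeq_eq (s : Finset (Fin (d + 1))) :
    ∃ (m : ℤ) (a : Localization.Away (∏ i, f i)),
      algebraMap _ (ReesAmbient f) (∏ i ∈ s, extendedReesSeq f hf i) = ambMono f m a := by
  induction s using Finset.induction_on with
  | empty => exact ⟨0, 1, by rw [Finset.prod_empty, map_one, ambMono_one]⟩
  | insert i s hi ih =>
    obtain ⟨m, a, h⟩ := ih
    rw [Finset.prod_insert hi, map_mul, h]
    induction i using Fin.lastCases with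
    | last => exact ⟨_, _, by rw [algebraMap_extendedReesSeq_last, ambMono_mul]⟩
    | cast i => exact ⟨_, _, by rw [algebraMap_extendedReesSeq_castSucc, ambMono_mul]⟩

variable {hf}

theorem ambRestr_mem_extendedReesKer (W : Set ℤ) {u : ReesAmbient f}
    (hu : u ∈ extendedReesKer hf) : ambRestr f W u ∈ extendedReesKer hf := by
  induction hu using Submodule.iSup_induction' with
  | mem i u hu =>
    obtain ⟨m, a, h⟩ := exists_algebraMap_prod_extendedReesSeq_eq hf (Finset.univ.erase i)
    exact Submodule.mem_iSup_of_mem i (ambRestr_mem_locSub h W hu)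
  | zero => rw [map_zero]; exact zero_mem _
  | add u v _ _ hu hv => rw [map_add]; exact add_mem hu hv

theorem ambRestr_ambRestr {V W : Set ℤ} (h : V ⊆ W) (u : ReesAmbient f) :
    ambRestr f V (ambRestr f W u) = ambRestr f V u := ambCoeff_ext fun n => by
  classical
  rw [ambCoeff_restr, ambCoeff_restr, ambCoeff_restr]
  by_cases hn : n ∈ V
  · rw [if_pos hn, if_pos hn, if_pos (h hn)]
  · rw [if_neg hn, if_neg hn]

theorem ambRestr_ambMono_of_mem {W : Set ℤ} {n : ℤ} (hn : n ∈ W)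
    (a : Localization.Away (∏ i, f i)) : ambRestr f W (ambMono f n a) = ambMono f n a :=
  ambCoeff_ext fun m => by
    classical
    rw [ambCoeff_restr, ambCoeff_mono]
    by_cases h : n = m
    · rw [if_pos (h ▸ hn)]
    · rw [if_neg h, ite_self]

theorem ambRestr_ambMono_of_notMem {W : Set ℤ} {n : ℤ} (hn : n ∉ W)
    (a : Localization.Away (∏ i, f i)) : ambRestr f W (ambMono f n a) = 0 :=
  ambCoeff_ext fun m => by
    classical
    rw [ambCoeff_restr, ambCoeff_mono]
    by_cases h : n = m
    · rw [if_neg (h ▸ hn)]; rfl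
    · rw [if_neg h, ite_self]; rfl

theorem mem_reesKer_of_mem_extendedReesKer (hd : 2 ≤ d) {u : ReesAmbient f}
    (hu : u ∈ extendedReesKer hf) : u ∈ reesKer hf := by
  induction hu using Submodule.iSup_induction' with
  | mem i u hu =>
    induction i using Fin.lastCases with
    | last => exact mem_reesKer_of_mem_rightAll ((mem_extendedReesLoc_erase_last (by omega) u).1 hu)
    | cast i =>
      exact reesKerMixed_le
        (Submodule.mem_iSup_of_mem i ((mem_extendedReesLoc_erase_castSucc hd i u).1 hu))
  | zero => exact zero_mem _
  | add u v _ _ hu hv => exact add_mem hu hv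

/-- The Rees kernel is the extended one plus R_f[t]. Truncation to negative degrees kills R_f[t] and
preserves the graded submodule `extendedReesKer`; conversely u differs from its truncation by an
element of R_f[t]. -/
theorem mem_reesKer_iff (hd : 2 ≤ d) {u : ReesAmbient f} :
    u ∈ reesKer hf ↔ ambRestr f (Set.Iio 0) u ∈ extendedReesKer hf := by
  classical
  constructor
  · intro hu
    induction hu using Submodule.iSup_induction' with
    | mem w u hu =>
      rcases w with i | b
      · exact ambRestr_mem_extendedReesKer _ (Submodule.mem_iSup_of_mem i.castSucc
          ((mem_extendedReesLoc_erase_castSucc hd i u).2 hu))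
      · cases b
        · exact ambRestr_mem_extendedReesKer _ (Submodule.mem_iSup_of_mem (Fin.last d)
            ((mem_extendedReesLoc_erase_last (by omega) u).2 hu))
        · have h0 := (mem_reesLoc_castAdd_iff (by omega)).1 hu
          have : ambRestr f (Set.Iio 0) u = 0 := ambCoeff_ext fun n => by
            rw [ambCoeff_restr]
            split_ifs with h
            · exact h0 n h
            · rfl
          rw [this]; exact zero_mem _
    | zero => rw [map_zero]; exact zero_mem _
    | add u v _ _ hu hv => rw [map_add]; exact add_mem hu hv
  · intro hu
    rw [← sub_add_cancel u (ambRestr f (Set.Iio 0) u)]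
    refine add_mem (mem_reesKer_of_mem_leftAll ((mem_reesLoc_castAdd_iff (by omega)).2 ?_))
      (mem_reesKer_of_mem_extendedReesKer hd hu)
    intro n hn
    have h : ambCoeff f (u - ambRestr f (Set.Iio 0) u) n + ambCoeff f (ambRestr f (Set.Iio 0) u) n =
        ambCoeff f u n := by rw [← ambCoeff_add, sub_add_cancel]
    rw [ambCoeff_restr, if_pos (Set.mem_Iio.2 hn)] at h
    exact left_eq_add.1 (by rw [add_comm]; exact h.symm)

/-- The top local cohomology of the extended Rees algebra as a quotient of `R_f[t, t⁻¹]`. -/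
theorem exists_extendedReesLocalCohomology_presentation (hf : ∀ i, f i ∈ I)
    (hnzd : ∀ i, f i ∈ nonZeroDivisors R) :
    ∃ π : ReesAmbient f →ₗ[extendedReesAlgebra I] ExtendedReesLocalCohomology f hf,
      Function.Surjective π ∧
      (∀ u (z : cechCocycles (extendedReesSeq f hf) (d + 1)),
        cechLocHom (isUnit_algebraMap_extendedReesSeq hf) Finset.univ (z.1 Finset.univ) = u →
          π u = cechClass (extendedReesSeq f hf) (d + 1) z) ∧
      LinearMap.ker π = extendedReesKer hf :=
  exists_cechCohomology_top (isUnit_algebraMap_extendedReesSeq hf)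
    (algebraMap_extendedRees_injective hnzd) extendedReesLoc_univ (by simp)

/-- The element `a / f ^ l` of `R_f`. -/
def ambFrac (f : Fin d → R) (a : R) (l : ℕ) : Localization.Away (∏ i, f i) :=
  algebraMap R _ a * (∏ i, ambInv f i) ^ l

theorem exists_eq_ambFrac (q : Localization.Away (∏ i, f i)) : ∃ (a : R) (l : ℕ),
    q = ambFrac f a l := by
  obtain ⟨l, a, h⟩ := exists_eq_mul_prod_ambInv q
  exact ⟨a, l, h⟩

theorem algebraMap_prod_mul_prod_ambInv :
    algebraMap R (Localization.Away (∏ i, f i)) (∏ i, f i) * ∏ i, ambInv f i = 1 := by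
  rw [map_prod, ← Finset.prod_mul_distrib]
  exact Finset.prod_eq_one fun i _ => algebraMap_mul_ambInv i

theorem pow_mul_ambFrac (a : R) (l : ℕ) :
    algebraMap R (Localization.Away (∏ i, f i)) (∏ i, f i) ^ l * ambFrac f a l =
      algebraMap R _ a := by
  rw [ambFrac, mul_left_comm, ← mul_pow, algebraMap_prod_mul_prod_ambInv, one_pow, mul_one]

theorem cechLocHom_reesFraction (a : R) (l m : ℕ) (j : Fin d) :
    cechLocHom (isUnit_algebraMap_reesSeq hf) (reesTopIndex j) (reesFraction f hf a l m j) =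
      ambMono f (-m) (ambFrac f a l) := by
  have h1 := congrArg (cechLocHom (isUnit_algebraMap_reesSeq hf) (reesTopIndex j))
    (reesFraction_spec f hf a l m j)
  rw [map_mul, AlgHom.commutes, AlgHom.commutes] at h1
  have hu : IsUnit (algebraMap (reesAlgebra I) (ReesAmbient f)
      (algebraMap R (reesAlgebra I) (∏ i, f i) ^ l * reesT (f j) (hf j) ^ m)) := by
    have h2 : IsUnit (ambMono f 0 (algebraMap R _ (∏ i, f i))) := by
      refine IsUnit.of_mul_eq_one (ambMono f 0 (∏ i, ambInv f i)) ?_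
      rw [ambMono_mul, algebraMap_prod_mul_prod_ambInv, add_zero, ambMono_one]
    have h3 := isUnit_algebraMap_reesSeq hf (Fin.natAdd d j)
    rw [reesSeq_natAdd] at h3
    rw [map_mul, map_pow, map_pow, algebraMap_rees_algebraMap]
    exact (h2.pow l).mul (h3.pow m)
  refine hu.mul_left_cancel (h1.trans ?_)
  simp only [map_mul, map_pow, algebraMap_rees_algebraMap, algebraMap_reesT, ambMono_pow,
    ambMono_mul]
  rw [show (l : ℤ) * 0 + (m : ℤ) * 1 + -(m : ℤ) = 0 + (m : ℤ) * 0 by ring, ← pow_mul_ambFrac a l]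
  congr 1
  ring

theorem cechLocHom_extendedReesCochain (a : R) (l m : ℕ) :
    cechLocHom (isUnit_algebraMap_extendedReesSeq hf) Finset.univ
      (extendedReesCochain f hf a l m Finset.univ) = ambMono f (-m) (ambFrac f a l) := by
  have h1 := congrArg (cechLocHom (isUnit_algebraMap_extendedReesSeq hf) Finset.univ)
    (extendedReesCochain_spec f hf a l m)
  rw [map_mul, AlgHom.commutes, AlgHom.commutes] at h1
  have h0 : ∀ r : R, algebraMap (extendedReesAlgebra I) (ReesAmbient f) (algebraMap R _ r) =
      ambMono f 0 (algebraMap R _ r) := fun r => by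
    rw [← IsScalarTower.algebraMap_apply]; rfl
  have hu : IsUnit (algebraMap (extendedReesAlgebra I) (ReesAmbient f)
      (algebraMap R (extendedReesAlgebra I) (∏ i, f i) ^ l)) := by
    have h2 : IsUnit (ambMono f 0 (algebraMap R _ (∏ i, f i))) := by
      refine IsUnit.of_mul_eq_one (ambMono f 0 (∏ i, ambInv f i)) ?_
      rw [ambMono_mul, algebraMap_prod_mul_prod_ambInv, add_zero, ambMono_one]
    rw [map_pow, h0]
    exact h2.pow l
  refine hu.mul_left_cancel (h1.trans ?_)
  simp only [map_mul, map_pow, h0, algebraMap_reesTInv, ambMono_pow, ambMono_mul, one_pow, mul_one]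
  rw [pow_mul_ambFrac]
  congr 1
  ring

theorem cechEmb_reesCochain (a : R) (l m : ℕ) :
    cechEmb (isUnit_algebraMap_reesSeq hf) (reesCochain f hf a l m) =
      topCochain f I (ambMono f (-m) (ambFrac f a l)) := by
  funext s
  rw [cechEmb_apply]
  by_cases h : ∃ j, s = reesTopIndex j
  · obtain ⟨j, rfl⟩ := h
    rw [reesCochain_apply, topCochain_apply_top, cechLocHom_reesFraction]
  · push Not at h
    rw [reesCochain_apply_of_ne f hf a l m s h, topCochain_apply_of_ne _ h, map_zero]

end Kernels

/-! ### Existence, uniqueness and injectivity of γ. -/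

section Comparison

variable {R : Type*} [CommRing R] {I : Ideal R} {d : ℕ} {f : Fin d → R} {hf : ∀ i, f i ∈ I}
  (hd : 2 ≤ d)
  {π : ReesAmbient f →ₗ[reesAlgebra I] ReesLocalCohomology f hf} (hπ : Function.Surjective π)
  (hπc : ∀ u (z : cechCocycles (reesSeq f hf) (d + 1)),
    cechEmb (isUnit_algebraMap_reesSeq hf) z.1 = topCochain f I u →
      π u = cechClass (reesSeq f hf) (d + 1) z)
  (hπk : LinearMap.ker π = reesKer hf)
  {π' : ReesAmbient f →ₗ[extendedReesAlgebra I] ExtendedReesLocalCohomology f hf}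
  (hπc' : ∀ u (z : cechCocycles (extendedReesSeq f hf) (d + 1)),
    cechLocHom (isUnit_algebraMap_extendedReesSeq hf) Finset.univ (z.1 Finset.univ) = u →
      π' u = cechClass (extendedReesSeq f hf) (d + 1) z)
  (hπk' : LinearMap.ker π' = extendedReesKer hf)

include hd hπc hπk hπc'

/-- Every monomial of negative degree is some (a / f^l) t^(-m), and monomials of degree at least 0
die in the source. So the condition on generators says precisely that γ is induced by truncation. -/
theorem isReesComparison_iff
    {γ : ReesLocalCohomology f hf →ₗ[R] ExtendedReesLocalCohomology f hf} :
    IsReesComparison f hf γ ↔ ∀ u, γ (π u) = π' (ambRestr f (Set.Iio 0) u) := by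
  have h1 : ∀ (a : R) (l m : ℕ), π (ambMono f (-m) (ambFrac f a l)) =
      cechClass _ _ ⟨reesCochain f hf a l m, reesCochain_mem f hf a l m⟩ := fun a l m =>
    hπc _ ⟨reesCochain f hf a l m, reesCochain_mem f hf a l m⟩ (cechEmb_reesCochain a l m)
  have h2 : ∀ (a : R) (l m : ℕ), π' (ambMono f (-m) (ambFrac f a l)) =
      cechClass _ _ ⟨extendedReesCochain f hf a l m, extendedReesCochain_mem f hf a l m⟩ :=
    fun a l m => hπc' _ ⟨extendedReesCochain f hf a l m, extendedReesCochain_mem f hf a l m⟩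
      (cechLocHom_extendedReesCochain a l m)
  have hmem : ∀ m : ℕ, 0 < m → (-(m : ℤ)) ∈ Set.Iio (0 : ℤ) := fun m hm => by
    rw [Set.mem_Iio]; omega
  constructor
  · intro hγ u
    refine ambient_induction (P := fun u => γ (π u) = π' (ambRestr f (Set.Iio 0) u)) u ?_
      (fun u v hu hv => ?_) fun n => ?_
    · simp only [map_zero]
    · simp only [map_add, hu, hv]
    · obtain ⟨a, l, h⟩ := exists_eq_ambFrac (ambCoeff f u n)
      rw [h]
      by_cases hn : n < 0
      · obtain ⟨m, rfl⟩ : ∃ m : ℕ, n = -(m : ℤ) := ⟨n.natAbs, by omega⟩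
        rw [ambRestr_ambMono_of_mem (Set.mem_Iio.2 hn), h1, h2]
        exact hγ a l m (by omega)
      · rw [ambRestr_ambMono_of_notMem (by simpa using hn), map_zero]
        have : ambMono f n (ambFrac f a l) ∈ LinearMap.ker π := by
          rw [hπk, mem_reesKer_iff hd, ambRestr_ambMono_of_notMem (by simpa using hn)]
          exact zero_mem _
        rw [LinearMap.mem_ker.1 this, map_zero]
  · intro h a l m hm
    rw [← h1, ← h2, h, ambRestr_ambMono_of_mem (hmem m hm)]

include hπ hπk'

theorem existsUnique_isReesComparison :
    ∃! γ : ReesLocalCohomology f hf →ₗ[R] ExtendedReesLocalCohomology f hf,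
      IsReesComparison f hf γ := by
  let g : ReesAmbient f →ₗ[R] ReesLocalCohomology f hf := π.restrictScalars R
  let h : ReesAmbient f →ₗ[R] ExtendedReesLocalCohomology f hf :=
    π'.restrictScalars R ∘ₗ ambRestr f (Set.Iio 0)
  have hg : Function.Surjective g := hπ
  have hle : LinearMap.ker g ≤ LinearMap.ker h := by
    intro u hu
    have h1 : u ∈ LinearMap.ker π := hu
    rw [hπk, mem_reesKer_iff hd, ← hπk'] at h1
    exact h1
  refine ⟨(LinearMap.ker g).liftQ h hle ∘ₗ (g.quotKerEquivOfSurjective hg).symm.toLinearMap,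
    (isReesComparison_iff hd hπc hπk hπc').2 fun u => ?_, fun γ hγ => ?_⟩
  · have : (g.quotKerEquivOfSurjective hg).symm (π u) = Submodule.Quotient.mk u :=
      (LinearEquiv.symm_apply_eq _).2 rfl
    rw [LinearMap.comp_apply, LinearEquiv.coe_coe, this]
    rfl
  · ext ζ
    obtain ⟨u, rfl⟩ := hπ ζ
    rw [(isReesComparison_iff hd hπc hπk hπc').1 hγ]
    have : (g.quotKerEquivOfSurjective hg).symm (π u) = Submodule.Quotient.mk u :=
      (LinearEquiv.symm_apply_eq _).2 rfl
    rw [LinearMap.comp_apply, LinearEquiv.coe_coe, this]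
    rfl

theorem isReesComparison_injective
    {γ : ReesLocalCohomology f hf →ₗ[R] ExtendedReesLocalCohomology f hf}
    (hγ : IsReesComparison f hf γ) : Function.Injective γ := by
  refine (injective_iff_map_eq_zero _).2 fun ζ hζ => ?_
  obtain ⟨u, rfl⟩ := hπ ζ
  rw [(isReesComparison_iff hd hπc hπk hπc').1 hγ, ← LinearMap.mem_ker, hπk', ← mem_reesKer_iff hd,
    ← hπk] at hζ
  exact hζ

end Comparison
end

noncomputable section

set_option linter.unusedSectionVars false

/-! ### Multipliers: passing between 𝓡⁰ and 𝓡'⁰. -/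

section MinimalPrimes

open Polynomial LaurentPolynomial

variable {R : Type*} [CommRing R] {I : Ideal R} {d : ℕ} {f : Fin d → R} (hf : ∀ i, f i ∈ I)

theorem exists_pow_mul_eq_reesInclusion (i : Fin d) (c : extendedReesAlgebra I) :
    ∃ (N : ℕ) (c' : reesAlgebra I),
      reesInclusion I c' = reesInclusion I (reesT (f i) (hf i)) ^ N * c := by
  have hN : ∃ N : ℕ, ∀ n : ℤ, n + N < 0 → c.1.coeff n = 0 := by
    refine ⟨c.1.coeff.support.sup Int.natAbs, fun n hn => ?_⟩
    by_contra h
    have := Finset.le_sup (f := Int.natAbs) (Finsupp.mem_support_iff.2 h)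
    omega
  obtain ⟨N, hN⟩ := hN
  have h1 : (reesInclusion I (reesT (f i) (hf i))).1 = AddMonoidAlgebra.single 1 (f i) := by
    change toLaurent (Polynomial.monomial 1 (f i)) = _
    rw [← Polynomial.C_mul_X_pow_eq_monomial, Polynomial.toLaurent_C_mul_X_pow,
      LaurentPolynomial.single_eq_C_mul_T]
    rfl
  have h2 : ∀ q : R[T;T⁻¹], ∀ n : ℤ, (AddMonoidAlgebra.single 1 (f i) ^ N * q : R[T;T⁻¹]).coeff n =
      f i ^ N * q.coeff (n - N) := by
    intro q n
    rw [AddMonoidAlgebra.single_pow, AddMonoidAlgebra.coeff_single_mul_apply]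
    simp [sub_eq_neg_add]
  obtain ⟨c', hc'⟩ := exists_reesInclusion_eq
    (q := reesInclusion I (reesT (f i) (hf i)) ^ N * c) (fun n hn => by
      change ((reesInclusion I (reesT (f i) (hf i))).1 ^ N * c.1).coeff n = 0
      rw [h1, h2, hN _ (by omega), mul_zero])
  exact ⟨N, c', hc'⟩

variable {hf}

theorem isNilpotent_of_pow_mul (hnzd : ∀ i, f i ∈ nonZeroDivisors R) (i : Fin d)
    {c : extendedReesAlgebra I} {N : ℕ}
    (h : IsNilpotent (reesInclusion I (reesT (f i) (hf i)) ^ N * c)) : IsNilpotent c := by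
  have hinj := algebraMap_extendedRees_injective (I := I) hnzd
  obtain ⟨k, hk⟩ := h
  refine ⟨k, hinj ?_⟩
  have h1 := congrArg (algebraMap _ (ReesAmbient f)) hk
  rw [mul_pow, map_mul, map_zero, ← extendedReesSeq_castSucc, map_pow, map_pow] at h1
  rw [map_zero]
  exact (((isUnit_algebraMap_extendedReesSeq hf i.castSucc).pow N).pow k).mul_right_eq_zero.1 h1

/-- Any b ∈ 𝓡' enters 𝓡 after multiplication by a power of f_it, and this power is a nonzerodivisor,
so testing nilpotency against elements of 𝓡 is enough. -/
theorem reesInclusion_mem_minimalPrimesCompl (hnzd : ∀ i, f i ∈ nonZeroDivisors R) (i : Fin d)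
    (hf : ∀ i, f i ∈ I)
    {c : reesAlgebra I} (hc : c ∈ minimalPrimesCompl (reesAlgebra I)) :
    reesInclusion I c ∈ minimalPrimesCompl (extendedReesAlgebra I) := by
  rw [mem_minimalPrimesCompl_iff] at hc ⊢
  intro b hb
  obtain ⟨N, b', hb'⟩ := exists_pow_mul_eq_reesInclusion hf i b
  refine isNilpotent_of_pow_mul (hf := hf) hnzd i (N := N) ?_
  rw [← hb', IsNilpotent.map_iff reesInclusion_injective]
  refine hc b' ((IsNilpotent.map_iff reesInclusion_injective).1 ?_)
  rw [map_mul, hb', mul_left_comm]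
  obtain ⟨k, hk⟩ := hb
  exact ⟨k, by rw [mul_pow, hk, mul_zero]⟩

theorem mem_minimalPrimesCompl_of_reesInclusion (hnzd : ∀ i, f i ∈ nonZeroDivisors R) (i : Fin d)
    {c : extendedReesAlgebra I} (hc : c ∈ minimalPrimesCompl (extendedReesAlgebra I)) {N : ℕ}
    {c' : reesAlgebra I} (h : reesInclusion I c' = reesInclusion I (reesT (f i) (hf i)) ^ N * c) :
    c' ∈ minimalPrimesCompl (reesAlgebra I) := by
  rw [mem_minimalPrimesCompl_iff] at hc ⊢
  intro b hb
  rw [← IsNilpotent.map_iff (f := reesInclusion I) reesInclusion_injective] at hb ⊢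
  refine hc _ (isNilpotent_of_pow_mul (hf := hf) hnzd i (N := N) ?_)
  rwa [map_mul, h, mul_assoc] at hb

end MinimalPrimes

/-! ### Separating the components of a Frobenius power. -/

section FrobeniusCoefficients

variable {R : Type*} [CommRing R] {I : Ideal R} {d : ℕ} {f : Fin d → R}

/-- The q-th powers of the monomials of u sit in degrees that are multiples of q, and c has degrees
in [0, q). The products therefore occupy disjoint blocks, and the n-th block sees only u_n. No
homogeneous multiplier has to be chosen. -/
theorem ambRestr_algebraMap_mul_pow (p : ℕ) [Fact p.Prime] [CharP (ReesAmbient f) p] (e : ℕ)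
    (c : reesAlgebra I) (hc : c.1.natDegree < p ^ e) (n : ℤ) (u : ReesAmbient f) :
    ambRestr f (Set.Ico (n * p ^ e) ((n + 1) * p ^ e))
      (algebraMap _ (ReesAmbient f) c * u ^ p ^ e) =
      algebraMap _ (ReesAmbient f) c * ambMono f n (ambCoeff f u n) ^ p ^ e := by
  classical
  have hq : p ^ e ≠ 0 := pow_ne_zero _ (Fact.out : p.Prime).ne_zero
  refine ambient_induction (P := fun u => ambRestr f (Set.Ico (n * p ^ e) ((n + 1) * p ^ e))
      (algebraMap _ (ReesAmbient f) c * u ^ p ^ e) =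
      algebraMap _ (ReesAmbient f) c * ambMono f n (ambCoeff f u n) ^ p ^ e) u ?_ ?_ fun m => ?_
  · have : ambMono f n (ambCoeff f 0 n) = 0 := ambMono_zero n
    rw [this, zero_pow hq, mul_zero, map_zero]
  · intro u v hu hv
    rw [add_pow_char_pow, mul_add, map_add, hu, hv, ambCoeff_add, ambMono_add, add_pow_char_pow,
      mul_add]
  · have hc0 : ∀ k : ℤ, k ∉ Set.Ico (0 : ℤ) (p ^ e) →
        ambCoeff f (algebraMap _ (ReesAmbient f) c) k = 0 := by
      intro k hk
      rw [← algebraMap_reesInclusion, ambCoeff_algebraMap]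
      by_cases h0 : 0 ≤ k
      · lift k to ℕ using h0
        rw [reesInclusion_coeff_natCast, Polynomial.coeff_eq_zero_of_natDegree_lt, map_zero]
        refine hc.trans_le ?_
        by_contra hlt
        exact hk ⟨by positivity, by exact_mod_cast not_le.1 hlt⟩
      · rw [reesInclusion_coeff_neg _ (by omega), map_zero]
    refine ambCoeff_ext fun k => ?_
    rw [ambCoeff_restr, ambCoeff_mono,
      mul_comm (algebraMap _ (ReesAmbient f) c) (ambMono f m (ambCoeff f u m) ^ p ^ e),
      mul_comm (algebraMap _ (ReesAmbient f) c) (ambMono f n _ ^ p ^ e), ambMono_pow, ambCoeff_mono_mul, ambMono_pow, ambCoeff_mono_mul]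
    have hq' : ((p ^ e : ℕ) : ℤ) = (p : ℤ) ^ e := by push_cast; rfl
    have hpos : (0 : ℤ) < (p : ℤ) ^ e := by
      rw [← hq']; exact_mod_cast Nat.pos_of_ne_zero hq
    rw [hq', mul_comm ((p : ℤ) ^ e) m, mul_comm ((p : ℤ) ^ e) n]
    by_cases hk : k ∈ Set.Ico (n * (p : ℤ) ^ e) ((n + 1) * p ^ e)
    · rw [if_pos hk]
      by_cases hmn : m = n
      · rw [if_pos hmn, hmn]
      · rw [if_neg hmn, zero_pow hq, zero_mul, hc0, mul_zero]
        rintro ⟨h1, h2⟩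
        obtain ⟨h3, h4⟩ := hk
        rcases lt_or_gt_of_ne hmn with h | h
        · have : (m + 1) * (p : ℤ) ^ e ≤ n * (p : ℤ) ^ e :=
            mul_le_mul_of_nonneg_right (by omega) hpos.le
          linarith
        · have : (n + 1) * (p : ℤ) ^ e ≤ m * (p : ℤ) ^ e :=
            mul_le_mul_of_nonneg_right (by omega) hpos.le
          linarith
    · rw [if_neg hk, hc0 (k - n * (p : ℤ) ^ e), mul_zero]
      rintro ⟨h1, h2⟩
      exact hk ⟨by linarith, by linarith⟩

end FrobeniusCoefficients

/-! ### Homogeneous parts of the cohomology of the extended Rees algebra. -/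

section GradedPieces

variable {R : Type*} [CommRing R] {I : Ideal R} {d : ℕ} {f : Fin d → R} {hf : ∀ i, f i ∈ I}

theorem mem_extendedReesPiece_iff (hnzd : ∀ i, f i ∈ nonZeroDivisors R) {q : extendedReesAlgebra I}
    {n : ℤ} : q ∈ extendedReesPiece I n ↔
      ∃ a, algebraMap _ (ReesAmbient f) q = ambMono f n a := by
  constructor
  · intro h
    refine ⟨algebraMap R _ (q.1.coeff n), ambCoeff_ext fun k => ?_⟩
    rw [ambCoeff_algebraMap, ambCoeff_mono]
    split_ifs with hk
    · rw [hk]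
    · rw [h k (Ne.symm hk), map_zero]
  · rintro ⟨a, h⟩ k hk
    apply algebraMap_away_injective hnzd
    rw [← ambCoeff_algebraMap, h, ambCoeff_mono, if_neg (Ne.symm hk), map_zero]

theorem isUnit_and_prod_extendedReesSeq (s : Finset (Fin (d + 1))) :
    ∃ a b : Localization.Away (∏ i, f i), a * b = 1 ∧
      algebraMap _ (ReesAmbient f) (∏ i ∈ s, extendedReesSeq f hf i) =
        ambMono f (∑ i ∈ s, extendedReesSeqDegree d i) a := by
  induction s using Finset.induction_on with
  | empty => exact ⟨1, 1, one_mul 1, by rw [Finset.prod_empty, map_one, Finset.sum_empty, ambMono_one]⟩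
  | insert i s hi ih =>
    obtain ⟨a, b, hab, h⟩ := ih
    rw [Finset.prod_insert hi, map_mul, h, Finset.sum_insert hi]
    induction i using Fin.lastCases with
    | last =>
      refine ⟨1 * a, b, by rw [one_mul, hab], ?_⟩
      rw [algebraMap_extendedReesSeq_last, ambMono_mul]
      simp [extendedReesSeqDegree]
    | cast i =>
      refine ⟨algebraMap R _ (f i) * a, ambInv f i * b, ?_, ?_⟩
      · rw [mul_mul_mul_comm, algebraMap_mul_ambInv, hab, one_mul]
      · rw [algebraMap_extendedReesSeq_castSucc, ambMono_mul]
        simp [extendedReesSeqDegree]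

theorem numerator_mem_extendedReesPiece (hnzd : ∀ i, f i ∈ nonZeroDivisors R) (hd : 0 < d) (r : R)
    (l m : ℕ) : algebraMap R (extendedReesAlgebra I) r *
      (∏ i, reesInclusion I (reesT (f i) (hf i))) ^ ((d - 1) * l) * reesTInv I ^ m ∈
      extendedReesPiece I (-(m : ℤ) + (d * l : ℕ) * ∑ i, extendedReesSeqDegree d i) := by
  rw [mem_extendedReesPiece_iff hnzd]
  have h0 : algebraMap (extendedReesAlgebra I) (ReesAmbient f) (algebraMap R _ r) =
      ambMono f 0 (algebraMap R _ r) := by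
    rw [← IsScalarTower.algebraMap_apply]; rfl
  have h1 : algebraMap (extendedReesAlgebra I) (ReesAmbient f)
      (∏ i, reesInclusion I (reesT (f i) (hf i))) = ambMono f d (algebraMap R _ (∏ i, f i)) := by
    have : ∀ s : Finset (Fin d), algebraMap (extendedReesAlgebra I) (ReesAmbient f)
        (∏ i ∈ s, reesInclusion I (reesT (f i) (hf i))) =
          ambMono f s.card (algebraMap R _ (∏ i ∈ s, f i)) := by
      intro s
      induction s using Finset.induction_on with
      | empty => simp [ambMono_one]
      | insert i s hi ih =>
        rw [Finset.prod_insert hi, map_mul, ih, Finset.prod_insert hi, map_mul,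
          Finset.card_insert_of_notMem hi, algebraMap_reesInclusion, algebraMap_reesT, ambMono_mul,
          Nat.cast_add, Nat.cast_one, add_comm (1 : ℤ)]
    simpa using this Finset.univ
  rw [map_mul, map_mul, map_pow, map_pow, h0, h1, algebraMap_reesTInv, ambMono_pow, ambMono_pow,
    ambMono_mul, ambMono_mul]
  refine ⟨_, congrArg (ambMono f · _) ?_⟩
  simp only [extendedReesSeqDegree, Fin.sum_snoc, Finset.sum_const, Finset.card_univ,
    Fintype.card_fin, nsmul_eq_mul, mul_one]
  push_cast [Nat.cast_sub (show 1 ≤ d from hd)]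
  ring

variable {π' : ReesAmbient f →ₗ[extendedReesAlgebra I] ExtendedReesLocalCohomology f hf}
  (hπc' : ∀ u (z : cechCocycles (extendedReesSeq f hf) (d + 1)),
    cechLocHom (isUnit_algebraMap_extendedReesSeq hf) Finset.univ (z.1 Finset.univ) = u →
      π' u = cechClass (extendedReesSeq f hf) (d + 1) z)
  (hnzd : ∀ i, f i ∈ nonZeroDivisors R)

include hπc' hnzd

/-- The explicit fraction with numerator containing (t⁻¹)^m serves as homogeneous representative;
this is why the degree is taken to be nonpositive. -/
theorem map_ambMono_mem_piece (hd : 0 < d) {n : ℤ} (hn : n ≤ 0)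
    (a : Localization.Away (∏ i, f i)) :
    π' (ambMono f n a) ∈ extendedReesLocalCohomologyPiece f hf n := by
  obtain ⟨r, l, rfl⟩ := exists_eq_ambFrac a
  obtain ⟨m, rfl⟩ : ∃ m : ℕ, n = -(m : ℤ) := ⟨n.natAbs, by omega⟩
  let z : cechCocycles (extendedReesSeq f hf) (d + 1) :=
    ⟨extendedReesCochain f hf r l m, extendedReesCochain_mem f hf r l m⟩
  have hz : cechClass (extendedReesSeq f hf) (d + 1) z = π' (ambMono f (-m) (ambFrac f r l)) :=
    (hπc' _ z (cechLocHom_extendedReesCochain r l m)).symm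
  have hs : ∀ s : Finset (Fin (d + 1)), ∃ (l' : ℕ) (a : extendedReesAlgebra I),
      a ∈ extendedReesPiece I (-(m : ℤ) + l' * ∑ i ∈ s, extendedReesSeqDegree d i) ∧
        z.1 s = cechFraction (extendedReesSeq f hf) s a l' := by
    intro s
    by_cases hs : s = Finset.univ
    · subst hs
      refine ⟨d * l, _, numerator_mem_extendedReesPiece (hf := hf) hnzd hd r l m, ?_⟩
      change extendedReesCochain f hf r l m Finset.univ = _
      rw [extendedReesCochain, Pi.single_eq_same]
    · refine ⟨0, 0, zero_mem _, ?_⟩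
      change extendedReesCochain f hf r l m s = _
      rw [cechFraction, Localization.mk_zero, extendedReesCochain, Pi.single_eq_of_ne hs]
  exact Submodule.subset_span ⟨z, hz, hs⟩

theorem exists_ambMono_of_mem_piece {n : ℤ} {ζ : ExtendedReesLocalCohomology f hf}
    (hζ : ζ ∈ extendedReesLocalCohomologyPiece f hf n) : ∃ a, π' (ambMono f n a) = ζ := by
  induction hζ using Submodule.span_induction with
  | mem ζ h =>
    obtain ⟨z, rfl, h⟩ := h
    obtain ⟨l, q, hq, hz⟩ := h Finset.univ
    obtain ⟨b, hb⟩ := (mem_extendedReesPiece_iff hnzd).1 hq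
    obtain ⟨x, y, hxy, hprod⟩ := isUnit_and_prod_extendedReesSeq (hf := hf) Finset.univ
    refine ⟨b * y ^ l, hπc' _ z ?_⟩
    have h1 : algebraMap _ (CechLoc (extendedReesSeq f hf) Finset.univ)
        (∏ i, extendedReesSeq f hf i) ^ l * z.1 Finset.univ = algebraMap _ _ q := by
      rw [hz, cechFraction, ← map_pow, ← Localization.mk_one_eq_algebraMap,
        ← Localization.mk_one_eq_algebraMap, Localization.mk_mul, Localization.mk_eq_mk_iff,
        Localization.r_iff_exists]
      refine ⟨1, ?_⟩
      simp only [Submonoid.coe_one, one_mul]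
    have h2 := congrArg (cechLocHom (isUnit_algebraMap_extendedReesSeq hf) Finset.univ) h1
    rw [map_mul, map_pow, AlgHom.commutes, AlgHom.commutes, hb, hprod, ambMono_pow] at h2
    refine IsUnit.mul_left_cancel
      (IsUnit.of_mul_eq_one (ambMono f (-(l * ∑ i, extendedReesSeqDegree d i)) (y ^ l))
        (ambMono_mul_eq_one (by rw [← mul_pow, hxy, one_pow]))) (h2.trans ?_)
    rw [ambMono_mul, mul_left_comm, ← mul_pow, hxy, one_pow, mul_one]
    congr 1
    ring
  | zero => exact ⟨0, by rw [ambMono_zero, map_zero]⟩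
  | add ζ ξ _ _ hζ hξ =>
    obtain ⟨a, rfl⟩ := hζ
    obtain ⟨b, rfl⟩ := hξ
    exact ⟨a + b, by rw [ambMono_add, map_add]⟩
  | smul r ζ _ hζ =>
    obtain ⟨a, rfl⟩ := hζ
    refine ⟨r • a, ?_⟩
    rw [← smul_ambMono]
    exact (π'.restrictScalars R).map_smul r _

end GradedPieces
end

noncomputable section

set_option linter.unusedSectionVars false

/-! ### Tight closure of zero in the two cohomology modules. -/

section TightClosureOfZero

theorem mem_tightClosure_bot_iff (p : ℕ) [Fact p.Prime] {A L : Type*} [CommRing A] [CommRing L]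
    [Algebra A L] [CharP A p]
    (hinj : Function.Injective (algebraMap A L)) {x : A}
    (hx : IsUnit (algebraMap A L x)) (hL : locSub A L x = ⊤) {ι : Type*} (y : ι → A)
    (hy : ∀ i, IsUnit (algebraMap A L (y i))) {H : Type*} [AddCommGroup H] [Module A H]
    (π : L →ₗ[A] H) (hπ : Function.Surjective π)
    (hker : LinearMap.ker π = ⨆ i, Subalgebra.toSubmodule (locSub A L (y i))) (u : L) :
    π u ∈ tightClosure p (⊥ : Submodule A H) ↔ ∃ c ∈ minimalPrimesCompl A, ∃ e₀ : ℕ, ∀ e ≥ e₀,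
      algebraMap A L c * u ^ p ^ e ∈ LinearMap.ker π := by
  change (∃ c ∈ minimalPrimesCompl A, ∃ e₀ : ℕ, ∀ e ≥ e₀,
    FrobeniusTwist.of p e c • ((1 : FrobeniusTwist A p e) ⊗ₜ[A] π u) ∈
      (⊥ : Submodule A H).baseChange (FrobeniusTwist A p e)) ↔ _
  simp only [Submodule.baseChange_bot, Submodule.mem_bot,
    smul_tmul_eq_zero_iff p hinj hx hL y hy π hπ hker]

variable {R : Type*} [CommRing R] (p : ℕ) [Fact p.Prime] [CharP R p] {I : Ideal R} {d : ℕ}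
  {f : Fin d → R} {hf : ∀ i, f i ∈ I} (hd : 2 ≤ d) (hnzd : ∀ i, f i ∈ nonZeroDivisors R)
  {π : ReesAmbient f →ₗ[reesAlgebra I] ReesLocalCohomology f hf} (hπ : Function.Surjective π)
  (hπc : ∀ u (z : cechCocycles (reesSeq f hf) (d + 1)),
    cechEmb (isUnit_algebraMap_reesSeq hf) z.1 = topCochain f I u →
      π u = cechClass (reesSeq f hf) (d + 1) z)
  (hπk : LinearMap.ker π = reesKer hf)
  {π' : ReesAmbient f →ₗ[extendedReesAlgebra I] ExtendedReesLocalCohomology f hf}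
  (hπ' : Function.Surjective π')
  (hπc' : ∀ u (z : cechCocycles (extendedReesSeq f hf) (d + 1)),
    cechLocHom (isUnit_algebraMap_extendedReesSeq hf) Finset.univ (z.1 Finset.univ) = u →
      π' u = cechClass (extendedReesSeq f hf) (d + 1) z)
  (hπk' : LinearMap.ker π' = extendedReesKer hf)

include hnzd

include hd hπ hπk in
theorem mem_tightClosure_rees_iff (u : ReesAmbient f) :
    π u ∈ tightClosure p (⊥ : Submodule (reesAlgebra I) (ReesLocalCohomology f hf)) ↔
      ∃ c ∈ minimalPrimesCompl (reesAlgebra I), ∃ e₀ : ℕ, ∀ e ≥ e₀,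
        algebraMap _ (ReesAmbient f) c * u ^ p ^ e ∈ reesKer hf := by
  have hd0 : 0 < d := by omega
  rw [← hπk]
  exact mem_tightClosure_bot_iff p (algebraMap_rees_injective hnzd)
    -- R_f[t, t⁻¹] is already the localization of 𝓡 at f_1, …, f_d and one f_jt, which presents it
    -- as inverting a single element.
    (isUnit_algebraMap_prod (isUnit_algebraMap_reesSeq hf) (reesTopIndex ⟨0, hd0⟩))
    (reesLoc_eq_top (isMixed_reesTopIndex _) fun i => isCovered_reesTopIndex i _)
    (fun w => ∏ i ∈ reesKerIndex w, reesSeq f hf i)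
    (fun w => isUnit_algebraMap_prod (isUnit_algebraMap_reesSeq hf) _) π hπ hπk u

include hπ' hπk' in
theorem mem_tightClosure_extendedRees_iff (u : ReesAmbient f) :
    π' u ∈ tightClosure p
      (⊥ : Submodule (extendedReesAlgebra I) (ExtendedReesLocalCohomology f hf)) ↔
      ∃ c ∈ minimalPrimesCompl (extendedReesAlgebra I), ∃ e₀ : ℕ, ∀ e ≥ e₀,
        algebraMap _ (ReesAmbient f) c * u ^ p ^ e ∈ extendedReesKer hf := by
  rw [← hπk']
  exact mem_tightClosure_bot_iff p (algebraMap_extendedRees_injective hnzd)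
    (isUnit_algebraMap_prod (isUnit_algebraMap_extendedReesSeq hf) Finset.univ)
    extendedReesLoc_univ
    (fun i => ∏ j ∈ Finset.univ.erase i, extendedReesSeq f hf j)
    (fun i => isUnit_algebraMap_prod (isUnit_algebraMap_extendedReesSeq hf) _) π' hπ' hπk' u

include hd hπ hπc hπk hπ' hπc' hπk' in
-- From left to right, each negative component of u is isolated by a degree block and inherits the
-- multiplier c. From right to left, a homogeneous class of negative degree is its own truncation,
-- and its multiplier is moved into 𝓡 by a power of f_1t.
theorem map_tightClosure_rees_eq
    {γ : ReesLocalCohomology f hf →ₗ[R] ExtendedReesLocalCohomology f hf}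
    (hγ : IsReesComparison f hf γ) :
    ((tightClosure p (⊥ : Submodule (reesAlgebra I) (ReesLocalCohomology f hf))).restrictScalars
        R).map γ =
      ⨆ (j : ℤ) (_ : j < 0),
        (tightClosure p (⊥ : Submodule (extendedReesAlgebra I)
          (ExtendedReesLocalCohomology f hf))).restrictScalars R ⊓
          extendedReesLocalCohomologyPiece f hf j := by
  classical
  have hd0 : 0 < d := by omega
  have hinj := algebraMap_rees_injective (I := I) hnzd
  have : Nontrivial (reesAlgebra I) :=
    CharP.nontrivial_of_char_ne_one (R := reesAlgebra I) (Fact.out : p.Prime).ne_one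
  have : Nontrivial (ReesAmbient f) := hinj.nontrivial
  have : CharP (ReesAmbient f) p := charP_of_algebra_nontrivial p (reesAlgebra I) _
  have hγ' := (isReesComparison_iff hd hπc hπk hπc').1 hγ
  apply le_antisymm
  · rintro _ ⟨ζ, hζ, rfl⟩
    obtain ⟨u, rfl⟩ := hπ ζ
    rw [hγ']
    obtain ⟨c, hc, e₀, he⟩ := (mem_tightClosure_rees_iff p hd hnzd hπ hπk u).1 hζ
    refine ambient_induction (P := fun v => π' v ∈ ⨆ (j : ℤ) (_ : j < 0),
        (tightClosure p (⊥ : Submodule (extendedReesAlgebra I)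
          (ExtendedReesLocalCohomology f hf))).restrictScalars R ⊓
          extendedReesLocalCohomologyPiece f hf j) (ambRestr f (Set.Iio 0) u) ?_ ?_ fun n => ?_
    · rw [map_zero]; exact zero_mem _
    · intro v w hv hw
      rw [map_add]; exact add_mem hv hw
    · rw [ambCoeff_restr]
      by_cases hn : n < 0
      swap
      · rw [if_neg (by simpa using hn), ambMono_zero, map_zero]; exact zero_mem _
      rw [if_pos (Set.mem_Iio.2 hn)]
      refine Submodule.mem_iSup_of_mem n (Submodule.mem_iSup_of_mem hn ⟨?_, ?_⟩)
      -- The exponent e must also be at least the degree of c, so that deg c < p^e and the blocks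
      -- are disjoint.
      · refine (mem_tightClosure_extendedRees_iff p hnzd hπ' hπk' _).2
          ⟨_, reesInclusion_mem_minimalPrimesCompl hnzd ⟨0, hd0⟩ hf hc, max e₀ c.1.natDegree,
            fun e he' => ?_⟩
        have h1 := (mem_reesKer_iff hd).1 (he e ((le_max_left _ _).trans he'))
        have hdeg : c.1.natDegree < p ^ e :=
          ((le_max_right _ _).trans he').trans_lt (Nat.lt_pow_self (Fact.out : p.Prime).one_lt)
        -- For n < 0 the whole block [nq, (n+1)q) lies in negative degrees, so cutting out the block
        -- after truncation loses nothing.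
        have h2 := ambRestr_mem_extendedReesKer (Set.Ico (n * p ^ e) ((n + 1) * p ^ e)) h1
        rwa [ambRestr_ambRestr, ambRestr_algebraMap_mul_pow p e c hdeg] at h2
        rintro k ⟨-, hk⟩
        have : (n + 1) * (p : ℤ) ^ e ≤ 0 :=
          mul_nonpos_of_nonpos_of_nonneg (by omega) (by positivity)
        exact lt_of_lt_of_le hk this
      · exact map_ambMono_mem_piece hπc' hnzd hd0 hn.le _
  · refine iSup_le fun j => iSup_le fun hj => ?_
    rintro ζ ⟨hζ, hζj⟩
    obtain ⟨a, rfl⟩ := exists_ambMono_of_mem_piece hπc' hnzd hζj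
    refine ⟨π (ambMono f j a), ?_, ?_⟩
    · obtain ⟨c, hc, e₀, he⟩ := (mem_tightClosure_extendedRees_iff p hnzd hπ' hπk' _).1 hζ
      obtain ⟨N, c', hc'⟩ := exists_pow_mul_eq_reesInclusion hf ⟨0, hd0⟩ c
      refine (mem_tightClosure_rees_iff p hd hnzd hπ hπk _).2
        ⟨c', mem_minimalPrimesCompl_of_reesInclusion (hf := hf) hnzd ⟨0, hd0⟩ hc hc', e₀,
          fun e he' => mem_reesKer_of_mem_extendedReesKer hd ?_⟩
      rw [← algebraMap_reesInclusion, hc', map_mul, mul_assoc, ← Algebra.smul_def]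
      exact Submodule.smul_mem _ _ (he e he')
    · rw [hγ', ambRestr_ambMono_of_mem (Set.mem_Iio.2 hj)]

end TightClosureOfZero
end

noncomputable section

/-! ### Parameter ideals indexed by finite types. -/

section ParameterIdeals

theorem ofList_toList_map {A ι : Type*} [CommRing A] (s : Finset ι) (y : ι → A) :
    Ideal.ofList (s.toList.map y) = Ideal.span (y '' s) := by
  refine congrArg Ideal.span (Set.ext fun a => ?_)
  simp

theorem ofList_cons_toList_erase {A ι : Type*} [CommRing A] [Fintype ι] [DecidableEq ι] (i : ι)
    (y : ι → A) :
    Ideal.ofList (y i :: ((Finset.univ.erase i).toList.map y)) = Ideal.span (Set.range y) := by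
  rw [Ideal.ofList_cons, ofList_toList_map, ← Ideal.span_union, ← Set.image_univ]
  congr 1
  rw [← Set.image_singleton, ← Set.image_union]
  congr 1
  ext j
  simp

theorem length_toList_erase_map {A ι : Type*} [Fintype ι] [DecidableEq ι] (i : ι) (y : ι → A) :
    ((Finset.univ.erase i).toList.map y).length + 1 = Fintype.card ι := by
  rw [List.length_map, Finset.length_toList, Finset.card_erase_of_mem (Finset.mem_univ i),
    Finset.card_univ]
  have : 0 < Fintype.card ι := Fintype.card_pos_iff.2 ⟨i⟩
  omega

/-- Parameters in a ring of full depth form a regular sequence in every order, so y_i may be put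
first. -/
theorem mem_nonZeroDivisors_of_radical_eq {B : Type u} [CommRing B] [IsLocalRing B]
    [IsNoetherianRing B] {ι : Type*} [Fintype ι] {y : ι → B}
    (hB : DepthGE B B (Fintype.card ι))
    (hy : (Ideal.span (Set.range y)).radical = IsLocalRing.maximalIdeal B) (i : ι) :
    y i ∈ nonZeroDivisors B := by
  classical
  rw [← length_toList_erase_map i y] at hB
  have hmem : ∀ z ∈ y i :: ((Finset.univ.erase i).toList.map y),
      z ∈ IsLocalRing.maximalIdeal B := by
    intro z hz
    rw [← hy, ← ofList_cons_toList_erase i y]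
    exact Ideal.le_radical (Ideal.subset_span hz)
  have hreg := isWeaklyRegular_of_le_radical (M := B) _ hmem hB (by
    rw [ofList_cons_toList_erase, ← hy]
    exact Ideal.radical_mono le_sup_right)
  have h1 := ((RingTheory.Sequence.isWeaklyRegular_cons_iff _ _ _).1 hreg).1
  rw [mem_nonZeroDivisors_iff_right]
  intro z hz
  exact h1 (by simpa [mul_comm] using hz)

theorem IsReductionOf.radical_eq {R : Type*} [CommRing R] {J I : Ideal R} (h : IsReductionOf J I) :
    J.radical = I.radical := by
  obtain ⟨hJI, n, hn⟩ := h
  refine le_antisymm (Ideal.radical_mono hJI) ?_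
  rw [← Ideal.radical_pow I (Nat.succ_ne_zero n), hn]
  exact Ideal.radical_mono Ideal.mul_le_left

end ParameterIdeals
end

noncomputable section

/-! ### Regularity of a sequence at a maximal ideal. -/

section RegularAt

open RingTheory.Sequence Pointwise

theorem isRegularAt_cons {A : Type*} [CommRing A] {𝔪 J : Ideal A} {v : A} {vs : List A} :
    IsRegularAt 𝔪 J (v :: vs) ↔
      (∀ a, v * a ∈ J → ∃ s ∉ 𝔪, s * a ∈ J) ∧ IsRegularAt 𝔪 (Ideal.span {v} ⊔ J) vs :=
  Iff.rfl

/-- Dividing `B / J` by a further element. -/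
def quotSMulTopQuotientEquiv {B : Type*} [CommRing B] (v : B) (J : Ideal B) :
    QuotSMulTop v (B ⧸ J) ≃ₗ[B] B ⧸ (Ideal.span {v} ⊔ J) :=
  (Submodule.quotEquivOfEq _ _ (by
      rw [← Ideal.submodule_span_eq, Submodule.map_span, Set.image_singleton]
      ext a
      rw [Submodule.mem_smul_pointwise_iff_exists, Submodule.mem_span_singleton]
      constructor
      · rintro ⟨b, -, rfl⟩
        obtain ⟨b, rfl⟩ := Submodule.Quotient.mk_surjective _ b
        exact ⟨b, by rw [Submodule.mkQ_apply, ← Submodule.Quotient.mk_smul,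
          ← Submodule.Quotient.mk_smul, smul_eq_mul, smul_eq_mul, mul_comm]⟩
      · rintro ⟨b, rfl⟩
        exact ⟨Submodule.Quotient.mk b, trivial, by rw [Submodule.mkQ_apply,
          ← Submodule.Quotient.mk_smul, ← Submodule.Quotient.mk_smul, smul_eq_mul, smul_eq_mul,
          mul_comm]⟩)).trans
    ((Submodule.quotientQuotientEquivQuotientSup J (Ideal.span {v})).trans
      (Submodule.quotEquivOfEq _ _ (sup_comm _ _)))

theorem isRegularAt_maximalIdeal_iff {B : Type*} [CommRing B] [IsLocalRing B] {ws : List B} :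
    ∀ {J : Ideal B}, IsRegularAt (IsLocalRing.maximalIdeal B) J ws ↔
      IsWeaklyRegular (B ⧸ J) ws := by
  induction ws with
  | nil => exact fun {J} => ⟨fun _ => IsWeaklyRegular.nil _ _, fun _ => trivial⟩
  | cons v ws ih =>
    intro J
    rw [isRegularAt_cons, isWeaklyRegular_cons_iff, isSMulRegular_quotient_iff_mem_of_smul_mem,
      (quotSMulTopQuotientEquiv v J).isWeaklyRegular_congr, ih]
    refine and_congr_left fun _ => forall_congr' fun a => imp_congr_right fun _ => ?_
    constructor
    · rintro ⟨s, hs, h⟩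
      exact (Ideal.unit_mul_mem_iff_mem _ (IsLocalRing.notMem_maximalIdeal.1 hs)).1 h
    · exact fun h => ⟨1, (Ideal.ne_top_iff_one _).1 (IsLocalRing.maximalIdeal.isMaximal B).ne_top,
        by rwa [one_mul]⟩

theorem isRegularAt_map_iff {A B : Type*} [CommRing A] [CommRing B] [Algebra A B] (𝔪 : Ideal A)
    [𝔪.IsPrime] [IsLocalization.AtPrime B 𝔪] [IsLocalRing B] {vs : List A} :
    ∀ {J : Ideal A}, IsRegularAt (IsLocalRing.maximalIdeal B) (J.map (algebraMap A B))
      (vs.map (algebraMap A B)) ↔ IsRegularAt 𝔪 J vs := by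
  induction vs with
  | nil => exact fun {J} => Iff.rfl
  | cons v vs ih =>
    intro J
    rw [List.map_cons, isRegularAt_cons, isRegularAt_cons, ← ih, Ideal.map_sup, Ideal.map_span,
      Set.image_singleton]
    refine and_congr_left fun _ => ?_
    have hmem : ∀ a, algebraMap A B a ∈ J.map (algebraMap A B) ↔ ∃ s ∉ 𝔪, s * a ∈ J :=
      IsLocalization.algebraMap_mem_map_algebraMap_iff 𝔪.primeCompl B J
    have hunit : ∀ s ∉ 𝔪, IsUnit (algebraMap A B s) := fun s hs =>
      IsLocalization.map_units B (⟨s, hs⟩ : 𝔪.primeCompl)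
    constructor
    · intro h a ha
      obtain ⟨s, hs, hsa⟩ := h (algebraMap A B a) (by
        rw [← map_mul]
        exact Ideal.mem_map_of_mem _ ha)
      rw [Ideal.unit_mul_mem_iff_mem _ (IsLocalRing.notMem_maximalIdeal.1 hs)] at hsa
      exact (hmem a).1 hsa
    · intro h b hb
      obtain ⟨⟨a, t⟩, hat⟩ := IsLocalization.surj 𝔪.primeCompl b
      obtain ⟨s, hs, hsa⟩ := (hmem (v * a)).1 (by
        rw [map_mul, ← hat, ← mul_assoc]
        exact Ideal.mul_mem_right _ _ hb)
      obtain ⟨s', hs', hsa'⟩ := h (s * a) (by rwa [mul_left_comm])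
      refine ⟨algebraMap A B (s' * s * t), IsLocalRing.notMem_maximalIdeal.2 (hunit _ ?_), ?_⟩
      · exact 𝔪.primeCompl.mul_mem (𝔪.primeCompl.mul_mem hs' hs) t.2
      · rw [map_mul, mul_assoc, mul_comm _ b, hat, ← map_mul, mul_assoc]
        exact Ideal.mem_map_of_mem _ hsa'

/-- The hypotheses say that φ induces an isomorphism from A/J to B/K, and regularity depends only on
the quotient ring. It is applied to 𝓡/I𝓡 and 𝓡'/t⁻¹𝓡'. -/
theorem IsRegularAt.map_of_quotient {A B : Type*} [CommRing A] [CommRing B] (φ : A →+* B)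
    {𝔪 : Ideal A} {𝔫 : Ideal B} (h𝔪 : ∀ s ∉ 𝔪, φ s ∉ 𝔫) {vs : List A} :
    ∀ {J : Ideal A} {K : Ideal B}, (∀ b, ∃ a, b - φ a ∈ K) → (∀ a, φ a ∈ K ↔ a ∈ J) →
      IsRegularAt 𝔪 J vs → IsRegularAt 𝔫 K (vs.map φ) := by
  induction vs with
  | nil => exact fun _ _ _ => trivial
  | cons v vs ih =>
    intro J K hs hc ⟨h1, h2⟩
    refine ⟨fun b hb => ?_, ih (fun b => ?_) (fun a => ?_) h2⟩
    · obtain ⟨a, ha⟩ := hs b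
      obtain ⟨s, hs, hsa⟩ := h1 a ((hc _).1 (by
        rw [map_mul, ← sub_sub_cancel (φ v * b) (φ v * φ a), ← mul_sub]
        exact sub_mem hb (Ideal.mul_mem_left _ _ ha)))
      refine ⟨φ s, h𝔪 s hs, ?_⟩
      rw [← sub_add_cancel b (φ a), mul_add, ← map_mul]
      exact add_mem (Ideal.mul_mem_left _ _ ha) ((hc _).2 hsa)
    · obtain ⟨a, ha⟩ := hs b
      exact ⟨a, Ideal.mem_sup_right ha⟩
    · rw [Ideal.mem_span_singleton_sup, Ideal.mem_span_singleton_sup]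
      constructor
      · rintro ⟨b, k, hk, hb⟩
        obtain ⟨a', ha'⟩ := hs b
        refine ⟨a', a - a' * v, (hc _).1 ?_, by ring⟩
        rw [map_sub, map_mul, ← hb]
        convert add_mem hk (Ideal.mul_mem_right (φ v) _ ha') using 1
        ring
      · rintro ⟨b, j, hj, rfl⟩
        exact ⟨φ b, φ j, (hc _).2 hj, by rw [map_add, map_mul]⟩

end RegularAt

/-! ### Primary ideals, Frobenius powers and localization. -/

section Primary

theorem Ideal.mem_of_mul_mem_of_radical_eq {A : Type*} [CommRing A] {J 𝔪 : Ideal A}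
    [h𝔪 : 𝔪.IsMaximal] (hJ : J.radical = 𝔪) {s a : A} (hs : s ∉ 𝔪) (h : s * a ∈ J) : a ∈ J := by
  have h1 : J.IsPrimary := Ideal.isPrimary_of_isMaximal_radical (by rwa [hJ])
  rw [mul_comm] at h
  exact ((Ideal.isPrimary_iff.1 h1).2 h).resolve_right (by rwa [hJ])

theorem algebraMap_mem_map_iff_of_radical_eq {A B : Type*} [CommRing A] [CommRing B] [Algebra A B]
    {J 𝔪 : Ideal A} [h𝔪 : 𝔪.IsMaximal] [IsLocalization.AtPrime B 𝔪] (hJ : J.radical = 𝔪) {a : A} :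
    algebraMap A B a ∈ J.map (algebraMap A B) ↔ a ∈ J := by
  refine ⟨fun h => ?_, Ideal.mem_map_of_mem _⟩
  obtain ⟨s, hs, h⟩ := (IsLocalization.algebraMap_mem_map_algebraMap_iff 𝔪.primeCompl B J a).1 h
  exact Ideal.mem_of_mul_mem_of_radical_eq hJ hs h

theorem radical_span_pow {A ι : Type*} [CommRing A] (x : ι → A) {l : ℕ} (hl : l ≠ 0) :
    (Ideal.span (Set.range fun i => x i ^ l)).radical = (Ideal.span (Set.range x)).radical := by
  apply le_antisymm
  · refine Ideal.radical_mono (Ideal.span_le.2 ?_)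
    rintro _ ⟨i, rfl⟩
    exact Ideal.pow_mem_of_mem (Ideal.span (Set.range x)) (Ideal.subset_span ⟨i, rfl⟩) _
      (Nat.pos_of_ne_zero hl)
  · refine Ideal.radical_le_radical_iff.2 (Ideal.span_le.2 ?_)
    rintro _ ⟨i, rfl⟩
    exact ⟨l, Ideal.subset_span ⟨i, rfl⟩⟩

theorem radical_map_iterateFrobenius {A : Type*} [CommRing A] (p e : ℕ) [Fact p.Prime] [CharP A p]
    (J : Ideal A) : (J.map (iterateFrobenius A p e)).radical = J.radical := by
  have hq : 0 < p ^ e := pow_pos (Fact.out : p.Prime).pos e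
  apply le_antisymm
  · refine Ideal.radical_mono (Ideal.map_le_iff_le_comap.2 fun a ha => ?_)
    rw [Ideal.mem_comap, iterateFrobenius_def]
    exact Ideal.pow_mem_of_mem _ ha _ hq
  · refine Ideal.radical_le_radical_iff.2 fun a ha => ⟨p ^ e, ?_⟩
    rw [← iterateFrobenius_def]
    exact Ideal.mem_map_of_mem _ ha

theorem map_map_iterateFrobenius {A B : Type*} [CommRing A] [CommRing B] [Algebra A B] (p e : ℕ)
    [Fact p.Prime] [CharP A p] [CharP B p] (J : Ideal A) :
    (J.map (iterateFrobenius A p e)).map (algebraMap A B)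
      = (J.map (algebraMap A B)).map (iterateFrobenius B p e) := by
  rw [Ideal.map_map, Ideal.map_map]
  congr 1
  ext a
  simp [iterateFrobenius_def]

theorem algebraMap_mem_minimalPrimesCompl {A B : Type*} [CommRing A] [CommRing B] [Algebra A B]
    (M : Submonoid A) [IsLocalization M B] {c : A} (hc : c ∈ minimalPrimesCompl A) :
    algebraMap A B c ∈ minimalPrimesCompl B := by
  intro Q hQ hcQ
  have h := IsLocalization.minimalPrimes_map M B (⊥ : Ideal A)
  rw [Ideal.map_bot] at h
  have hQ' : Q ∈ Ideal.under A ⁻¹' (⊥ : Ideal A).minimalPrimes := h ▸ hQ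
  exact hc _ hQ' hcQ

theorem mem_minimalPrimesCompl_of_injective {A B : Type*} [CommRing A] [CommRing B] {φ : A →+* B}
    (hφ : Function.Injective φ) {c : A} (hc : φ c ∈ minimalPrimesCompl B) :
    c ∈ minimalPrimesCompl A := by
  rw [mem_minimalPrimesCompl_iff] at hc ⊢
  intro b hb
  refine (IsNilpotent.map_iff hφ).1 (hc _ ?_)
  rw [← map_mul]
  exact hb.map φ

end Primary

/-! ### Powers of parameters in a ring of full depth. -/

section SystemsOfParameters

variable {B : Type u} [CommRing B] [IsLocalRing B] [IsNoetherianRing B] {ι : Type*} [Fintype ι]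
  {y : ι → B} (hB : DepthGE B B (Fintype.card ι))
  (hy : (Ideal.span (Set.range y)).radical = IsLocalRing.maximalIdeal B)

include hB hy

theorem mem_span_pow_of_pow_mul_mem (i : ι) {e e' : ι → ℕ} {N : ℕ} (he : ∀ j, e j ≠ 0)
    (hne : ∀ j ≠ i, e' j = e j) (hi : e' i = e i + N) {a : B}
    (h : y i ^ N * a ∈ Ideal.span (Set.range fun j => y j ^ e' j)) :
    a ∈ Ideal.span (Set.range fun j => y j ^ e j) := by
  classical
  set w : List B := (Finset.univ.erase i).toList.map fun j => y j ^ e j with hw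
  have hw' : (Finset.univ.erase i).toList.map (fun j => y j ^ e' j) = w := by
    refine List.map_congr_left fun j hj => ?_
    rw [hne j (by simpa using hj)]
  rw [← ofList_cons_toList_erase i, hw', Ideal.ofList_cons, Ideal.mem_span_singleton_sup] at h
  rw [← ofList_cons_toList_erase i, ← hw, Ideal.ofList_cons, Ideal.mem_span_singleton_sup]
  obtain ⟨g, b, hb, hab⟩ := h
  refine ⟨g, a - g * y i ^ e i, ?_, by ring⟩
  have hmul : y i ^ N * (a - g * y i ^ e i) ∈ Ideal.ofList w := by
    convert hb using 1
    rw [hi, pow_add] at hab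
    linear_combination -hab
  -- The case N = 0 is separate because y_i^0 = 1 is not in the maximal ideal.
  rcases Nat.eq_zero_or_pos N with rfl | hN
  · simpa using hmul
  have hym : ∀ j, y j ∈ IsLocalRing.maximalIdeal B := fun j =>
    hy ▸ Ideal.le_radical (Ideal.subset_span ⟨j, rfl⟩)
  refine isSMulRegular_of_le_radical (y i ^ N) w ?_ ?_ ?_ hmul
  · intro z hz
    rcases List.mem_cons.1 hz with rfl | hz
    · exact Ideal.pow_mem_of_mem _ (hym i) _ hN
    · obtain ⟨j, -, rfl⟩ := List.mem_map.1 hz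
      exact Ideal.pow_mem_of_mem _ (hym j) _ (Nat.pos_of_ne_zero (he j))
  · rw [hw, length_toList_erase_map]
    exact hB
  · rw [← hy]
    refine Ideal.radical_le_radical_iff.2 (Ideal.span_le.2 ?_)
    rintro _ ⟨j, rfl⟩
    by_cases hj : j = i
    · subst hj
      exact ⟨N, Ideal.subset_span List.mem_cons_self⟩
    · refine ⟨e j, Ideal.subset_span (List.mem_cons_of_mem _ ?_)⟩
      exact List.mem_map.2 ⟨j, by simpa using hj, rfl⟩

/-- The transition maps from B/(y_i^k) to B/(y_i^{k+N}) in the limit defining top local cohomology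
are injective. The factors y_i^N are cancelled one index at a time, each being regular modulo powers
of the others. -/
theorem mem_span_pow_of_prod_pow_mul_mem {k N : ℕ} (hk : k ≠ 0) {a : B}
    (h : (∏ i, y i) ^ N * a ∈ Ideal.span (Set.range fun i => y i ^ (k + N))) :
    a ∈ Ideal.span (Set.range fun i => y i ^ k) := by
  classical
  have key : ∀ (s : Finset ι) (a : B), (∏ i ∈ s, y i) ^ N * a ∈
      Ideal.span (Set.range fun i => y i ^ (if i ∈ s then k + N else k)) →
      a ∈ Ideal.span (Set.range fun i => y i ^ k) := by
    intro s
    induction s using Finset.induction_on with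
    | empty => exact fun a h => by simpa using h
    | insert i s hi ih =>
      intro a h
      rw [Finset.prod_insert hi, mul_pow, mul_assoc] at h
      refine ih a (mem_span_pow_of_pow_mul_mem hB hy i (e' := fun j =>
        if j ∈ insert i s then k + N else k) (N := N) (fun j => ?_) (fun j hj => ?_) ?_ h)
      · split_ifs <;> omega
      · simp [hj]
      · simp [hi]
  exact key Finset.univ a (by simpa using h)

end SystemsOfParameters

theorem ofList_ofFn {A : Type*} [CommRing A] {n : ℕ} (y : Fin n → A) :
    Ideal.ofList (List.ofFn y) = Ideal.span (Set.range y) := by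
  refine congrArg Ideal.span (Set.ext fun a => ?_)
  simp [List.mem_ofFn]

/-- If the ideal of one system of parameters is tightly closed, then so are the ideals generated by
the powers of any other one. -/
theorem tightClosure_span_pow_le (p : ℕ) [Fact p.Prime] {B : Type u} [CommRing B] [IsLocalRing B]
    [IsNoetherianRing B] [CharP B p] {n : ℕ} (hn : n ≠ 0) (hB : DepthGE B B n) {x y : Fin n → B}
    (hx : (Ideal.span (Set.range x)).radical = IsLocalRing.maximalIdeal B)
    (hy : (Ideal.span (Set.range y)).radical = IsLocalRing.maximalIdeal B)
    (htc : tightClosure p (Ideal.span (Set.range y)) ≤ Ideal.span (Set.range y)) {l : ℕ}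
    (hl : l ≠ 0) :
    tightClosure p (Ideal.span (Set.range fun i => x i ^ l)) ≤
      Ideal.span (Set.range fun i => x i ^ l) := by
  have hcard : DepthGE B B (Fintype.card (Fin n)) := by rwa [Fintype.card_fin]
  have hnzd := mem_nonZeroDivisors_of_radical_eq hcard hy
  have hmem : ∀ {z : Fin n → B},
      (Ideal.span (Set.range z)).radical = IsLocalRing.maximalIdeal B →
      ∀ a ∈ List.ofFn z, a ∈ IsLocalRing.maximalIdeal B := fun hz a ha =>
    hz ▸ Ideal.le_radical (Ideal.subset_span ((List.mem_ofFn' _ _).1 ha))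
  have hpow : ∀ {k : ℕ}, k ≠ 0 → tightClosure p (Ideal.span (Set.range fun i => y i ^ k)) ≤
      Ideal.span (Set.range fun i => y i ^ k) := by
    intro k hk
    have := tightClosure_ofList_map_pow_le p (List.ofFn y) (hmem hy) (by rwa [List.length_ofFn])
      (by rw [ofList_ofFn, hy]) (by rwa [ofList_ofFn]) hk
    rwa [List.map_ofFn, ofList_ofFn] at this
  have hxl : (Ideal.span (Set.range fun i => x i ^ l)).radical = IsLocalRing.maximalIdeal B :=
    (radical_span_pow x hl).trans hx
  have hreg : IsRegularAt (IsLocalRing.maximalIdeal B) ⊥ (List.ofFn fun i => x i ^ l) := by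
    rw [isRegularAt_maximalIdeal_iff,
      (Submodule.quotEquivOfEqBot (⊥ : Ideal B) rfl).isWeaklyRegular_congr]
    refine isWeaklyRegular_of_le_radical _ (hmem hxl) (by rwa [List.length_ofFn]) ?_
    rw [ofList_ofFn, ← hxl]
    exact Ideal.radical_mono le_sup_right
  obtain ⟨m, rfl⟩ := Nat.exists_eq_succ_of_ne_zero hn
  -- In H^n computed from y there is a class annihilated exactly by (x_i^l). Written as a fraction
  -- with denominator a power of ∏ y_i, it exhibits (x_i^l) as a colon ideal of some (y_i^{k+1}),
  -- which is tightly closed.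
  have hζ := exists_cechCohomology_annihilator hy _ hreg (by rw [ofList_ofFn, hxl])
  rw [List.length_ofFn, ofList_ofFn] at hζ
  obtain ⟨ζ, hζ1, hζ2⟩ := hζ
  set L := Localization.Away (∏ i, y i)
  have hprod : IsUnit (algebraMap B L (∏ i, y i)) := IsLocalization.Away.algebraMap_isUnit _
  have hunit : ∀ i, IsUnit (algebraMap B L (y i)) := fun i =>
    isUnit_of_dvd_unit (map_dvd _ (Finset.dvd_prod_of_mem y (Finset.mem_univ i))) hprod
  have hinj : Function.Injective (algebraMap B L) :=
    IsLocalization.injective L (M := Submonoid.powers (∏ i, y i)) (by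
      rw [Submonoid.powers_le]
      exact prod_mem fun i _ => hnzd i)
  have hL : ∀ u : L, ∃ (k : ℕ) (b : B), algebraMap B L (∏ i, y i) ^ k * u = algebraMap B L b := by
    intro u
    obtain ⟨k, b, h⟩ := IsLocalization.Away.surj (∏ i, y i) u
    exact ⟨k, b, by rw [mul_comm, h]⟩
  obtain ⟨π, hπ, -, hker⟩ := exists_cechCohomology_top hunit hinj
    (eq_top_iff.2 fun u _ => hL u) (Fintype.card_fin (m + 1))
  obtain ⟨u, rfl⟩ := hπ ζ
  obtain ⟨k, b, hkb⟩ := hL u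
  -- Numerator and denominator are multiplied by ∏ y_i to make the exponent nonzero.
  have hu : algebraMap B L (∏ i, y i) ^ (k + 1) * u = algebraMap B L ((∏ i, y i) * b) := by
    rw [map_mul, ← hkb]
    ring
  refine tightClosure_le_of_colon p ((∏ i, y i) * b) (fun a => ?_) (hpow (Nat.succ_ne_zero k))
  have hann : a • π u = 0 ↔ ∃ N, (∏ i, y i) ^ N * (a * ((∏ i, y i) * b)) ∈
      Ideal.span (Set.range fun i => y i ^ (k + 1 + N)) := by
    rw [← map_smul, ← LinearMap.mem_ker, hker]
    refine mem_iSup_locSub_iff hunit hinj ?_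
    rw [Algebra.smul_def, mul_left_comm, hu, ← map_mul]
  constructor
  · intro ha
    obtain ⟨s, hs, h⟩ := hζ2 a (hann.2 ⟨0, by simpa using ha⟩)
    exact (Ideal.unit_mul_mem_iff_mem _ (IsLocalRing.notMem_maximalIdeal.1 hs)).1 h
  · intro ha
    obtain ⟨N, hN⟩ := hann.1 (hζ1 a ha)
    exact mem_span_pow_of_prod_pow_mul_mem hcard hy (Nat.succ_ne_zero k) hN
end

noncomputable section

/-! ### The ideals I𝓡, 𝓡_+ and t⁻¹𝓡'. -/

section ReesIdeals

open Polynomial LaurentPolynomial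

variable {R : Type*} [CommRing R] {I : Ideal R}

/-- The element `a tⁿ` of the Rees algebra, for `a ∈ Iⁿ`. -/
def reesMonomial (n : ℕ) (a : R) (ha : a ∈ I ^ n) : reesAlgebra I :=
  ⟨Polynomial.monomial n a, reesAlgebra.monomial_mem.2 ha⟩

theorem sum_reesMonomial (q : reesAlgebra I) :
    ∑ n ∈ q.1.support, reesMonomial n (q.1.coeff n) (q.2 n) = q := by
  apply Subtype.ext
  rw [AddSubmonoidClass.coe_finsetSum]
  exact q.1.as_sum_support.symm

theorem rees_mem_of_monomial_mem {J : Ideal (reesAlgebra I)} {q : reesAlgebra I}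
    (h : ∀ n, reesMonomial n (q.1.coeff n) (q.2 n) ∈ J) : q ∈ J := by
  rw [← sum_reesMonomial q]
  exact sum_mem fun n _ => h n

/-- The projection of the Rees algebra onto its part of degree zero. -/
def reesConst (I : Ideal R) : reesAlgebra I →+* R :=
  (Polynomial.constantCoeff : R[X] →+* R).comp (reesAlgebra I).val.toRingHom

theorem reesConst_apply (q : reesAlgebra I) : reesConst I q = q.1.coeff 0 := rfl

theorem reesConst_algebraMap (r : R) : reesConst I (algebraMap R _ r) = r := by
  change (Polynomial.C r).coeff 0 = r
  simp

theorem mem_reesIrrelevant_iff {q : reesAlgebra I} : q ∈ reesIrrelevant I ↔ q.1.coeff 0 = 0 :=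
  Iff.rfl

theorem sub_algebraMap_mem_reesIrrelevant (q : reesAlgebra I) :
    q - algebraMap R _ (q.1.coeff 0) ∈ reesIrrelevant I := by
  change reesConst I _ = 0
  rw [map_sub, reesConst_algebraMap, reesConst_apply, sub_self]

/-- I𝓡 is the sum of the I^{n+1} t^n because I · I^n = I^{n+1}. It is 𝓡_+ shifted down by one
degree. -/
theorem mem_map_algebraMap_rees_iff {q : reesAlgebra I} :
    q ∈ I.map (algebraMap R (reesAlgebra I)) ↔ ∀ n, q.1.coeff n ∈ I ^ (n + 1) := by
  constructor
  · intro h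
    induction h using Submodule.span_induction with
    | mem x hx =>
      obtain ⟨a, ha, rfl⟩ := hx
      intro n
      change (Polynomial.C a).coeff n ∈ _
      rw [Polynomial.coeff_C]
      split_ifs with h
      · subst h
        simpa using ha
      · exact zero_mem _
    | zero => exact fun n => zero_mem _
    | add x y _ _ hx hy => exact fun n => by simpa using add_mem (hx n) (hy n)
    | smul a x _ hx =>
      intro n
      change (a.1 * x.1).coeff n ∈ _
      rw [Polynomial.coeff_mul]
      refine sum_mem fun k hk => ?_
      rw [← Finset.HasAntidiagonal.mem_antidiagonal.1 hk, add_assoc, pow_add]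
      exact Ideal.mul_mem_mul (a.2 _) (hx _)
  · intro h
    refine rees_mem_of_monomial_mem fun n => ?_
    have key : ∀ a ∈ I * I ^ n, ∃ ha : a ∈ I ^ n,
        reesMonomial n a ha ∈ I.map (algebraMap R (reesAlgebra I)) := by
      intro a ha
      induction ha using Submodule.mul_induction_on' with
      | mem_mul_mem a ha b hb =>
        refine ⟨Ideal.mul_mem_left _ _ hb, ?_⟩
        have : reesMonomial n (a * b) (Ideal.mul_mem_left _ _ hb)
            = algebraMap R _ a * reesMonomial n b hb := by
          apply Subtype.ext
          change Polynomial.monomial n (a * b) = Polynomial.C a * Polynomial.monomial n b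
          rw [Polynomial.C_mul_monomial]
        rw [this]
        exact Ideal.mul_mem_right _ _ (Ideal.mem_map_of_mem _ ha)
      | add a _ b _ ha hb =>
        obtain ⟨ha, ha'⟩ := ha
        obtain ⟨hb, hb'⟩ := hb
        refine ⟨add_mem ha hb, ?_⟩
        have : reesMonomial n (a + b) (add_mem ha hb)
            = reesMonomial n a ha + reesMonomial n b hb :=
          Subtype.ext (map_add (Polynomial.monomial n) a b)
        rw [this]
        exact add_mem ha' hb'
    exact (key _ (by rw [← pow_succ']; exact h n)).2

/-- Shifting degrees by one turns 𝓡_+ into I𝓡, and the factor at in place of a compensates for the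
shift. This makes 𝓡_+ and I𝓡 isomorphic 𝓡-modules when a is a nonzerodivisor. -/
theorem span_mul_reesIrrelevant_eq {a : R} (ha : a ∈ I) :
    Ideal.span {algebraMap R (reesAlgebra I) a} * reesIrrelevant I
      = Ideal.span {reesT a ha} * I.map (algebraMap R (reesAlgebra I)) := by
  ext q
  rw [Ideal.mem_span_singleton_mul, Ideal.mem_span_singleton_mul]
  constructor
  · rintro ⟨z, hz, rfl⟩
    refine ⟨⟨z.1.divX, fun n => ?_⟩, mem_map_algebraMap_rees_iff.2 fun n => ?_, ?_⟩
    · rw [Polynomial.coeff_divX]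
      exact Ideal.pow_le_pow_right (Nat.le_succ n) (z.2 (n + 1))
    · change z.1.divX.coeff n ∈ _
      rw [Polynomial.coeff_divX]
      exact z.2 (n + 1)
    · apply Subtype.ext
      change Polynomial.monomial 1 a * z.1.divX = Polynomial.C a * z.1
      conv_rhs => rw [← Polynomial.divX_mul_X_add z.1, mem_reesIrrelevant_iff.1 hz, map_zero,
        add_zero]
      rw [← Polynomial.C_mul_X_eq_monomial]
      ring
  · rintro ⟨w, hw, rfl⟩
    refine ⟨⟨X * w.1, fun n => ?_⟩, ?_, ?_⟩
    · rcases n with _ | n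
      · simp
      · rw [Polynomial.coeff_X_mul]
        exact mem_map_algebraMap_rees_iff.1 hw n
    · change (X * w.1).coeff 0 = 0
      simp
    · apply Subtype.ext
      change Polynomial.C a * (X * w.1) = Polynomial.monomial 1 a * w.1
      rw [← Polynomial.C_mul_X_eq_monomial, mul_assoc]

theorem coeff_reesTInv_mul (q : extendedReesAlgebra I) (n : ℤ) :
    (reesTInv I * q).1.coeff n = q.1.coeff (n + 1) := by
  change (AddMonoidAlgebra.single (-1) 1 * q.1 : R[T;T⁻¹]).coeff n = _
  rw [AddMonoidAlgebra.coeff_single_mul_apply]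
  simp [add_comm]

theorem mem_span_reesTInv_iff {q : extendedReesAlgebra I} :
    q ∈ Ideal.span {reesTInv I} ↔ ∀ n : ℤ, q.1.coeff n ∈ I ^ (n + 1).toNat := by
  rw [Ideal.mem_span_singleton]
  constructor
  · rintro ⟨b, rfl⟩ n
    rw [coeff_reesTInv_mul]
    exact b.2 _
  · intro h
    refine ⟨⟨AddMonoidAlgebra.single 1 1 * q.1, fun n => ?_⟩, ?_⟩
    · rw [AddMonoidAlgebra.coeff_single_mul_apply]
      have := h (-1 + n)
      rwa [neg_add_cancel_comm, ← one_mul (q.1.coeff (-1 + n))] at this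
    · apply Subtype.ext
      change _ = AddMonoidAlgebra.single (-1) 1 * (AddMonoidAlgebra.single 1 1 * q.1)
      rw [← mul_assoc, AddMonoidAlgebra.single_mul_single]
      rw [neg_add_cancel, one_mul]
      exact (one_mul q.1).symm

/-- Both conditions ask for coefficients in I^{n+1}. With `exists_sub_reesInclusion_mem` this
identifies 𝓡/I𝓡 with 𝓡'/t⁻¹𝓡', the associated graded ring of I. -/
theorem reesInclusion_mem_span_reesTInv_iff {q : reesAlgebra I} :
    reesInclusion I q ∈ Ideal.span {reesTInv I} ↔ q ∈ I.map (algebraMap R (reesAlgebra I)) := by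
  rw [mem_span_reesTInv_iff, mem_map_algebraMap_rees_iff]
  constructor
  · intro h n
    simpa [reesInclusion_coeff_natCast] using h n
  · intro h n
    rcases lt_or_ge n 0 with hn | hn
    · rw [reesInclusion_coeff_neg q hn]
      exact zero_mem _
    · lift n to ℕ using hn
      rw [reesInclusion_coeff_natCast]
      exact h n

theorem exists_sub_reesInclusion_mem (b : extendedReesAlgebra I) :
    ∃ a, b - reesInclusion I a ∈ Ideal.span {reesTInv I} := by
  refine ⟨⟨LaurentPolynomial.trunc b.1, fun n => b.2 n⟩, mem_span_reesTInv_iff.2 fun n => ?_⟩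
  rcases lt_or_ge n 0 with hn | hn
  · rw [show (n + 1).toNat = 0 by omega]
    simp
  · lift n to ℕ using hn
    have : (b - reesInclusion I ⟨LaurentPolynomial.trunc b.1, fun n => b.2 n⟩).1.coeff n = 0 := by
      change b.1.coeff n - (reesInclusion I _).1.coeff n = 0
      rw [reesInclusion_coeff_natCast]
      exact sub_self _
    rw [this]
    exact zero_mem _

theorem reesInclusion_reesT_mul_reesTInv {a : R} (ha : a ∈ I) :
    reesInclusion I (reesT a ha) * reesTInv I = algebraMap R _ a := by
  apply Subtype.ext
  change Polynomial.toLaurent (Polynomial.monomial 1 a) * T (-1) = AddMonoidAlgebra.single 0 a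
  rw [← Polynomial.C_mul_X_pow_eq_monomial, Polynomial.toLaurent_C_mul_X_pow, mul_assoc,
    ← LaurentPolynomial.T_add, LaurentPolynomial.single_eq_C_mul_T]
  simp

theorem reesTInv_mem_nonZeroDivisors : reesTInv I ∈ nonZeroDivisors (extendedReesAlgebra I) := by
  rw [mem_nonZeroDivisors_iff_left]
  intro q hq
  apply Subtype.ext
  refine LaurentPolynomial.ext fun n => ?_
  have := coeff_reesTInv_mul q (n - 1)
  rw [hq, sub_add_cancel] at this
  exact this.symm

/-- 𝓡' is generated over 𝓡 by t⁻¹. Subtracting the part in degrees at least 0 and dividing by t⁻¹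
shortens the negative tail by one, which gives the induction. -/
theorem isNoetherianRing_extendedReesAlgebra [IsNoetherianRing (reesAlgebra I)] :
    IsNoetherianRing (extendedReesAlgebra I) := by
  let φ : (reesAlgebra I)[X] →+* extendedReesAlgebra I :=
    Polynomial.eval₂RingHom (reesInclusion I).toRingHom (reesTInv I)
  refine isNoetherianRing_of_surjective _ _ φ fun b => ?_
  have hN : ∃ N : ℕ, ∀ n : ℤ, n + N < 0 → b.1.coeff n = 0 := by
    refine ⟨b.1.coeff.support.sup Int.natAbs, fun n hn => ?_⟩
    by_contra h
    have := Finset.le_sup (f := Int.natAbs) (Finsupp.mem_support_iff.2 h)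
    omega
  obtain ⟨N, hN⟩ := hN
  induction N generalizing b with
  | zero =>
    obtain ⟨a, rfl⟩ := exists_reesInclusion_eq fun n hn => hN n (by simpa using hn)
    exact ⟨Polynomial.C a, Polynomial.eval₂_C _ _⟩
  | succ N ih =>
    obtain ⟨a, ha⟩ := exists_sub_reesInclusion_mem b
    obtain ⟨c, hc⟩ := Ideal.mem_span_singleton.1 ha
    obtain ⟨q, hq⟩ := ih c fun n hn => by
      have := coeff_reesTInv_mul c (n - 1)
      rw [sub_add_cancel] at this
      rw [← this, ← hc]
      change b.1.coeff (n - 1) - (reesInclusion I a).1.coeff (n - 1) = 0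
      rw [hN _ (by push_cast; omega), reesInclusion_coeff_neg _ (by omega), sub_zero]
    refine ⟨Polynomial.C a + X * q, ?_⟩
    rw [map_add, map_mul, hq]
    have h1 : φ (Polynomial.C a) = reesInclusion I a := Polynomial.eval₂_C _ _
    have h2 : φ X = reesTInv I := Polynomial.eval₂_X _ _
    rw [h1, h2, ← hc]
    ring

end ReesIdeals

/-! ### 𝔐 and 𝔑 are maximal and correspond to each other. -/

section Maximal

variable {R : Type*} [CommRing R] [IsLocalRing R] {I : Ideal R}

theorem mem_reesMaximal_iff {q : reesAlgebra I} :
    q ∈ reesMaximal I ↔ q.1.coeff 0 ∈ IsLocalRing.maximalIdeal R := by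
  constructor
  · intro h
    have : reesMaximal I ≤ (IsLocalRing.maximalIdeal R).comap (reesConst I) := by
      refine sup_le (Ideal.map_le_iff_le_comap.2 fun r hr => ?_) fun q hq => ?_
      · rwa [Ideal.mem_comap, Ideal.mem_comap, reesConst_algebraMap]
      · rw [Ideal.mem_comap, reesConst_apply, mem_reesIrrelevant_iff.1 hq]
        exact zero_mem _
    exact this h
  · intro h
    rw [← sub_add_cancel q (algebraMap R _ (q.1.coeff 0))]
    exact add_mem (Ideal.mem_sup_right (sub_algebraMap_mem_reesIrrelevant q))
      (Ideal.mem_sup_left (Ideal.mem_map_of_mem _ h))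

theorem reesMaximal_isMaximal : (reesMaximal I).IsMaximal := by
  have : reesMaximal I = (IsLocalRing.maximalIdeal R).comap (reesConst I) :=
    Ideal.ext fun q => mem_reesMaximal_iff
  rw [this]
  exact Ideal.comap_isMaximal_of_surjective _ fun r => ⟨algebraMap R _ r, reesConst_algebraMap r⟩

theorem reesInclusion_mem_extendedReesMaximal_iff (hI : I.radical = IsLocalRing.maximalIdeal R)
    {q : reesAlgebra I} : reesInclusion I q ∈ extendedReesMaximal I ↔ q ∈ reesMaximal I := by
  have hprime := extendedReesMaximal_isPrime I hI
  have h1 : reesInclusion I q - algebraMap R _ (q.1.coeff 0) ∈ extendedReesMaximal I := by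
    refine Ideal.le_radical (Ideal.mem_sup_left ?_)
    rw [← (reesInclusion I).commutes, ← map_sub]
    exact Ideal.mem_map_of_mem (reesInclusion I).toRingHom (sub_algebraMap_mem_reesIrrelevant q)
  rw [mem_reesMaximal_iff]
  rw [show reesInclusion I q ∈ extendedReesMaximal I ↔
    algebraMap R _ (q.1.coeff 0) ∈ extendedReesMaximal I by
      constructor
      · intro h
        have := sub_mem h h1
        rwa [sub_sub_cancel] at this
      · intro h
        have := add_mem h1 h
        rwa [sub_add_cancel] at this]
  constructor
  · intro h
    by_contra hu
    exact hprime.ne_top (Ideal.eq_top_of_isUnit_mem _ h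
      ((IsLocalRing.notMem_maximalIdeal.1 hu).map (algebraMap R _)))
  · intro h
    -- Some power a^k of the constant term lies in I, and then a^k = (a^k t) t⁻¹ is a multiple of
    -- t⁻¹.
    rw [← hI] at h
    obtain ⟨k, hk⟩ := h
    refine hprime.mem_of_pow_mem k ?_
    rw [← map_pow, ← reesInclusion_reesT_mul_reesTInv hk]
    exact Ideal.le_radical (Ideal.mem_sup_right (Ideal.mul_mem_left _ _
      (Ideal.mem_span_singleton_self _)))

/-- Every element of 𝓡' agrees modulo t⁻¹ ∈ 𝔑 with one of 𝓡, and 𝔑 contracts to the maximal ideal 𝔐,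
where inverses modulo 𝔐 exist. -/
theorem extendedReesMaximal_isMaximal (hI : I.radical = IsLocalRing.maximalIdeal R) :
    (extendedReesMaximal I).IsMaximal := by
  refine Ideal.isMaximal_iff.2 ⟨(Ideal.ne_top_iff_one _).1
    (extendedReesMaximal_isPrime I hI).ne_top, fun J b hJ hb hbJ => ?_⟩
  obtain ⟨a, ha⟩ := exists_sub_reesInclusion_mem b
  have ha' : b - reesInclusion I a ∈ extendedReesMaximal I :=
    Ideal.le_radical ((le_sup_right : Ideal.span {reesTInv I} ≤ _) ha)
  have haM : a ∉ reesMaximal I := by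
    rw [← reesInclusion_mem_extendedReesMaximal_iff hI]
    intro h
    have := add_mem ha' h
    rw [sub_add_cancel] at this
    exact hb this
  obtain ⟨a', i, hi, h⟩ := reesMaximal_isMaximal.exists_inv haM
  have h1 : reesInclusion I a ∈ J := by
    have := sub_mem hbJ (hJ ha')
    rwa [sub_sub_cancel] at this
  rw [← map_one (reesInclusion I), ← h, map_add, map_mul]
  exact add_mem (Ideal.mul_mem_left _ _ h1)
    (hJ ((reesInclusion_mem_extendedReesMaximal_iff hI).2 hi))

end Maximal
end

noncomputable section

set_option linter.unusedSectionVars false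

/-! ### Elements generating 𝔐 and 𝔑 up to radical. -/

section Radicals

open Polynomial

theorem IsReductionOf.pow_succ_eq {R : Type*} [CommRing R] {J I : Ideal R}
    (h : IsReductionOf J I) : ∃ r, ∀ n ≥ r, I ^ (n + 1) = J * I ^ n := by
  obtain ⟨-, r, hr⟩ := h
  refine ⟨r, fun n hn => ?_⟩
  obtain ⟨m, rfl⟩ := Nat.exists_eq_add_of_le hn
  rw [show r + m + 1 = (r + 1) + m by ring, pow_add, hr, pow_add, mul_assoc]

variable {R : Type*} [CommRing R] {I : Ideal R} {d : ℕ} {f : Fin d → R} (hf : ∀ i, f i ∈ I)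

theorem reesMonomial_mem_span_reesT {n : ℕ} {a : R} (ha : a ∈ Ideal.span (Set.range f) * I ^ n) :
    ∃ ha' : a ∈ I ^ (n + 1), reesMonomial (n + 1) a ha' ∈
      Ideal.span (Set.range fun i => reesT (f i) (hf i)) := by
  induction ha using Submodule.mul_induction_on' with
  | mem_mul_mem a ha b hb =>
    obtain ⟨c, rfl⟩ := Ideal.mem_span_range_iff_exists_fun.1 ha
    have hmem : (∑ i, c i * f i) * b ∈ I ^ (n + 1) := by
      rw [pow_succ']
      exact Ideal.mul_mem_mul (sum_mem fun i _ => Ideal.mul_mem_left _ _ (hf i)) hb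
    refine ⟨hmem, ?_⟩
    have : reesMonomial (n + 1) ((∑ i, c i * f i) * b) hmem
        = ∑ i, reesMonomial n (c i * b) (Ideal.mul_mem_left _ _ hb) * reesT (f i) (hf i) := by
      apply Subtype.ext
      rw [AddSubmonoidClass.coe_finsetSum]
      change Polynomial.monomial (n + 1) ((∑ i, c i * f i) * b)
        = ∑ i, Polynomial.monomial n (c i * b) * Polynomial.monomial 1 (f i)
      rw [Finset.sum_mul, map_sum]
      refine Finset.sum_congr rfl fun i _ => ?_
      rw [Polynomial.monomial_mul_monomial]
      congr 1
      ring
    rw [this]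
    exact sum_mem fun i _ => Ideal.mul_mem_left _ _ (Ideal.subset_span ⟨i, rfl⟩)
  | add a _ b _ ha hb =>
    obtain ⟨ha, ha'⟩ := ha
    obtain ⟨hb, hb'⟩ := hb
    refine ⟨add_mem ha hb, ?_⟩
    have : reesMonomial (n + 1) (a + b) (add_mem ha hb)
        = reesMonomial (n + 1) a ha + reesMonomial (n + 1) b hb :=
      Subtype.ext (map_add (Polynomial.monomial (n + 1)) a b)
    rw [this]
    exact add_mem ha' hb'

/-- From degree r on, the reduction gives I^{n+1} = J I^n, so monomials of large degree are
combinations of the f_it; every monomial of positive degree has a power of large degree. -/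
theorem reesIrrelevant_le_radical (hJ : IsReductionOf (Ideal.span (Set.range f)) I) :
    reesIrrelevant I ≤ (Ideal.span (Set.range fun i => reesT (f i) (hf i))).radical := by
  obtain ⟨r, hr⟩ := hJ.pow_succ_eq
  intro q hq
  refine rees_mem_of_monomial_mem fun n => ?_
  rcases n with _ | n
  · have : reesMonomial 0 (q.1.coeff 0) (q.2 0) = 0 := by
      apply Subtype.ext
      change Polynomial.monomial 0 (q.1.coeff 0) = 0
      rw [mem_reesIrrelevant_iff.1 hq, map_zero]
    rw [this]
    exact zero_mem _
  -- The (r + 1)-st power has degree (n + 1)(r + 1), which is one more than n(r + 1) + r ≥ r, so the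
  -- reduction equation applies to its coefficient.
  · refine ⟨r + 1, ?_⟩
    have h1 : q.1.coeff (n + 1) ^ (r + 1) ∈ Ideal.span (Set.range f) * I ^ (n * (r + 1) + r) := by
      rw [← hr _ (Nat.le_add_left _ _), show n * (r + 1) + r + 1 = (n + 1) * (r + 1) by ring,
        pow_mul]
      exact Ideal.pow_mem_pow (q.2 (n + 1)) _
    obtain ⟨h2, h3⟩ := reesMonomial_mem_span_reesT hf h1
    convert h3 using 1
    apply Subtype.ext
    change Polynomial.monomial (n + 1) (q.1.coeff (n + 1)) ^ (r + 1) = Polynomial.monomial _ _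
    rw [Polynomial.monomial_pow, show n * (r + 1) + r + 1 = (n + 1) * (r + 1) by ring]

theorem radical_span_extendedReesSeq (hJ : IsReductionOf (Ideal.span (Set.range f)) I) :
    (Ideal.span (Set.range (extendedReesSeq f hf))).radical = extendedReesMaximal I := by
  apply le_antisymm
  · refine Ideal.radical_mono (Ideal.span_le.2 ?_)
    rintro _ ⟨i, rfl⟩
    induction i using Fin.lastCases with
    | last =>
      rw [extendedReesSeq_last]
      exact Ideal.mem_sup_right (Ideal.mem_span_singleton_self _)
    | cast i =>
      rw [extendedReesSeq_castSucc]
      refine Ideal.mem_sup_left (Ideal.mem_map_of_mem (reesInclusion I).toRingHom ?_)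
      rw [mem_reesIrrelevant_iff]
      exact Polynomial.coeff_monomial_of_ne _ one_ne_zero.symm
  · refine Ideal.radical_le_radical_iff.2 (sup_le (Ideal.map_le_iff_le_comap.2 ?_) ?_)
    · intro q hq
      obtain ⟨k, hk⟩ := reesIrrelevant_le_radical hf hJ hq
      refine ⟨k, ?_⟩
      have h1 := Ideal.mem_map_of_mem (reesInclusion I).toRingHom hk
      rw [map_pow] at h1
      refine Ideal.map_le_iff_le_comap.2 (Ideal.span_le.2 ?_) h1
      rintro _ ⟨i, rfl⟩
      exact Ideal.subset_span ⟨i.castSucc, extendedReesSeq_castSucc hf i⟩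
    · rw [Ideal.span_le, Set.singleton_subset_iff]
      exact Ideal.le_radical (Ideal.subset_span ⟨Fin.last d, extendedReesSeq_last hf⟩)

variable [IsLocalRing R]

theorem reesSeq_mem_reesMaximal (hI : I.radical = IsLocalRing.maximalIdeal R) (i : Fin (d + d)) :
    reesSeq f hf i ∈ reesMaximal I := by
  induction i using Fin.addCases with
  | left i =>
    rw [reesSeq_castAdd]
    exact Ideal.mem_sup_left (Ideal.mem_map_of_mem _ (hI ▸ Ideal.le_radical (hf i)))
  | right i =>
    rw [reesSeq_natAdd]
    refine Ideal.mem_sup_right ?_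
    rw [mem_reesIrrelevant_iff]
    exact Polynomial.coeff_monomial_of_ne _ one_ne_zero.symm

theorem reesMaximal_le_radical (hI : I.radical = IsLocalRing.maximalIdeal R)
    (hJ : IsReductionOf (Ideal.span (Set.range f)) I) {K : Ideal (reesAlgebra I)}
    (h1 : ∀ i, algebraMap R _ (f i) ∈ K.radical) (h2 : ∀ i, reesT (f i) (hf i) ∈ K.radical) :
    reesMaximal I ≤ K.radical := by
  refine sup_le ?_ ((reesIrrelevant_le_radical hf hJ).trans ?_)
  · rw [← hI, ← hJ.radical_eq, Ideal.map_le_iff_le_comap, ← K.radical_idem, Ideal.comap_radical,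
      Ideal.radical_le_radical_iff, ← Ideal.comap_radical, K.radical_idem, Ideal.span_le]
    rintro _ ⟨i, rfl⟩
    exact h1 i
  · refine Ideal.radical_le_radical_iff.2 (Ideal.span_le.2 ?_)
    rintro _ ⟨i, rfl⟩
    exact h2 i

theorem radical_span_reesSeq (hI : I.radical = IsLocalRing.maximalIdeal R)
    (hJ : IsReductionOf (Ideal.span (Set.range f)) I) :
    (Ideal.span (Set.range (reesSeq f hf))).radical = reesMaximal I := by
  have := reesMaximal_isMaximal (I := I)
  apply le_antisymm
  · refine this.isPrime.radical_le_iff.2 (Ideal.span_le.2 ?_)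
    rintro _ ⟨i, rfl⟩
    exact reesSeq_mem_reesMaximal hf hI i
  · exact reesMaximal_le_radical hf hI hJ
      (fun i => Ideal.le_radical (Ideal.subset_span ⟨Fin.castAdd d i, reesSeq_castAdd hf i⟩))
      (fun i => Ideal.le_radical (Ideal.subset_span ⟨Fin.natAdd d i, reesSeq_natAdd hf i⟩))

/-- The elements `f₁, f₂ - f₁t, …, f_d - f_{d-1}t, -f_dt` of the Rees algebra. They form a system of
parameters at `𝔐`. -/
def reesParameters : Fin (d + 1) → reesAlgebra I := fun k =>
  Fin.snoc (α := fun _ => reesAlgebra I) (fun i => algebraMap R _ (f i)) 0 k -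
    Fin.cons (α := fun _ => reesAlgebra I) 0 (fun i => reesT (f i) (hf i)) k

theorem algebraMap_mul_reesT (i j : Fin d) : algebraMap R (reesAlgebra I) (f i) *
    reesT (f j) (hf j) = algebraMap R (reesAlgebra I) (f j) * reesT (f i) (hf i) := by
  apply Subtype.ext
  change Polynomial.C (f i) * Polynomial.monomial 1 (f j)
    = Polynomial.C (f j) * Polynomial.monomial 1 (f i)
  rw [Polynomial.C_mul_monomial, Polynomial.C_mul_monomial, mul_comm]

/-- A prime P containing the parameters contains f_1. If f_i ∈ P, then f_{i+1} · (f_it) = f_i ·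
(f_{i+1}t) ∈ P, so one of f_{i+1} and f_it is in P; the parameter f_{i+1} - f_it brings in the
other. At the end f_{d+1} is read as 0. -/
theorem reesSeq_mem_of_reesParameters_mem {P : Ideal (reesAlgebra I)} [hP : P.IsPrime]
    (h : ∀ k, reesParameters hf k ∈ P) (k : Fin (d + 1)) :
    Fin.snoc (α := fun _ => reesAlgebra I) (fun i => algebraMap R _ (f i)) 0 k ∈ P ∧
      Fin.cons (α := fun _ => reesAlgebra I) 0 (fun i => reesT (f i) (hf i)) k ∈ P := by
  induction k using Fin.induction with
  | zero =>
    have := h 0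
    rw [reesParameters, Fin.cons_zero, sub_zero] at this
    exact ⟨this, by rw [Fin.cons_zero]; exact zero_mem _⟩
  | succ i ih =>
    have h0 := ih.1
    rw [Fin.snoc_castSucc] at h0
    have h1 := h i.succ
    rw [reesParameters, Fin.cons_succ] at h1
    rw [Fin.cons_succ]
    have hmul : Fin.snoc (α := fun _ => reesAlgebra I) (fun i => algebraMap R _ (f i)) 0 i.succ *
        reesT (f i) (hf i) ∈ P := by
      generalize i.succ = k
      induction k using Fin.lastCases with
      | last =>
        rw [Fin.snoc_last, zero_mul]
        exact zero_mem _
      | cast j =>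
        rw [Fin.snoc_castSucc, algebraMap_mul_reesT]
        exact Ideal.mul_mem_right _ _ h0
    rcases hP.mem_or_mem hmul with h2 | h2
    · exact ⟨h2, by have := sub_mem h2 h1; rwa [sub_sub_cancel] at this⟩
    · exact ⟨by have := add_mem h1 h2; rwa [sub_add_cancel] at this, h2⟩

theorem radical_span_reesParameters (hI : I.radical = IsLocalRing.maximalIdeal R)
    (hJ : IsReductionOf (Ideal.span (Set.range f)) I) :
    (Ideal.span (Set.range (reesParameters hf))).radical = reesMaximal I := by
  have := reesMaximal_isMaximal (I := I)
  have hmem := reesSeq_mem_reesMaximal hf hI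
  apply le_antisymm
  · refine this.isPrime.radical_le_iff.2 (Ideal.span_le.2 ?_)
    rintro _ ⟨k, rfl⟩
    refine sub_mem ?_ ?_
    · induction k using Fin.lastCases with
      | last =>
        rw [Fin.snoc_last]
        exact zero_mem _
      | cast j =>
        rw [Fin.snoc_castSucc, ← reesSeq_castAdd hf]
        exact hmem _
    · induction k using Fin.cases with
      | zero =>
        rw [Fin.cons_zero]
        exact zero_mem _
      | succ j =>
        rw [Fin.cons_succ, ← reesSeq_natAdd hf]
        exact hmem _
  · have key : ∀ P : Ideal (reesAlgebra I), Ideal.span (Set.range (reesParameters hf)) ≤ P →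
        P.IsPrime → ∀ k, Fin.snoc (α := fun _ => reesAlgebra I)
          (fun i => algebraMap R _ (f i)) 0 k ∈ P ∧ Fin.cons (α := fun _ => reesAlgebra I) 0
          (fun i => reesT (f i) (hf i)) k ∈ P := fun P hP hP' =>
      reesSeq_mem_of_reesParameters_mem hf fun k => hP (Ideal.subset_span ⟨k, rfl⟩)
    refine reesMaximal_le_radical hf hI hJ (fun i => ?_) (fun i => ?_)
    · rw [Ideal.radical_eq_sInf, Submodule.mem_sInf]
      intro P hP
      have := (key P hP.1 hP.2 i.castSucc).1
      rwa [Fin.snoc_castSucc] at this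
    · rw [Ideal.radical_eq_sInf, Submodule.mem_sInf]
      intro P hP
      have := (key P hP.1 hP.2 i.succ).2
      rwa [Fin.cons_succ] at this

end Radicals

/-! ### Transfer of depth between modules. -/

section Depth

theorem DepthGE.le_ringKrullDim {B : Type u} [CommRing B] [IsLocalRing B] [IsNoetherianRing B]
    {k : ℕ} (h : DepthGE B B k) : (k : WithBot ℕ∞) ≤ ringKrullDim B := by
  obtain ⟨rs, rfl, h1, h2⟩ := h.exists_isWeaklyRegular
  obtain ⟨P, hP⟩ := associatedPrimes.nonempty B B
  exact (length_le_ringKrullDim_of_isAssociatedPrime rs h1 h2 P hP).trans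
    (ringKrullDim_quotient_le P)

/-- A is a retract of B, so a regular sequence of A, pushed into B, acts on A as before; its
elements are nonunits of B because their images in A are. -/
theorem depthGE_of_algebraMap_surjective {A B : Type u} [CommRing A] [IsLocalRing A]
    [IsNoetherianRing A] [CommRing B] [IsLocalRing B] [IsNoetherianRing B] [Algebra A B]
    [Algebra B A] [IsScalarTower A B A] (hs : Function.Surjective (algebraMap B A)) {k : ℕ}
    (h : DepthGE A A k) : DepthGE B A k := by
  obtain ⟨rs, rfl, h1, h2⟩ := h.exists_isWeaklyRegular
  have : Module.Finite B A := Module.Finite.of_surjective (Algebra.linearMap B A) hs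
  rw [← RingTheory.Sequence.isWeaklyRegular_map_algebraMap_iff B] at h2
  rw [← List.length_map (algebraMap A B)]
  refine depthGE_of_isRegular _ (fun r hr => ?_) h2
  obtain ⟨a, ha, rfl⟩ := List.mem_map.1 hr
  intro hu
  have := hu.map (algebraMap B A)
  rw [← IsScalarTower.algebraMap_apply] at this
  exact h1 a ha this

/-- Multiplication by a nonzerodivisor. -/
def idealEquivSpanMul {B : Type*} [CommRing B] {x : B} (hx : x ∈ nonZeroDivisors B) (J : Ideal B) :
    J ≃ₗ[B] (Ideal.span {x} * J : Ideal B) :=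
  (LinearEquiv.ofInjective ((LinearMap.mulLeft B x).comp J.subtype) (fun a b hab => by
    refine Subtype.ext ((mul_cancel_left_mem_nonZeroDivisors hx).1 hab))).trans
    (LinearEquiv.ofEq _ _ (by
      ext b
      rw [Ideal.mem_span_singleton_mul]
      simp))

/-- The equation x P = y Q with nonzerodivisors x and y makes P and Q isomorphic modules. Depth
passes from B/P to P, where it rises by one, then to Q, and back down to B/Q. -/
theorem depthGE_quotient_of_span_mul_eq {B : Type u} [CommRing B] [IsLocalRing B]
    [IsNoetherianRing B] {P Q : Ideal B} {x y : B} (hx : x ∈ nonZeroDivisors B)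
    (hy : y ∈ nonZeroDivisors B) (h : Ideal.span {x} * P = Ideal.span {y} * Q) (hP : P ≠ ⊥) {k : ℕ}
    (hB : DepthGE B B (k + 1)) (hBP : DepthGE B (B ⧸ P) k) : DepthGE B (B ⧸ Q) k := by
  have : Nontrivial P := (Submodule.nontrivial_iff_ne_bot).2 hP
  have h1 : DepthGE B P (k + 1) := DepthGE.left (f := P.subtype) (g := Submodule.mkQ P)
    P.injective_subtype P.mkQ_surjective (LinearMap.exact_subtype_mkQ P) hB hBP
  have h2 : DepthGE B Q (k + 1) := h1.of_linearEquiv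
    ((idealEquivSpanMul hx P).trans ((LinearEquiv.ofEq _ _ h).trans (idealEquivSpanMul hy Q).symm))
  exact DepthGE.right (f := Q.subtype) (g := Submodule.mkQ Q)
    Q.injective_subtype Q.mkQ_surjective (LinearMap.exact_subtype_mkQ Q) h2 (hB.mono k.le_succ)

end Depth
end

noncomputable section

set_option linter.unusedSectionVars false

/-! ### Radicals under localization at a prime. -/

section LocalizationRadical

variable {A B : Type*} [CommRing A] [CommRing B] [Algebra A B] {𝔪 : Ideal A} [𝔪.IsPrime]
  [IsLocalization.AtPrime B 𝔪] [IsLocalRing B]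

theorem maximalIdeal_le_radical_map {J : Ideal A} (hJ : 𝔪 ≤ J.radical) :
    IsLocalRing.maximalIdeal B ≤ (J.map (algebraMap A B)).radical := by
  rw [← IsLocalization.AtPrime.map_eq_maximalIdeal 𝔪 B]
  exact (Ideal.map_mono hJ).trans (Ideal.map_radical_le _)

theorem radical_map_eq_maximalIdeal {J : Ideal A} (hJ : J.radical = 𝔪) :
    (J.map (algebraMap A B)).radical = IsLocalRing.maximalIdeal B := by
  refine le_antisymm ?_ (maximalIdeal_le_radical_map hJ.ge)
  refine (IsLocalRing.maximalIdeal.isMaximal B).isPrime.radical_le_iff.2 ?_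
  rw [← IsLocalization.AtPrime.map_eq_maximalIdeal 𝔪 B]
  exact Ideal.map_mono (hJ ▸ Ideal.le_radical)

theorem map_span_range {ι : Type*} (x : ι → A) : (Ideal.span (Set.range x)).map (algebraMap A B)
    = Ideal.span (Set.range fun i => algebraMap A B (x i)) := by
  rw [Ideal.map_span, ← Set.range_comp]
  rfl

theorem radical_span_algebraMap_eq {ι : Type*} {x : ι → A}
    (hx : (Ideal.span (Set.range x)).radical = 𝔪) :
    (Ideal.span (Set.range fun i => algebraMap A B (x i))).radical =
      IsLocalRing.maximalIdeal B := by
  rw [← map_span_range]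
  exact radical_map_eq_maximalIdeal hx

end LocalizationRadical

/-! ### Parameters in a local ring of full depth. -/

section RegularParameters

variable {B : Type u} [CommRing B] [IsLocalRing B] [IsNoetherianRing B]

theorem isSystemOfParameters_of_depthGE {n : ℕ} {y : Fin n → B} (hB : DepthGE B B n)
    (hy : (Ideal.span (Set.range y)).radical = IsLocalRing.maximalIdeal B) :
    IsSystemOfParameters y := by
  refine ⟨le_antisymm ?_ hB.le_ringKrullDim, hy⟩
  have := ringKrullDim_le_length_of_le_radical (List.ofFn y)
    (fun a ha => hy ▸ Ideal.le_radical (Ideal.subset_span ((List.mem_ofFn' _ _).1 ha)))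
    (by rw [ofList_ofFn, hy])
  rwa [List.length_ofFn] at this

theorem isRegularAt_ofFn_of_depthGE {n : ℕ} {y : Fin n → B} (hB : DepthGE B B n)
    (hy : (Ideal.span (Set.range y)).radical = IsLocalRing.maximalIdeal B) :
    IsRegularAt (IsLocalRing.maximalIdeal B) ⊥ (List.ofFn y) := by
  rw [isRegularAt_maximalIdeal_iff,
    (Submodule.quotEquivOfEqBot (⊥ : Ideal B) rfl).isWeaklyRegular_congr]
  refine isWeaklyRegular_of_le_radical _
    (fun a ha => hy ▸ Ideal.le_radical (Ideal.subset_span ((List.mem_ofFn' _ _).1 ha)))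
    (by rwa [List.length_ofFn]) ?_
  rw [ofList_ofFn, ← hy]
  exact Ideal.radical_mono le_sup_right

end RegularParameters

/-! ### Depth of the local rings of 𝓡 and of the associated graded ring. -/

section ReesLocal

variable {R : Type u} [CommRing R] [IsLocalRing R] {I : Ideal R} [h𝔐 : (reesMaximal I).IsPrime]
  (B : Type u) [CommRing B] [Algebra (reesAlgebra I) B]
  [IsLocalization.AtPrime B (reesMaximal I)]

/-- The projection of the localization of the Rees algebra at `𝔐` onto the base ring. -/
def reesLocalConst : B →+* R :=
  IsLocalization.lift (M := (reesMaximal I).primeCompl) (g := reesConst I) fun s =>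
    IsLocalRing.notMem_maximalIdeal.1 fun h => s.2 (mem_reesMaximal_iff.2 h)

theorem reesLocalConst_algebraMap (q : reesAlgebra I) :
    reesLocalConst (I := I) B (algebraMap _ B q) = q.1.coeff 0 :=
  IsLocalization.lift_eq _ q

theorem reesLocalConst_surjective : Function.Surjective (reesLocalConst (I := I) B) := fun r =>
  ⟨algebraMap (reesAlgebra I) B (algebraMap R _ r), by
    rw [reesLocalConst_algebraMap]
    exact reesConst_algebraMap (I := I) r⟩

theorem ker_reesLocalConst :
    RingHom.ker (reesLocalConst (I := I) B) = (reesIrrelevant I).map (algebraMap _ B) := by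
  apply le_antisymm
  · intro b hb
    obtain ⟨⟨a, s⟩, has⟩ := IsLocalization.surj (reesMaximal I).primeCompl b
    have h1 := congrArg (reesLocalConst (I := I) B) has
    rw [map_mul, (RingHom.mem_ker).1 hb, zero_mul, reesLocalConst_algebraMap] at h1
    have h2 : b * algebraMap _ B s.1 ∈ (reesIrrelevant I).map (algebraMap _ B) := by
      rw [has]
      exact Ideal.mem_map_of_mem _ (mem_reesIrrelevant_iff.2 h1.symm)
    exact (Ideal.mul_unit_mem_iff_mem _ (IsLocalization.map_units B s)).1 h2
  · refine Ideal.map_le_iff_le_comap.2 fun q hq => ?_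
    rw [Ideal.mem_comap, RingHom.mem_ker, reesLocalConst_algebraMap]
    exact hq

variable {d : ℕ} {f : Fin d → R} (hf : ∀ i, f i ∈ I) (hnzd : ∀ i, f i ∈ nonZeroDivisors R)

theorem algebraMap_reesSeq_mem_nonZeroDivisors (hf : ∀ i, f i ∈ I)
    (hnzd : ∀ i, f i ∈ nonZeroDivisors R) (i : Fin (d + d)) :
    algebraMap _ B (reesSeq f hf i) ∈ nonZeroDivisors B := by
  refine IsLocalization.nonZeroDivisors_le_comap (reesMaximal I).primeCompl B ?_
  rw [mem_nonZeroDivisors_iff_left]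
  intro q hq
  apply algebraMap_rees_injective (I := I) hnzd
  have h1 := congrArg (algebraMap _ (ReesAmbient f)) hq
  rw [map_mul, map_zero] at h1
  rw [map_zero]
  exact (isUnit_algebraMap_reesSeq hf i).mul_right_eq_zero.1 h1

include hf hnzd

/-- The nonzerodivisor f_1t is killed by the surjection onto R, so the dimension is at least d + 1;
the Cohen–Macaulay property turns this into depth. -/
theorem depthGE_reesLocal [IsLocalRing B] [NeZero d] (hdim : ringKrullDim R = d)
    (hB : IsCohenMacaulayLocal B) : DepthGE B B (d + 1) := by
  refine depthGE_of_isCohenMacaulayLocal hB ?_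
  have hx := algebraMap_reesSeq_mem_nonZeroDivisors B hf hnzd (Fin.natAdd d 0)
  refine le_trans ?_ (ringKrullDim_quotient_succ_le_of_nonZeroDivisor hx)
  have h1 : ∀ b ∈ Ideal.span {algebraMap _ B (reesSeq f hf (Fin.natAdd d 0))},
      reesLocalConst (I := I) B b = 0 := by
    intro b hb
    rw [← RingHom.mem_ker, ker_reesLocalConst]
    refine Ideal.span_le.2 (Set.singleton_subset_iff.2 (Ideal.mem_map_of_mem _ ?_)) hb
    rw [reesSeq_natAdd, mem_reesIrrelevant_iff]
    exact Polynomial.coeff_monomial_of_ne _ one_ne_zero.symm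
  have h2 := ringKrullDim_le_of_surjective (Ideal.Quotient.lift _ (reesLocalConst (I := I) B) h1)
    (Ideal.Quotient.lift_surjective_of_surjective _ h1 (reesLocalConst_surjective (I := I) B))
  rw [hdim] at h2
  rw [Nat.cast_add, Nat.cast_one]
  exact add_le_add_left h2 1

/-- The quotient by 𝓡_+ is R, of depth d. The identity f_1 𝓡_+ = (f_1t) I𝓡 transfers this depth to
the quotient by I𝓡. -/
theorem depthGE_reesLocal_quotient [IsLocalRing B] [NeZero d] [IsNoetherianRing R]
    [IsNoetherianRing B] (hR : DepthGE R R d) (hB : DepthGE B B (d + 1)) :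
    DepthGE B (B ⧸ (I.map (algebraMap R (reesAlgebra I))).map (algebraMap _ B)) d := by
  let _ : Algebra B R := (reesLocalConst (I := I) B).toAlgebra
  let _ : Algebra R B := ((algebraMap (reesAlgebra I) B).comp (algebraMap R _)).toAlgebra
  have : IsScalarTower R B R := IsScalarTower.of_algebraMap_eq fun r => by
    change r = reesLocalConst (I := I) B (algebraMap (reesAlgebra I) B (algebraMap R _ r))
    rw [reesLocalConst_algebraMap]
    exact (reesConst_algebraMap (I := I) r).symm
  have hs : Function.Surjective (algebraMap B R) := reesLocalConst_surjective (I := I) B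
  have h1 : DepthGE B R d := depthGE_of_algebraMap_surjective hs hR
  have : Module.Finite B R := Module.Finite.of_surjective (Algebra.linearMap B R) hs
  have hker : LinearMap.ker (Algebra.linearMap B R) = (reesIrrelevant I).map (algebraMap _ B) :=
    ker_reesLocalConst (I := I) B
  have h2 : DepthGE B (B ⧸ (reesIrrelevant I).map (algebraMap _ B)) d := h1.of_linearEquiv
    (((Submodule.quotEquivOfEq _ _ hker.symm).trans
      ((Algebra.linearMap B R).quotKerEquivOfSurjective hs)).symm)
  have hx := algebraMap_reesSeq_mem_nonZeroDivisors B hf hnzd (Fin.castAdd d 0)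
  have hy := algebraMap_reesSeq_mem_nonZeroDivisors B hf hnzd (Fin.natAdd d 0)
  refine depthGE_quotient_of_span_mul_eq hx hy ?_ ?_ hB h2
  · have := congrArg (Ideal.map (algebraMap _ B)) (span_mul_reesIrrelevant_eq (hf 0))
    rw [Ideal.map_mul, Ideal.map_mul, Ideal.map_span, Ideal.map_span, Set.image_singleton,
      Set.image_singleton] at this
    rwa [reesSeq_castAdd, reesSeq_natAdd]
  · intro h
    refine nonZeroDivisors.ne_zero hy ?_
    rw [← Ideal.mem_bot, ← h, reesSeq_natAdd]
    refine Ideal.mem_map_of_mem _ ?_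
    rw [mem_reesIrrelevant_iff]
    exact Polynomial.coeff_monomial_of_ne _ one_ne_zero.symm

/-- Modulo I𝓡 the f_i vanish, so the d elements f_it alone define 𝔐 up to radical; with depth d they
form a regular sequence. -/
theorem isRegularAt_reesT [IsLocalRing B] [IsNoetherianRing B]
    (hI : I.radical = IsLocalRing.maximalIdeal R)
    (hJ : IsReductionOf (Ideal.span (Set.range f)) I)
    (h : DepthGE B (B ⧸ (I.map (algebraMap R (reesAlgebra I))).map (algebraMap _ B)) d) :
    IsRegularAt (reesMaximal I) (I.map (algebraMap R (reesAlgebra I)))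
      (List.ofFn fun i => reesT (f i) (hf i)) := by
  rw [← isRegularAt_map_iff (B := B), isRegularAt_maximalIdeal_iff]
  refine isWeaklyRegular_of_le_radical _ ?_ (by rwa [List.length_map, List.length_ofFn]) ?_
  · intro b hb
    obtain ⟨q, hq, rfl⟩ := List.mem_map.1 hb
    obtain ⟨i, rfl⟩ := (List.mem_ofFn' _ _).1 hq
    rw [← IsLocalization.AtPrime.map_eq_maximalIdeal (reesMaximal I) B]
    refine Ideal.mem_map_of_mem _ ?_
    have := reesSeq_mem_reesMaximal hf hI (Fin.natAdd d i)
    rwa [reesSeq_natAdd] at this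
  · rw [Ideal.annihilator_quotient, ← Ideal.map_ofList, ← Ideal.map_sup, ofList_ofFn]
    refine maximalIdeal_le_radical_map (reesMaximal_le_radical hf hI hJ (fun i => ?_) fun i => ?_)
    · exact Ideal.le_radical (Ideal.mem_sup_left (Ideal.mem_map_of_mem _ (hf i)))
    · exact Ideal.le_radical (Ideal.mem_sup_right (Ideal.subset_span ⟨i, rfl⟩))

omit hnzd in
-- t⁻¹ is a nonzerodivisor on 𝓡', and modulo it the sequence f_1t, …, f_dt is the one on 𝓡/I𝓡.
theorem isRegularAt_reesTInv_cons (hI : I.radical = IsLocalRing.maximalIdeal R)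
    (h : IsRegularAt (reesMaximal I) (I.map (algebraMap R (reesAlgebra I)))
      (List.ofFn fun i => reesT (f i) (hf i))) :
    IsRegularAt (extendedReesMaximal I) ⊥
      (reesTInv I :: (List.ofFn fun i => reesT (f i) (hf i)).map (reesInclusion I)) := by
  refine ⟨fun a ha => ⟨1, (Ideal.ne_top_iff_one _).1 (extendedReesMaximal_isPrime I hI).ne_top, ?_⟩,
    ?_⟩
  · rw [Ideal.mem_bot] at ha ⊢
    rw [one_mul]
    exact (mul_right_mem_nonZeroDivisors_eq_zero_iff reesTInv_mem_nonZeroDivisors).1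
      (by rwa [mul_comm])
  · rw [sup_bot_eq]
    exact h.map_of_quotient (reesInclusion I).toRingHom
      (fun s hs h => hs ((reesInclusion_mem_extendedReesMaximal_iff hI).1 h))
      exists_sub_reesInclusion_mem (fun a => reesInclusion_mem_span_reesTInv_iff)

end ReesLocal
end

noncomputable section

set_option linter.unusedSectionVars false

/-! ### Tightly closed parameter ideals versus tightly closed zero in local cohomology. -/

section TightClosureOfLocalCohomology

variable {S : Type u} [CommRing S] (p : ℕ) [Fact p.Prime] [CharP S p] {𝔪 : Ideal S}
  [h𝔪 : 𝔪.IsMaximal] {B : Type u} [CommRing B] [Algebra S B] [IsLocalization.AtPrime B 𝔪]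
  [IsLocalRing B] [CharP B p] {ι : Type*} [LinearOrder ι] [Fintype ι] {x : ι → S}
  (hx : (Ideal.span (Set.range x)).radical = 𝔪)

include hx

/-- If the ideals generated by powers of a system of parameters are tightly closed, then so is the
zero submodule of the top local cohomology. -/
theorem tightClosure_cechCohomology_eq_bot [IsNoetherianRing B] {L : Type*} [CommRing L]
    [Algebra S L] (hunit : ∀ i, IsUnit (algebraMap S L (x i)))
    (hinj : Function.Injective (algebraMap S L)) (hL : locSub S L (∏ i, x i) = ⊤) {n : ℕ}
    (hn : Fintype.card ι = n + 1) (hB : DepthGE B B (n + 1))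
    (htc : ∀ l ≠ 0, tightClosure p (Ideal.span (Set.range fun i => algebraMap S B (x i) ^ l)) ≤
      Ideal.span (Set.range fun i => algebraMap S B (x i) ^ l)) :
    tightClosure p (⊥ : Submodule S (CechCohomology x (n + 1))) = ⊥ := by
  have hxB : (Ideal.span (Set.range fun i => algebraMap S B (x i))).radical =
      IsLocalRing.maximalIdeal B := radical_span_algebraMap_eq hx
  have hpow : ∀ l, (Ideal.span (Set.range fun i => x i ^ l)).map (algebraMap S B) =
      Ideal.span (Set.range fun i => algebraMap S B (x i) ^ l) := fun l => by
    rw [map_span_range]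
    simp only [map_pow]
  obtain ⟨π, hπ, -, hker⟩ := exists_cechCohomology_top hunit hinj hL hn
  refine (Submodule.eq_bot_iff _).2 fun ζ hζ => ?_
  obtain ⟨u, rfl⟩ := hπ ζ
  have hprod : IsUnit (algebraMap S L (∏ i, x i)) := by
    rw [map_prod, IsUnit.prod_univ_iff]
    exact hunit
  have herase : ∀ i, IsUnit (algebraMap S L (∏ j ∈ Finset.univ.erase i, x j)) := fun i =>
    isUnit_of_dvd_unit (map_dvd _ (Finset.prod_dvd_prod_of_subset _ _ x (Finset.subset_univ _)))
      hprod
  obtain ⟨c, hc, e₀, h⟩ := (mem_tightClosure_bot_iff p hinj hprod hL _ herase π hπ hker u).1 hζ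
  obtain ⟨k, a, hka⟩ : u ∈ locSub S L (∏ i, x i) := hL ▸ trivial
  -- One further factor ∏ x_i makes the exponent nonzero, as required for the powers to form a
  -- system of parameters.
  have hka' : algebraMap S L (∏ i, x i) ^ (k + 1) * u = algebraMap S L ((∏ i, x i) * a) := by
    rw [map_mul, ← hka]
    ring
  have hmem : (∏ i, x i) * a ∈ Ideal.span (Set.range fun i => x i ^ (k + 1)) := by
    rw [← algebraMap_mem_map_iff_of_radical_eq (B := B)
      ((radical_span_pow x (Nat.succ_ne_zero k)).trans hx), hpow]
    refine htc _ (Nat.succ_ne_zero k) ((mem_tightClosure_ideal_iff p).2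
      ⟨_, algebraMap_mem_minimalPrimesCompl 𝔪.primeCompl hc, e₀, fun e he => ?_⟩)
    have hq : p ^ e ≠ 0 := pow_ne_zero _ (Fact.out : p.Prime).ne_zero
    have h1 := h e he
    have h2 : algebraMap S L (∏ i, x i) ^ ((k + 1) * p ^ e) * (algebraMap S L c * u ^ p ^ e)
        = algebraMap S L (c * ((∏ i, x i) * a) ^ p ^ e) := by
      rw [map_mul, map_pow, ← hka', mul_pow, ← pow_mul]
      ring
    rw [hker, mem_iSup_locSub_iff hunit hinj h2] at h1
    obtain ⟨N, hN⟩ := h1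
    have h3 := Ideal.mem_map_of_mem (algebraMap S B) hN
    rw [hpow, map_mul, map_pow, map_prod] at h3
    -- Vanishing of c u^q in the direct limit holds a priori only after multiplying by (∏ x_i)^N;
    -- full depth removes this factor and leaves a genuine tight closure relation.
    have h4 := mem_span_pow_of_prod_pow_mul_mem (by rwa [hn]) hxB
      (mul_ne_zero (Nat.succ_ne_zero k) hq) h3
    rw [map_mul, map_pow] at h4
    rw [Ideal.map_span, ← Set.range_comp]
    convert h4 using 3
    ext i
    simp [iterateFrobenius_def, pow_mul]
  rw [← LinearMap.mem_ker, hker, mem_iSup_locSub_iff hunit hinj hka']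
  exact ⟨0, by simpa using hmem⟩

/-- If the zero submodule of local cohomology is tightly closed, then so are the ideals generated by
regular sequences which define it. -/
theorem tightClosure_span_le_of_cechCohomology (hinj : Function.Injective (algebraMap S B)) {n : ℕ}
    {y : Fin n → S} (hy : (Ideal.span (Set.range y)).radical = 𝔪)
    (hreg : IsRegularAt 𝔪 ⊥ (List.ofFn y))
    (htc : tightClosure p (⊥ : Submodule S (CechCohomology x n)) = ⊥) :
    tightClosure p (Ideal.span (Set.range fun i => algebraMap S B (y i))) ≤
      Ideal.span (Set.range fun i => algebraMap S B (y i)) := by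
  have hζ := exists_cechCohomology_annihilator hx _ hreg (by rw [ofList_ofFn, hy])
  rw [List.length_ofFn, ofList_ofFn] at hζ
  obtain ⟨ζ, hζ1, hζ2⟩ := hζ
  rw [← map_span_range]
  set J := Ideal.span (Set.range y)
  have hunit : ∀ s : 𝔪.primeCompl, IsUnit (algebraMap S B s) := IsLocalization.map_units B
  intro b hb
  obtain ⟨⟨a, s⟩, has⟩ := IsLocalization.surj 𝔪.primeCompl b
  have ha : algebraMap S B a ∈ tightClosure p (J.map (algebraMap S B)) := by
    rw [← has, mul_comm, ← smul_eq_mul]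
    exact Submodule.smul_mem _ _ hb
  obtain ⟨c, hc, e₀, h⟩ := (mem_tightClosure_ideal_iff p).1 ha
  -- The multiplier of the local ring is cleared of its denominator. Its numerator is in S⁰ because
  -- S embeds in the localization and the denominator is a unit there.
  obtain ⟨⟨c', t⟩, hct⟩ := IsLocalization.surj 𝔪.primeCompl c
  have hc' : c' ∈ minimalPrimesCompl S := by
    refine mem_minimalPrimesCompl_of_injective hinj ?_
    rw [← hct]
    exact mul_mem hc fun P hP h => hP.1.1.ne_top (Ideal.eq_top_of_isUnit_mem _ h (hunit t))
  have hann : a • ζ ∈ tightClosure p (⊥ : Submodule S (CechCohomology x n)) := by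
    refine ⟨c', hc', e₀, fun e he => ?_⟩
    rw [Submodule.baseChange_bot, Submodule.mem_bot]
    refine smul_tmul_smul_eq_zero p ζ hζ1 ?_
    -- The Frobenius powers of the parameter ideal are 𝔪-primary, so membership may be tested after
    -- localization.
    rw [← algebraMap_mem_map_iff_of_radical_eq (B := B)
      ((radical_map_iterateFrobenius p e J).trans hy), map_map_iterateFrobenius, map_mul, map_pow,
      ← hct, mul_right_comm]
    exact Ideal.mul_mem_right _ _ (h e he)
  rw [htc, Submodule.mem_bot] at hann
  obtain ⟨s', hs', h'⟩ := hζ2 a hann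
  have h1 : algebraMap S B a ∈ J.map (algebraMap S B) :=
    (IsLocalization.algebraMap_mem_map_algebraMap_iff 𝔪.primeCompl B J a).2 ⟨s', hs', h'⟩
  rw [← has] at h1
  exact (Ideal.mul_unit_mem_iff_mem _ (hunit s)).1 h1

end TightClosureOfLocalCohomology

/-! ### F-rationality of the Rees algebra. -/

section FRational

variable {R : Type u} [CommRing R] [IsLocalRing R] {I : Ideal R} {d : ℕ} {f : Fin d → R}
  (hf : ∀ i, f i ∈ I)

/-- An element outside 𝔐 has an invertible constant term, so it is a unit in R[[t]]. Hence 𝓡 embeds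
in its localization at 𝔐. -/
theorem reesMaximal_primeCompl_le_nonZeroDivisors [(reesMaximal I).IsPrime] :
    (reesMaximal I).primeCompl ≤ nonZeroDivisors (reesAlgebra I) := by
  intro q hq
  rw [mem_nonZeroDivisors_iff_left]
  intro z hz
  have hu : IsUnit (q.1 : PowerSeries R) := by
    rw [PowerSeries.isUnit_iff_constantCoeff, Polynomial.constantCoeff_coe]
    exact IsLocalRing.notMem_maximalIdeal.1 fun h => hq (mem_reesMaximal_iff.2 h)
  have h1 : (q.1 : PowerSeries R) * (z.1 : PowerSeries R) = 0 := by
    rw [← Polynomial.coe_mul]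
    have : q.1 * z.1 = 0 := congrArg Subtype.val hz
    rw [this, Polynomial.coe_zero]
  exact Subtype.ext (Polynomial.coe_eq_zero_iff.1 (hu.mul_right_eq_zero.1 h1))

/-- The sequence t⁻¹, f_1t, …, f_dt is regular at 𝔑, so the local ring has depth d + 1 without any
separate assumption on 𝓡'. -/
theorem depthGE_extendedReesLocal (hI : I.radical = IsLocalRing.maximalIdeal R)
    [(reesMaximal I).IsPrime] [(extendedReesMaximal I).IsPrime] (A : Type u) [CommRing A] [IsLocalRing A]
    [IsNoetherianRing A] [Algebra (extendedReesAlgebra I) A]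
    [IsLocalization.AtPrime A (extendedReesMaximal I)]
    (h : IsRegularAt (reesMaximal I) (I.map (algebraMap R (reesAlgebra I)))
      (List.ofFn fun i => reesT (f i) (hf i)))
    (hJ : IsReductionOf (Ideal.span (Set.range f)) I) : DepthGE A A (d + 1) := by
  have h1 := isRegularAt_reesTInv_cons hf hI h
  have hrad := radical_span_extendedReesSeq hf hJ
  rw [← isRegularAt_map_iff (B := A), Ideal.map_bot, isRegularAt_maximalIdeal_iff,
    (Submodule.quotEquivOfEqBot (⊥ : Ideal A) rfl).isWeaklyRegular_congr] at h1
  have h2 := depthGE_of_isRegular _ (fun a ha => ?_) h1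
  · simpa using h2
  · obtain ⟨q, hq, rfl⟩ := List.mem_map.1 ha
    rw [← IsLocalization.AtPrime.map_eq_maximalIdeal (extendedReesMaximal I) A]
    refine Ideal.mem_map_of_mem _ ?_
    rw [← hrad]
    refine Ideal.le_radical (Ideal.subset_span ?_)
    rcases List.mem_cons.1 hq with rfl | hq'
    · exact ⟨Fin.last d, extendedReesSeq_last hf⟩
    · obtain ⟨q', hq'', rfl⟩ := List.mem_map.1 hq'
      obtain ⟨i, rfl⟩ := (List.mem_ofFn' _ _).1 hq''
      exact ⟨i.castSucc, extendedReesSeq_castSucc hf i⟩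

theorem tightClosure_extendedReesLocalCohomology_eq_bot (p : ℕ) [Fact p.Prime] [CharP R p]
    (hJ : IsReductionOf (Ideal.span (Set.range f)) I) (hnzd : ∀ i, f i ∈ nonZeroDivisors R)
    [h𝔑 : (extendedReesMaximal I).IsMaximal] (A : Type u) [CommRing A] [IsLocalRing A]
    [IsNoetherianRing A] [Algebra (extendedReesAlgebra I) A]
    [IsLocalization.AtPrime A (extendedReesMaximal I)] [CharP A p] (hA : DepthGE A A (d + 1))
    (hrat : IsFRationalLocal p A) :
    tightClosure p (⊥ : Submodule (extendedReesAlgebra I)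
      (ExtendedReesLocalCohomology f hf)) = ⊥ := by
  have hx := radical_span_extendedReesSeq hf hJ
  have hxA : (Ideal.span (Set.range fun i => algebraMap _ A (extendedReesSeq f hf i))).radical =
      IsLocalRing.maximalIdeal A := radical_span_algebraMap_eq hx
  obtain ⟨n, y, ⟨hn, hy⟩, htc⟩ := hrat
  have hdimA := (isSystemOfParameters_of_depthGE hA hxA).1
  -- The given system of parameters has length equal to the dimension, which is d + 1 because f_1t,
  -- …, f_dt, t⁻¹ is another one.
  obtain rfl : n = d + 1 := by
    rw [hn] at hdimA
    exact_mod_cast hdimA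
  exact tightClosure_cechCohomology_eq_bot p hx (isUnit_algebraMap_extendedReesSeq hf)
    (algebraMap_extendedRees_injective hnzd) extendedReesLoc_univ (Fintype.card_fin _) hA
    fun l hl => tightClosure_span_pow_le p (Nat.succ_ne_zero d) hA hxA hy htc.le hl

/-- The ideal shown to be tightly closed is that of f_1, f_2 - f_1t, …, -f_dt: these d + 1 elements
are parameters at 𝔐, whereas the Čech complex uses 2d elements. -/
theorem isFRationalLocal_of_tightClosure_reesLocalCohomology_eq_bot (p : ℕ) [Fact p.Prime]
    [CharP R p] (hI : I.radical = IsLocalRing.maximalIdeal R)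
    (hJ : IsReductionOf (Ideal.span (Set.range f)) I)
    [h𝔐 : (reesMaximal I).IsMaximal] (B : Type u) [CommRing B] [IsLocalRing B]
    [IsNoetherianRing B] [Algebra (reesAlgebra I) B]
    [IsLocalization.AtPrime B (reesMaximal I)] [CharP B p] (hB : DepthGE B B (d + 1))
    (hzero : tightClosure p (⊥ : Submodule (reesAlgebra I) (ReesLocalCohomology f hf)) = ⊥) :
    IsFRationalLocal p B := by
  have hv := radical_span_reesParameters hf hI hJ
  have hvB : (Ideal.span (Set.range fun i => algebraMap _ B (reesParameters hf i))).radical =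
      IsLocalRing.maximalIdeal B := radical_span_algebraMap_eq hv
  have hvreg : IsRegularAt (reesMaximal I) ⊥ (List.ofFn (reesParameters hf)) := by
    rw [← isRegularAt_map_iff (B := B), Ideal.map_bot, List.map_ofFn]
    exact isRegularAt_ofFn_of_depthGE hB hvB
  have hinj : Function.Injective (algebraMap (reesAlgebra I) B) :=
    IsLocalization.injective B (M := (reesMaximal I).primeCompl)
      reesMaximal_primeCompl_le_nonZeroDivisors
  exact ⟨d + 1, _, isSystemOfParameters_of_depthGE hB hvB, le_antisymm
    (tightClosure_span_le_of_cechCohomology p (radical_span_reesSeq hf hI hJ) hinj hv hvreg hzero)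
    (le_tightClosure p _)⟩

theorem isFRationalLocal_rees (p : ℕ) [Fact p.Prime] [CharP R p] (hd : 2 ≤ d)
    (hdim : ringKrullDim R = d) (hI : I.radical = IsLocalRing.maximalIdeal R)
    (hJ : IsReductionOf (Ideal.span (Set.range f)) I) (hR : IsCohenMacaulayLocal R)
    (hnzd : ∀ i, f i ∈ nonZeroDivisors R) [IsNoetherianRing (reesAlgebra I)]
    [h𝔐 : (reesMaximal I).IsMaximal] [h𝔑 : (extendedReesMaximal I).IsMaximal]
    (B : Type u) [CommRing B] [IsLocalRing B] [Algebra (reesAlgebra I) B]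
    [IsLocalization.AtPrime B (reesMaximal I)] [CharP B p] (hB : IsCohenMacaulayLocal B)
    (A : Type u) [CommRing A] [IsLocalRing A] [Algebra (extendedReesAlgebra I) A]
    [IsLocalization.AtPrime A (extendedReesMaximal I)] [CharP A p] (hrat : IsFRationalLocal p A)
    {γ : ReesLocalCohomology f hf →ₗ[R] ExtendedReesLocalCohomology f hf}
    (hγ : Function.Injective γ)
    (hmap : ((tightClosure p (⊥ : Submodule (reesAlgebra I)
        (ReesLocalCohomology f hf))).restrictScalars R).map γ =
      ⨆ (j : ℤ) (_ : j < 0), (tightClosure p (⊥ : Submodule (extendedReesAlgebra I)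
        (ExtendedReesLocalCohomology f hf))).restrictScalars R ⊓
          extendedReesLocalCohomologyPiece f hf j) :
    IsFRationalLocal p B := by
  have : NeZero d := ⟨by omega⟩
  have := hR.1
  have : IsNoetherianRing B := hB.1
  have : IsNoetherianRing (extendedReesAlgebra I) := isNoetherianRing_extendedReesAlgebra
  have : IsNoetherianRing A :=
    IsLocalization.isNoetherianRing (extendedReesMaximal I).primeCompl A inferInstance
  have hBd : DepthGE B B (d + 1) := depthGE_reesLocal B hf hnzd hdim hB
  have hreg := isRegularAt_reesT B hf hnzd hI hJ (depthGE_reesLocal_quotient B hf hnzd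
    (depthGE_of_isCohenMacaulayLocal hR hdim.ge) hBd)
  have hzero' := tightClosure_extendedReesLocalCohomology_eq_bot hf p hJ hnzd A
    (depthGE_extendedReesLocal hf hI A hreg hJ) hrat
  refine isFRationalLocal_of_tightClosure_reesLocalCohomology_eq_bot hf p hI hJ B hBd ?_
  -- The image of the tight closure of zero under γ is a sum of graded parts of the corresponding
  -- tight closure for 𝓡', which is zero; injectivity of γ finishes.
  refine (Submodule.eq_bot_iff _).2 fun ζ hζ => hγ ?_
  have h1 : γ ζ ∈ ((tightClosure p (⊥ : Submodule (reesAlgebra I)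
      (ReesLocalCohomology f hf))).restrictScalars R).map γ := ⟨ζ, hζ, rfl⟩
  rw [hmap, hzero'] at h1
  rw [map_zero, ← Submodule.mem_bot R]
  refine (iSup₂_le fun j _ => ?_ : _ ≤ (⊥ : Submodule R _)) h1
  exact inf_le_left

end FRational
end

/-- Let `(R, 𝔪)` be a Cohen–Macaulay local ring of characteristic `p > 0` and dimension `d ≥ 2`,
`I` an `𝔪`-primary ideal with a reduction `(f₁, …, f_d)`, and assume that the Rees algebra `𝓡`
is Cohen–Macaulay. Then `γ : H^{d+1}_𝔐(𝓡) → H^{d+1}_𝔑(𝓡')` exists and is unique, it maps the tight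
closure of zero onto `⨁_{j < 0}` of the degree `j` parts of the tight closure of zero, and if
`𝓡'_𝔑` is F-rational then so is `𝓡_𝔐`. -/
theorem proposition3p2 {R : Type*} [CommRing R] [IsLocalRing R] (p : ℕ) [Fact p.Prime]
    [CharP R p] (d : ℕ) (hd : 2 ≤ d) (hdim : ringKrullDim R = d)
    (I : Ideal R) (hI : I.radical = IsLocalRing.maximalIdeal R)
    (f : Fin d → R) (hf : ∀ i, f i ∈ I) (hJ : IsReductionOf (Ideal.span (Set.range f)) I)
    (hR : IsCohenMacaulayLocal R) (hRees : IsCohenMacaulay (reesAlgebra I)) :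
    (∃! γ : ReesLocalCohomology f hf →ₗ[R] ExtendedReesLocalCohomology f hf,
      IsReesComparison f hf γ) ∧
    (∀ γ : ReesLocalCohomology f hf →ₗ[R] ExtendedReesLocalCohomology f hf,
      IsReesComparison f hf γ →
      ((tightClosure p (⊥ : Submodule (reesAlgebra I) (ReesLocalCohomology f hf))).restrictScalars
          R).map γ =
        ⨆ (j : ℤ) (_ : j < 0),
          (tightClosure p (⊥ : Submodule (extendedReesAlgebra I)
            (ExtendedReesLocalCohomology f hf))).restrictScalars R ⊓
            extendedReesLocalCohomologyPiece f hf j) ∧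
    (IsFRationalAt p (extendedReesMaximal I) (extendedReesMaximal_isPrime I hI) →
      IsFRationalAt p (reesMaximal I) (reesMaximal_isPrime I)) := by
  have := hR.1
  have hrad : (Ideal.span (Set.range f)).radical = IsLocalRing.maximalIdeal R :=
    hJ.radical_eq.trans hI
  have hnzd : ∀ i, f i ∈ nonZeroDivisors R :=
    mem_nonZeroDivisors_of_radical_eq
      (depthGE_of_isCohenMacaulayLocal hR (by rw [hdim, Fintype.card_fin])) hrad
  obtain ⟨π, hπ, hπc, hπk⟩ := exists_reesLocalCohomology_presentation (hf := hf) hd hnzd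
  obtain ⟨π', hπ', hπc', hπk'⟩ := exists_extendedReesLocalCohomology_presentation hf hnzd
  have hmap := fun γ => map_tightClosure_rees_eq p hd hnzd hπ hπc hπk hπ' hπc' hπk' (γ := γ)
  have hex := existsUnique_isReesComparison hd hπ hπc hπk hπc' hπk'
  refine ⟨hex, hmap, fun hrat => ?_⟩
  have := reesMaximal_isMaximal (I := I)
  have := extendedReesMaximal_isMaximal hI
  have := hRees.1
  have := charP_of_algebra_nontrivial p (reesAlgebra I) (Localization.AtPrime (reesMaximal I))
  have := charP_of_algebra_nontrivial p (extendedReesAlgebra I)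
    (Localization.AtPrime (extendedReesMaximal I))
  obtain ⟨γ, hγ, -⟩ := hex
  exact isFRationalLocal_rees hf p hd hdim hI hJ hR hnzd _ (hRees.2 (reesMaximal I)) _ hrat
    (isReesComparison_injective hd hπ hπc hπk hπc' hπk' hγ) (hmap γ hγ)
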